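/- **Setting.** Let $\mathcal X\subset\mathbb R^d$ ($d\ge 1$) be compact and convex with $0\in\mathcal X$ and $\|x-x'\|\le R$ for all $x,x'\in\mathcal X$; let $f:\mathcal X\times\mathcal Z\to\mathbb R$ be such that each $f(\cdot,z)$ is convex, $L$-Lipschitz and $\beta$-smooth on $\mathcal X$ (differentiable with $\beta$-Lipschitz gradient field $\nabla f(\cdot,z)$, $\|\nabla f\|\le L$), where $L,R>0$, $\beta\ge 0$. Let $P$ be a distribution on $\mathcal Z$, $F(x)=\mathbb E_{z\sim P}f(x,z)$, $F^*=\min_{\mathcal X}F$. The data are $n$ users with $m$ samples each, all i.i.d. from $P$. Let $0<\varepsilon\le 10$, $0<\delta<1/(mn)$, and let $q>0$ and $p$ satisfy $$n^{1-q}>\frac{100\log(20nmde^{\varepsilon}/\delta)}{\varepsilon(1-2^{-q})},\qquad p\ge 3q+2.5+\log_n(\sqrt m).$$ **Algorithm (user-level DP accelerated phased ERM with outlier gradient removal).** Put $\lambda=\frac LR\bigl(\frac1{\sqrt{nm}}+\frac{\sqrt d}{\varepsilon n\sqrt m}\bigr)$ and $l=\lfloor\log_2 n\rfloor$, and for $i=1,\dots,l$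 put $\lambda_i=\lambda 2^{pi}$, $n_i=\lfloor(1-2^{-q})n/2^{iq}\rfloor$, $N_i=\lceil 4\sqrt{2(\beta+\lambda_i)/\lambda_i}\,\rceil$, $T_i=\lceil 4\log_2(nm)\rceil N_i$ (so $T_i=\widetilde\Theta(1+\sqrt{\beta/\lambda_i})$), $$K_i=\max\Bigl\{\Bigl\lceil 500\log\tfrac{\max(n_i^2m^2,\,T_i)\,e^{\varepsilon}}{\delta}\Bigl(\tfrac1\varepsilon+\tfrac{n_i\varepsilon}{\sqrt{T_i\log(1/\delta)}}\Bigr)\Bigr\rceil,\ \Bigl\lceil \tfrac{n_i}{T_i}\Bigr\rceil\Bigr\},$$ $\tau=c\,L\log(\max(ndm,T_1))/\sqrt m$ for a constant $c$, and $\sigma_i=1000\,\tau\sqrt{T_i}\log(nde^{\varepsilon}/\delta)/(\varepsilon n_i)$. Start at any $x_0\in\mathcal X$ and assign disjoint sets $D_i$ of $n_i$ users to the phases $i=1,\dots,l$ in any data-independent way. Phase $i$ draws $\xi_i\sim\mathrm{Lap}(8/\varepsilon)$ and makes $T_i$ iterations of multi-stage AC-SA (accelerated stochastic approximation), started at $x_{i-1}$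 and restarted every $N_i$ iterations from its current aggregated iterate. In the $s$-th iteration of a stage, with $\alpha=\frac2{s+1}$, $\gamma=\frac{4(\beta+\lambda_i)}{s(s+1)}$, previous aggregated iterate $x^{ag}$ and previous prox iterate $x$ (equal to $x^{ag}$ if $s=1$): 1. $x^{md}=\frac{(1-\alpha)(\lambda_i+\gamma)\,x^{ag}+\alpha((1-\alpha)\lambda_i+\gamma)\,x}{\gamma+(1-\alpha^2)\lambda_i}$. Draw $K_i$ users uniformly with replacement from $D_i$ and compute their average gradients $q_k=\frac1m\sum_z\nabla f(x^{md},z)$, $k\le K_i$. 2. Let $h_k=\#\{k':\|q_k-q_{k'}\|\le 2\tau\}$ and $v\sim\mathrm{Lap}(16/\varepsilon)$. If $\frac1{K_i}\sum_k h_k+v<\frac45K_i+\xi_i$, the phase stops and returns $x_i=0$. 3. Otherwise keep the $k$-th drawn user, independently, with probability $0$ if $h_k<K_i/2$, $1$ if $h_k\ge 2K_i/3$, and $\frac{h_k-K_i/2}{K_i/6}$ in between. Let $g$ be the average of the kept $q_k$ and $G=g+\zeta+\lambda_i(x^{md}-x_{i-1})$ with $\zeta\sim\mathcal N(0,\sigma_i^2I_d)$.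 Replace $x$ by $\arg\min_{y\in\mathcal X}\ \alpha\bigl(\langle G,y\rangle+\frac{\lambda_i}2\|y-x^{md}\|^2\bigr)+\frac{(1-\alpha)\lambda_i+\gamma}{2}\|y-x\|^2$ and then $x^{ag}$ by $\alpha x+(1-\alpha)x^{ag}$. If not stopped, the phase returns the last aggregated iterate as $x_i$. All random draws are independent. The output is $x_l$. **Theorem.** There are absolute constants $c_0>0$ and $k\in\mathbb N$ such that for every $c\ge c_0$ there is $C>0$, depending on $c$ only, for which the following holds in the above setting, with $\Lambda=\log\bigl(nmd(1+\beta R/L)/\delta\bigr)$. The excess risk satisfies $$\mathbb E F(x_l)-F^*\le C\Bigl(\frac{2^p}{1-2^{-q}}\Bigr)^k\Lambda^k\cdot LR\left(\frac1{\sqrt{mn}}+\frac{\sqrt{d\log(1/\delta)}}{\varepsilon n\sqrt m}\right),$$ and the number of gradients $\nabla f(x,z)$ evaluated by the algorithm is, for all data and all random draws, at most $$C\Lambda^k\left[mn\left(1+\varepsilon\Bigl(\frac{\beta R}L\Bigr)^{1/4}\Bigl((mn)^{1/8}\wedge\Bigl(\frac{\varepsilon^2n^2m}{d}\Bigr)^{1/8}\Bigr)\right)+\sqrt{\frac{\beta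 R}L}\left(\frac{n^{1/4}m^{5/4}}{\varepsilon}+\frac{n^{1/2}m^{5/4}}{d^{1/4}\varepsilon^{1/2}}\right)\right].$$ -/

import Mathlib

open MeasureTheory ProbabilityTheory

noncomputable section

namespace UserDP

/-- The parameter space `ℝ^d` with the Euclidean norm. -/
abbrev Vec (d : ℕ) := EuclideanSpace ℝ (Fin d)

/-! ### Losses -/

/-- For every `z`, the loss `f(·, z)` is convex, `L`-Lipschitz and `β`-smooth on `X`, with gradient
field `gradf(·, z)`.  The bound `norm_grad_le` follows from the other fields when `X` has nonempty
interior; on a lower-dimensional `X`, where a gradient relative to `X` is determined only up to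
vectors normal to `X`, it says that the gradient field used by the algorithm is one of norm at most
the Lipschitz constant.  The measurability and integrability fields make `E_P f(x, z)` meaningful. -/
structure IsLoss {d : ℕ} {Z : Type*} [MeasurableSpace Z] (P : Measure Z) (X : Set (Vec d))
    (f : Vec d → Z → ℝ) (gradf : Vec d → Z → Vec d) (L β : ℝ) : Prop where
  convex : ∀ z, ConvexOn ℝ X (fun x => f x z)
  lipschitz : ∀ z, ∀ x ∈ X, ∀ y ∈ X, |f x z - f y z| ≤ L * ‖x - y‖
  hasGradient : ∀ z, ∀ x ∈ X, HasGradientWithinAt (fun y => f y z) (gradf x z) X x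
  smooth : ∀ z, ∀ x ∈ X, ∀ y ∈ X, ‖gradf x z - gradf y z‖ ≤ β * ‖x - y‖
  norm_grad_le : ∀ z, ∀ x ∈ X, ‖gradf x z‖ ≤ L
  integrable : ∀ x ∈ X, Integrable (f x) P
  measurable_grad : ∀ x ∈ X, Measurable (gradf x)

/-- The population loss `F(x) = E_{z ∼ P} f(x, z)`. -/
def popLoss {d : ℕ} {Z : Type*} [MeasurableSpace Z] (P : Measure Z) (f : Vec d → Z → ℝ)
    (x : Vec d) : ℝ :=
  ∫ z, f x z ∂P

/-! ### Noise -/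

/-- The Laplace distribution `Lap(b)`, with density `exp (-|x| / b) / (2 b)`. -/
def laplace (b : ℝ) : Measure ℝ :=
  volume.withDensity fun x => ENNReal.ofReal (1 / (2 * b) * Real.exp (-|x| / b))

/-- The Gaussian distribution `N(0, σ² I_d)`. -/
def gaussianVec (d : ℕ) (σ : ℝ) : Measure (Vec d) :=
  (stdGaussian (Vec d)).map fun v => σ • v

/-- Randomness of one iteration: the indices of the `K` sampled users among `N`, the Laplace noise
of the concentration score, one uniform variable per sampled user (which decides whether that user
is kept), and the Gaussian noise of the gradient. -/
abbrev StepRand (K N d : ℕ) := (Fin K → Fin N) × ℝ × (Fin K → ℝ) × Vec d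

/-- Randomness of one phase: the Laplace noise of the threshold and that of the `T` iterations. -/
abbrev PhaseRand (T K N d : ℕ) := ℝ × (Fin T → StepRand K N d)

/-- Law of the randomness of one iteration; users are drawn uniformly with replacement. -/
def stepLaw (K N d : ℕ) (ε σ : ℝ) : Measure (StepRand K N d) :=
  (Measure.pi fun _ : Fin K => uniformOn (Set.univ : Set (Fin N))).prod
    ((laplace (16 / ε)).prod
      ((Measure.pi fun _ : Fin K => (volume : Measure ℝ).restrict (Set.Icc 0 1)).prod
        (gaussianVec d σ)))

/-- Law of the randomness of one phase: everything is independent, and the threshold noise is drawn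
once per phase. -/
def phaseLaw (T K N d : ℕ) (ε σ : ℝ) : Measure (PhaseRand T K N d) :=
  (laplace (8 / ε)).prod (Measure.pi fun _ : Fin T => stepLaw K N d ε σ)

/-! ### One phase: user-level DP accelerated minibatch SGD -/

/-- Euclidean projection onto `X` (a closest point of `X`, which exists and is unique for nonempty
compact convex `X`). -/
def proj {d : ℕ} (X : Set (Vec d)) (u : Vec d) : Vec d :=
  Classical.epsilon fun y => y ∈ X ∧ ∀ w ∈ X, ‖u - y‖ ≤ ‖u - w‖

/-- The empirical gradient `q(Z) = (1/m) ∑_{z ∈ Z} ∇f(x, z)` of one user, together with the number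
of gradients `∇f(x, z)` evaluated to compute it, one for each sample. -/
def userGrad {d m : ℕ} {Z : Type*} (gradf : Vec d → Z → Vec d) (x : Vec d) (U : Fin m → Z) :
    Vec d × ℕ :=
  ((1 / (m : ℝ)) • ∑ r, gradf x (U r), ∑ _r : Fin m, 1)

/-- `∑_{k'} 1(‖q k - q k'‖ ≤ 2τ)`: the number of sampled users whose gradient is `2τ`-close to that
of the `k`-th sampled user. -/
def closeCount {d K : ℕ} (q : Fin K → Vec d) (τ : ℝ) (k : Fin K) : ℝ :=
  ∑ k', if ‖q k - q k'‖ ≤ 2 * τ then 1 else 0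

/-- The concentration score `(1/K) ∑_{k, k'} 1(‖q k - q k'‖ ≤ 2τ)`. -/
def concentration {d K : ℕ} (q : Fin K → Vec d) (τ : ℝ) : ℝ :=
  (1 / (K : ℝ)) * ∑ k, closeCount q τ k

/-- The probability with which a user with closeness count `h` is kept. -/
def keepProb (K : ℕ) (h : ℝ) : ℝ :=
  if h < K / 2 then 0 else if 2 * K / 3 ≤ h then 1 else (h - K / 2) / (K / 6)

/-- The sampled users that survive outlier removal: the `k`-th one is kept iff `u k`, uniform on
`[0, 1]`, is below its keeping probability. -/
def inliers {d K : ℕ} (q : Fin K → Vec d) (τ : ℝ) (u : Fin K → ℝ) : Finset (Fin K) :=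
  Finset.univ.filter fun k => u k < keepProb K (closeCount q τ k)

/-- State inside a phase: the aggregated iterate `x^{ag}` and the prox iterate `x` of AC-SA, whether
the phase was halted, and the number of gradients `∇f(x, z)` evaluated so far. -/
structure SgdState (d : ℕ) where
  xag : Vec d
  x : Vec d
  halted : Prop
  evals : ℕ

/-- The inputs of a phase: domain `X`, smoothness `β`, regularization `lam`, length `N₀` of the
stages of multi-stage AC-SA, threshold parameter `τ`, and center `x₀` (the starting point of the
phase and the center of its regularizer). -/
structure PhaseInput (d : ℕ) where
  X : Set (Vec d)
  β : ℝ
  lam : ℝ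
  N₀ : ℕ
  τ : ℝ
  x₀ : Vec d

open Classical in
/-- Iteration `t = 0, 1, …` of a phase.  The iteration is one step of AC-SA for the
`lam`-strongly convex and `(β + lam)`-smooth regularized empirical loss; every `N₀` iterations AC-SA
is restarted from its current aggregated iterate (multi-stage AC-SA).  With `s` the number of the
step within its stage, the step sizes are `α = 2 / (s + 1)` and `γ = 4 (β + lam) / (s (s + 1))`.
The projection computes the minimizer over `x ∈ X` of
`α (⟪G, x⟫ + (lam/2) ‖x - x^{md}‖²) + ((1 - α) lam + γ) / 2 * ‖x - x_{prev}‖²`. -/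
def sgdStep {d m N K : ℕ} {Z : Type*} (I : PhaseInput d) (gradf : Vec d → Z → Vec d)
    (D : Fin N → Fin m → Z) (ξ : ℝ) (t : ℕ) (r : StepRand K N d) (st : SgdState d) : SgdState d :=
  if st.halted then st else
    let s : ℝ := (t % I.N₀ : ℕ) + 1
    let α : ℝ := 2 / (s + 1)
    let γ : ℝ := 4 * (I.β + I.lam) / (s * (s + 1))
    let xprev : Vec d := if t % I.N₀ = 0 then st.xag else st.x
    let xmd : Vec d :=
      ((1 - α) * (I.lam + γ) / (γ + (1 - α ^ 2) * I.lam)) • st.xag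
        + (α * ((1 - α) * I.lam + γ) / (γ + (1 - α ^ 2) * I.lam)) • xprev
    let q : Fin K → Vec d := fun k => (userGrad gradf xmd (D (r.1 k))).1
    let evals : ℕ := st.evals + ∑ k, (userGrad gradf xmd (D (r.1 k))).2
    if 4 * K / 5 + ξ ≤ concentration q I.τ + r.2.1 then
      let S := inliers q I.τ r.2.2.1
      let g : Vec d := (1 / (S.card : ℝ)) • ∑ k ∈ S, q k
      let G : Vec d := (g + r.2.2.2) + I.lam • (xmd - I.x₀)
      let x : Vec d := proj I.X
        ((1 / (I.lam + γ)) • ((α * I.lam) • xmd + ((1 - α) * I.lam + γ) • xprev - α • G))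
      { xag := α • x + (1 - α) • st.xag, x := x, halted := False, evals := evals }
    else
      { st with halted := True, evals := evals }

open Classical in
/-- A phase of `T` iterations on the users `D`: the returned point (the last aggregated iterate, or
`0` if the phase was halted) and the number of gradients evaluated. -/
def runPhase {d m N K T : ℕ} {Z : Type*} (I : PhaseInput d) (gradf : Vec d → Z → Vec d)
    (D : Fin N → Fin m → Z) (ω : PhaseRand T K N d) : Vec d × ℕ :=
  let st := Fin.foldl T (fun st t => sgdStep I gradf D ω.1 t (ω.2 t) st)
    { xag := I.x₀, x := I.x₀, halted := False, evals := 0 }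
  (if st.halted then 0 else st.xag, st.evals)

/-! ### User-level DP accelerated phased ERM -/

/-- Number of users `n`, samples per user `m`, dimension `d`, privacy parameters `ε`, `δ`, constants
`β`, `L`, `R` of the problem, and the parameters `p`, `q` of the algorithm. -/
structure Params where
  n : ℕ
  m : ℕ
  d : ℕ
  ε : ℝ
  δ : ℝ
  β : ℝ
  L : ℝ
  R : ℝ
  p : ℝ
  q : ℝ

namespace Params

variable (A : Params)

/-- Number of phases `l = ⌊log₂ n⌋`. -/
def phases : ℕ := Nat.log 2 A.n

/-- `λ = (L/R) (1/√(nm) + √d / (ε n √m))`. -/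
def lam : ℝ :=
  A.L / A.R * (1 / √(A.n * A.m : ℝ) + √(A.d : ℝ) / (A.ε * A.n * √(A.m : ℝ)))

/-- `λ_i = λ 2^{p i}`. -/
def lamPh (i : ℕ) : ℝ := A.lam * (2 : ℝ) ^ (A.p * i)

/-- `n_i = (1 - 2^{-q}) n / 2^{i q}`, rounded down. -/
def users (i : ℕ) : ℕ := ⌊(1 - (1 / 2 : ℝ) ^ A.q) * A.n / (2 : ℝ) ^ (i * A.q)⌋₊

/-- Length of the stages of AC-SA in phase `i`: `4 √(2 (β + λ_i) / λ_i)`, rounded up. -/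
def stageLen (i : ℕ) : ℕ := ⌈4 * √(2 * (A.β + A.lamPh i) / A.lamPh i)⌉₊

/-- Number of iterations in phase `i`: `T_i` is the product of the length of the stages with their
number `⌈4 log₂ (nm)⌉`, hence of order `(1 + √(β/λ_i)) log (nm)`. -/
def iters (i : ℕ) : ℕ := ⌈4 * Real.logb 2 (A.n * A.m)⌉₊ * A.stageLen i

/-- Number of users sampled in each iteration of phase `i`:
`K_i = 500 log (max(n_i² m², T_i) e^ε / δ) (1/ε + n_i ε / √(T_i log (1/δ)))`, or `n_i / T_i` if that
is larger, rounded up. -/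
def batch (i : ℕ) : ℕ :=
  max
    ⌈500 * Real.log (max ((A.users i : ℝ) ^ 2 * (A.m : ℝ) ^ 2) (A.iters i) * Real.exp A.ε / A.δ)
      * (1 / A.ε + A.users i * A.ε / √(A.iters i * Real.log (1 / A.δ)))⌉₊
    ⌈(A.users i : ℝ) / A.iters i⌉₊

/-- `τ = c L log (max(ndm, T_1)) / √m`, where `T_1` is the largest of the `T_i`. -/
def tau (c : ℝ) : ℝ :=
  c * A.L * Real.log (max (A.n * A.d * A.m : ℝ) (A.iters 1)) / √(A.m : ℝ)

/-- `σ_i = 1000 τ √T_i log (n d e^ε / δ) / (ε n_i)`. -/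
def sigma (c : ℝ) (i : ℕ) : ℝ :=
  1000 * A.tau c * √(A.iters i : ℝ) * Real.log (A.n * A.d * Real.exp A.ε / A.δ)
    / (A.ε * A.users i)

/-- The randomness of the whole algorithm; `i : Fin l` stands for phase number `i + 1`. -/
abbrev Rand :=
  (i : Fin A.phases) → PhaseRand (A.iters (i + 1)) (A.batch (i + 1)) (A.users (i + 1)) A.d

/-- The law of the randomness of the algorithm. -/
def randLaw (c : ℝ) : Measure A.Rand :=
  Measure.pi fun i : Fin A.phases =>
    phaseLaw (A.iters (i + 1)) (A.batch (i + 1)) (A.users (i + 1)) A.d A.ε (A.sigma c (i + 1))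

/-- A data set: `n` users with `m` samples each. -/
abbrev Data (Z : Type*) := Fin A.n → Fin A.m → Z

/-- An assignment of `n_i` users to each phase. -/
abbrev Selection := (i : Fin A.phases) → Fin (A.users (i + 1)) → Fin A.n

/-- The users assigned to the phases are pairwise distinct, within a phase and across phases. -/
def IsDisjoint (sel : A.Selection) : Prop :=
  Function.Injective fun a : (i : Fin A.phases) × Fin (A.users (i + 1)) => sel a.1 a.2

/-- User-level DP accelerated phased ERM with outlier gradient removal: the output `x_l` and the
number of gradients `∇f(x, z)` evaluated, as functions of the data and of the randomness. -/
def phasedERM {Z : Type*} (c : ℝ) (X : Set (Vec A.d)) (gradf : Vec A.d → Z → Vec A.d)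
    (x₀ : Vec A.d) (sel : A.Selection) (D : A.Data Z) (ω : A.Rand) : Vec A.d × ℕ :=
  Fin.foldl A.phases
    (fun st i =>
      let I : PhaseInput A.d :=
        { X := X, β := A.β, lam := A.lamPh (i + 1), N₀ := A.stageLen (i + 1), τ := A.tau c,
          x₀ := st.1 }
      let out := runPhase I gradf (fun j => D (sel i j)) (ω i)
      (out.1, st.2 + out.2))
    (x₀, 0)

/-- The joint law of an i.i.d. data set and of the independent randomness of the algorithm. -/
def jointLaw {Z : Type*} [MeasurableSpace Z] (c : ℝ) (P : Measure Z) :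
    Measure (A.Data Z × A.Rand) :=
  (Measure.pi fun _ : Fin A.n => Measure.pi fun _ : Fin A.m => P).prod (A.randLaw c)

/-- The logarithm `log (n m d (1 + βR/L) / δ)`, powers of which are hidden in the bounds. -/
def logFactor : ℝ :=
  Real.log (A.n * A.m * A.d * (1 + A.β * A.R / A.L) / A.δ)

/-- The optimal rate `1/√(mn) + √(d log (1/δ)) / (ε n √m)`. -/
def rate : ℝ :=
  1 / √(A.m * A.n : ℝ) + √(A.d * Real.log (1 / A.δ)) / (A.ε * A.n * √(A.m : ℝ))

/-- The gradient complexity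
`mn (1 + ε (βR/L)^{1/4} ((mn)^{1/8} ∧ (ε²n²m/d)^{1/8}))
  + √(βR/L) (n^{1/4} m^{5/4} / ε + n^{1/2} m^{5/4} / (d^{1/4} ε^{1/2}))`. -/
def complexity : ℝ :=
  A.m * A.n * (1 + A.ε * (A.β * A.R / A.L) ^ (1 / 4 : ℝ)
      * min ((A.m * A.n : ℝ) ^ (1 / 8 : ℝ))
          ((A.ε ^ 2 * (A.n : ℝ) ^ 2 * A.m / A.d) ^ (1 / 8 : ℝ)))
    + √(A.β * A.R / A.L)
      * ((A.n : ℝ) ^ (1 / 4 : ℝ) * (A.m : ℝ) ^ (5 / 4 : ℝ) / A.ε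
        + (A.n : ℝ) ^ (1 / 2 : ℝ) * (A.m : ℝ) ^ (5 / 4 : ℝ)
          / ((A.d : ℝ) ^ (1 / 4 : ℝ) * A.ε ^ (1 / 2 : ℝ)))

/-- The conditions on the parameters. -/
structure Admissible : Prop where
  one_le_n : 1 ≤ A.n
  one_le_m : 1 ≤ A.m
  one_le_d : 1 ≤ A.d
  ε_pos : 0 < A.ε
  ε_le : A.ε ≤ 10
  δ_pos : 0 < A.δ
  δ_lt : A.δ < 1 / (A.m * A.n)
  β_nonneg : 0 ≤ A.β
  L_pos : 0 < A.L
  R_pos : 0 < A.R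
  q_pos : 0 < A.q
  users_large : 100 * Real.log (20 * A.n * A.m * A.d * Real.exp A.ε / A.δ)
      / (A.ε * (1 - (1 / 2 : ℝ) ^ A.q)) < (A.n : ℝ) ^ (1 - A.q)
  p_large : 3 * A.q + 2.5 + Real.logb A.n √(A.m : ℝ) ≤ A.p

end Params

end UserDP

end

/-! Excess risk of the phases. Let x̂_i minimize over X the empirical loss of phase i plus (λ_i/2)‖x
- x_{i-1}‖². Replacing one sample moves x̂_i by O(L/(λ_i n_i m)), so for every y fixed before phase
i one has E F(x̂_i) ≤ F(y) + (λ_i/2)‖y - x_{i-1}‖² + 2L²/(λ_i n_i m)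
(`GlobalLoss.integral_popLoss_erm_le`). Taking y = x̂_{i-1} makes the losses telescope
(`PhaseSequence.integral_le`); the price of a phase is λ_i E‖x_{i-1} - x̂_{i-1}‖², the optimization
error of the phase before it. That error is at most a log factor times λR²/λ_{i-1}, so each phase
costs about 2^p λR², and λR² is the optimal rate up to logarithms. The last phase is regularized so
strongly that ‖x_l - x̂_l‖ is of order R/√(nm), up to a power of 2^p/(1 - 2^{-q}) and logarithms,
and Lipschitz continuity finishes.

Optimization error. AC-SA decreases a weighted potential, up to a variance and a bias of the
stochastic gradient (`acsaStep_potential_le`). A stage of length at least √(32(β+λ_i)/λ_i) shrinks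
the gap by 8, because strong convexity turns the gap at a restart into a squared distance
(`BatchSetup.convergence`). After about 4 log₂(nm) stages only variance is left: τ²/K_i from
sampling users and dσ_i² from the Gaussian noise.

Outlier removal. If every user gradient at the visited point is within τ of the population gradient
and the Laplace variables are small, nobody is removed and the phase does not halt. A user's average
of m gradients concentrates at a fixed point, free of the dimension (`measure_norm_sum_gt_le`), but
the visited points depend on the users' data. A union bound over a net of X would cost a power of d.
Instead the injected Gaussian noise provides independence: with user j deleted from the sampling
pool the run is independent of j's data, and the two runs have comparable laws. Drawing user j only
translates the Gaussian noise, and for subsampled translations the second moment of the likelihood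
ratio is 1 + O((τ/(σ_i n_i))²) per iteration (`integral_shift_le`, `integral_batchRun_le`). Over T_i
iterations this compounds to a constant by the choice of σ_i.

The comparison needs user gradients within τ of a common center, so it is carried out for an
idealized run on clipped gradients, where outlying gradients are replaced by the population gradient
(`clipGrad`). The bias due to clipping is supported on the rare outlier events, and the true phase
agrees with the clipped one unless such an event or a large Laplace variable occurs
(`GlobalLoss.measure_phase_ne_le`). All failure events are measured along the clipped run, which
avoids circularity.

Gradient count. No probability is involved: phase i evaluates at most T_i K_i m gradients. Inserting
the two lower bounds on λ contained in its definition bounds this by the stated complexity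
(`phase_evals_le`). -/

open MeasureTheory ProbabilityTheory

noncomputable section

namespace UserDP

/-! ### Chains driven by independent randomness -/

section Chain

variable {S S' : Type*}

/-- The final state of a chain with step functions `f i`, started at `s` and driven by `ω`. -/
def chain {T : ℕ} {Ω : Fin T → Type*} (f : ∀ i, S → Ω i → S) (s : S) (ω : ∀ i, Ω i) : S :=
  Fin.foldl T (fun s i => f i s (ω i)) s

lemma chain_zero {Ω : Fin 0 → Type*} (f : ∀ i, S → Ω i → S) (s : S) (ω : ∀ i, Ω i) :
    chain f s ω = s := by
  simp [chain]

lemma chain_succ {T : ℕ} {Ω : Fin (T + 1) → Type*} (f : ∀ i, S → Ω i → S) (s : S)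
    (ω : ∀ i, Ω i) :
    chain f s ω = f (Fin.last T)
      (chain (fun i : Fin T => f i.castSucc) s (fun i => ω i.castSucc)) (ω (Fin.last T)) := by
  simp [chain, Fin.foldl_succ_last]

lemma measurable_snoc {T : ℕ} {Ω : Fin (T + 1) → Type*} [∀ i, MeasurableSpace (Ω i)] :
    Measurable fun p : (∀ i : Fin T, Ω i.castSucc) × Ω (Fin.last T) =>
      (Fin.snoc p.1 p.2 : ∀ i, Ω i) := by
  refine measurable_pi_lambda _ fun i => ?_
  induction i using Fin.lastCases with
  | last => simpa using measurable_snd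
  | cast i => simpa using by fun_prop

/-- The last coordinate is split off, rather than the first, because `chain_succ` peels off the last
step. The coordinate spaces may vary with the index, as they do from phase to phase. -/
lemma measurePreserving_snoc {T : ℕ} {Ω : Fin (T + 1) → Type*} [∀ i, MeasurableSpace (Ω i)]
    (μ : ∀ i, Measure (Ω i)) [∀ i, IsProbabilityMeasure (μ i)] :
    MeasurePreserving
      (fun p : (∀ i : Fin T, Ω i.castSucc) × Ω (Fin.last T) => (Fin.snoc p.1 p.2 : ∀ i, Ω i))
      ((Measure.pi fun i : Fin T => μ i.castSucc).prod (μ (Fin.last T))) (Measure.pi μ) := by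
  refine ⟨measurable_snoc, ?_⟩
  refine (Measure.pi_eq fun s hs => ?_).symm
  rw [Measure.map_apply measurable_snoc (MeasurableSet.univ_pi hs)]
  have : (fun p : (∀ i : Fin T, Ω i.castSucc) × Ω (Fin.last T) =>
      (Fin.snoc p.1 p.2 : ∀ i, Ω i)) ⁻¹' (Set.univ.pi s) =
      (Set.univ.pi fun i : Fin T => s i.castSucc) ×ˢ s (Fin.last T) := by
    ext p
    simp only [Set.mem_preimage, Set.mem_pi, Set.mem_univ, true_imp_iff, Set.mem_prod]
    constructor
    · intro h
      exact ⟨fun i => by simpa using h i.castSucc, by simpa using h (Fin.last T)⟩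
    · intro h i
      induction i using Fin.lastCases with
      | last => simpa using h.2
      | cast i => simpa using h.1 i
  rw [this, Measure.prod_prod, Measure.pi_pi, Fin.prod_univ_castSucc]

lemma chain_snoc {T : ℕ} {Ω : Fin (T + 1) → Type*} (f : ∀ i, S → Ω i → S) (s : S)
    (ω : ∀ i : Fin T, Ω i.castSucc) (r : Ω (Fin.last T)) :
    chain f s (Fin.snoc ω r) = f (Fin.last T) (chain (fun i : Fin T => f i.castSucc) s ω) r := by
  simp [chain_succ]

/-- A property preserved by every step holds at the end of the chain. -/
lemma chain_induction {T : ℕ} {Ω : Fin T → Type*} {f : ∀ i, S → Ω i → S} {p : S → Prop}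
    (hp : ∀ i s r, p s → p (f i s r)) {s : S} (hs : p s) (ω : ∀ i, Ω i) : p (chain f s ω) := by
  induction T with
  | zero => simpa [chain_zero] using hs
  | succ T ih =>
    rw [chain_succ]
    exact hp _ _ _ (ih (fun i s r h => hp _ s r h) _)

/-- A relation preserved by every step holds at the end of the chains. -/
lemma chain_rel {T : ℕ} {Ω Ω' : Fin T → Type*} {f : ∀ i, S → Ω i → S}
    {f' : ∀ i, S' → Ω' i → S'}
    {R : S → S' → Prop} {s : S} {s' : S'} (hs : R s s') (ω : ∀ i, Ω i) (ω' : ∀ i, Ω' i)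
    (hR : ∀ i s s', R s s' → R (f i s (ω i)) (f' i s' (ω' i))) :
    R (chain f s ω) (chain f' s' ω') := by
  induction T with
  | zero => simpa [chain_zero] using hs
  | succ T ih =>
    rw [chain_succ, chain_succ]
    exact hR _ _ _ (ih _ _ fun i s s' h => hR _ s s' h)

/-- The parameter `α` carries whatever is integrated besides the driving randomness: data, starting
point, threshold noise. -/
lemma measurable_chain {α : Type*} [MeasurableSpace α] [MeasurableSpace S] {T : ℕ}
    {Ω : Fin T → Type*} [∀ i, MeasurableSpace (Ω i)] {f : α → ∀ i, S → Ω i → S} {s : α → S}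
    (hf : ∀ i, Measurable fun p : α × S × Ω i => f p.1 i p.2.1 p.2.2) (hs : Measurable s) :
    Measurable fun p : α × (∀ i, Ω i) => chain (f p.1) (s p.1) p.2 := by
  induction T with
  | zero => simpa [chain_zero] using by fun_prop
  | succ T ih =>
    simp only [chain_succ]
    have h := ih (f := fun a i => f a i.castSucc) (fun i => hf i.castSucc)
    refine (hf (Fin.last T)).comp (measurable_fst.prodMk (Measurable.prodMk ?_ ?_))
    · exact h.comp (f := fun p : α × (∀ i, Ω i) => (p.1, fun i : Fin T => p.2 i.castSucc))
        (by fun_prop)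
    · fun_prop

lemma measurable_chain' [MeasurableSpace S] {T : ℕ}
    {Ω : Fin T → Type*} [∀ i, MeasurableSpace (Ω i)] {f : ∀ i, S → Ω i → S} (s : S)
    (hf : ∀ i, Measurable fun p : S × Ω i => f i p.1 p.2) :
    Measurable fun ω : (∀ i, Ω i) => chain f s ω :=
  (measurable_chain (α := Unit) (f := fun _ => f) (s := fun _ => s)
    (fun i => (hf i).comp measurable_snd) measurable_const).comp
    (f := fun ω => ((), ω)) (by fun_prop)

/-- Fubini, conditioning on all randomness before the last step. The bound on `φ` is required only
at reachable states, since potentials are bounded on X and not on the whole space. -/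
lemma integral_chain_succ [MeasurableSpace S] {T : ℕ} {Ω : Fin (T + 1) → Type*}
    [∀ i, MeasurableSpace (Ω i)] (μ : ∀ i, Measure (Ω i)) [∀ i, IsProbabilityMeasure (μ i)]
    {f : ∀ i, S → Ω i → S} (s : S) (hf : ∀ i, Measurable fun p : S × Ω i => f i p.1 p.2)
    {φ : S → ℝ} (hφ : Measurable φ) {M : ℝ} (hM : ∀ ω, |φ (chain f s ω)| ≤ M) :
    ∫ ω, φ (chain f s ω) ∂Measure.pi μ =
      ∫ ω, (∫ r, φ (f (Fin.last T) (chain (fun i : Fin T => f i.castSucc) s ω) r)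
        ∂μ (Fin.last T)) ∂Measure.pi fun i : Fin T => μ i.castSucc := by
  have hm : Measurable fun ω => φ (chain f s ω) := hφ.comp (measurable_chain' s hf)
  have hp := measurePreserving_snoc μ
  rw [← hp.map_eq, integral_map hp.measurable.aemeasurable hm.aestronglyMeasurable]
  rw [integral_prod]
  · simp only [chain_snoc]
  · refine Integrable.of_bound (C := M) (hm.comp hp.measurable).aestronglyMeasurable ?_
    exact Filter.Eventually.of_forall fun p => hM _

/-- Two chains driven by the same randomness stay related unless some step fails. -/
lemma measure_chain_not_rel_le {T : ℕ} {Ω : Fin T → Type*}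
    [∀ i, MeasurableSpace (Ω i)] (μ : ∀ i, Measure (Ω i)) [∀ i, IsProbabilityMeasure (μ i)]
    {f : ∀ i, S → Ω i → S} {f' : ∀ i, S' → Ω i → S'} {R : S → S' → Prop} {s : S} {s' : S'}
    (hs : R s s') (Fail : ∀ i, Set (S × Ω i))
    (hR : ∀ i s s' r, R s s' → (s, r) ∉ Fail i → R (f i s r) (f' i s' r)) :
    Measure.pi μ {ω | ¬ R (chain f s ω) (chain f' s' ω)} ≤
      ∑ i : Fin T, ((Measure.pi fun j : Fin i => μ (Fin.castLE i.is_lt.le j)).prod (μ i))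
        {p | (chain (fun j : Fin i => f (Fin.castLE i.is_lt.le j)) s p.1, p.2) ∈ Fail i} := by
  induction T with
  | zero => simp [chain_zero, hs]
  | succ T ih =>
    rw [Fin.sum_univ_castSucc]
    set ν := (Measure.pi fun i : Fin T => μ i.castSucc).prod (μ (Fin.last T)) with hν
    set E : Set (∀ i : Fin T, Ω i.castSucc) := {ω | ¬ R (chain (fun i : Fin T => f i.castSucc) s ω)
      (chain (fun i : Fin T => f' i.castSucc) s' ω)} with hE
    set G : Set ((∀ i : Fin T, Ω i.castSucc) × Ω (Fin.last T)) :=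
      {p | (chain (fun j : Fin T => f j.castSucc) s p.1, p.2) ∈ Fail (Fin.last T)} with hG
    -- Neither the relation nor the failure sets are assumed measurable, so the law of the pair
    -- (prefix, last step) is transported on a measurable hull of the bad event.
    let tm := toMeasurable ν (Prod.fst ⁻¹' E ∪ G)
    have hinit : Measurable fun ω : (∀ i, Ω i) =>
        ((fun i : Fin T => ω i.castSucc, ω (Fin.last T)) :
          (∀ i : Fin T, Ω i.castSucc) × Ω (Fin.last T)) := by fun_prop
    have hsub : {ω | ¬ R (chain f s ω) (chain f' s' ω)} ⊆
        (fun ω : (∀ i, Ω i) => ((fun i : Fin T => ω i.castSucc, ω (Fin.last T)) :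
          (∀ i : Fin T, Ω i.castSucc) × Ω (Fin.last T))) ⁻¹' tm := by
      intro ω hω
      refine subset_toMeasurable ν _ ?_
      by_contra hc
      simp only [Set.mem_union, not_or] at hc
      apply hω
      rw [chain_succ, chain_succ]
      exact hR _ _ _ _ (not_not.1 hc.1) hc.2
    have hmeas : MeasurableSet tm := measurableSet_toMeasurable _ _
    have hp := measurePreserving_snoc μ
    calc Measure.pi μ {ω | ¬ R (chain f s ω) (chain f' s' ω)}
        ≤ Measure.pi μ ((fun ω : (∀ i, Ω i) => ((fun i : Fin T => ω i.castSucc, ω (Fin.last T)) :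
          (∀ i : Fin T, Ω i.castSucc) × Ω (Fin.last T))) ⁻¹' tm) := measure_mono hsub
      _ = ν tm := by
          rw [← hp.map_eq, Measure.map_apply hp.measurable (hinit hmeas), ← Set.preimage_comp]
          congr 1
          ext p
          simp
      _ = ν (Prod.fst ⁻¹' E ∪ G) := measure_toMeasurable _
      _ ≤ ν (Prod.fst ⁻¹' E) + ν G := measure_union_le _ _
      _ ≤ _ := by
          refine add_le_add ?_ le_rfl
          have : ν (Prod.fst ⁻¹' E) = (Measure.pi fun i : Fin T => μ i.castSucc) E := by
            rw [show (Prod.fst ⁻¹' E : Set ((∀ i : Fin T, Ω i.castSucc) × Ω (Fin.last T))) =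
              E ×ˢ Set.univ by ext; simp]
            rw [Measure.prod_prod, measure_univ, mul_one]
          rw [this]
          exact ih (fun i => μ i.castSucc) (f := fun i => f i.castSucc)
            (f' := fun i => f' i.castSucc) (fun i => Fail i.castSucc)
            (fun i s s' r h h' => hR i.castSucc s s' r h h')

end Chain

/-! ### Concentration of sums of independent bounded vectors -/

section Concentration

lemma integrable_of_norm_le {E Z : Type*} [NormedAddCommGroup E] [MeasurableSpace E] [BorelSpace E]
    [SecondCountableTopology E] [MeasurableSpace Z] (P : Measure Z) [IsFiniteMeasure P]
    {X : Z → E} (hX : Measurable X) {M : ℝ} (hM : ∀ z, ‖X z‖ ≤ M) : Integrable X P :=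
  Integrable.of_bound hX.aestronglyMeasurable M (Filter.Eventually.of_forall hM)

lemma norm_sum_le_of_norm_le {E Z : Type*} [NormedAddCommGroup E] {X : Z → E} {M : ℝ}
    (hM : ∀ z, ‖X z‖ ≤ M) {m : ℕ} (z : Fin m → Z) : ‖∑ r, X (z r)‖ ≤ m * M := by
  refine (norm_sum_le _ _).trans ((Finset.sum_le_sum fun r _ => hM (z r)).trans_eq ?_)
  simp

variable {E : Type*} [NormedAddCommGroup E] [InnerProductSpace ℝ E]

/-- With θ the cosine of the angle, ‖s + x‖² is the average of (‖s‖ + ‖x‖)² and (‖s‖ - ‖x‖)² with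
weights (1 ± θ)/2. As a power series in the squared argument, cosh has nonnegative coefficients and
is therefore convex in the square, term by term; the addition formulas then give the right side. -/
lemma cosh_norm_add_le (s x : E) :
    Real.cosh ‖s + x‖ ≤ Real.cosh ‖s‖ * Real.cosh ‖x‖
      + inner ℝ s x / (‖s‖ * ‖x‖) * (Real.sinh ‖s‖ * Real.sinh ‖x‖) := by
  set a := ‖s‖
  set b := ‖x‖
  set θ := inner ℝ s x / (a * b) with hθ
  have hθ1 : |θ| ≤ 1 := by
    rw [hθ]; exact abs_real_inner_div_norm_mul_norm_le_one s x
  have hab : a * b * θ = inner ℝ s x := by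
    by_cases h : a * b = 0
    · have : |inner ℝ s x| ≤ 0 := (abs_real_inner_le_norm s x).trans_eq h
      rw [h, zero_mul]
      exact (abs_nonpos_iff.1 this).symm
    · rw [hθ, mul_div_cancel₀ _ h]
  obtain ⟨h1, h2⟩ := abs_le.1 hθ1
  have hy : ‖s + x‖ ^ 2 = (1 + θ) / 2 * (a + b) ^ 2 + (1 - θ) / 2 * (a - b) ^ 2 := by
    rw [norm_add_sq_real, ← hab]; ring
  have key : Real.cosh ‖s + x‖ ≤
      (1 + θ) / 2 * Real.cosh (a + b) + (1 - θ) / 2 * Real.cosh (a - b) := by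
    refine hasSum_le (fun n => ?_) (Real.hasSum_cosh _)
      (((Real.hasSum_cosh (a + b)).mul_left ((1 + θ) / 2)).add
        ((Real.hasSum_cosh (a - b)).mul_left ((1 - θ) / 2)))
    rw [← mul_div_assoc, ← mul_div_assoc, ← add_div]
    refine div_le_div_of_nonneg_right ?_ (by positivity)
    rw [pow_mul, pow_mul, pow_mul, hy]
    have hc : ConvexOn ℝ (Set.Ici (0 : ℝ)) fun x => x ^ n := convexOn_pow n
    have := hc.2 (Set.mem_Ici.2 (sq_nonneg (a + b))) (Set.mem_Ici.2 (sq_nonneg (a - b)))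
      (show 0 ≤ (1 + θ) / 2 by linarith) (show 0 ≤ (1 - θ) / 2 by linarith) (by ring)
    simpa using this
  refine key.trans_eq ?_
  rw [Real.cosh_add, Real.cosh_sub]
  ring

lemma exp_sub_id_mono {b M : ℝ} (hb : 0 ≤ b) (hM : b ≤ M) :
    Real.exp b - b ≤ Real.exp M - M := by
  have h1 : Real.exp M = Real.exp b * Real.exp (M - b) := by
    rw [← Real.exp_add]; congr 1; ring
  have h2 : 1 + (M - b) ≤ Real.exp (M - b) := by linarith [Real.add_one_le_exp (M - b)]
  have h3 : 1 ≤ Real.exp b := Real.one_le_exp hb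
  nlinarith [mul_nonneg (sub_nonneg.2 h3) (sub_nonneg.2 hM),
    mul_le_mul_of_nonneg_left h2 (Real.exp_pos b).le]

/-- Separates a part linear in `x`, which disappears in expectation when `x` is centered, from a
factor exp M - M = 1 + O(M²). It rests on θ ≤ 1 and t ≤ sinh t: θ sinh‖x‖ ≤ θ‖x‖ + (sinh‖x‖ - ‖x‖).
-/
lemma cosh_norm_add_le' (s x : E) {M : ℝ} (hx : ‖x‖ ≤ M) :
    Real.cosh ‖s + x‖ ≤ Real.cosh ‖s‖ * (Real.exp M - M)
      + Real.sinh ‖s‖ / ‖s‖ * inner ℝ s x := by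
  refine (cosh_norm_add_le s x).trans ?_
  have h1 : inner ℝ s x / (‖s‖ * ‖x‖) * Real.sinh ‖x‖ ≤
      inner ℝ s x / ‖s‖ + (Real.sinh ‖x‖ - ‖x‖) := by
    have hθ1 := (abs_le.1 (abs_real_inner_div_norm_mul_norm_le_one s x)).2
    have h2 : inner ℝ s x / ‖s‖ = inner ℝ s x / (‖s‖ * ‖x‖) * ‖x‖ := by
      by_cases h : ‖x‖ = 0
      · have : x = 0 := norm_eq_zero.1 h
        simp [this]
      · by_cases h' : ‖s‖ = 0
        · simp [h']
        · field_simp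
    rw [h2]
    have h3 : ‖x‖ ≤ Real.sinh ‖x‖ := Real.self_le_sinh_iff.2 (norm_nonneg _)
    nlinarith [mul_le_mul_of_nonneg_right hθ1 (sub_nonneg.2 h3)]
  have hs0 : 0 ≤ Real.sinh ‖s‖ := Real.sinh_nonneg_iff.2 (norm_nonneg _)
  have hsc : Real.sinh ‖s‖ ≤ Real.cosh ‖s‖ := (Real.sinh_lt_cosh _).le
  have h3 : ‖x‖ ≤ Real.sinh ‖x‖ := Real.self_le_sinh_iff.2 (norm_nonneg _)
  have h4 := exp_sub_id_mono (norm_nonneg x) hx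
  have h5 : Real.exp ‖x‖ = Real.cosh ‖x‖ + Real.sinh ‖x‖ := (Real.cosh_add_sinh _).symm
  calc Real.cosh ‖s‖ * Real.cosh ‖x‖
      + inner ℝ s x / (‖s‖ * ‖x‖) * (Real.sinh ‖s‖ * Real.sinh ‖x‖)
      = Real.cosh ‖s‖ * Real.cosh ‖x‖
        + Real.sinh ‖s‖ * (inner ℝ s x / (‖s‖ * ‖x‖) * Real.sinh ‖x‖) := by ring
    _ ≤ Real.cosh ‖s‖ * Real.cosh ‖x‖
        + Real.sinh ‖s‖ * (inner ℝ s x / ‖s‖ + (Real.sinh ‖x‖ - ‖x‖)) := by gcongr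
    _ = Real.cosh ‖s‖ * Real.cosh ‖x‖ + Real.sinh ‖s‖ * (Real.sinh ‖x‖ - ‖x‖)
        + Real.sinh ‖s‖ / ‖s‖ * inner ℝ s x := by ring
    _ ≤ Real.cosh ‖s‖ * Real.cosh ‖x‖ + Real.cosh ‖s‖ * (Real.sinh ‖x‖ - ‖x‖)
        + Real.sinh ‖s‖ / ‖s‖ * inner ℝ s x := by
        gcongr
    _ = Real.cosh ‖s‖ * (Real.exp ‖x‖ - ‖x‖) + Real.sinh ‖s‖ / ‖s‖ * inner ℝ s x := by
        rw [h5]; ring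
    _ ≤ _ := by
        gcongr

variable [MeasurableSpace E] [BorelSpace E] [SecondCountableTopology E] [CompleteSpace E]
  {Z : Type*} [MeasurableSpace Z] (P : Measure Z) [IsProbabilityMeasure P]

/-- Plays the role of the moment generating function: conditionally on the earlier summands the
linear term of `cosh_norm_add_le'` has mean zero, so each new summand costs one factor. The
dimension never enters. -/
lemma integral_cosh_norm_sum_le {X : Z → E} (hX : Measurable X) {M : ℝ} (hM : ∀ z, ‖X z‖ ≤ M)
    (h0 : ∫ z, X z ∂P = 0) (m : ℕ) :
    ∫ z, Real.cosh ‖∑ r, X (z r)‖ ∂Measure.pi (fun _ : Fin m => P) ≤ (Real.exp M - M) ^ m := by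
  induction m with
  | zero => simp
  | succ m ih =>
    have hM0 : 0 ≤ M := by
      obtain ⟨z⟩ : Nonempty Z := nonempty_of_isProbabilityMeasure P
      exact (norm_nonneg _).trans (hM z)
    have hp := measurePreserving_snoc fun _ : Fin (m + 1) => P
    have hb : ∀ (k : ℕ) (z : Fin k → Z),
        |Real.cosh ‖∑ r, X (z r)‖| ≤ Real.cosh (k * M) := fun k z => by
      rw [abs_of_pos (Real.cosh_pos _), Real.cosh_le_cosh, abs_of_nonneg (norm_nonneg _),
        abs_of_nonneg (by positivity)]
      exact norm_sum_le_of_norm_le hM z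
    have hmeas : ∀ k : ℕ, Measurable fun z : Fin k → Z => Real.cosh ‖∑ r, X (z r)‖ := fun k =>
      Real.measurable_cosh.comp (Finset.measurable_sum _ fun r _ =>
        hX.comp (measurable_pi_apply r)).norm
    have hint : ∀ k : ℕ, Integrable (fun z : Fin k → Z => Real.cosh ‖∑ r, X (z r)‖)
        (Measure.pi fun _ => P) := fun k =>
      Integrable.of_bound (hmeas k).aestronglyMeasurable _ (Filter.Eventually.of_forall (hb k))
    rw [← hp.map_eq, integral_map hp.measurable.aemeasurable (hmeas _).aestronglyMeasurable,
      integral_prod _ (by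
        refine Integrable.of_bound ((hmeas (m + 1)).comp hp.measurable).aestronglyMeasurable _
          (Filter.Eventually.of_forall fun p => hb _ _))]
    simp only [Fin.sum_univ_castSucc, Fin.snoc_castSucc, Fin.snoc_last]
    calc _ ≤ ∫ z, Real.cosh ‖∑ r, X (z r)‖ * (Real.exp M - M)
          ∂Measure.pi (fun _ : Fin m => P) := by
          refine integral_mono_of_nonneg (Filter.Eventually.of_forall fun z =>
            integral_nonneg fun _ => (Real.cosh_pos _).le) ((hint m).mul_const _)
            (Filter.Eventually.of_forall fun z => ?_)
          set s := ∑ r, X (z r)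
          have hi : Integrable (fun x => Real.sinh ‖s‖ / ‖s‖ * inner ℝ s (X x)) P :=
            ((integrable_of_norm_le P hX hM).const_inner s).const_mul _
          calc ∫ x, Real.cosh ‖s + X x‖ ∂P
              ≤ ∫ x, (Real.cosh ‖s‖ * (Real.exp M - M)
                + Real.sinh ‖s‖ / ‖s‖ * inner ℝ s (X x)) ∂P :=
                integral_mono_of_nonneg (Filter.Eventually.of_forall fun _ => (Real.cosh_pos _).le)
                  ((integrable_const _).add hi)
                  (Filter.Eventually.of_forall fun x => cosh_norm_add_le' s (X x) (hM x))
            _ = _ := by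
                rw [integral_add (integrable_const _) hi, integral_const, integral_const_mul,
                  integral_inner (integrable_of_norm_le P hX hM), h0]
                simp [s]
      _ ≤ _ := by
          rw [integral_mul_const, pow_succ]
          have : 0 ≤ Real.exp M - M := by linarith [Real.add_one_le_exp M]
          gcongr

/-- Hoeffding-type bound for bounded centered vectors, independent of the dimension. -/
lemma measure_norm_sum_gt_le {X : Z → E} (hX : Measurable X) {b : ℝ} (hb : 0 < b)
    (hM : ∀ z, ‖X z‖ ≤ b) (h0 : ∫ z, X z ∂P = 0) {m : ℕ} (hm : 1 ≤ m) (a : ℝ) :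
    (Measure.pi (fun _ : Fin m => P)).real {z | b * √m * a < ‖∑ r, X (z r)‖} ≤
      2 * Real.exp (1 - a) := by
  have hm' : (1 : ℝ) ≤ √m := by
    rw [Real.one_le_sqrt]; exact_mod_cast hm
  -- With this scaling each summand has norm at most 1/√m, and exp x - x ≤ 1 + x² ≤ exp(x²) at x =
  -- 1/√m bounds the m-fold product by e. Markov's inequality with cosh t ≥ exp(t)/2 then gives an
  -- exponential tail in `a`; a Gaussian tail is not needed because τ carries a full logarithm.
  set θ : ℝ := 1 / (b * √m) with hθ
  have hθ0 : 0 < θ := by positivity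
  have h1 := integral_cosh_norm_sum_le P (X := fun z => θ • X z) (hX.const_smul θ)
    (M := 1 / √m) (fun z => by
      rw [norm_smul, Real.norm_of_nonneg hθ0.le, hθ]
      calc 1 / (b * √m) * ‖X z‖ ≤ 1 / (b * √m) * b := by gcongr; exact hM z
        _ = 1 / √m := by field_simp) (by rw [integral_smul, h0, smul_zero]) m
  have h2 : (Real.exp (1 / √m) - 1 / √m) ^ m ≤ Real.exp 1 := by
    have h3 : Real.exp (1 / √m) - 1 / √m ≤ Real.exp (1 / m) := by
      have h4 : |1 / √(m : ℝ)| ≤ 1 := by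
        rw [abs_of_pos (by positivity)]
        exact (div_le_one (by positivity)).2 hm'
      have h5 := (abs_le.1 (Real.abs_exp_sub_one_sub_id_le h4)).2
      have h6 : (1 / √(m : ℝ)) ^ 2 = 1 / m := by
        rw [div_pow, Real.sq_sqrt (by positivity), one_pow]
      have h7 := Real.add_one_le_exp (1 / (m : ℝ))
      rw [h6] at h5
      linarith
    have h8 : 0 ≤ Real.exp (1 / √m) - 1 / √m := by linarith [Real.add_one_le_exp (1 / √(m : ℝ))]
    calc _ ≤ (Real.exp (1 / m)) ^ m := pow_le_pow_left₀ h8 h3 m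
      _ = Real.exp 1 := by
        rw [← Real.exp_nat_mul]; congr 1; field_simp
  have hmeas : Measurable fun z : Fin m → Z => Real.cosh ‖∑ r, θ • X (z r)‖ :=
    Real.measurable_cosh.comp (Finset.measurable_sum _ fun r _ =>
        (hX.comp (measurable_pi_apply r)).const_smul θ).norm
  have hint : Integrable (fun z : Fin m → Z => Real.cosh ‖∑ r, θ • X (z r)‖)
      (Measure.pi fun _ : Fin m => P) := by
    refine Integrable.of_bound hmeas.aestronglyMeasurable (Real.cosh (m * (θ * b)))
      (Filter.Eventually.of_forall fun z => ?_)
    rw [Real.norm_of_nonneg (Real.cosh_pos _).le, Real.cosh_le_cosh,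
      abs_of_nonneg (norm_nonneg _), abs_of_nonneg (by positivity)]
    refine norm_sum_le_of_norm_le (X := fun z => θ • X z) (fun z => ?_) z
    rw [norm_smul, Real.norm_of_nonneg hθ0.le]
    gcongr; exact hM z
  have h3 := mul_meas_ge_le_integral_of_nonneg
    (Filter.Eventually.of_forall fun _ => (Real.cosh_pos _).le) hint (Real.exp a / 2)
  have h4 : (Measure.pi (fun _ : Fin m => P)).real {z | b * √m * a < ‖∑ r, X (z r)‖} ≤
      (Measure.pi (fun _ : Fin m => P)).real
        {z | Real.exp a / 2 ≤ Real.cosh ‖∑ r, θ • X (z r)‖} := by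
    refine measureReal_mono fun z hz => ?_
    change Real.exp a / 2 ≤ Real.cosh ‖∑ r, θ • X (z r)‖
    replace hz : b * √m * a < ‖∑ r, X (z r)‖ := hz
    rw [← Finset.smul_sum, norm_smul, Real.norm_of_nonneg hθ0.le, Real.cosh_eq]
    have h5 : a ≤ θ * ‖∑ r, X (z r)‖ := by
      rw [hθ, one_div_mul_eq_div, le_div_iff₀ (by positivity)]
      linarith
    have := Real.exp_le_exp.2 h5
    have := (Real.exp_pos (-(θ * ‖∑ r, X (z r)‖))).le
    linarith
  rw [Real.exp_sub, ← mul_div_assoc, le_div_iff₀ (Real.exp_pos a)]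
  have := Real.exp_pos a
  nlinarith

/-- Independent centered vectors are orthogonal in L². The uniform bound `M` serves integrability
only. -/
lemma integral_norm_sum_sq_le {X : Z → E} (hX : Measurable X) {M v : ℝ} (hM : ∀ z, ‖X z‖ ≤ M)
    (h0 : ∫ z, X z ∂P = 0) (hv : ∫ z, ‖X z‖ ^ 2 ∂P ≤ v) (m : ℕ) :
    ∫ z, ‖∑ r, X (z r)‖ ^ 2 ∂Measure.pi (fun _ : Fin m => P) ≤ m * v := by
  induction m with
  | zero => simp
  | succ m ih =>
    have hM0 : 0 ≤ M := by
      obtain ⟨z⟩ : Nonempty Z := nonempty_of_isProbabilityMeasure P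
      exact (norm_nonneg _).trans (hM z)
    have hp := measurePreserving_snoc fun _ : Fin (m + 1) => P
    have hb : ∀ (k : ℕ) (z : Fin k → Z), ‖‖∑ r, X (z r)‖ ^ 2‖ ≤ (k * M) ^ 2 := fun k z => by
      rw [Real.norm_of_nonneg (by positivity)]
      exact pow_le_pow_left₀ (norm_nonneg _) (norm_sum_le_of_norm_le hM z) 2
    have hmeas : ∀ k : ℕ, Measurable fun z : Fin k → Z => ‖∑ r, X (z r)‖ ^ 2 := fun k =>
      (Finset.measurable_sum _ fun r _ => hX.comp (measurable_pi_apply r)).norm.pow_const 2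
    have hint : ∀ k : ℕ, Integrable (fun z : Fin k → Z => ‖∑ r, X (z r)‖ ^ 2)
        (Measure.pi fun _ => P) := fun k =>
      Integrable.of_bound (hmeas k).aestronglyMeasurable _ (Filter.Eventually.of_forall (hb k))
    rw [← hp.map_eq, integral_map hp.measurable.aemeasurable (hmeas _).aestronglyMeasurable,
      integral_prod _ (by
        refine Integrable.of_bound ((hmeas (m + 1)).comp hp.measurable).aestronglyMeasurable _
          (Filter.Eventually.of_forall fun p => hb _ _))]
    simp only [Fin.sum_univ_castSucc, Fin.snoc_castSucc, Fin.snoc_last]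
    have hXs : Integrable (fun x => ‖X x‖ ^ 2) P := by
      refine Integrable.of_bound (hX.norm.pow_const 2).aestronglyMeasurable (M ^ 2)
        (Filter.Eventually.of_forall fun z => ?_)
      rw [Real.norm_of_nonneg (by positivity)]
      exact pow_le_pow_left₀ (norm_nonneg _) (hM z) 2
    have hin : ∀ s : E, ∫ x, ‖s + X x‖ ^ 2 ∂P = ‖s‖ ^ 2 + ∫ x, ‖X x‖ ^ 2 ∂P := fun s => by
      simp_rw [norm_add_sq_real]
      have hi : Integrable (fun x => 2 * inner ℝ s (X x)) P :=
            ((integrable_of_norm_le P hX hM).const_inner s).const_mul _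
      rw [integral_add (f := fun x => ‖s‖ ^ 2 + 2 * inner ℝ s (X x))
          ((integrable_const _).add hi) hXs,
        integral_add (integrable_const _) hi,
        integral_const_mul, integral_inner (integrable_of_norm_le P hX hM), h0]
      simp
    simp_rw [hin]
    rw [integral_add (hint m) (integrable_const _)]
    simp only [integral_const, probReal_univ, smul_eq_mul, one_mul]
    push_cast
    linarith

end Concentration

/-! ### Gaussian and Laplace noise -/

section Noise

variable {d : ℕ}

lemma integral_stdGaussian {F : Type*} [NormedAddCommGroup F] [NormedSpace ℝ F]
    {φ : Vec d → F} (hφ : StronglyMeasurable φ) :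
    ∫ x, φ x ∂stdGaussian (Vec d) =
      ∫ x : Fin d → ℝ, φ (WithLp.toLp 2 x) ∂Measure.pi fun _ => gaussianReal 0 1 := by
  rw [← map_pi_eq_stdGaussian, integral_map (by fun_prop) hφ.aestronglyMeasurable]

lemma real_inner_toLp (a : Vec d) (x : Fin d → ℝ) :
    inner ℝ a (WithLp.toLp 2 x) = ∑ i, a i * x i := by
  simp [PiLp.inner_apply, mul_comm]

lemma integrable_exp_inner_stdGaussian (a : Vec d) :
    Integrable (fun x => Real.exp (inner ℝ a x)) (stdGaussian (Vec d)) := by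
  rw [← map_pi_eq_stdGaussian, integrable_map_measure (by fun_prop) (by fun_prop)]
  have : Integrable (fun x : Fin d → ℝ => ∏ i, Real.exp (a i * x i))
      (Measure.pi fun _ => gaussianReal 0 1) :=
    Integrable.fintype_prod (f := fun i x => Real.exp (a i * x))
      fun i => integrable_exp_mul_gaussianReal (a i)
  refine this.congr (Filter.Eventually.of_forall fun x => ?_)
  simp only [Function.comp, real_inner_toLp, Real.exp_sum]

lemma integral_exp_inner_stdGaussian (a : Vec d) :
    ∫ x, Real.exp (inner ℝ a x) ∂stdGaussian (Vec d) = Real.exp (‖a‖ ^ 2 / 2) := by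
  rw [integral_stdGaussian (by fun_prop)]
  simp_rw [real_inner_toLp, Real.exp_sum]
  rw [integral_fintype_prod_eq_prod (f := fun i x => Real.exp (a i * x))]
  have : ∀ i, ∫ x, Real.exp (a i * x) ∂gaussianReal 0 1 = Real.exp (a i ^ 2 / 2) := fun i => by
    have := congrFun (mgf_id_gaussianReal (μ := 0) (v := 1)) (a i)
    simpa [mgf] using this
  simp_rw [this]
  rw [← Real.exp_sum, ← Finset.sum_div, EuclideanSpace.real_norm_sq_eq]

/-- The density of the translate by `a` of the standard Gaussian. -/
def gaussTilt (a x : Vec d) : ℝ := Real.exp (inner ℝ a x - ‖a‖ ^ 2 / 2)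

lemma gaussTilt_pos (a x : Vec d) : 0 < gaussTilt a x := Real.exp_pos _

lemma measurable_gaussTilt (a : Vec d) : Measurable (gaussTilt a) := by
  unfold gaussTilt; fun_prop

lemma integrable_gaussTilt (a : Vec d) : Integrable (gaussTilt a) (stdGaussian (Vec d)) := by
  have := (integrable_exp_inner_stdGaussian a).mul_const (Real.exp (-(‖a‖ ^ 2 / 2)))
  refine this.congr (Filter.Eventually.of_forall fun x => ?_)
  simp only [gaussTilt, ← Real.exp_add, sub_eq_add_neg]

lemma integrable_gaussTilt_mul (a b : Vec d) :
    Integrable (fun x => gaussTilt a x * gaussTilt b x) (stdGaussian (Vec d)) := by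
  have := (integrable_exp_inner_stdGaussian (a + b)).mul_const
    (Real.exp (-(‖a‖ ^ 2 / 2) - ‖b‖ ^ 2 / 2))
  refine this.congr (Filter.Eventually.of_forall fun x => ?_)
  simp only [gaussTilt, ← Real.exp_add, inner_add_left]
  congr 1; ring

/-- The χ² identity for translates of a Gaussian: it computes the second moment of the likelihood
ratio of a mixture of translates as an average of exp⟪v, v'⟫ over two independent translations. -/
lemma integral_gaussTilt_mul (a b : Vec d) :
    ∫ x, gaussTilt a x * gaussTilt b x ∂stdGaussian (Vec d) = Real.exp (inner ℝ a b) := by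
  have : ∀ x, gaussTilt a x * gaussTilt b x =
      Real.exp (inner ℝ (a + b) x) * Real.exp (-(‖a‖ ^ 2 / 2) - ‖b‖ ^ 2 / 2) := fun x => by
    simp only [gaussTilt, ← Real.exp_add, inner_add_left]
    congr 1; ring
  simp_rw [this]
  rw [integral_mul_const, integral_exp_inner_stdGaussian, ← Real.exp_add, norm_add_sq_real]
  congr 1; ring

/-- The Cameron–Martin formula. Both sides have the same characteristic function: on the right it
factors over the coordinates into one-dimensional Gaussian moment generating functions at the
complex points a_i + i t_i. -/
lemma map_add_stdGaussian (a : Vec d) :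
    (stdGaussian (Vec d)).map (fun x => a + x) =
      (stdGaussian (Vec d)).withDensity fun x => ENNReal.ofReal (gaussTilt a x) := by
  have hfin : IsFiniteMeasure ((stdGaussian (Vec d)).withDensity
      fun x => ENNReal.ofReal (gaussTilt a x)) :=
    isFiniteMeasure_withDensity_ofReal (integrable_gaussTilt a).2
  have hprob : IsProbabilityMeasure ((stdGaussian (Vec d)).map (fun x => a + x)) :=
    Measure.isProbabilityMeasure_map (by fun_prop)
  apply Measure.ext_of_charFun
  ext t
  rw [charFun_apply, charFun_apply, integral_map (by fun_prop) (by fun_prop),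
    integral_withDensity_eq_integral_toReal_smul (measurable_gaussTilt a).ennreal_ofReal
      (Filter.Eventually.of_forall fun _ => ENNReal.ofReal_lt_top)]
  have h1 : ∫ x, Complex.exp ((inner ℝ (a + x) t : ℝ) * Complex.I) ∂stdGaussian (Vec d) =
      Complex.exp ((inner ℝ a t : ℝ) * Complex.I) * Complex.exp (-‖t‖ ^ 2 / 2) := by
    rw [← charFun_stdGaussian, charFun_apply, ← integral_const_mul]
    congr 1; ext x
    rw [inner_add_left, ← Complex.exp_add]
    push_cast; ring_nf
  rw [h1, integral_stdGaussian]
  swap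
  · refine Measurable.stronglyMeasurable ?_
    have := measurable_gaussTilt a
    fun_prop
  have h2 : ∀ x : Fin d → ℝ, (ENNReal.ofReal (gaussTilt a (WithLp.toLp 2 x))).toReal •
      Complex.exp ((inner ℝ (WithLp.toLp 2 x : Vec d) t : ℝ) * Complex.I) =
      Complex.exp (-(‖a‖ ^ 2 / 2 : ℝ)) *
        ∏ i, Complex.exp ((a i + t i * Complex.I) * x i) := fun x => by
    rw [ENNReal.toReal_ofReal (gaussTilt_pos _ _).le, Complex.real_smul, gaussTilt,
      Complex.ofReal_exp, ← Complex.exp_sum, ← Complex.exp_add, ← Complex.exp_add,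
      real_inner_comm t, real_inner_toLp, real_inner_toLp]
    congr 1
    push_cast
    simp_rw [add_mul, Finset.sum_add_distrib, Finset.sum_mul]
    have : ∑ i, ((t i : ℂ) * x i * Complex.I) = ∑ i, (t i : ℂ) * Complex.I * x i :=
      Finset.sum_congr rfl fun i _ => by ring
    rw [this]; ring
  simp_rw [h2]
  rw [integral_const_mul, integral_fintype_prod_eq_prod
    (f := fun i (x : ℝ) => Complex.exp ((a i + t i * Complex.I) * x))]
  have h3 : ∀ i, ∫ x : ℝ, Complex.exp ((a i + t i * Complex.I) * x) ∂gaussianReal 0 1 =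
      Complex.exp ((a i + t i * Complex.I) ^ 2 / 2) := fun i => by
    have := complexMGF_id_gaussianReal (μ := 0) (v := 1) (a i + t i * Complex.I)
    simpa [complexMGF] using this
  simp_rw [h3]
  rw [← Complex.exp_sum, ← Complex.exp_add, ← Complex.exp_add]
  congr 1
  have h4 : (inner ℝ a t : ℝ) = ∑ i, a i * t i := by simp [PiLp.inner_apply, mul_comm]
  have h5 : ‖a‖ ^ 2 = ∑ i, a i ^ 2 := EuclideanSpace.real_norm_sq_eq a
  have h6 : ‖t‖ ^ 2 = ∑ i, t i ^ 2 := EuclideanSpace.real_norm_sq_eq t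
  rw [h4, h5, ← Complex.ofReal_pow, h6]
  push_cast
  have h7 : ∀ i, ((a i : ℂ) + t i * Complex.I) ^ 2 / 2 =
      (a i : ℂ) ^ 2 / 2 + a i * t i * Complex.I - (t i : ℂ) ^ 2 / 2 := fun i => by
    have := Complex.I_sq
    linear_combination ((t i : ℂ) ^ 2 / 2) * this
  simp_rw [h7, Finset.sum_sub_distrib, Finset.sum_add_distrib, Finset.sum_mul, ← Finset.sum_div]
  ring

lemma integral_add_stdGaussian {φ : Vec d → ℝ} (hφ : Measurable φ) (a : Vec d) :
    ∫ x, φ (a + x) ∂stdGaussian (Vec d) =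
      ∫ x, gaussTilt a x * φ x ∂stdGaussian (Vec d) := by
  have := integral_map (μ := stdGaussian (Vec d)) (φ := fun x => a + x) (by fun_prop)
    (hφ.aestronglyMeasurable)
  rw [← this, map_add_stdGaussian, integral_withDensity_eq_integral_toReal_smul
    (measurable_gaussTilt a).ennreal_ofReal
      (Filter.Eventually.of_forall fun _ => ENNReal.ofReal_lt_top)]
  congr 1; ext x
  rw [ENNReal.toReal_ofReal (gaussTilt_pos _ _).le, smul_eq_mul]

instance isProbabilityMeasure_gaussianVec (σ : ℝ) : IsProbabilityMeasure (gaussianVec d σ) :=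
  Measure.isProbabilityMeasure_map (by fun_prop)

lemma integral_gaussianVec {F : Type*} [NormedAddCommGroup F] [NormedSpace ℝ F] (σ : ℝ)
    {φ : Vec d → F} (hφ : StronglyMeasurable φ) :
    ∫ x, φ x ∂gaussianVec d σ = ∫ x, φ (σ • x) ∂stdGaussian (Vec d) := by
  rw [gaussianVec, integral_map (by fun_prop) hφ.aestronglyMeasurable]

lemma memLp_gaussianVec (σ : ℝ) : MemLp (fun x => x) 2 (gaussianVec d σ) := by
  rw [gaussianVec, memLp_map_measure_iff (by fun_prop) (by fun_prop)]
  exact (IsGaussian.memLp_two_id (μ := stdGaussian (Vec d))).const_smul σ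

lemma integrable_gaussianVec (σ : ℝ) : Integrable (fun x => x) (gaussianVec d σ) :=
  (memLp_gaussianVec σ).integrable (by norm_num)

lemma integrable_norm_sq_gaussianVec (σ : ℝ) :
    Integrable (fun x => ‖x‖ ^ 2) (gaussianVec d σ) :=
  (memLp_gaussianVec σ).integrable_norm_pow (by norm_num)

lemma integral_id_gaussianVec (σ : ℝ) : ∫ x, x ∂gaussianVec d σ = 0 := by
  rw [integral_gaussianVec (φ := fun x => x) σ stronglyMeasurable_id, integral_smul,
      integral_id_stdGaussian,
    smul_zero]

lemma integral_norm_sq_gaussianVec (σ : ℝ) :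
    ∫ x, ‖x‖ ^ 2 ∂gaussianVec d σ = d * σ ^ 2 := by
  rw [integral_gaussianVec σ (by fun_prop)]
  simp_rw [norm_smul, mul_pow]
  rw [integral_const_mul, integral_stdGaussian (by fun_prop)]
  simp_rw [EuclideanSpace.real_norm_sq_eq]
  have h1 : Integrable (fun x : ℝ => x ^ 2) (gaussianReal 0 1) :=
    (IsGaussian.memLp_two_id (μ := gaussianReal 0 1)).integrable_sq
  rw [integral_finsetSum _ fun i _ => integrable_comp_eval (μ := fun _ : Fin d => gaussianReal 0 1)
    (i := i) h1]
  have h2 : ∫ x : ℝ, x ^ 2 ∂gaussianReal 0 1 = 1 := by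
    have := variance_id_gaussianReal (μ := 0) (v := 1)
    rw [variance_eq_integral (by fun_prop)] at this
    simpa using this
  have h3 : ∀ i : Fin d, ∫ x : Fin d → ℝ, x i ^ 2 ∂(Measure.pi fun _ => gaussianReal 0 1) = 1 :=
    fun i => by
      rw [← h2]
      exact integral_comp_eval (μ := fun _ : Fin d => gaussianReal 0 1) (i := i)
        (f := fun x => x ^ 2) (by fun_prop)
  simp [h3, mul_comm]

lemma laplace_Ioi {b a : ℝ} (hb : 0 < b) (ha : 0 ≤ a) :
    laplace b (Set.Ioi a) = ENNReal.ofReal (Real.exp (-(a / b)) / 2) := by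
  rw [laplace, withDensity_apply _ measurableSet_Ioi]
  have hb' : -(1 / b) < 0 := neg_neg_of_pos (by positivity)
  have h1 : ∫⁻ x in Set.Ioi a, ENNReal.ofReal (1 / (2 * b) * Real.exp (-|x| / b)) =
      ∫⁻ x in Set.Ioi a, ENNReal.ofReal (1 / (2 * b) * Real.exp (-(1 / b) * x)) := by
    refine setLIntegral_congr_fun measurableSet_Ioi fun x hx => ?_
    have hx0 : 0 ≤ x := ha.trans (le_of_lt hx)
    simp only [abs_of_nonneg hx0]
    congr 3; ring
  rw [h1, ← ofReal_integral_eq_lintegral_ofReal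
    ((integrableOn_exp_mul_Ioi hb' a).const_mul _)
    (Filter.Eventually.of_forall fun x => by positivity), integral_const_mul,
    integral_exp_mul_Ioi hb']
  congr 1
  rw [show -(1 / b) * a = -(a / b) by ring]
  field_simp

lemma laplace_Iic {b a : ℝ} (hb : 0 < b) (ha : 0 ≤ a) :
    laplace b (Set.Iic (-a)) = ENNReal.ofReal (Real.exp (-(a / b)) / 2) := by
  rw [laplace, withDensity_apply _ measurableSet_Iic]
  have hb' : 0 < 1 / b := by positivity
  have h1 : ∫⁻ x in Set.Iic (-a), ENNReal.ofReal (1 / (2 * b) * Real.exp (-|x| / b)) =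
      ∫⁻ x in Set.Iic (-a), ENNReal.ofReal (1 / (2 * b) * Real.exp ((1 / b) * x)) := by
    refine setLIntegral_congr_fun measurableSet_Iic fun x hx => ?_
    have hx0 : x ≤ 0 := (show x ≤ -a from hx).trans (by linarith)
    simp only [abs_of_nonpos hx0]
    congr 3; ring
  rw [h1, ← ofReal_integral_eq_lintegral_ofReal
    ((integrableOn_exp_mul_Iic hb' (-a)).const_mul _)
    (Filter.Eventually.of_forall fun x => by positivity), integral_const_mul,
    integral_exp_mul_Iic hb']
  congr 1
  rw [show 1 / b * -a = -(a / b) by ring]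
  field_simp

lemma isProbabilityMeasure_laplace {b : ℝ} (hb : 0 < b) : IsProbabilityMeasure (laplace b) := by
  constructor
  rw [← Set.Iic_union_Ioi (a := (0 : ℝ)), measure_union (Set.Iic_disjoint_Ioi le_rfl)
    measurableSet_Ioi, laplace_Ioi hb le_rfl]
  have := laplace_Iic hb le_rfl
  rw [neg_zero] at this
  rw [this, ← ENNReal.ofReal_add (by positivity) (by positivity)]
  norm_num

end Noise

/-! ### Projection onto a compact convex set -/

section Projection

variable {d : ℕ} {X : Set (Vec d)}

lemma proj_spec (hX : IsCompact X) (h0 : X.Nonempty) (u : Vec d) :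
    proj X u ∈ X ∧ ∀ w ∈ X, ‖u - proj X u‖ ≤ ‖u - w‖ := by
  refine Classical.epsilon_spec (p := fun y => y ∈ X ∧ ∀ w ∈ X, ‖u - y‖ ≤ ‖u - w‖) ?_
  obtain ⟨y, hy, h⟩ := hX.exists_isMinOn h0 (f := fun w => ‖u - w‖) (by fun_prop)
  exact ⟨y, hy, fun w hw => h hw⟩

lemma proj_inner_le (hX : IsCompact X) (hc : Convex ℝ X) (h0 : X.Nonempty) (u : Vec d)
    {w : Vec d} (hw : w ∈ X) : inner ℝ (u - proj X u) (w - proj X u) ≤ 0 := by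
  obtain ⟨h1, h2⟩ := proj_spec hX h0 u
  refine (norm_eq_iInf_iff_real_inner_le_zero hc h1).1 ?_ w hw
  have : Nonempty X := ⟨⟨_, h1⟩⟩
  refine le_antisymm (le_ciInf fun w => h2 w w.2) ?_
  exact ciInf_le ⟨0, by rintro _ ⟨w, rfl⟩; exact norm_nonneg _⟩ (⟨_, h1⟩ : X)

lemma proj_lipschitz (hX : IsCompact X) (hc : Convex ℝ X) (h0 : X.Nonempty) (u v : Vec d) :
    ‖proj X u - proj X v‖ ≤ ‖u - v‖ := by
  have h1 := proj_inner_le hX hc h0 u (proj_spec hX h0 v).1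
  have h2 := proj_inner_le hX hc h0 v (proj_spec hX h0 u).1
  set a := proj X u
  set b := proj X v
  have h3 : ‖a - b‖ ^ 2 ≤ inner ℝ (u - v) (a - b) := by
    rw [← real_inner_self_eq_norm_sq]
    have : inner ℝ (u - v) (a - b) - inner ℝ (a - b) (a - b) =
        - inner ℝ (u - a) (b - a) - inner ℝ (v - b) (a - b) := by
      simp only [inner_sub_left, inner_sub_right, real_inner_comm]
      ring
    linarith
  have h4 := (real_inner_le_norm (u - v) (a - b))
  by_contra hcon
  push Not at hcon
  have h5 : 0 < ‖a - b‖ := (norm_nonneg _).trans_lt hcon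
  nlinarith

lemma continuous_proj (hX : IsCompact X) (hc : Convex ℝ X) (h0 : X.Nonempty) :
    Continuous (proj X) :=
  (LipschitzWith.of_dist_le' (K := 1) fun u v => by
    simpa [dist_eq_norm] using proj_lipschitz hX hc h0 u v).continuous

lemma proj_eq_self (hX : IsCompact X) {x : Vec d} (hx : x ∈ X) : proj X x = x := by
  have := (proj_spec hX ⟨x, hx⟩ x).2 x hx
  rw [sub_self, norm_zero] at this
  exact (sub_eq_zero.1 (norm_le_zero_iff.1 this)).symm

end Projection

/-! ### First-order inequalities for smooth convex functions on a convex set -/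

section FirstOrder

variable {d : ℕ} {X : Set (Vec d)}

/-- `h` is convex and `β`-smooth on `X` with gradient field `g`, in terms of its first-order
upper and lower models. -/
structure FirstOrder (X : Set (Vec d)) (h : Vec d → ℝ) (g : Vec d → Vec d) (β : ℝ) : Prop where
  lower : ∀ x ∈ X, ∀ y ∈ X, h x + inner ℝ (g x) (y - x) ≤ h y
  upper : ∀ x ∈ X, ∀ y ∈ X, h y ≤ h x + inner ℝ (g x) (y - x) + β / 2 * ‖y - x‖ ^ 2

/-- X may have empty interior, so only gradients relative to X are available. A segment inside X
reduces everything to a derivative on [0, 1]. -/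
lemma hasDerivWithinAt_segment (hX : Convex ℝ X) {h : Vec d → ℝ} {g : Vec d → Vec d}
    (hg : ∀ x ∈ X, HasGradientWithinAt h (g x) X x) {x y : Vec d} (hx : x ∈ X) (hy : y ∈ X)
    {t : ℝ} (ht : t ∈ Set.Icc (0 : ℝ) 1) :
    HasDerivWithinAt (fun t : ℝ => h (x + t • (y - x))) (inner ℝ (g (x + t • (y - x))) (y - x))
      (Set.Icc 0 1) t := by
  have hmaps : Set.MapsTo (fun t : ℝ => x + t • (y - x)) (Set.Icc 0 1) X := fun s hs =>
    hX.add_smul_sub_mem hx hy hs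
  have h1 : HasDerivWithinAt (fun t : ℝ => x + t • (y - x)) (y - x) (Set.Icc 0 1) t := by
    have := ((hasDerivWithinAt_id t (Set.Icc (0 : ℝ) 1)).smul_const (y - x)).const_add x
    simpa using this
  exact (hg _ (hmaps ht)).hasFDerivWithinAt.comp_hasDerivWithinAt t h1 hmaps

/-- Along a segment, convexity puts the slope above the initial derivative, and the Lipschitz
gradient keeps the derivative below that of a quadratic with the same initial value. The rest of the
argument uses these two models and no differentiability. -/
lemma FirstOrder.of_hasGradientWithinAt (hX : Convex ℝ X) {h : Vec d → ℝ} {g : Vec d → Vec d}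
    {β : ℝ} (hc : ConvexOn ℝ X h) (hg : ∀ x ∈ X, HasGradientWithinAt h (g x) X x)
    (hs : ∀ x ∈ X, ∀ y ∈ X, ‖g x - g y‖ ≤ β * ‖x - y‖) : FirstOrder X h g β where
  lower x hx y hy := by
    have h1 := hasDerivWithinAt_segment hX hg hx hy (t := 0) (by simp)
    simp only [zero_smul, add_zero] at h1
    have hcv : ConvexOn ℝ (Set.Icc (0 : ℝ) 1) (fun t : ℝ => h (x + t • (y - x))) := by
      refine ⟨convex_Icc 0 1, fun s hs t ht a b ha hb hab => ?_⟩
      have := hc.2 (hX.add_smul_sub_mem hx hy hs) (hX.add_smul_sub_mem hx hy ht) ha hb hab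
      have e : x + (a • s + b • t) • (y - x) = a • (x + s • (y - x)) + b • (x + t • (y - x)) := by
        obtain rfl : b = 1 - a := by linarith
        module
      change h (x + (a • s + b • t) • (y - x)) ≤ _
      rw [e]
      exact this
    have h2 := hcv.le_slope_of_hasDerivWithinAt (x := 0) (y := 1) (by simp) (by simp)
      zero_lt_one h1
    simp only [slope_def_field, one_smul, zero_smul, add_zero, sub_zero, div_one,
      add_sub_cancel] at h2
    linarith
  upper x hx y hy := by
    set φ : ℝ → ℝ := fun t => h (x + t • (y - x)) with hφ
    set B : ℝ → ℝ := fun t => h x + t * inner ℝ (g x) (y - x) + β / 2 * t ^ 2 * ‖y - x‖ ^ 2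
    have hd : ∀ t ∈ Set.Icc (0 : ℝ) 1, HasDerivWithinAt φ
        (inner ℝ (g (x + t • (y - x))) (y - x)) (Set.Icc 0 1) t := fun t ht =>
      hasDerivWithinAt_segment hX hg hx hy ht
    have hB : ∀ t, HasDerivAt B (inner ℝ (g x) (y - x) + β * t * ‖y - x‖ ^ 2) t := fun t => by
      have h1 := ((hasDerivAt_id t).mul_const (inner ℝ (g x) (y - x))).const_add (h x)
      have h2 := (((hasDerivAt_id t).pow 2).const_mul (β / 2)).mul_const (‖y - x‖ ^ 2)
      have h3 := h1.add h2
      refine h3.congr_deriv ?_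
      simp only [id, Nat.cast_ofNat]; ring
    have key := image_le_of_deriv_right_le_deriv_boundary (a := 0) (b := 1) (f := φ) (B := B)
      (f' := fun t => inner ℝ (g (x + t • (y - x))) (y - x))
      (B' := fun t => inner ℝ (g x) (y - x) + β * t * ‖y - x‖ ^ 2)
      (fun t ht => (hd t ht).continuousWithinAt)
      (fun t ht => by
        refine ((hd t (Set.Ico_subset_Icc_self ht)).mono_of_mem_nhdsWithin ?_)
        exact Icc_mem_nhdsGE_of_mem ht)
      (by simp [hφ, B]) (fun t _ => (hB t).continuousAt.continuousWithinAt)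
      (fun t _ => (hB t).hasDerivWithinAt)
      (fun t ht => by
        have hm := hX.add_smul_sub_mem hx hy (Set.Ico_subset_Icc_self ht)
        have h1 : inner ℝ (g (x + t • (y - x)) - g x) (y - x) ≤ β * t * ‖y - x‖ ^ 2 := by
          refine (real_inner_le_norm _ _).trans ?_
          have h2 := hs _ hm x hx
          rw [add_sub_cancel_left, norm_smul, Real.norm_of_nonneg ht.1] at h2
          calc _ ≤ β * (t * ‖y - x‖) * ‖y - x‖ := by gcongr
            _ = _ := by ring
        rw [inner_sub_left] at h1
        linarith)
    have := key (x := 1) (by simp)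
    simp only [hφ, B, one_smul, add_sub_cancel] at this
    linarith

lemma FirstOrder.convex_comb {ι : Type*} (s : Finset ι) {h : ι → Vec d → ℝ}
    {g : ι → Vec d → Vec d} {β : ℝ} (hh : ∀ i ∈ s, FirstOrder X (h i) (g i) β) (hs : s.Nonempty) :
    FirstOrder X (fun x => (1 / (s.card : ℝ)) * ∑ i ∈ s, h i x)
      (fun x => (1 / (s.card : ℝ)) • ∑ i ∈ s, g i x) β where
  lower x hx y hy := by
    have := Finset.sum_le_sum fun i hi => (hh i hi).lower x hx y hy
    rw [Finset.sum_add_distrib] at this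
    rw [real_inner_smul_left, sum_inner, ← mul_add]
    gcongr
  upper x hx y hy := by
    have := Finset.sum_le_sum fun i hi => (hh i hi).upper x hx y hy
    rw [Finset.sum_add_distrib, Finset.sum_add_distrib, Finset.sum_const, nsmul_eq_mul] at this
    have h0 : (0 : ℝ) < s.card := by exact_mod_cast hs.card_pos
    rw [real_inner_smul_left, sum_inner, ← mul_add]
    calc _ ≤ 1 / (s.card : ℝ) * (∑ i ∈ s, h i x + ∑ i ∈ s, inner ℝ (g i x) (y - x) +
          s.card * (β / 2 * ‖y - x‖ ^ 2)) := by gcongr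
      _ = _ := by field_simp

end FirstOrder

/-! ### One step of AC-SA -/

section Acsa

variable {d : ℕ}

/-- Step size `α = 2 / (s + 1)` of step number `s = k + 1` of a stage. -/
def acsaα (k : ℕ) : ℝ := 2 / ((k : ℝ) + 1 + 1)

/-- Step size `γ = 4 B / (s (s + 1))` of step number `s = k + 1` of a stage. -/
def acsaγ (B : ℝ) (k : ℕ) : ℝ := 4 * B / (((k : ℝ) + 1) * ((k : ℝ) + 1 + 1))

/-- The prox iterate used by iteration `t`, reset at the beginning of a stage. -/
def acsaPrev (N₀ t : ℕ) (s : Vec d × Vec d) : Vec d := if t % N₀ = 0 then s.1 else s.2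

/-- The point at which iteration `t` evaluates gradients. -/
def acsaMid (I : PhaseInput d) (t : ℕ) (s : Vec d × Vec d) : Vec d :=
  ((1 - acsaα (t % I.N₀)) * (I.lam + acsaγ (I.β + I.lam) (t % I.N₀))
      / (acsaγ (I.β + I.lam) (t % I.N₀) + (1 - acsaα (t % I.N₀) ^ 2) * I.lam)) • s.1
    + (acsaα (t % I.N₀) * ((1 - acsaα (t % I.N₀)) * I.lam + acsaγ (I.β + I.lam) (t % I.N₀))
      / (acsaγ (I.β + I.lam) (t % I.N₀) + (1 - acsaα (t % I.N₀) ^ 2) * I.lam))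
        • acsaPrev I.N₀ t s

/-- The new prox iterate, for the stochastic gradient `v` of the unregularized loss. -/
def acsaProx (I : PhaseInput d) (t : ℕ) (s : Vec d × Vec d) (v : Vec d) : Vec d :=
  proj I.X ((1 / (I.lam + acsaγ (I.β + I.lam) (t % I.N₀))) •
    ((acsaα (t % I.N₀) * I.lam) • acsaMid I t s
      + ((1 - acsaα (t % I.N₀)) * I.lam + acsaγ (I.β + I.lam) (t % I.N₀)) • acsaPrev I.N₀ t s
      - acsaα (t % I.N₀) • (v + I.lam • (acsaMid I t s - I.x₀))))

/-- Iteration `t` of multi-stage AC-SA on the pair of aggregated and prox iterates. -/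
def acsaStep (I : PhaseInput d) (t : ℕ) (s : Vec d × Vec d) (v : Vec d) : Vec d × Vec d :=
  (acsaα (t % I.N₀) • acsaProx I t s v + (1 - acsaα (t % I.N₀)) • s.1, acsaProx I t s v)

/-- The center of the prox step, up to the stochastic gradient. -/
def acsaCenter (I : PhaseInput d) (t : ℕ) (s : Vec d × Vec d) : Vec d :=
  (acsaα (t % I.N₀) * I.lam / (I.lam + acsaγ (I.β + I.lam) (t % I.N₀))) • acsaMid I t s
    + (((1 - acsaα (t % I.N₀)) * I.lam + acsaγ (I.β + I.lam) (t % I.N₀))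
      / (I.lam + acsaγ (I.β + I.lam) (t % I.N₀))) • acsaPrev I.N₀ t s

/-- The weight `s (s + 1) / 2` of the potential after `s` steps of a stage. -/
def acsaW (k : ℕ) : ℝ := (k : ℝ) * (k + 1) / 2

/-- The regularized objective. -/
def regObj (h : Vec d → ℝ) (lam : ℝ) (c x : Vec d) : ℝ := h x + lam / 2 * ‖x - c‖ ^ 2

lemma acsaα_pos (k : ℕ) : 0 < acsaα k := by unfold acsaα; positivity

lemma acsaα_le_one (k : ℕ) : acsaα k ≤ 1 := by
  unfold acsaα
  rw [div_le_one (by positivity)]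
  have : (0 : ℝ) ≤ k := k.cast_nonneg
  linarith

lemma acsaγ_pos {B : ℝ} (hB : 0 < B) (k : ℕ) : 0 < acsaγ B k := by unfold acsaγ; positivity

/-- The hypotheses on the inputs of a phase under which it is analysed. -/
structure PhaseInput.Valid (I : PhaseInput d) : Prop where
  convex : Convex ℝ I.X
  compact : IsCompact I.X
  mem : I.x₀ ∈ I.X
  β_nonneg : 0 ≤ I.β
  lam_pos : 0 < I.lam

variable {I : PhaseInput d}

lemma acsaPrev_mem {X : Set (Vec d)} {N₀ t : ℕ} {s : Vec d × Vec d} (h1 : s.1 ∈ X)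
    (h2 : s.2 ∈ X) : acsaPrev N₀ t s ∈ X := by
  unfold acsaPrev; split_ifs <;> assumption

lemma acsa_denom_pos (hI : I.Valid) (k : ℕ) :
    0 < acsaγ (I.β + I.lam) k + (1 - acsaα k ^ 2) * I.lam := by
  have h1 := acsaγ_pos (show 0 < I.β + I.lam by linarith [hI.β_nonneg, hI.lam_pos]) k
  have h2 := acsaα_le_one k
  have h3 := acsaα_pos k
  have : 0 ≤ (1 - acsaα k ^ 2) * I.lam := mul_nonneg (by nlinarith) hI.lam_pos.le
  linarith

lemma acsaMid_mem (hI : I.Valid) (t : ℕ) {s : Vec d × Vec d} (h1 : s.1 ∈ I.X) (h2 : s.2 ∈ I.X) :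
    acsaMid I t s ∈ I.X := by
  have hd := acsa_denom_pos hI (t % I.N₀)
  have hγ := acsaγ_pos (show 0 < I.β + I.lam by linarith [hI.β_nonneg, hI.lam_pos]) (t % I.N₀)
  have ha := acsaα_pos (t % I.N₀)
  have ha' : 0 ≤ 1 - acsaα (t % I.N₀) := by linarith [acsaα_le_one (t % I.N₀)]
  have hl := hI.lam_pos
  refine hI.convex h1 (acsaPrev_mem h1 h2) (by positivity) (by positivity) ?_
  rw [← add_div, div_eq_one_iff_eq hd.ne']
  ring

lemma acsaProx_mem (hI : I.Valid) (t : ℕ) (s : Vec d × Vec d) (v : Vec d) :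
    acsaProx I t s v ∈ I.X :=
  (proj_spec hI.compact ⟨_, hI.mem⟩ _).1

lemma acsaStep_mem (hI : I.Valid) (t : ℕ) {s : Vec d × Vec d} (v : Vec d) (h1 : s.1 ∈ I.X) :
    (acsaStep I t s v).1 ∈ I.X ∧ (acsaStep I t s v).2 ∈ I.X := by
  refine ⟨?_, acsaProx_mem hI t s v⟩
  exact hI.convex (acsaProx_mem hI t s v) h1 (acsaα_pos _).le
    (by linarith [acsaα_le_one (t % I.N₀)]) (by ring)

/-- The weights defining x^{md} are those for which x^{md} = α · center + (1 - α) · x^{ag}. The new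
aggregated iterate therefore differs from x^{md} by α times the prox displacement, and the
smoothness error is quadratic in that displacement with a factor α². -/
lemma acsaStep_sub_mid (hI : I.Valid) (t : ℕ) (s : Vec d × Vec d) (v : Vec d) :
    (acsaStep I t s v).1 - acsaMid I t s =
      acsaα (t % I.N₀) • (acsaProx I t s v - acsaCenter I t s) := by
  have hd := acsa_denom_pos hI (t % I.N₀)
  have hγ := acsaγ_pos (show 0 < I.β + I.lam by linarith [hI.β_nonneg, hI.lam_pos]) (t % I.N₀)
  have hl := hI.lam_pos
  have key : acsaα (t % I.N₀) • acsaCenter I t s + (1 - acsaα (t % I.N₀)) • s.1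
      = acsaMid I t s := by
    simp only [acsaCenter, acsaMid]
    set α := acsaα (t % I.N₀)
    set γ := acsaγ (I.β + I.lam) (t % I.N₀)
    set p := acsaPrev I.N₀ t s
    have hlg : I.lam + γ ≠ 0 := by positivity
    obtain ⟨D, hD⟩ : ∃ D, D = γ + (1 - α ^ 2) * I.lam := ⟨_, rfl⟩
    rw [← hD] at hd ⊢
    match_scalars <;> field_simp <;> rw [hD] <;> ring
  rw [acsaStep, ← key]
  module

/-- First-order optimality of the prox step. -/
lemma acsaProx_inner_le (hI : I.Valid) (t : ℕ) (s : Vec d × Vec d) (v : Vec d) {y : Vec d}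
    (hy : y ∈ I.X) :
    inner ℝ ((I.lam + acsaγ (I.β + I.lam) (t % I.N₀)) • (acsaCenter I t s - acsaProx I t s v)
      - acsaα (t % I.N₀) • (v + I.lam • (acsaMid I t s - I.x₀))) (y - acsaProx I t s v) ≤ 0 := by
  have hγ := acsaγ_pos (show 0 < I.β + I.lam by linarith [hI.β_nonneg, hI.lam_pos]) (t % I.N₀)
  have hl := hI.lam_pos
  have h := proj_inner_le hI.compact hI.convex ⟨_, hI.mem⟩
    ((1 / (I.lam + acsaγ (I.β + I.lam) (t % I.N₀))) •
    ((acsaα (t % I.N₀) * I.lam) • acsaMid I t s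
      + ((1 - acsaα (t % I.N₀)) * I.lam + acsaγ (I.β + I.lam) (t % I.N₀)) • acsaPrev I.N₀ t s
      - acsaα (t % I.N₀) • (v + I.lam • (acsaMid I t s - I.x₀)))) hy
  change inner ℝ (_ - acsaProx I t s v) (y - acsaProx I t s v) ≤ 0 at h
  have h2 := mul_nonpos_of_nonneg_of_nonpos
    (show 0 ≤ I.lam + acsaγ (I.β + I.lam) (t % I.N₀) by positivity) h
  rw [← real_inner_smul_left] at h2
  refine le_of_eq_of_le ?_ h2
  congr 1
  simp only [acsaCenter]
  set α := acsaα (t % I.N₀)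
  set γ := acsaγ (I.β + I.lam) (t % I.N₀)
  have hlg : I.lam + γ ≠ 0 := by positivity
  match_scalars <;> field_simp

lemma acsaW_succ (k : ℕ) : acsaW (k + 1) = ((k : ℝ) + 1) * (k + 2) / 2 := by
  simp only [acsaW]; push_cast; ring

/-- This and the next two identities are why the weight is s(s+1)/2: multiplying the one-step
inequality by it makes the coefficient of the old gap equal to the previous weight, and that of the
prox term equal to a constant plus λ times the weight, so that everything telescopes. -/
lemma acsaW_mul_α (k : ℕ) : acsaW (k + 1) * acsaα k = k + 1 := by
  rw [acsaW_succ, acsaα]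
  have : (0 : ℝ) ≤ k := k.cast_nonneg
  field_simp; ring

lemma acsaW_mul_one_sub_α (k : ℕ) : acsaW (k + 1) * (1 - acsaα k) = acsaW k := by
  rw [mul_sub, acsaW_mul_α, acsaW_succ, acsaW]; ring

lemma acsaW_mul_γ (B : ℝ) (k : ℕ) : acsaW (k + 1) * acsaγ B k = 2 * B := by
  rw [acsaW_succ, acsaγ]
  have : (0 : ℝ) ≤ k := k.cast_nonneg
  field_simp; ring

/-- The condition under which the γ-part of the prox term absorbs the smoothness error Bα²/2 times
the squared displacement. -/
lemma mul_acsaα_sq_le_γ {B : ℝ} (hB : 0 ≤ B) (k : ℕ) : B * acsaα k ^ 2 ≤ acsaγ B k := by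
  rw [acsaγ, acsaα]
  have : (0 : ℝ) ≤ k := k.cast_nonneg
  rw [div_pow, ← mul_div_assoc, div_le_div_iff₀ (by positivity) (by positivity)]
  have : 0 ≤ B * ((k : ℝ) + 1 + 1) := by positivity
  nlinarith

lemma FirstOrder.regObj_upper {h : Vec d → ℝ} {g : Vec d → Vec d} {X : Set (Vec d)} {β : ℝ}
    (hh : FirstOrder X h g β) (lam : ℝ) (c : Vec d) {x y : Vec d} (hx : x ∈ X) (hy : y ∈ X) :
    regObj h lam c y ≤ regObj h lam c x + inner ℝ (g x + lam • (x - c)) (y - x)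
      + (β + lam) / 2 * ‖y - x‖ ^ 2 := by
  have h1 := hh.upper x hx y hy
  have h2 : ‖y - c‖ ^ 2 = ‖y - x‖ ^ 2 + 2 * inner ℝ (x - c) (y - x) + ‖x - c‖ ^ 2 := by
    rw [show y - c = (x - c) + (y - x) by abel, norm_add_sq_real]; ring
  simp only [regObj, inner_add_left, real_inner_smul_left]
  rw [h2]
  linarith

lemma FirstOrder.regObj_lower {h : Vec d → ℝ} {g : Vec d → Vec d} {X : Set (Vec d)} {β : ℝ}
    (hh : FirstOrder X h g β) (lam : ℝ) (c : Vec d) {x y : Vec d} (hx : x ∈ X) (hy : y ∈ X) :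
    regObj h lam c x + inner ℝ (g x + lam • (x - c)) (y - x) + lam / 2 * ‖y - x‖ ^ 2
      ≤ regObj h lam c y := by
  have h1 := hh.lower x hx y hy
  have h2 : ‖y - c‖ ^ 2 = ‖y - x‖ ^ 2 + 2 * inner ℝ (x - c) (y - x) + ‖x - c‖ ^ 2 := by
    rw [show y - c = (x - c) + (y - x) by abel, norm_add_sq_real]; ring
  simp only [regObj, inner_add_left, real_inner_smul_left]
  rw [h2]
  linarith

/-- Squared distances to a convex combination. -/
lemma norm_sub_comb_sq_le {a b : ℝ} (ha : 0 ≤ a) (hb : 0 ≤ b) (hab : 0 < a + b) (y u v : Vec d) :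
    (a + b) * ‖y - ((a / (a + b)) • u + (b / (a + b)) • v)‖ ^ 2
      ≤ a * ‖y - u‖ ^ 2 + b * ‖y - v‖ ^ 2 := by
  have e : (a + b) • (y - ((a / (a + b)) • u + (b / (a + b)) • v)) =
      a • (y - u) + b • (y - v) := by
    match_scalars <;> field_simp
  have h1 : (a + b) ^ 2 * ‖y - ((a / (a + b)) • u + (b / (a + b)) • v)‖ ^ 2 =
      ‖a • (y - u) + b • (y - v)‖ ^ 2 := by
    rw [← e, norm_smul, mul_pow, Real.norm_of_nonneg hab.le]
  rw [norm_add_sq_real, norm_smul, norm_smul, real_inner_smul_left, real_inner_smul_right,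
    Real.norm_of_nonneg ha, Real.norm_of_nonneg hb] at h1
  have h2 : 2 * inner ℝ (y - u) (y - v) ≤ ‖y - u‖ ^ 2 + ‖y - v‖ ^ 2 := by
    have := norm_sub_sq_real (y - u) (y - v)
    nlinarith [sq_nonneg ‖(y - u) - (y - v)‖]
  have h3 := mul_le_mul_of_nonneg_left h2 (mul_nonneg ha hb)
  refine le_of_mul_le_mul_left ?_ hab
  nlinarith

/-- One step of AC-SA decreases the potential, up to the errors of the stochastic gradient. -/
lemma acsaStep_potential_le (hI : I.Valid) {h : Vec d → ℝ} {g : Vec d → Vec d}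
    (hh : FirstOrder I.X h g I.β) {R : ℝ} (hR : ∀ x ∈ I.X, ∀ y ∈ I.X, ‖x - y‖ ≤ R) (t : ℕ)
    {s : Vec d × Vec d} (h1 : s.1 ∈ I.X) (h2 : s.2 ∈ I.X) {y : Vec d} (hy : y ∈ I.X)
    {v b e : Vec d} (hv : v = g (acsaMid I t s) + b + e) :
    acsaW (t % I.N₀ + 1)
        * (regObj h I.lam I.x₀ (acsaStep I t s v).1 - regObj h I.lam I.x₀ y)
      + (I.lam * acsaW (t % I.N₀ + 1) + 2 * (I.β + I.lam)) / 2 * ‖y - (acsaStep I t s v).2‖ ^ 2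
    ≤ acsaW (t % I.N₀) * (regObj h I.lam I.x₀ s.1 - regObj h I.lam I.x₀ y)
      + (I.lam * acsaW (t % I.N₀) + 2 * (I.β + I.lam)) / 2 * ‖y - acsaPrev I.N₀ t s‖ ^ 2
      + ((t % I.N₀ : ℕ) + 1) * inner ℝ e (y - acsaCenter I t s) + ‖e‖ ^ 2 / I.lam
      + ((t % I.N₀ : ℕ) + 1) * (‖b‖ * R) := by
  have hl := hI.lam_pos
  have hB : 0 < I.β + I.lam := by linarith [hI.β_nonneg]
  have hmid := acsaMid_mem hI t h1 h2
  have hstep := acsaStep_mem hI t v h1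
  have hdiff := acsaStep_sub_mid hI t s v
  have hprox := acsaProx_inner_le hI t s v hy
  have hαγ := mul_acsaα_sq_le_γ hB.le (t % I.N₀)
  have hγ := acsaγ_pos hB (t % I.N₀)
  have hα0 := acsaα_pos (t % I.N₀)
  have hα1 := acsaα_le_one (t % I.N₀)
  -- The center is a convex combination of x^{md} and the previous prox iterate. The x^{md} part is
  -- paid for by the strong convexity of the lower model at `y`.
  have hw : (I.lam + acsaγ (I.β + I.lam) (t % I.N₀)) * ‖y - acsaCenter I t s‖ ^ 2 ≤
      acsaα (t % I.N₀) * I.lam * ‖y - acsaMid I t s‖ ^ 2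
      + ((1 - acsaα (t % I.N₀)) * I.lam + acsaγ (I.β + I.lam) (t % I.N₀))
        * ‖y - acsaPrev I.N₀ t s‖ ^ 2 := by
    have := norm_sub_comb_sq_le (a := acsaα (t % I.N₀) * I.lam)
      (b := (1 - acsaα (t % I.N₀)) * I.lam + acsaγ (I.β + I.lam) (t % I.N₀)) (by positivity)
      (by have := mul_nonneg (sub_nonneg.2 hα1) hl.le
          linarith) (by nlinarith) y (acsaMid I t s) (acsaPrev I.N₀ t s)
    rw [show acsaα (t % I.N₀) * I.lam
      + ((1 - acsaα (t % I.N₀)) * I.lam + acsaγ (I.β + I.lam) (t % I.N₀))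
      = I.lam + acsaγ (I.β + I.lam) (t % I.N₀) by ring] at this
    exact this
  have hup := hh.regObj_upper I.lam I.x₀ hmid hstep.1
  have hlo1 := hh.regObj_lower I.lam I.x₀ hmid h1
  have hlo2 := hh.regObj_lower I.lam I.x₀ hmid hy
  have hxag : (acsaStep I t s v).1 - acsaMid I t s =
      acsaα (t % I.N₀) • ((y - acsaMid I t s) - (y - acsaProx I t s v))
        + (1 - acsaα (t % I.N₀)) • (s.1 - acsaMid I t s) := by
    simp only [acsaStep]; module
  have hnorm : ‖(acsaStep I t s v).1 - acsaMid I t s‖ ^ 2 =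
      acsaα (t % I.N₀) ^ 2 * ‖acsaCenter I t s - acsaProx I t s v‖ ^ 2 := by
    rw [hdiff, norm_smul, mul_pow, Real.norm_of_nonneg hα0.le, norm_sub_rev]
  rw [hnorm, hxag] at hup
  have hbR : inner ℝ b (y - acsaProx I t s v) ≤ ‖b‖ * R :=
    (real_inner_le_norm _ _).trans (mul_le_mul_of_nonneg_left
      (hR _ hy _ (acsaProx_mem hI t s v)) (norm_nonneg _))
  have hWα := acsaW_mul_α (t % I.N₀)
  have hW1 := acsaW_mul_one_sub_α (t % I.N₀)
  have hWγ := acsaW_mul_γ (I.β + I.lam) (t % I.N₀)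
  have hWpos : 0 ≤ acsaW (t % I.N₀ + 1) := by unfold acsaW; positivity
  -- Equal to 2(k+1)/(k+2): the weighted variance cost of a step is bounded uniformly along the
  -- stage.
  have hWα2 : acsaW (t % I.N₀ + 1) * acsaα (t % I.N₀) ^ 2 ≤ 2 := by
    rw [pow_two, ← mul_assoc, hWα, acsaα]
    rw [mul_div_assoc', div_le_iff₀ (by positivity)]
    linarith
  have hx2 : (acsaStep I t s v).2 = acsaProx I t s v := rfl
  rw [hx2]
  -- The prox point depends on the error `e`, but the center does not: the first product has mean
  -- zero once `e` is centered, and the second is handled by Young's inequality.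
  have hesplit : inner ℝ e (y - acsaProx I t s v) = inner ℝ e (y - acsaCenter I t s)
      + inner ℝ e (acsaCenter I t s - acsaProx I t s v) := by
    rw [← inner_add_right]; congr 1; abel
  have hthree : 2 * inner ℝ (acsaCenter I t s - acsaProx I t s v) (y - acsaProx I t s v) =
      ‖acsaCenter I t s - acsaProx I t s v‖ ^ 2 + ‖y - acsaProx I t s v‖ ^ 2
        - ‖y - acsaCenter I t s‖ ^ 2 := by
    have := norm_sub_sq_real (y - acsaProx I t s v) (acsaCenter I t s - acsaProx I t s v)
    rw [show y - acsaProx I t s v - (acsaCenter I t s - acsaProx I t s v) =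
      y - acsaCenter I t s by abel, real_inner_comm] at this
    linarith
  -- Of the available (λ+γ)/2 times the squared displacement, γ is used up by the smoothness error;
  -- the remaining λ/2 is spent here.
  have hyoung : acsaα (t % I.N₀) * inner ℝ e (acsaCenter I t s - acsaProx I t s v) ≤
      acsaα (t % I.N₀) ^ 2 * ‖e‖ ^ 2 / (2 * I.lam)
        + I.lam / 2 * ‖acsaCenter I t s - acsaProx I t s v‖ ^ 2 := by
    have h3 := real_inner_le_norm e (acsaCenter I t s - acsaProx I t s v)
    have h4 := mul_le_mul_of_nonneg_left h3 hα0.le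
    refine h4.trans ?_
    have h5 : acsaα (t % I.N₀) ^ 2 * ‖e‖ ^ 2 / (2 * I.lam)
        + I.lam / 2 * ‖acsaCenter I t s - acsaProx I t s v‖ ^ 2
        - acsaα (t % I.N₀) * (‖e‖ * ‖acsaCenter I t s - acsaProx I t s v‖) =
        (acsaα (t % I.N₀) * ‖e‖ - I.lam * ‖acsaCenter I t s - acsaProx I t s v‖) ^ 2
          / (2 * I.lam) := by
      field_simp; ring
    have h6 : 0 ≤ (acsaα (t % I.N₀) * ‖e‖
      - I.lam * ‖acsaCenter I t s - acsaProx I t s v‖) ^ 2 / (2 * I.lam) := by positivity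
    linarith
  have hG : v + I.lam • (acsaMid I t s - I.x₀) =
      (g (acsaMid I t s) + I.lam • (acsaMid I t s - I.x₀)) + b + e := by rw [hv]; abel
  rw [hG] at hprox
  -- All vector identities have been extracted. Replacing points, differences and step sizes by
  -- variables leaves an inequality between real quantities, linear in norms and inner products.
  generalize acsaStep I t s v = st at *
  generalize hΔ : g (acsaMid I t s) + I.lam • (acsaMid I t s - I.x₀) = Δ at *
  generalize acsaProx I t s v = x at *
  generalize acsaCenter I t s = w at *
  generalize acsaMid I t s = md at *
  generalize acsaPrev I.N₀ t s = pr at *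
  generalize acsaα (t % I.N₀) = α at *
  generalize acsaγ (I.β + I.lam) (t % I.N₀) = γ at *
  generalize acsaW (t % I.N₀ + 1) = W at *
  generalize acsaW (t % I.N₀) = W' at *
  generalize ((t % I.N₀ : ℕ) : ℝ) = k at *
  generalize w - x = Q at *
  generalize y - x = V at *
  generalize y - md = U at *
  generalize s.1 - md = A at *
  generalize y - w = Y at *
  simp only [inner_add_left, inner_sub_left, inner_add_right, inner_sub_right,
    real_inner_smul_left, real_inner_smul_right] at hprox hup
  generalize regObj h I.lam I.x₀ st.1 = Ψ' at *
  generalize regObj h I.lam I.x₀ s.1 = Ψa at *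
  generalize regObj h I.lam I.x₀ md = Ψm at *
  generalize regObj h I.lam I.x₀ y = Ψy at *
  have key : Ψ' ≤ (1 - α) * Ψa + α * Ψy + ((1 - α) * I.lam + γ) / 2 * ‖y - pr‖ ^ 2
      - (I.lam + γ) / 2 * ‖V‖ ^ 2 + α * inner ℝ b V + α * inner ℝ e Y
      + α ^ 2 * ‖e‖ ^ 2 / (2 * I.lam) := by
    have e1 := mul_le_mul_of_nonneg_left hlo1 (sub_nonneg.2 hα1)
    have e2 := mul_le_mul_of_nonneg_left hlo2 hα0.le
    have e3 : 0 ≤ (1 - α) * (I.lam / 2 * ‖A‖ ^ 2) :=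
      mul_nonneg (sub_nonneg.2 hα1) (by positivity)
    have e4 := mul_le_mul_of_nonneg_right hαγ (sq_nonneg ‖Q‖)
    have e5 : (I.lam + γ) * (2 * inner ℝ Q V) = (I.lam + γ) * (‖Q‖ ^ 2 + ‖V‖ ^ 2 - ‖Y‖ ^ 2) := by
      rw [hthree]
    have e6 : α * inner ℝ e V = α * (inner ℝ e Y + inner ℝ e Q) := by rw [hesplit]
    linarith
  -- Multiplication by the new weight turns the recursion into a comparison of potentials, through
  -- the three weight identities.
  have hkey := mul_le_mul_of_nonneg_left key hWpos
  have e1 : W * ((1 - α) * Ψa + α * Ψy + ((1 - α) * I.lam + γ) / 2 * ‖y - pr‖ ^ 2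
      - (I.lam + γ) / 2 * ‖V‖ ^ 2 + α * inner ℝ b V + α * inner ℝ e Y
      + α ^ 2 * ‖e‖ ^ 2 / (2 * I.lam)) =
      W' * (Ψa - Ψy) + W * Ψy + (I.lam * W' + 2 * (I.β + I.lam)) / 2 * ‖y - pr‖ ^ 2
      - (I.lam * W + 2 * (I.β + I.lam)) / 2 * ‖V‖ ^ 2 + (k + 1) * inner ℝ b V
      + (k + 1) * inner ℝ e Y + W * α ^ 2 * (‖e‖ ^ 2 / (2 * I.lam)) := by
    rw [← hW1, ← hWγ, ← hWα]; ring
  rw [e1] at hkey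
  have hk1 : 0 ≤ k + 1 := by rw [← hWα]; positivity
  have e2 := mul_le_mul_of_nonneg_left hbR hk1
  have e3 : W * α ^ 2 * (‖e‖ ^ 2 / (2 * I.lam)) ≤ 2 * (‖e‖ ^ 2 / (2 * I.lam)) := by
    gcongr
  have e4 : 2 * (‖e‖ ^ 2 / (2 * I.lam)) = ‖e‖ ^ 2 / I.lam := by field_simp
  linarith

end Acsa

/-! ### The law of the randomness of one iteration -/

section StepLaw

variable {K N d : ℕ} {ε σ : ℝ}

lemma isProbabilityMeasure_uniform (hN : 0 < N) :
    IsProbabilityMeasure (uniformOn (Set.univ : Set (Fin N))) :=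
  have : Nonempty (Fin N) := ⟨⟨0, hN⟩⟩
  isProbabilityMeasure_uniformOn Set.finite_univ Set.univ_nonempty

lemma integral_uniform {F : Type*} [NormedAddCommGroup F] [NormedSpace ℝ F] [CompleteSpace F]
    (φ : Fin N → F) :
    ∫ j, φ j ∂uniformOn (Set.univ : Set (Fin N)) = (1 / (N : ℝ)) • ∑ j, φ j := by
  rcases Nat.eq_zero_or_pos N with rfl | hN
  · simp [Measure.eq_zero_of_isEmpty]
  · have := isProbabilityMeasure_uniform hN
    rw [integral_fintype .of_finite, Finset.smul_sum]
    refine Finset.sum_congr rfl fun j _ => ?_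
    congr 1
    rw [measureReal_def, uniformOn_univ]
    simp

lemma isProbabilityMeasure_unitInterval :
    IsProbabilityMeasure ((volume : Measure ℝ).restrict (Set.Icc 0 1)) :=
  ⟨by simp⟩

lemma isProbabilityMeasure_stepLaw (hN : 0 < N) (hε : 0 < ε) :
    IsProbabilityMeasure (stepLaw K N d ε σ) := by
  have := isProbabilityMeasure_uniform hN
  have := isProbabilityMeasure_laplace (b := 16 / ε) (by positivity)
  have := isProbabilityMeasure_unitInterval
  unfold stepLaw
  infer_instance

/-- The part of the randomness of an iteration that matters when no user is removed. -/
def sampleLaw (K N d : ℕ) (σ : ℝ) : Measure ((Fin K → Fin N) × Vec d) :=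
  (Measure.pi fun _ : Fin K => uniformOn (Set.univ : Set (Fin N))).prod (gaussianVec d σ)

lemma isProbabilityMeasure_sampleLaw (hN : 0 < N) :
    IsProbabilityMeasure (sampleLaw K N d σ) := by
  have := isProbabilityMeasure_uniform hN
  unfold sampleLaw
  infer_instance

lemma measurePreserving_sample (hN : 0 < N) (hε : 0 < ε) :
    MeasurePreserving (fun r : StepRand K N d => (r.1, r.2.2.2)) (stepLaw K N d ε σ)
      (sampleLaw K N d σ) := by
  have := isProbabilityMeasure_uniform hN
  have := isProbabilityMeasure_laplace (b := 16 / ε) (by positivity)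
  have := isProbabilityMeasure_unitInterval
  exact (MeasurePreserving.id _).prod (measurePreserving_snd.comp measurePreserving_snd)

lemma integral_stepLaw (hN : 0 < N) (hε : 0 < ε) {φ : (Fin K → Fin N) × Vec d → ℝ}
    (hφ : Measurable φ) :
    ∫ r, φ (r.1, r.2.2.2) ∂stepLaw K N d ε σ = ∫ p, φ p ∂sampleLaw K N d σ := by
  have h := measurePreserving_sample (K := K) (d := d) (σ := σ) hN hε
  rw [← h.map_eq, integral_map h.measurable.aemeasurable hφ.aestronglyMeasurable]

end StepLaw

/-! ### Minibatch AC-SA with Gaussian noise -/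

section Batch

variable {K N d : ℕ}

/-- The average of the sampled gradients, plus noise. -/
def batchGrad (a : Fin N → Vec d) (p : (Fin K → Fin N) × Vec d) : Vec d :=
  (1 / (K : ℝ)) • ∑ k, a (p.1 k) + p.2

/-- The mean of a family of gradients. -/
def meanGrad (a : Fin N → Vec d) : Vec d := (1 / (N : ℝ)) • ∑ j, a j

/-- The mean minimizes the sum of squared distances. Applied with `c` the population gradient, it
bounds the sampling variance by τ² although the users' own mean is unknown. -/
lemma sum_norm_sub_mean_sq_le (hN : 0 < N) (a : Fin N → Vec d) (c : Vec d) :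
    ∑ j, ‖a j - meanGrad a‖ ^ 2 ≤ ∑ j, ‖a j - c‖ ^ 2 := by
  have hN' : (N : ℝ) ≠ 0 := by positivity
  have h1 : ∑ j, (a j - meanGrad a) = 0 := by
    rw [Finset.sum_sub_distrib, Finset.sum_const, Finset.card_univ, Fintype.card_fin, meanGrad,
      ← Nat.cast_smul_eq_nsmul ℝ, smul_smul, mul_one_div_cancel hN', one_smul, sub_self]
  have h2 : ∀ j, ‖a j - c‖ ^ 2 = ‖a j - meanGrad a‖ ^ 2
      + 2 * inner ℝ (a j - meanGrad a) (meanGrad a - c) + ‖meanGrad a - c‖ ^ 2 := fun j => by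
    rw [← norm_add_sq_real]; congr 2; abel
  simp_rw [h2, Finset.sum_add_distrib, ← Finset.mul_sum, ← sum_inner, h1, inner_zero_left]
  have : 0 ≤ ∑ _j : Fin N, ‖meanGrad a - c‖ ^ 2 := Finset.sum_nonneg fun _ _ => sq_nonneg _
  linarith

variable {σ τ : ℝ} {a : Fin N → Vec d} {c : Vec d}

lemma integral_sample_avg (hN : 0 < N) (a : Fin N → Vec d) :
    ∫ idx : Fin K → Fin N, ∑ k, (a (idx k) - meanGrad a)
      ∂(Measure.pi fun _ : Fin K => uniformOn (Set.univ : Set (Fin N))) = 0 := by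
  have := isProbabilityMeasure_uniform hN
  rw [integral_finsetSum _ fun k _ => .of_finite]
  refine Finset.sum_eq_zero fun k _ => ?_
  rw [integral_comp_eval (μ := fun _ : Fin K => uniformOn (Set.univ : Set (Fin N))) (i := k)
    (f := fun j => a j - meanGrad a) (measurable_of_finite _).aestronglyMeasurable,
    integral_uniform, Finset.sum_sub_distrib, Finset.sum_const, Finset.card_univ,
    Fintype.card_fin, smul_sub, ← Nat.cast_smul_eq_nsmul ℝ, smul_smul,
    one_div_mul_cancel (by positivity), one_smul, meanGrad, sub_self]

/-- The centered error of the stochastic gradient. -/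
lemma batchGrad_sub_mean (hK : 0 < K) (p : (Fin K → Fin N) × Vec d) :
    batchGrad a p - meanGrad a = (1 / (K : ℝ)) • ∑ k, (a (p.1 k) - meanGrad a) + p.2 := by
  rw [batchGrad, Finset.sum_sub_distrib, Finset.sum_const, Finset.card_univ, Fintype.card_fin,
    smul_sub, ← Nat.cast_smul_eq_nsmul ℝ, smul_smul, one_div_mul_cancel (by positivity), one_smul]
  abel

lemma measurable_batchGrad : Measurable (batchGrad (K := K) a) := by
  unfold batchGrad
  refine Measurable.add (Measurable.fun_const_smul (Finset.measurable_sum _ fun k _ => ?_) _)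
    measurable_snd
  exact (measurable_of_finite a).comp (by fun_prop)

lemma integrable_batch_error (hN : 0 < N) (hK : 0 < K) :
    Integrable (fun p => batchGrad a p - meanGrad a) (sampleLaw K N d σ) := by
  have := isProbabilityMeasure_uniform hN
  have := isProbabilityMeasure_sampleLaw (K := K) (d := d) (σ := σ) hN
  simp_rw [batchGrad_sub_mean hK]
  refine Integrable.add ?_ ((integrable_gaussianVec σ).comp_snd _)
  refine Integrable.comp_fst (f := fun idx : Fin K → Fin N =>
    (1 / (K : ℝ)) • ∑ k, (a (idx k) - meanGrad a)) .of_finite _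

lemma integral_batch_error (hN : 0 < N) (hK : 0 < K) :
    ∫ p, (batchGrad a p - meanGrad a) ∂sampleLaw K N d σ = 0 := by
  have := isProbabilityMeasure_uniform hN
  have := isProbabilityMeasure_sampleLaw (K := K) (d := d) (σ := σ) hN
  simp_rw [batchGrad_sub_mean hK]
  unfold sampleLaw
  rw [integral_add, integral_fun_snd (f := fun x => x), integral_fun_fst
    (f := fun idx : Fin K → Fin N => (1 / (K : ℝ)) • ∑ k, (a (idx k) - meanGrad a)),
    integral_id_gaussianVec, integral_smul, integral_sample_avg hN]
  · simp
  · exact Integrable.comp_fst (f := fun idx : Fin K → Fin N =>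
      (1 / (K : ℝ)) • ∑ k, (a (idx k) - meanGrad a)) .of_finite _
  · exact (integrable_gaussianVec σ).comp_snd _

lemma integrable_batch_error_sq (hN : 0 < N) (hK : 0 < K) :
    Integrable (fun p => ‖batchGrad a p - meanGrad a‖ ^ 2) (sampleLaw K N d σ) := by
  have := isProbabilityMeasure_uniform hN
  have := isProbabilityMeasure_sampleLaw (K := K) (d := d) (σ := σ) hN
  have h : MemLp (fun p => batchGrad a p - meanGrad a) 2 (sampleLaw K N d σ) := by
    simp_rw [batchGrad_sub_mean hK]
    refine MemLp.add ?_ ((memLp_gaussianVec σ).comp_snd _)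
    refine MemLp.comp_fst (f := fun idx : Fin K → Fin N =>
      (1 / (K : ℝ)) • ∑ k, (a (idx k) - meanGrad a)) ?_ _
    exact .of_discrete
  exact h.integrable_norm_pow (by norm_num)

/-- The sampling error and the Gaussian noise are independent and centered, so their variances add;
drawing with replacement gives the 1/K. -/
lemma integral_batch_error_sq_le (hN : 0 < N) (hK : 0 < K) (hτ : ∀ j, ‖a j - c‖ ≤ τ) :
    ∫ p, ‖batchGrad a p - meanGrad a‖ ^ 2 ∂sampleLaw K N d σ ≤ τ ^ 2 / K + d * σ ^ 2 := by
  have := isProbabilityMeasure_uniform hN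
  have hprob := isProbabilityMeasure_sampleLaw (K := K) (d := d) (σ := σ) hN
  have hK' : (0 : ℝ) < K := by exact_mod_cast hK
  have hint := integrable_batch_error_sq (σ := σ) (a := a) hN hK
  simp_rw [batchGrad_sub_mean hK] at hint ⊢
  unfold sampleLaw at hint ⊢
  rw [integral_prod _ hint]
  set ν := Measure.pi fun _ : Fin K => uniformOn (Set.univ : Set (Fin N))
  have hin : ∀ s : Vec d, ∫ x, ‖s + x‖ ^ 2 ∂gaussianVec d σ = ‖s‖ ^ 2 + d * σ ^ 2 := fun s => by
    simp_rw [norm_add_sq_real]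
    have hi : Integrable (fun x => 2 * inner ℝ s x) (gaussianVec d σ) :=
      ((integrable_gaussianVec σ).const_inner s).const_mul _
    rw [integral_add (f := fun x => ‖s‖ ^ 2 + 2 * inner ℝ s x) ((integrable_const _).add hi)
      (integrable_norm_sq_gaussianVec σ), integral_add (integrable_const _) hi, integral_const_mul,
      integral_inner (integrable_gaussianVec σ), integral_id_gaussianVec,
      integral_norm_sq_gaussianVec]
    simp
  simp_rw [hin]
  rw [integral_add .of_finite (integrable_const _)]
  simp only [integral_const, probReal_univ, smul_eq_mul, one_mul]
  gcongr
  simp_rw [norm_smul, mul_pow]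
  rw [integral_const_mul]
  have hτ0 : 0 ≤ τ := (norm_nonneg _).trans (hτ ⟨0, hN⟩)
  have h1 : ∫ idx : Fin K → Fin N, ‖∑ k, (a (idx k) - meanGrad a)‖ ^ 2 ∂ν ≤ K * τ ^ 2 := by
    obtain ⟨M, hM⟩ : ∃ M, ∀ j, ‖a j - meanGrad a‖ ≤ M :=
      ⟨∑ j, ‖a j - meanGrad a‖, fun j => Finset.single_le_sum
        (f := fun j => ‖a j - meanGrad a‖) (fun _ _ => norm_nonneg _) (Finset.mem_univ j)⟩
    refine integral_norm_sum_sq_le (uniformOn (Set.univ : Set (Fin N)))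
      (X := fun j => a j - meanGrad a) (measurable_of_finite _) hM ?_ ?_ K
    · rw [integral_uniform, Finset.sum_sub_distrib, Finset.sum_const, Finset.card_univ,
        Fintype.card_fin, smul_sub, ← Nat.cast_smul_eq_nsmul ℝ, smul_smul,
        one_div_mul_cancel (by positivity), one_smul, meanGrad, sub_self]
    · rw [integral_uniform]
      have h2 := sum_norm_sub_mean_sq_le hN a c
      have h3 : ∑ j, ‖a j - c‖ ^ 2 ≤ ∑ _j : Fin N, τ ^ 2 :=
        Finset.sum_le_sum fun j _ => pow_le_pow_left₀ (norm_nonneg _) (hτ j) 2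
      rw [Finset.sum_const, Finset.card_univ, Fintype.card_fin, nsmul_eq_mul] at h3
      have hN' : (0 : ℝ) < N := by exact_mod_cast hN
      rw [smul_eq_mul, one_div_mul_eq_div, div_le_iff₀ hN']
      linarith
  rw [Real.norm_of_nonneg (by positivity)]
  calc (1 / (K : ℝ)) ^ 2 * _ ≤ (1 / (K : ℝ)) ^ 2 * (K * τ ^ 2) := by gcongr
    _ = τ ^ 2 / K := by field_simp

/-! #### Expected decrease of the potential -/

variable {I : PhaseInput d}

/-- One iteration of AC-SA driven by sampled gradients of the family `a`. -/
def batchStep (I : PhaseInput d) (a : Fin N → Vec d → Vec d) (t : ℕ) (s : Vec d × Vec d)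
    (r : StepRand K N d) : Vec d × Vec d :=
  acsaStep I t s (batchGrad (fun j => a j (acsaMid I t s)) (r.1, r.2.2.2))

/-- The state after `t` iterations of `batchStep`. -/
def batchRun (I : PhaseInput d) (a : Fin N → Vec d → Vec d) (t : ℕ)
    (ω : Fin t → StepRand K N d) : Vec d × Vec d :=
  chain (fun i : Fin t => batchStep I a i) (I.x₀, I.x₀) ω

lemma batchRun_mem (hI : I.Valid) (a : Fin N → Vec d → Vec d) (t : ℕ)
    (ω : Fin t → StepRand K N d) :
    (batchRun I a t ω).1 ∈ I.X ∧ (batchRun I a t ω).2 ∈ I.X :=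
  chain_induction (p := fun s : Vec d × Vec d => s.1 ∈ I.X ∧ s.2 ∈ I.X)
    (fun i _ _ h => acsaStep_mem hI i _ h.1) ⟨hI.mem, hI.mem⟩ ω

lemma measurable_acsaMid (I : PhaseInput d) (t : ℕ) : Measurable (acsaMid I t) := by
  unfold acsaMid acsaPrev
  split_ifs <;> fun_prop

/-- AC-SA depends measurably on the center, the state and the stochastic gradient. -/
lemma measurable_acsaStep (hX : IsCompact I.X) (hc : Convex ℝ I.X) (h0 : I.X.Nonempty) (t : ℕ) :
    Measurable fun p : Vec d × (Vec d × Vec d) × Vec d =>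
      acsaStep { I with x₀ := p.1 } t p.2.1 p.2.2 := by
  have hp := (continuous_proj hX hc h0).measurable
  have hprox : Measurable fun p : Vec d × (Vec d × Vec d) × Vec d =>
      acsaProx { I with x₀ := p.1 } t p.2.1 p.2.2 := by
    have hm : Measurable fun p : Vec d × (Vec d × Vec d) × Vec d =>
        acsaMid { I with x₀ := p.1 } t p.2.1 :=
      (measurable_acsaMid I t).comp (by fun_prop)
    unfold acsaProx
    refine hp.comp ?_
    unfold acsaPrev
    dsimp only
    split_ifs <;> fun_prop
  unfold acsaStep
  fun_prop

lemma measurable_acsaStep' (hI : I.Valid) (t : ℕ) :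
    Measurable fun p : (Vec d × Vec d) × Vec d => acsaStep I t p.1 p.2 :=
  (measurable_acsaStep hI.compact hI.convex ⟨_, hI.mem⟩ t).comp
    (f := fun p : (Vec d × Vec d) × Vec d => (I.x₀, p)) (by fun_prop)

lemma measurable_sample_apply {a : Fin N → Vec d → Vec d} (ha : ∀ j, Measurable (a j)) :
    Measurable fun p : Fin N × Vec d => a p.1 p.2 :=
  measurable_from_prod_countable_right ha

lemma measurable_batchStep (hI : I.Valid) {a : Fin N → Vec d → Vec d}
    (ha : ∀ j, Measurable (a j)) (t : ℕ) :
    Measurable fun p : (Vec d × Vec d) × StepRand K N d => batchStep I a t p.1 p.2 := by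
  have hm := measurable_acsaMid I t
  have hg : Measurable fun p : (Vec d × Vec d) × StepRand K N d =>
      batchGrad (fun j => a j (acsaMid I t p.1)) (p.2.1, p.2.2.2.2) := by
    unfold batchGrad
    refine Measurable.add (Measurable.fun_const_smul (Finset.measurable_sum _ fun k _ => ?_) _)
      (by fun_prop)
    exact (measurable_sample_apply ha).comp
      (f := fun p : (Vec d × Vec d) × StepRand K N d => (p.2.1 k, acsaMid I t p.1)) (by fun_prop)
  exact (measurable_acsaStep' hI t).comp
    (f := fun p : (Vec d × Vec d) × StepRand K N d =>
      (p.1, batchGrad (fun j => a j (acsaMid I t p.1)) (p.2.1, p.2.2.2.2))) (by fun_prop)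

lemma measurable_batchRun (hI : I.Valid) {a : Fin N → Vec d → Vec d}
    (ha : ∀ j, Measurable (a j)) (t : ℕ) :
    Measurable (batchRun (K := K) I a t) :=
  measurable_chain' _ fun i => measurable_batchStep hI ha i

/-- The potential of AC-SA after `k` steps of a stage, with prox iterate `p`. -/
def acsaPot (I : PhaseInput d) (h : Vec d → ℝ) (y : Vec d) (k : ℕ) (xag p : Vec d) : ℝ :=
  acsaW k * (regObj h I.lam I.x₀ xag - regObj h I.lam I.x₀ y)
    + (I.lam * acsaW k + 2 * (I.β + I.lam)) / 2 * ‖y - p‖ ^ 2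

lemma continuous_acsaPot (I : PhaseInput d) {h : Vec d → ℝ} (hc : Continuous h) (y : Vec d)
    (k : ℕ) : Continuous fun s : Vec d × Vec d => acsaPot I h y k s.1 s.2 := by
  unfold acsaPot regObj; fun_prop

lemma exists_bound_on_iterates (hX : IsCompact I.X) {φ : Vec d × Vec d → ℝ} (hφ : Continuous φ) :
    ∃ M, ∀ s : Vec d × Vec d, s.1 ∈ I.X → s.2 ∈ I.X → |φ s| ≤ M := by
  obtain ⟨M, hM⟩ := (hX.prod hX).exists_bound_of_continuousOn hφ.continuousOn
  exact ⟨M, fun s h1 h2 => hM s ⟨h1, h2⟩⟩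

lemma measurable_acsaPot_acsaStep (hI : I.Valid) {h : Vec d → ℝ} (hc : Continuous h) (y : Vec d)
    (k t : ℕ) (s : Vec d × Vec d) (A : Fin N → Vec d) :
    Measurable fun p : (Fin K → Fin N) × Vec d =>
      acsaPot I h y k (acsaStep I t s (batchGrad A p)).1 (acsaStep I t s (batchGrad A p)).2 := by
  have h1 : Measurable fun p : (Fin K → Fin N) × Vec d => (s, batchGrad A p) :=
    measurable_const.prodMk measurable_batchGrad
  have h2 := (measurable_acsaStep' hI t).comp h1
  have h3 := (continuous_acsaPot I hc y k).measurable.comp h2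
  exact h3

/-- Expected decrease of the potential in one iteration. -/
lemma integral_acsaPot_acsaStep_le (hI : I.Valid) (hN : 0 < N) (hK : 0 < K) {σ τ R : ℝ}
    {h : Vec d → ℝ} {g : Vec d → Vec d} (hc : Continuous h)
    (hh : FirstOrder I.X h g I.β) (hR : ∀ x ∈ I.X, ∀ y ∈ I.X, ‖x - y‖ ≤ R)
    {A : Fin N → Vec d} {c : Vec d} (hτ : ∀ j, ‖A j - c‖ ≤ τ) (t : ℕ) {s : Vec d × Vec d}
    (h1 : s.1 ∈ I.X) (h2 : s.2 ∈ I.X) {y : Vec d} (hy : y ∈ I.X) :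
    ∫ p, acsaPot I h y (t % I.N₀ + 1) (acsaStep I t s (batchGrad A p)).1
        (acsaStep I t s (batchGrad A p)).2 ∂sampleLaw K N d σ
      ≤ acsaPot I h y (t % I.N₀) s.1 (acsaPrev I.N₀ t s) + (τ ^ 2 / K + d * σ ^ 2) / I.lam
        + ((t % I.N₀ : ℕ) + 1) * (‖meanGrad A - g (acsaMid I t s)‖ * R) := by
  have := isProbabilityMeasure_sampleLaw (K := K) (d := d) (σ := σ) hN
  have hmeas : Measurable fun p : (Fin K → Fin N) × Vec d =>
      acsaPot I h y (t % I.N₀ + 1) (acsaStep I t s (batchGrad A p)).1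
        (acsaStep I t s (batchGrad A p)).2 :=
    measurable_acsaPot_acsaStep hI hc y _ t s A
  have hl := hI.lam_pos
  have hie := integrable_batch_error (σ := σ) (a := A) hN hK
  have hie2 := integrable_batch_error_sq (σ := σ) (a := A) hN hK
  have hi1 : Integrable (fun p => ((t % I.N₀ : ℕ) + 1 : ℝ)
      * inner ℝ (y - acsaCenter I t s) (batchGrad A p - meanGrad A)) (sampleLaw K N d σ) :=
    (hie.const_inner _).const_mul _
  have hi2 : Integrable (fun p => ‖batchGrad A p - meanGrad A‖ ^ 2 / I.lam)
      (sampleLaw K N d σ) := hie2.div_const _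
  obtain ⟨M, hM⟩ := exists_bound_on_iterates hI.compact
    (continuous_acsaPot I hc y (t % I.N₀ + 1))
  have hint : Integrable (fun p : (Fin K → Fin N) × Vec d =>
      acsaPot I h y (t % I.N₀ + 1) (acsaStep I t s (batchGrad A p)).1
        (acsaStep I t s (batchGrad A p)).2) (sampleLaw K N d σ) := by
    refine Integrable.of_bound hmeas.aestronglyMeasurable M
      (Filter.Eventually.of_forall fun p => ?_)
    have := acsaStep_mem hI t (batchGrad A p) h1
    exact hM _ this.1 this.2
  have hpt : ∀ p : (Fin K → Fin N) × Vec d,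
      acsaPot I h y (t % I.N₀ + 1) (acsaStep I t s (batchGrad A p)).1
        (acsaStep I t s (batchGrad A p)).2 ≤
      (acsaPot I h y (t % I.N₀) s.1 (acsaPrev I.N₀ t s)
          + ((t % I.N₀ : ℕ) + 1) * (‖meanGrad A - g (acsaMid I t s)‖ * R))
          + ((t % I.N₀ : ℕ) + 1) * inner ℝ (y - acsaCenter I t s) (batchGrad A p - meanGrad A)
          + ‖batchGrad A p - meanGrad A‖ ^ 2 / I.lam := fun p => by
    -- The error is split into the deterministic bias of the mean of the family `A` against `g`,
    -- caused by clipping, and the centered error of sampling and noise.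
    have := acsaStep_potential_le hI hh hR t h1 h2 hy (v := batchGrad A p)
      (b := meanGrad A - g (acsaMid I t s)) (e := batchGrad A p - meanGrad A) (by abel)
    rw [real_inner_comm] at this
    refine (le_of_eq rfl).trans (this.trans (le_of_eq ?_))
    simp only [acsaPot]
    ring
  have hi0 := (integrable_const (μ := sampleLaw K N d σ)
    (acsaPot I h y (t % I.N₀) s.1 (acsaPrev I.N₀ t s)
      + ((t % I.N₀ : ℕ) + 1) * (‖meanGrad A - g (acsaMid I t s)‖ * R))).add hi1
  refine (integral_mono hint (hi0.add hi2) hpt).trans ?_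
  rw [integral_add' hi0 hi2, integral_add' (integrable_const _) hi1, integral_const_mul,
    integral_div, integral_inner hie, integral_batch_error hN hK]
  have := integral_batch_error_sq_le (σ := σ) (a := A) (c := c) hN hK hτ
  have := div_le_div_of_nonneg_right this hl.le
  simp only [integral_const, probReal_univ, smul_eq_mul, one_mul, inner_zero_right, mul_zero,
    add_zero]
  linarith

lemma integral_acsaPot_batchStep_le (hI : I.Valid) (hN : 0 < N) (hK : 0 < K) {ε σ τ R : ℝ}
    (hε : 0 < ε) {h : Vec d → ℝ} {g : Vec d → Vec d} (hc : Continuous h)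
    (hh : FirstOrder I.X h g I.β) (hR : ∀ x ∈ I.X, ∀ y ∈ I.X, ‖x - y‖ ≤ R)
    {a : Fin N → Vec d → Vec d} {c : Vec d → Vec d}
    (hτ : ∀ j, ∀ x ∈ I.X, ‖a j x - c x‖ ≤ τ) (t : ℕ) {s : Vec d × Vec d}
    (h1 : s.1 ∈ I.X) (h2 : s.2 ∈ I.X) {y : Vec d} (hy : y ∈ I.X) :
    ∫ r, acsaPot I h y (t % I.N₀ + 1) (batchStep I a t s r).1 (batchStep I a t s r).2
        ∂stepLaw K N d ε σ
      ≤ acsaPot I h y (t % I.N₀) s.1 (acsaPrev I.N₀ t s) + (τ ^ 2 / K + d * σ ^ 2) / I.lam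
        + ((t % I.N₀ : ℕ) + 1)
          * (‖meanGrad (fun j => a j (acsaMid I t s)) - g (acsaMid I t s)‖ * R) := by
  refine (le_of_eq ?_).trans (integral_acsaPot_acsaStep_le hI hN hK (σ := σ) hc hh hR
    (A := fun j => a j (acsaMid I t s)) (fun j => hτ j _ (acsaMid_mem hI t h1 h2)) t h1 h2 hy)
  exact integral_stepLaw (φ := fun p : (Fin K → Fin N) × Vec d =>
      acsaPot I h y (t % I.N₀ + 1) (acsaStep I t s (batchGrad (fun j => a j (acsaMid I t s)) p)).1
        (acsaStep I t s (batchGrad (fun j => a j (acsaMid I t s)) p)).2) hN hε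
    (measurable_acsaPot_acsaStep hI hc y _ t s _)

end Batch

/-! ### Convergence of multi-stage AC-SA -/

section Convergence

variable {K N d : ℕ} {I : PhaseInput d}

/-- A regularized objective grows quadratically away from its minimizer. -/
lemma FirstOrder.growth {X : Set (Vec d)} (hX : Convex ℝ X) {h : Vec d → ℝ} {g : Vec d → Vec d}
    {β lam : ℝ} (hh : FirstOrder X h g β) (c : Vec d) {y : Vec d} (hy : y ∈ X)
    (hmin : ∀ x ∈ X, regObj h lam c y ≤ regObj h lam c x) {x : Vec d} (hx : x ∈ X) :
    lam / 2 * ‖x - y‖ ^ 2 ≤ regObj h lam c x - regObj h lam c y := by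
  -- Strong convexity is used at z = y + s(x - y), towards both `x` and `y`, with weights s and 1 -
  -- s. The gradient at z cancels, minimality of `y` is invoked only through its value at z, and s →
  -- 0 restores the full constant.
  have key : ∀ s : ℝ, 0 < s → s < 1 →
      lam / 2 * ((1 - s) * ‖x - y‖ ^ 2) ≤ regObj h lam c x - regObj h lam c y := by
    intro s hs hs1
    set z := y + s • (x - y) with hz
    have hzX : z ∈ X := hX.add_smul_sub_mem hy hx ⟨hs.le, hs1.le⟩
    have h1 := hh.regObj_lower lam c hzX hx
    have h2 := hh.regObj_lower lam c hzX hy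
    have h3 := hmin z hzX
    have e1 : x - z = (1 - s) • (x - y) := by rw [hz]; module
    have e2 : y - z = (-s) • (x - y) := by rw [hz]; module
    rw [e1, real_inner_smul_right, norm_smul, mul_pow, Real.norm_of_nonneg (by linarith)] at h1
    rw [e2, real_inner_smul_right, norm_smul, mul_pow, norm_neg, Real.norm_of_nonneg hs.le] at h2
    have h4 := mul_le_mul_of_nonneg_left h1 hs.le
    have h5 := mul_le_mul_of_nonneg_left h2 (show 0 ≤ 1 - s by linarith)
    refine le_of_mul_le_mul_left ?_ hs
    nlinarith
  have hcont : Filter.Tendsto (fun s : ℝ => lam / 2 * ((1 - s) * ‖x - y‖ ^ 2))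
      (nhdsWithin 0 (Set.Ioi 0)) (nhds (lam / 2 * ((1 - 0) * ‖x - y‖ ^ 2))) :=
    (Continuous.tendsto (by fun_prop) 0).mono_left nhdsWithin_le_nhds
  rw [sub_zero, one_mul] at hcont
  refine le_of_tendsto hcont ?_
  filter_upwards [Ioo_mem_nhdsGT (zero_lt_one' ℝ)] with s hs
  exact key s hs.1 hs.2

lemma integral_batchRun_succ (hI : I.Valid) (hN : 0 < N) {ε σ : ℝ} (hε : 0 < ε)
    {a : Fin N → Vec d → Vec d} (ha : ∀ j, Measurable (a j)) (t : ℕ) {φ : Vec d × Vec d → ℝ}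
    (hφ : Measurable φ) {M : ℝ} (hM : ∀ s : Vec d × Vec d, s.1 ∈ I.X → s.2 ∈ I.X → |φ s| ≤ M) :
    ∫ ω, φ (batchRun I a (t + 1) ω) ∂(Measure.pi fun _ : Fin (t + 1) => stepLaw K N d ε σ) =
      ∫ ω, (∫ r, φ (batchStep I a t (batchRun I a t ω) r) ∂stepLaw K N d ε σ)
        ∂(Measure.pi fun _ : Fin t => stepLaw K N d ε σ) := by
  have := isProbabilityMeasure_stepLaw (K := K) (d := d) (σ := σ) hN hε
  exact integral_chain_succ (fun _ : Fin (t + 1) => stepLaw K N d ε σ)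
    (f := fun i : Fin (t + 1) => batchStep I a i) (I.x₀, I.x₀)
    (fun i => measurable_batchStep hI ha i) hφ
    (fun ω => hM _ (batchRun_mem hI a (t + 1) ω).1 (batchRun_mem hI a (t + 1) ω).2)

lemma integrable_batchRun (hI : I.Valid) (hN : 0 < N) {ε σ : ℝ} (hε : 0 < ε)
    {a : Fin N → Vec d → Vec d} (ha : ∀ j, Measurable (a j)) (t : ℕ) {φ : Vec d × Vec d → ℝ}
    (hφ : Measurable φ) {M : ℝ} (hM : ∀ s : Vec d × Vec d, s.1 ∈ I.X → s.2 ∈ I.X → |φ s| ≤ M) :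
    Integrable (fun ω => φ (batchRun I a t ω))
      (Measure.pi fun _ : Fin t => stepLaw K N d ε σ) := by
  have := isProbabilityMeasure_stepLaw (K := K) (d := d) (σ := σ) hN hε
  have hm : Measurable fun ω => φ (batchRun (K := K) I a t ω) :=
    hφ.comp (measurable_batchRun hI ha t)
  refine Integrable.of_bound hm.aestronglyMeasurable M
    (Filter.Eventually.of_forall fun ω => ?_)
  exact hM _ (batchRun_mem hI a t ω).1 (batchRun_mem hI a t ω).2

/-- Hypotheses for the convergence of minibatch AC-SA with Gaussian noise. -/
structure BatchSetup (I : PhaseInput d) (K N T : ℕ) (ε σ τ R η : ℝ) (h : Vec d → ℝ)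
    (g : Vec d → Vec d) (a : Fin N → Vec d → Vec d) (c : Vec d → Vec d) : Prop where
  valid : I.Valid
  N_pos : 0 < N
  K_pos : 0 < K
  ε_pos : 0 < ε
  cont : Continuous h
  firstOrder : FirstOrder I.X h g I.β
  meas_g : Measurable g
  meas : ∀ j, Measurable (a j)
  diam : ∀ x ∈ I.X, ∀ y ∈ I.X, ‖x - y‖ ≤ R
  close : ∀ j, ∀ x ∈ I.X, ‖a j x - c x‖ ≤ τ
  bdd : ∃ M, ∀ x ∈ I.X, ‖meanGrad (fun j => a j x) - g x‖ ≤ M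
  bias : ∀ t < T, ∫ ω, ‖meanGrad (fun j => a j (acsaMid I t (batchRun I a t ω)))
    - g (acsaMid I t (batchRun I a t ω))‖ ∂(Measure.pi fun _ : Fin t => stepLaw K N d ε σ) ≤ η

variable {T : ℕ} {ε σ τ R η : ℝ} {h : Vec d → ℝ} {g : Vec d → Vec d} {a : Fin N → Vec d → Vec d}
  {c : Vec d → Vec d}

/-- The one-step inequality summed over `k` steps of a stage. The case distinction at k = 0 encodes
the restart: the prox iterate is reset to the aggregated one, and as the weight then vanishes, the
potential is a squared distance without any gap. -/
lemma BatchSetup.stage (H : BatchSetup I K N T ε σ τ R η h g a c) {y : Vec d} (hy : y ∈ I.X)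
    (hR : 0 ≤ R) (S k : ℕ) (hk : k ≤ I.N₀) (hT : S * I.N₀ + k ≤ T) :
    ∫ ω, (fun s : Vec d × Vec d => acsaPot I h y k s.1 (if k = 0 then s.1 else s.2))
        (batchRun I a (S * I.N₀ + k) ω) ∂(Measure.pi fun _ => stepLaw K N d ε σ)
      ≤ ∫ ω, (fun s : Vec d × Vec d => (I.β + I.lam) * ‖y - s.1‖ ^ 2)
        (batchRun I a (S * I.N₀) ω) ∂(Measure.pi fun _ => stepLaw K N d ε σ)
        + k * ((τ ^ 2 / K + d * σ ^ 2) / I.lam) + acsaW k * (R * η) := by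
  have := isProbabilityMeasure_stepLaw (K := K) (d := d) (σ := σ) H.N_pos H.ε_pos
  induction k with
  | zero =>
    simp only [acsaPot, acsaW, Nat.cast_zero, zero_mul, zero_div, mul_zero, zero_add, add_zero,
      if_true]
    refine le_of_eq ?_
    congr 1; ext ω
    change _ = (I.β + I.lam) * ‖y - (batchRun I a (S * I.N₀ + 0) ω).1‖ ^ 2
    ring
  | succ k ih =>
    have ih := ih (by omega) (by omega)
    set t := S * I.N₀ + k with ht
    have htk : t % I.N₀ = k := by
      rw [ht, mul_comm, Nat.mul_add_mod, Nat.mod_eq_of_lt (by omega)]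
    have hcont := continuous_acsaPot I H.cont y (k + 1)
    obtain ⟨M, hM⟩ := exists_bound_on_iterates H.valid.compact hcont
    have hstep := integral_batchRun_succ (K := K) (σ := σ) H.valid H.N_pos H.ε_pos H.meas t
      hcont.measurable hM
    simp only [Nat.add_eq_zero_iff, one_ne_zero, and_false, if_false]
    rw [show S * I.N₀ + (k + 1) = t + 1 by omega, hstep]
    set ν := Measure.pi fun _ : Fin t => stepLaw K N d ε σ
    have hc1 : Continuous fun s : Vec d × Vec d =>
        acsaPot I h y k s.1 (if k = 0 then s.1 else s.2) := by
      have := H.cont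
      unfold acsaPot regObj
      split_ifs <;> fun_prop
    obtain ⟨M1, hM1⟩ := exists_bound_on_iterates H.valid.compact hc1
    have hi1 := integrable_batchRun (K := K) (σ := σ) H.valid H.N_pos H.ε_pos H.meas t
      hc1.measurable hM1
    obtain ⟨M2, hM2⟩ := H.bdd
    have hmb : Measurable fun s : Vec d × Vec d =>
        ‖meanGrad (fun j => a j (acsaMid I t s)) - g (acsaMid I t s)‖ := by
      have h1 := measurable_acsaMid I t
      have h2 := H.meas_g
      have h3 := H.meas
      unfold meanGrad
      fun_prop
    have hi2 := integrable_batchRun (K := K) (σ := σ) (M := M2) H.valid H.N_pos H.ε_pos H.meas t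
      hmb (fun s h1 h2 => by
        rw [abs_of_nonneg (norm_nonneg _)]
        exact hM2 _ (acsaMid_mem H.valid t h1 h2))
    have hi3 := (hi2.mul_const R).const_mul ((k : ℝ) + 1)
    have hi4 := hi1.add (integrable_const (μ := ν) ((τ ^ 2 / K + d * σ ^ 2) / I.lam))
    have hle : ∀ ω : Fin t → StepRand K N d, (∫ r, acsaPot I h y (k + 1)
        (batchStep I a t (batchRun I a t ω) r).1
        (batchStep I a t (batchRun I a t ω) r).2 ∂stepLaw K N d ε σ) ≤
        acsaPot I h y k (batchRun I a t ω).1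
          (if k = 0 then (batchRun I a t ω).1 else (batchRun I a t ω).2)
        + (τ ^ 2 / K + d * σ ^ 2) / I.lam
        + ((k : ℝ) + 1) * (‖meanGrad (fun j => a j (acsaMid I t (batchRun I a t ω)))
          - g (acsaMid I t (batchRun I a t ω))‖ * R) := fun ω => by
      have hm := batchRun_mem H.valid a t ω
      have := integral_acsaPot_batchStep_le (σ := σ) H.valid H.N_pos H.K_pos H.ε_pos H.cont
        H.firstOrder H.diam H.close t hm.1 hm.2 hy
      rw [htk] at this
      simp only [acsaPrev, htk] at this
      exact this
    have hi0 : Integrable (fun ω : Fin t → StepRand K N d => ∫ r, acsaPot I h y (k + 1)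
        (batchStep I a t (batchRun I a t ω) r).1
        (batchStep I a t (batchRun I a t ω) r).2 ∂stepLaw K N d ε σ) ν := by
      have hm : Measurable fun p : (Fin t → StepRand K N d) × StepRand K N d =>
          batchStep I a t (batchRun I a t p.1) p.2 :=
        Measurable.comp (measurable_batchStep H.valid H.meas t)
          (f := fun p : (Fin t → StepRand K N d) × StepRand K N d => (batchRun I a t p.1, p.2))
          (((measurable_batchRun H.valid H.meas t).comp measurable_fst).prodMk measurable_snd)
      have hm2 := hcont.measurable.comp hm
      have hm3 := hm2.stronglyMeasurable.integral_prod_right' (ν := stepLaw K N d ε σ)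
      refine Integrable.of_bound hm3.aestronglyMeasurable M
        (Filter.Eventually.of_forall fun ω => ?_)
      refine (norm_integral_le_of_norm_le_const (C := M)
        (Filter.Eventually.of_forall fun r => ?_)).trans_eq (by simp)
      have hs := acsaStep_mem H.valid t (batchGrad
        (fun j => a j (acsaMid I t (batchRun I a t ω))) (r.1, r.2.2.2))
        (batchRun_mem H.valid a t ω).1
      exact hM _ hs.1 hs.2
    refine (integral_mono hi0 (hi4.add hi3) hle).trans ?_
    rw [integral_add' hi4 hi3, integral_add' hi1 (integrable_const _), integral_const_mul,
      integral_mul_const]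
    simp only [integral_const, probReal_univ, smul_eq_mul, one_mul]
    have hb := H.bias t (by omega)
    have hb2 := mul_le_mul_of_nonneg_right hb hR
    have hb3 := mul_le_mul_of_nonneg_left hb2 (show (0 : ℝ) ≤ (k : ℝ) + 1 by positivity)
    -- The biases enter with weights 1, …, k, whose sum is the weight of the potential; after
    -- division they cost only Rη per stage.
    have hW : acsaW (k + 1) = acsaW k + (k + 1) := by simp only [acsaW]; push_cast; ring
    rw [hW]
    push_cast
    linarith

/-- Convergence of multi-stage AC-SA: the initial gap shrinks by a factor `8` per stage. -/
lemma BatchSetup.convergence (H : BatchSetup I K N T ε σ τ R η h g a c) {y : Vec d} (hy : y ∈ I.X)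
    (hR : 0 ≤ R) (hη : 0 ≤ η) (hN₀ : 0 < I.N₀)
    (hstage : 32 * ((I.β + I.lam) / I.lam) ≤ (I.N₀ : ℝ) ^ 2)
    (hmin : ∀ x ∈ I.X, regObj h I.lam I.x₀ y ≤ regObj h I.lam I.x₀ x) (S : ℕ)
    (hT : S * I.N₀ ≤ T) :
    ∫ ω, (regObj h I.lam I.x₀ (batchRun I a (S * I.N₀) ω).1 - regObj h I.lam I.x₀ y)
        ∂(Measure.pi fun _ => stepLaw K N d ε σ)
      ≤ (regObj h I.lam I.x₀ I.x₀ - regObj h I.lam I.x₀ y) / 8 ^ S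
        + 2 * (2 * (τ ^ 2 / K + d * σ ^ 2) / (I.lam * I.N₀) + R * η) := by
  have := isProbabilityMeasure_stepLaw (K := K) (d := d) (σ := σ) H.N_pos H.ε_pos
  have hl := H.valid.lam_pos
  have hB : 0 < I.β + I.lam := by linarith [H.valid.β_nonneg]
  have hK : (0 : ℝ) < K := by exact_mod_cast H.K_pos
  have hn : (0 : ℝ) < I.N₀ := by exact_mod_cast hN₀
  set V := τ ^ 2 / K + d * σ ^ 2 with hV
  have hV0 : 0 ≤ V := by positivity
  set Ψ := regObj h I.lam I.x₀ with hΨ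
  have hgrow : ∀ x ∈ I.X, I.lam / 2 * ‖x - y‖ ^ 2 ≤ Ψ x - Ψ y := fun x hx =>
    H.firstOrder.growth H.valid.convex I.x₀ hy hmin hx
  have hΨc : Continuous Ψ := by
    have := H.cont
    rw [hΨ]; unfold regObj; fun_prop
  induction S with
  | zero =>
    have h0 : ∀ (t : ℕ) (_ : t = 0) (ω : Fin t → StepRand K N d),
        batchRun I a t ω = (I.x₀, I.x₀) := by
      rintro t rfl ω; exact chain_zero _ _ _
    simp only [h0 (0 * I.N₀) (by simp), pow_zero, div_one]
    simp only [integral_const, probReal_univ, smul_eq_mul, one_mul]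
    have : 0 ≤ 2 * (2 * V / (I.lam * I.N₀) + R * η) := by positivity
    linarith
  | succ S ih =>
    have hT' : S * I.N₀ + I.N₀ ≤ T := by rw [← Nat.succ_mul]; exact hT
    have ih := ih (by omega)
    have hst := H.stage hy hR S I.N₀ le_rfl hT'
    rw [← Nat.succ_mul] at hst
    simp only [hN₀.ne', if_false] at hst
    have hcg : Continuous fun s : Vec d × Vec d => Ψ s.1 - Ψ y := by fun_prop
    obtain ⟨M1, hM1⟩ := exists_bound_on_iterates H.valid.compact hcg
    have hi1 := fun t => integrable_batchRun (K := K) (σ := σ) H.valid H.N_pos H.ε_pos H.meas t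
      hcg.measurable hM1
    have hcp := continuous_acsaPot I H.cont y I.N₀
    obtain ⟨M2, hM2⟩ := exists_bound_on_iterates H.valid.compact hcp
    have hi2 := integrable_batchRun (K := K) (σ := σ) H.valid H.N_pos H.ε_pos H.meas
      ((S + 1) * I.N₀) hcp.measurable hM2
    have hcn : Continuous fun s : Vec d × Vec d => (I.β + I.lam) * ‖y - s.1‖ ^ 2 := by fun_prop
    obtain ⟨M3, hM3⟩ := exists_bound_on_iterates H.valid.compact hcn
    have hi3 := integrable_batchRun (K := K) (σ := σ) H.valid H.N_pos H.ε_pos H.meas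
      (S * I.N₀) hcn.measurable hM3
    have hWpos : 0 < acsaW I.N₀ := by unfold acsaW; positivity
    have e1 : acsaW I.N₀ * ∫ ω, (Ψ (batchRun I a ((S + 1) * I.N₀) ω).1 - Ψ y)
        ∂(Measure.pi fun _ => stepLaw K N d ε σ) ≤
        ∫ ω, acsaPot I h y I.N₀ (batchRun I a ((S + 1) * I.N₀) ω).1
          (batchRun I a ((S + 1) * I.N₀) ω).2 ∂(Measure.pi fun _ => stepLaw K N d ε σ) := by
      rw [← integral_const_mul]
      refine integral_mono ((hi1 _).const_mul _) hi2 fun ω => ?_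
      have : 0 ≤ (I.lam * acsaW I.N₀ + 2 * (I.β + I.lam)) / 2
        * ‖y - (batchRun I a ((S + 1) * I.N₀) ω).2‖ ^ 2 := by positivity
      simp only [acsaPot]
      linarith
    -- Quadratic growth around the minimizer converts the squared distance at the restart back into
    -- a gap.
    have e2 : ∫ ω, (I.β + I.lam) * ‖y - (batchRun I a (S * I.N₀) ω).1‖ ^ 2
        ∂(Measure.pi fun _ => stepLaw K N d ε σ) ≤ 2 * (I.β + I.lam) / I.lam *
        ∫ ω, (Ψ (batchRun I a (S * I.N₀) ω).1 - Ψ y)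
          ∂(Measure.pi fun _ => stepLaw K N d ε σ) := by
      rw [← integral_const_mul]
      refine integral_mono hi3 ((hi1 _).const_mul _) fun ω => ?_
      have h1 := hgrow _ (batchRun_mem H.valid a (S * I.N₀) ω).1
      rw [norm_sub_rev] at h1
      have h2 := mul_le_mul_of_nonneg_left h1
        (show 0 ≤ 2 * (I.β + I.lam) / I.lam by positivity)
      refine le_of_eq_of_le ?_ h2
      field_simp
    have hgap0 : 0 ≤ Ψ I.x₀ - Ψ y := sub_nonneg.2 (hmin _ H.valid.mem)
    have hE0 : 0 ≤ ∫ ω, (Ψ (batchRun I a (S * I.N₀) ω).1 - Ψ y)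
          ∂(Measure.pi fun _ => stepLaw K N d ε σ) :=
      integral_nonneg fun ω => sub_nonneg.2 (hmin _ (batchRun_mem H.valid a _ ω).1)
    have h5 := e1.trans (hst.trans (add_le_add_left (add_le_add_left e2 _) _))
    set X1 := ∫ ω, (Ψ (batchRun I a ((S + 1) * I.N₀) ω).1 - Ψ y)
          ∂(Measure.pi fun _ => stepLaw K N d ε σ)
    set X0 := ∫ ω, (Ψ (batchRun I a (S * I.N₀) ω).1 - Ψ y)
          ∂(Measure.pi fun _ => stepLaw K N d ε σ)
    -- The weight at the end of a stage is at least N₀²/2 ≥ 16(β+λ)/λ, against a coefficient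
    -- 2(β+λ)/λ of the old gap; hence the 8. The variance N₀V/λ, divided by the weight, is at most
    -- 2V/(λN₀).
    have h6 : X1 ≤ X0 / 8 + 2 * V / (I.lam * I.N₀) + R * η := by
      refine le_of_mul_le_mul_left (h5.trans ?_) hWpos
      have hWge : (I.N₀ : ℝ) ^ 2 / 2 ≤ acsaW I.N₀ := by
        simp only [acsaW]; nlinarith
      have h7 : 2 * (I.β + I.lam) / I.lam * X0 ≤ acsaW I.N₀ * (X0 / 8) := by
        have : 2 * (I.β + I.lam) / I.lam ≤ acsaW I.N₀ / 8 := by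
          have e : 2 * (I.β + I.lam) / I.lam = 2 * ((I.β + I.lam) / I.lam) := by ring
          rw [e]; linarith
        calc _ ≤ acsaW I.N₀ / 8 * X0 := by gcongr
          _ = _ := by ring
      have h8 : I.N₀ * (V / I.lam) ≤ acsaW I.N₀ * (2 * V / (I.lam * I.N₀)) := by
        calc (I.N₀ : ℝ) * (V / I.lam) = (I.N₀ : ℝ) ^ 2 / 2 * (2 * V / (I.lam * I.N₀)) := by
              field_simp
          _ ≤ _ := by gcongr
      linarith
    -- The factor 2 in the claim dominates the geometric series 1 + 1/8 + …; inductively, 2/8 + 1 ≤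
    -- 2.
    have h9 : X0 / 8 ≤ ((Ψ I.x₀ - Ψ y) / 8 ^ S
        + 2 * (2 * V / (I.lam * I.N₀) + R * η)) / 8 := by gcongr
    have h10 : (Ψ I.x₀ - Ψ y) / 8 ^ (S + 1) = (Ψ I.x₀ - Ψ y) / 8 ^ S / 8 := by
      rw [pow_succ, div_div]
    have h11 : 0 ≤ 2 * V / (I.lam * I.N₀) + R * η := by positivity
    rw [h10]
    linarith

end Convergence

/-! ### Cauchy–Schwarz for integrals -/

section CauchySchwarz

variable {α : Type*} [MeasurableSpace α] {μ : Measure α}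

lemma integral_mul_le_sqrt_mul_sqrt {f g : α → ℝ} (hf0 : ∀ x, 0 ≤ f x) (hg0 : ∀ x, 0 ≤ g x)
    (hf : MemLp f 2 μ) (hg : MemLp g 2 μ) :
    ∫ x, f x * g x ∂μ ≤ √(∫ x, f x ^ 2 ∂μ) * √(∫ x, g x ^ 2 ∂μ) := by
  have h := integral_mul_le_Lp_mul_Lq_of_nonneg (μ := μ) Real.HolderConjugate.two_two
    (Filter.Eventually.of_forall hf0) (Filter.Eventually.of_forall hg0)
    (by simpa using hf) (by simpa using hg)
  simpa [Real.sqrt_eq_rpow] using h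

lemma integral_sqrt_le [IsProbabilityMeasure μ] {f : α → ℝ} (hf0 : ∀ x, 0 ≤ f x)
    (hm : Measurable f) (hf : Integrable f μ) : ∫ x, √(f x) ∂μ ≤ √(∫ x, f x ∂μ) := by
  have h1 : MemLp (fun x => √(f x)) 2 μ := by
    rw [memLp_two_iff_integrable_sq hm.sqrt.aestronglyMeasurable]
    simpa [Real.sq_sqrt (hf0 _)] using hf
  have := integral_mul_le_sqrt_mul_sqrt (μ := μ) (f := fun x => √(f x)) (g := fun _ => 1)
    (fun x => Real.sqrt_nonneg _) (fun _ => zero_le_one) h1 (memLp_const 1)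
  simpa [Real.sq_sqrt (hf0 _)] using this

end CauchySchwarz

/-! ### Sampling with and without a distinguished user -/

section Merge

variable {K n : ℕ}

/-- Sampling a user uniformly: first decide whether it is user `j`, and if not, sample one of the
others. -/
def mergeUser (j : Fin (n + 1)) (b : Fin (n + 1)) (i : Fin n) : Fin (n + 1) :=
  if b = j then j else j.succAbove i

lemma map_mergeUser (hn : 0 < n) (j : Fin (n + 1)) :
    ((uniformOn (Set.univ : Set (Fin (n + 1)))).prod (uniformOn (Set.univ : Set (Fin n)))).map
      (fun p => mergeUser j p.1 p.2) = uniformOn (Set.univ : Set (Fin (n + 1))) := by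
  have h1 := isProbabilityMeasure_uniform hn
  have h2 := isProbabilityMeasure_uniform n.succ_pos
  have hm : Measurable fun p : Fin (n + 1) × Fin n => mergeUser j p.1 p.2 := measurable_of_finite _
  refine Measure.ext_of_singleton fun x => ?_
  rw [Measure.map_apply hm (measurableSet_singleton x)]
  obtain rfl | hx := eq_or_ne x j
  · have : (fun p : Fin (n + 1) × Fin n => mergeUser x p.1 p.2) ⁻¹' {x} = {x} ×ˢ Set.univ := by
      ext p
      by_cases h : p.1 = x <;> simp [mergeUser, h, Fin.succAbove_ne]
    rw [this, Measure.prod_prod, measure_univ, mul_one]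
  · obtain ⟨i, rfl⟩ := Fin.exists_succAbove_eq hx
    have : (fun p : Fin (n + 1) × Fin n => mergeUser j p.1 p.2) ⁻¹' {j.succAbove i} =
        {j}ᶜ ×ˢ {i} := by
      ext p
      by_cases h : p.1 = j
      · simp [mergeUser, h, (Fin.succAbove_ne j i).symm]
      · simp [mergeUser, h]
    rw [this, Measure.prod_prod, prob_compl_eq_one_sub (measurableSet_singleton j), uniformOn_univ,
      uniformOn_univ, uniformOn_univ]
    simp only [Measure.count_singleton, Fintype.card_fin]
    have e1 : (1 : ENNReal) - 1 / ((n + 1 : ℕ) : ENNReal) = n / ((n + 1 : ℕ) : ENNReal) := by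
      refine ENNReal.sub_eq_of_eq_add (by simp) ?_
      rw [← ENNReal.add_div]
      refine (ENNReal.div_self (a := ((n + 1 : ℕ) : ENNReal)) (by simp) (by simp)).symm.trans ?_
      push_cast; rfl
    rw [e1, ENNReal.div_eq_inv_mul, mul_assoc, one_div, ENNReal.mul_inv_cancel (a := (n : ENNReal))
      (by exact_mod_cast hn.ne') (by simp), mul_one, one_div]

/-- Couples K draws from n + 1 users to K draws `i` from the users other than `j`: an independent
sequence `b` decides which draws are overwritten by `j`. For fixed `i`, only the hits of `j` in `b`
distinguish the two batches. -/
lemma integral_mergeUser (hn : 0 < n) (j : Fin (n + 1)) (ψ : (Fin K → Fin (n + 1)) → ℝ) :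
    ∫ idx, ψ idx ∂(Measure.pi fun _ : Fin K => uniformOn (Set.univ : Set (Fin (n + 1)))) =
      ∫ i : Fin K → Fin n, (∫ b : Fin K → Fin (n + 1), ψ (fun k => mergeUser j (b k) (i k))
        ∂(Measure.pi fun _ : Fin K => uniformOn (Set.univ : Set (Fin (n + 1)))))
        ∂(Measure.pi fun _ : Fin K => uniformOn (Set.univ : Set (Fin n))) := by
  have h1 := isProbabilityMeasure_uniform hn
  have h2 := isProbabilityMeasure_uniform n.succ_pos
  have hm : Measurable fun p : Fin (n + 1) × Fin n => mergeUser j p.1 p.2 := measurable_of_finite _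
  have e1 : (Measure.pi fun _ : Fin K => uniformOn (Set.univ : Set (Fin (n + 1)))) =
      (Measure.pi fun _ : Fin K => (uniformOn (Set.univ : Set (Fin (n + 1)))).prod
        (uniformOn (Set.univ : Set (Fin n)))).map (fun x k => mergeUser j (x k).1 (x k).2) := by
    have := Measure.pi_map_pi (μ := fun _ : Fin K => (uniformOn (Set.univ : Set (Fin (n + 1)))).prod
        (uniformOn (Set.univ : Set (Fin n)))) (f := fun _ p => mergeUser j p.1 p.2)
        (fun _ => hm.aemeasurable)
    rw [this, map_mergeUser hn]
  have h3 := measurePreserving_arrowProdEquivProdArrow (Fin (n + 1)) (Fin n) (Fin K)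
    (fun _ => uniformOn (Set.univ : Set (Fin (n + 1)))) (fun _ => uniformOn
        (Set.univ : Set (Fin n)))
  conv_lhs => rw [e1]
  rw [integral_map (measurable_of_finite _).aemeasurable (measurable_of_finite
      _).aestronglyMeasurable]
  rw [integral_integral_swap .of_finite, ← integral_prod
    (f := fun p : (Fin K → Fin (n + 1)) × (Fin K → Fin n) => ψ fun k => mergeUser j (p.1 k) (p.2 k))
    .of_finite, ← h3.map_eq, integral_map h3.measurable.aemeasurable
    (measurable_of_finite _).aestronglyMeasurable]
  rfl

/-- How often user `j` is sampled. -/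
def hits (j : Fin n) (b : Fin K → Fin n) : ℝ := ∑ k, if b k = j then 1 else 0

lemma hits_nonneg (j : Fin n) (b : Fin K → Fin n) : 0 ≤ hits j b :=
  Finset.sum_nonneg fun k _ => by split_ifs <;> norm_num

lemma integral_hits (hn : 0 < n) (j : Fin n) :
    ∫ b, hits j b ∂(Measure.pi fun _ : Fin K => uniformOn (Set.univ : Set (Fin n))) =
      (K : ℝ) / n := by
  have h1 := isProbabilityMeasure_uniform hn
  unfold hits
  rw [integral_finsetSum _ fun k _ => .of_finite]
  have : ∀ k : Fin K, ∫ b : Fin K → Fin n, (if b k = j then (1 : ℝ) else 0)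
      ∂(Measure.pi fun _ : Fin K => uniformOn (Set.univ : Set (Fin n))) = 1 / n := fun k => by
    rw [integral_comp_eval (μ := fun _ : Fin K => uniformOn (Set.univ : Set (Fin n))) (i := k)
      (f := fun i => if i = j then (1 : ℝ) else 0) (measurable_of_finite _).aestronglyMeasurable,
      integral_uniform]
    simp
  simp_rw [this]
  simp [div_eq_mul_inv]

/-- Chernoff's bound with parameter 1: a single draw has exponential moment 1 + (e-1)/n ≤ exp(2/n).
-/
lemma measure_hits_gt_le (hn : 0 < n) (j : Fin n) (h : ℝ) :
    (Measure.pi fun _ : Fin K => uniformOn (Set.univ : Set (Fin n))).real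
      {b | 2 * ((K : ℝ) / n) + h < hits j b} ≤ Real.exp (-h) := by
  have h1 := isProbabilityMeasure_uniform hn
  have hn' : (0 : ℝ) < n := by exact_mod_cast hn
  have h2 : ∫ b, Real.exp (hits j b)
      ∂(Measure.pi fun _ : Fin K => uniformOn (Set.univ : Set (Fin n))) ≤
      Real.exp (2 * ((K : ℝ) / n)) := by
    simp_rw [hits, Real.exp_sum]
    rw [integral_fintype_prod_eq_prod (μ := fun _ : Fin K => uniformOn (Set.univ : Set (Fin n)))
      (f := fun _ i => Real.exp (if i = j then 1 else 0))]
    have : ∫ i, Real.exp (if i = j then 1 else 0) ∂uniformOn (Set.univ : Set (Fin n)) ≤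
        Real.exp (2 / n) := by
      rw [integral_uniform, smul_eq_mul]
      have e : ∀ i : Fin n, Real.exp (if i = j then 1 else 0) =
          1 + if i = j then Real.exp 1 - 1 else 0 := fun i => by split_ifs <;> simp
      simp_rw [e, Finset.sum_add_distrib]
      simp only [Finset.sum_const, Finset.card_univ, Fintype.card_fin, nsmul_eq_mul, mul_one,
        Finset.sum_ite_eq', Finset.mem_univ, if_true]
      have h3 := Real.exp_one_lt_d9
      have h4 := Real.add_one_le_exp (2 / (n : ℝ))
      refine le_trans ?_ h4
      rw [one_div_mul_eq_div, div_le_iff₀ hn', add_mul, div_mul_cancel₀ _ hn'.ne']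
      linarith
    calc _ ≤ ∏ _k : Fin K, Real.exp (2 / n) := by
          refine Finset.prod_le_prod (fun _ _ => integral_nonneg fun _ => (Real.exp_pos _).le)
            fun _ _ => this
      _ = _ := by
          rw [Finset.prod_const, Finset.card_univ, Fintype.card_fin, ← Real.exp_nat_mul]
          congr 1; ring
  have h3 := mul_meas_ge_le_integral_of_nonneg
    (μ := Measure.pi fun _ : Fin K => uniformOn (Set.univ : Set (Fin n)))
    (f := fun b => Real.exp (hits j b))
    (Filter.Eventually.of_forall fun _ => (Real.exp_pos _).le) .of_finite
    (Real.exp (2 * ((K : ℝ) / n) + h))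
  have h4 : (Measure.pi fun _ : Fin K => uniformOn (Set.univ : Set (Fin n))).real
      {b | 2 * ((K : ℝ) / n) + h < hits j b} ≤
      (Measure.pi fun _ : Fin K => uniformOn (Set.univ : Set (Fin n))).real
      {b | Real.exp (2 * ((K : ℝ) / n) + h) ≤ Real.exp (hits j b)} :=
    measureReal_mono fun b hb => Real.exp_le_exp.2 (le_of_lt hb)
  have h5 := h3.trans h2
  rw [Real.exp_add, mul_assoc] at h5
  have h6 := le_of_mul_le_mul_left (h5.trans_eq (mul_one _).symm) (Real.exp_pos _)
  rw [Real.exp_neg, ← one_div, le_div_iff₀ (Real.exp_pos h)]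
  rw [← Real.exp_add] at h6
  nlinarith [Real.exp_pos h]

end Merge

/-! ### Comparing one iteration with and without a distinguished user -/

section ChangeOfMeasure

variable {d K n : ℕ}

/-- Cauchy–Schwarz between `ψ` and the likelihood ratio of the whole mixture of translates. Mixing
before squaring is essential: the exponent pairs two independent indices b, b', whereas squaring
each component would give exp‖v b‖² and lose the gain from subsampling. -/
lemma sum_integral_shift_le {B : Type*} [Fintype B] {w : B → ℝ} (hw : ∀ b, 0 ≤ w b)
    (v : B → Vec d) {ψ : Vec d → ℝ} (hψ : Measurable ψ) (h0 : ∀ x, 0 ≤ ψ x) (h1 : ∀ x, ψ x ≤ 1) :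
    ∑ b, w b * ∫ x, ψ (v b + x) ∂stdGaussian (Vec d) ≤
      √(∑ b, ∑ b', w b * w b' * Real.exp (inner ℝ (v b) (v b')))
        * √(∫ x, ψ x ^ 2 ∂stdGaussian (Vec d)) := by
  have hi : ∀ b, Integrable (fun x => gaussTilt (v b) x * ψ x) (stdGaussian (Vec d)) := fun b =>
    (integrable_gaussTilt (v b)).mul_bdd (c := 1) hψ.aestronglyMeasurable
      (Filter.Eventually.of_forall fun x => by rw [Real.norm_of_nonneg (h0 x)]; exact h1 x)
  have e1 : ∑ b, w b * ∫ x, ψ (v b + x) ∂stdGaussian (Vec d) =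
      ∫ x, (∑ b, w b * gaussTilt (v b) x) * ψ x ∂stdGaussian (Vec d) := by
    simp_rw [Finset.sum_mul, mul_assoc]
    rw [integral_finsetSum _ fun b _ => (hi b).const_mul _]
    refine Finset.sum_congr rfl fun b _ => ?_
    rw [integral_const_mul, integral_add_stdGaussian hψ]
  have e2 : ∀ x, (∑ b, w b * gaussTilt (v b) x) ^ 2 =
      ∑ b, ∑ b', w b * w b' * (gaussTilt (v b) x * gaussTilt (v b') x) := fun x => by
    rw [sq, Finset.sum_mul_sum]
    exact Finset.sum_congr rfl fun b _ => Finset.sum_congr rfl fun b' _ => by ring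
  have hi2 : ∀ b b', Integrable (fun x => w b * w b' * (gaussTilt (v b) x * gaussTilt (v b') x))
      (stdGaussian (Vec d)) := fun b b' => (integrable_gaussTilt_mul _ _).const_mul _
  have hmeas : Measurable fun x => ∑ b, w b * gaussTilt (v b) x :=
    Finset.measurable_sum _ fun b _ => (measurable_gaussTilt (v b)).const_mul _
  have e3 : ∫ x, (∑ b, w b * gaussTilt (v b) x) ^ 2 ∂stdGaussian (Vec d) =
      ∑ b, ∑ b', w b * w b' * Real.exp (inner ℝ (v b) (v b')) := by
    simp_rw [e2]
    rw [integral_finsetSum _ fun b _ => integrable_finsetSum _ fun b' _ => hi2 b b']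
    refine Finset.sum_congr rfl fun b _ => ?_
    rw [integral_finsetSum _ fun b' _ => hi2 b b']
    refine Finset.sum_congr rfl fun b' _ => ?_
    rw [integral_const_mul, integral_gaussTilt_mul]
  rw [e1, ← e3]
  refine integral_mul_le_sqrt_mul_sqrt
    (fun x => Finset.sum_nonneg fun b _ => mul_nonneg (hw b) (gaussTilt_pos _ _).le) h0 ?_ ?_
  · rw [memLp_two_iff_integrable_sq hmeas.aestronglyMeasurable]
    simp_rw [e2]
    exact integrable_finsetSum _ fun b _ => integrable_finsetSum _ fun b' _ => hi2 b b'
  · exact MemLp.of_bound hψ.aestronglyMeasurable 1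
      (Filter.Eventually.of_forall fun x => by rw [Real.norm_of_nonneg (h0 x)]; exact h1 x)

/-- The displacement of the averaged gradient caused by drawing user `j`. -/
def userShift (A : Fin (n + 1) → Vec d) (j : Fin (n + 1)) (i : Fin K → Fin n)
    (b : Fin K → Fin (n + 1)) : Vec d :=
  (1 / (K : ℝ)) • ∑ k, if b k = j then A j - A (j.succAbove (i k)) else 0

/-- The presence of user `j` amounts to a translation of the Gaussian noise. -/
lemma batchGrad_mergeUser (A : Fin (n + 1) → Vec d) (j : Fin (n + 1)) (i : Fin K → Fin n)
    (b : Fin K → Fin (n + 1)) (x : Vec d) :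
    batchGrad A (fun k => mergeUser j (b k) (i k), x) =
      batchGrad (fun l => A (j.succAbove l)) (i, userShift A j i b + x) := by
  have : ∀ k, A (mergeUser j (b k) (i k)) = A (j.succAbove (i k))
      + if b k = j then A j - A (j.succAbove (i k)) else 0 := fun k => by
    unfold mergeUser; split_ifs <;> simp
  simp only [batchGrad, userShift, this, Finset.sum_add_distrib, smul_add]
  abel

lemma norm_userShift_le {A : Fin (n + 1) → Vec d} {c : Vec d} {τ : ℝ} (hA : ∀ l, ‖A l - c‖ ≤ τ)
    (j : Fin (n + 1)) (i : Fin K → Fin n) (b : Fin K → Fin (n + 1)) :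
    ‖userShift A j i b‖ ≤ 2 * τ / K * hits j b := by
  rw [userShift, norm_smul, Real.norm_of_nonneg (by positivity)]
  have : ‖∑ k, if b k = j then A j - A (j.succAbove (i k)) else 0‖ ≤ 2 * τ * hits j b := by
    rw [hits, Finset.mul_sum]
    refine (norm_sum_le _ _).trans (Finset.sum_le_sum fun k _ => ?_)
    split_ifs
    · have h1 := norm_sub_le (A j - c) (A (j.succAbove (i k)) - c)
      rw [sub_sub_sub_cancel_right] at h1
      linarith [hA j, hA (j.succAbove (i k))]
    · simp
  calc _ ≤ 1 / (K : ℝ) * (2 * τ * hits j b) := by gcongr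
    _ = _ := by ring

lemma exp_le_one_add_two_mul {x : ℝ} (h0 : 0 ≤ x) (h1 : x ≤ 1) : Real.exp x ≤ 1 + 2 * x := by
  have h2 := Real.abs_exp_sub_one_le (x := x) (by rwa [abs_of_nonneg h0])
  have h3 := (abs_le.1 h2).2
  rw [abs_of_nonneg h0] at h3
  linarith

/-- Truncation to H ≤ M keeps the exponents below 1, where exp x ≤ 1 + 2x; independence of the two
indices then factors the linear term into the square of the mean of H. With H the number of hits
this is the effect of subsampling: the typical influence of a user counts, not the largest one. The
truncated event is charged by its probability, as ψ ≤ 1. -/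
lemma integral_shift_le {B : Type*} [Fintype B] [MeasurableSpace B] [MeasurableSingletonClass B]
    (ν : Measure B) [IsProbabilityMeasure ν] {H : B → ℝ} (hH : ∀ b, 0 ≤ H b) {ρ M : ℝ}
    (hρ0 : 0 ≤ ρ) (hρ : ρ * M ≤ 1) {v : B → Vec d} (hv : ∀ b, ‖v b‖ ≤ ρ * H b) {ψ : Vec d → ℝ}
    (hψ : Measurable ψ) (h0 : ∀ x, 0 ≤ ψ x) (h1 : ∀ x, ψ x ≤ 1) :
    ∫ b, (∫ x, ψ (v b + x) ∂stdGaussian (Vec d)) ∂ν ≤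
      √((1 + 2 * (ρ * ∫ b, H b ∂ν) ^ 2) * ∫ x, ψ x ^ 2 ∂stdGaussian (Vec d))
        + ν.real {b | M < H b} := by
  classical
  rw [integral_fintype .of_finite]
  simp only [smul_eq_mul]
  set J : B → ℝ := fun b => ∫ x, ψ (v b + x) ∂stdGaussian (Vec d)
  set w : B → ℝ := fun b => if H b ≤ M then ν.real {b} else 0 with hw
  have hw0 : ∀ b, 0 ≤ w b := fun b => by
    simp only [hw]; split_ifs
    · exact measureReal_nonneg
    · exact le_rfl
  have hJ : ∀ b, J b ≤ 1 := fun b => by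
    have hm : Measurable fun x => ψ (v b + x) := hψ.comp (measurable_const_add (v b))
    refine (integral_mono (g := fun _ => (1 : ℝ)) (Integrable.of_bound (C := 1)
      hm.aestronglyMeasurable
      (Filter.Eventually.of_forall fun x => ?_)) (integrable_const _) fun x => h1 _).trans_eq
      (by simp)
    rw [Real.norm_of_nonneg (h0 _)]; exact h1 _
  have hsplit : ∀ b, ν.real {b} * J b ≤ w b * J b + if M < H b then ν.real {b} else 0 := fun b => by
    by_cases hb : H b ≤ M
    · simp [hw, hb, hb.not_gt]
    · simp only [hw, hb, not_le.1 hb, if_true, if_false, zero_mul, zero_add]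
      exact mul_le_of_le_one_right measureReal_nonneg (hJ b)
  refine (Finset.sum_le_sum fun b _ => hsplit b).trans ?_
  rw [Finset.sum_add_distrib]
  refine add_le_add ((sum_integral_shift_le hw0 v hψ h0 h1).trans ?_) (le_of_eq ?_)
  · rw [← Real.sqrt_mul (Finset.sum_nonneg fun b _ => Finset.sum_nonneg fun b' _ =>
      mul_nonneg (mul_nonneg (hw0 b) (hw0 b')) (Real.exp_pos _).le)]
    refine Real.sqrt_le_sqrt (mul_le_mul_of_nonneg_right ?_ (integral_nonneg fun x => sq_nonneg _))
    have hexp : ∀ b b', w b * w b' * Real.exp (inner ℝ (v b) (v b')) ≤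
        ν.real {b} * ν.real {b'} + 2 * ρ ^ 2 * (ν.real {b} * H b) * (ν.real {b'} * H b') :=
      fun b b' => by
      have p1 := hH b
      have p2 := hH b'
      have hnn : 0 ≤ ν.real {b} * ν.real {b'} +
          2 * ρ ^ 2 * (ν.real {b} * H b) * (ν.real {b'} * H b') := by positivity
      by_cases hb : H b ≤ M
      · by_cases hb' : H b' ≤ M
        · simp only [hw, hb, hb', if_true]
          have hx : inner ℝ (v b) (v b') ≤ (ρ * H b) * (ρ * H b') :=
            (real_inner_le_norm _ _).trans
              (mul_le_mul (hv b) (hv b') (norm_nonneg _) (mul_nonneg hρ0 p1))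
          have hb0 := mul_nonneg hρ0 p1
          have hb0' := mul_nonneg hρ0 p2
          have := (Real.exp_le_exp.2 hx).trans (exp_le_one_add_two_mul (mul_nonneg hb0 hb0')
            (mul_le_one₀ ((mul_le_mul_of_nonneg_left hb hρ0).trans hρ) hb0'
              ((mul_le_mul_of_nonneg_left hb' hρ0).trans hρ)))
          calc _ ≤ ν.real {b} * ν.real {b'} * (1 + 2 * (ρ * H b * (ρ * H b'))) := by gcongr
            _ = _ := by ring
        · simpa only [hw, hb', if_false, mul_zero, zero_mul] using hnn
      · simpa only [hw, hb, if_false, mul_zero, zero_mul] using hnn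
    refine (Finset.sum_le_sum fun b _ => Finset.sum_le_sum fun b' _ => hexp b b').trans
      (le_of_eq ?_)
    have s1 : ∑ b, ν.real {b} = 1 := by simp
    have s2 : ∑ b, ν.real {b} * H b = ∫ b, H b ∂ν := by
      rw [integral_fintype .of_finite]; simp
    have s3 : ∀ b, ∑ b', (ν.real {b} * ν.real {b'}
        + 2 * ρ ^ 2 * (ν.real {b} * H b) * (ν.real {b'} * H b')) =
        ν.real {b} + 2 * ρ ^ 2 * (ν.real {b} * H b) * ∫ b, H b ∂ν := fun b => by
      rw [Finset.sum_add_distrib, ← Finset.mul_sum, ← Finset.mul_sum, s1, s2, mul_one]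
    simp_rw [s3]
    rw [Finset.sum_add_distrib, ← Finset.sum_mul, ← Finset.mul_sum, s1, s2]
    ring
  · rw [← Finset.sum_filter, sum_measureReal_singleton]
    congr 1; ext b; simp

lemma integral_sampleLaw {N : ℕ} (hN : 0 < N) {σ : ℝ} (a : Fin N → Vec d) {φ : Vec d → ℝ}
    (hφ : Measurable φ) (h0 : ∀ x, 0 ≤ φ x) (h1 : ∀ x, φ x ≤ 1) :
    ∫ p, φ (batchGrad a p) ∂sampleLaw K N d σ =
      ∫ i, (∫ x, φ (batchGrad a (i, x)) ∂gaussianVec d σ)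
        ∂(Measure.pi fun _ : Fin K => uniformOn (Set.univ : Set (Fin N))) := by
  have := isProbabilityMeasure_uniform hN
  unfold sampleLaw
  refine integral_prod (fun p => φ (batchGrad a p)) ?_
  have hm := hφ.comp (measurable_batchGrad (K := K) (a := a))
  refine Integrable.of_bound (C := 1) hm.aestronglyMeasurable
    (Filter.Eventually.of_forall fun p => ?_)
  change ‖φ _‖ ≤ 1
  rw [Real.norm_of_nonneg (h0 _)]; exact h1 _

lemma measurable_batchGrad_right {N : ℕ} (a : Fin N → Vec d) (i : Fin K → Fin N) :
    Measurable fun x => batchGrad a (i, x) := by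
  unfold batchGrad; fun_prop

/-- The law of the sampled averaged gradient is comparable to its law without user `j`. -/
lemma integral_batchGrad_le (hn : 0 < n) {A : Fin (n + 1) → Vec d} {c : Vec d} {τ σ h : ℝ}
    (hA : ∀ l, ‖A l - c‖ ≤ τ) (hσ : 0 < σ) (j : Fin (n + 1))
    (hρ : 2 * τ / K / σ * (2 * ((K : ℝ) / (n + 1 : ℕ)) + h) ≤ 1)
    {φ : Vec d → ℝ} (hφ : Measurable φ) (h0 : ∀ x, 0 ≤ φ x) (h1 : ∀ x, φ x ≤ 1) :
    ∫ p, φ (batchGrad A p) ∂sampleLaw K (n + 1) d σ ≤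
      √((1 + 2 * (2 * τ / K / σ * ((K : ℝ) / (n + 1 : ℕ))) ^ 2)
        * ∫ p, φ (batchGrad (fun l => A (j.succAbove l)) p) ^ 2 ∂sampleLaw K n d σ)
      + Real.exp (-h) := by
  have u1 := isProbabilityMeasure_uniform hn
  have u2 := isProbabilityMeasure_uniform n.succ_pos
  have hτ : 0 ≤ τ := (norm_nonneg _).trans (hA j)
  set ρ := 2 * τ / K / σ with hρdef
  have hρ0 : 0 ≤ ρ := by positivity
  set Ac := 1 + 2 * (ρ * ((K : ℝ) / (n + 1 : ℕ))) ^ 2 with hAc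
  have hAc0 : 0 ≤ Ac := by positivity
  set U : (Fin K → Fin n) → ℝ := fun i =>
    ∫ x, φ (batchGrad (fun l => A (j.succAbove l)) (i, x)) ^ 2 ∂gaussianVec d σ with hU
  have hU0 : ∀ i, 0 ≤ U i := fun i => integral_nonneg fun x => sq_nonneg _
  have hfib : ∀ i : Fin K → Fin n,
      ∫ b, (∫ x, φ (batchGrad A (fun k => mergeUser j (b k) (i k), x)) ∂gaussianVec d σ)
        ∂(Measure.pi fun _ : Fin K => uniformOn (Set.univ : Set (Fin (n + 1)))) ≤
        √(Ac * U i) + Real.exp (-h) := fun i => by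
    set ψ : Vec d → ℝ := fun g => φ (batchGrad (fun l => A (j.succAbove l)) (i, σ • g)) with hψ
    have hm1 := hφ.comp (measurable_batchGrad_right (fun l => A (j.succAbove l)) i)
    have hψm : Measurable ψ := by
      have := hm1.comp (measurable_const_smul σ)
      exact this
    have e1 : ∀ b : Fin K → Fin (n + 1),
        ∫ x, φ (batchGrad A (fun k => mergeUser j (b k) (i k), x)) ∂gaussianVec d σ =
        ∫ g, ψ ((1 / σ) • userShift A j i b + g) ∂stdGaussian (Vec d) := fun b => by
      have hm := hφ.comp (measurable_batchGrad_right A fun k => mergeUser j (b k) (i k))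
      have := integral_gaussianVec σ hm.stronglyMeasurable
      refine this.trans (integral_congr_ae (Filter.Eventually.of_forall fun g => ?_))
      simp only [hψ, Function.comp, batchGrad_mergeUser, smul_add, smul_smul,
        mul_one_div_cancel hσ.ne', one_smul]
    simp_rw [e1]
    have key := integral_shift_le
      (Measure.pi fun _ : Fin K => uniformOn (Set.univ : Set (Fin (n + 1))))
      (H := hits j) (hits_nonneg j) hρ0 hρ (v := fun b => (1 / σ) • userShift A j i b)
      (fun b => by
        rw [norm_smul, Real.norm_of_nonneg (by positivity), hρdef]
        calc 1 / σ * ‖userShift A j i b‖ ≤ 1 / σ * (2 * τ / K * hits j b) := by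
              gcongr; exact norm_userShift_le hA j i b
          _ = _ := by ring) hψm (fun _ => h0 _) (fun _ => h1 _)
    refine key.trans (add_le_add (le_of_eq ?_) (measure_hits_gt_le n.succ_pos j h))
    rw [integral_hits n.succ_pos]
    congr 2
    have := integral_gaussianVec σ (hm1.pow_const 2).stronglyMeasurable
    exact this.symm
  have e2 := integral_sampleLaw (K := K) (σ := σ) hn (fun l => A (j.succAbove l))
    (φ := fun x => φ x ^ 2) (hφ.pow_const 2) (fun x => sq_nonneg _)
    (fun x => pow_le_one₀ (h0 x) (h1 x))
  rw [integral_sampleLaw n.succ_pos A hφ h0 h1, e2, integral_mergeUser hn j]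
  refine (integral_mono .of_finite .of_finite hfib).trans ?_
  rw [integral_add .of_finite (integrable_const _)]
  simp only [integral_const, probReal_univ, smul_eq_mul, one_mul]
  -- Jensen for the average over the draws `i` of the other users, so that the root stays outside.
  refine add_le_add_left ((integral_sqrt_le (fun i => mul_nonneg hAc0 (hU0 i))
    (measurable_of_finite _) .of_finite).trans_eq ?_) _
  rw [integral_const_mul]

end ChangeOfMeasure

/-! ### Comparing a run with and without a distinguished user -/

section RunComparison

variable {d K n : ℕ} {I : PhaseInput d}

lemma measurable_integral_batchStep (hI : I.Valid) {N : ℕ} (hN : 0 < N) {ε σ : ℝ} (hε : 0 < ε)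
    {a : Fin N → Vec d → Vec d} (ha : ∀ j, Measurable (a j)) (t : ℕ) {φ : Vec d × Vec d → ℝ}
    (hφ : Measurable φ) :
    Measurable fun s => ∫ r, φ (batchStep I a t s r) ∂stepLaw K N d ε σ := by
  have := isProbabilityMeasure_stepLaw (K := K) (d := d) (σ := σ) hN hε
  have h1 := hφ.comp (measurable_batchStep (K := K) hI ha t)
  exact (h1.stronglyMeasurable.integral_prod_right' (ν := stepLaw K N d ε σ)).measurable

lemma integral_mem_unit {α : Type*} [MeasurableSpace α] {μ : Measure α} [IsProbabilityMeasure μ]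
    {φ : α → ℝ} (hφ : Measurable φ) (h0 : ∀ s, 0 ≤ φ s) (h1 : ∀ s, φ s ≤ 1) :
    Integrable φ μ ∧ 0 ≤ ∫ x, φ x ∂μ ∧ ∫ x, φ x ∂μ ≤ 1 := by
  have hi : Integrable φ μ := Integrable.of_bound hφ.aestronglyMeasurable 1
    (Filter.Eventually.of_forall fun x => by rw [Real.norm_of_nonneg (h0 x)]; exact h1 x)
  refine ⟨hi, integral_nonneg h0, ?_⟩
  refine (integral_mono hi (integrable_const 1) h1).trans_eq (by simp)

lemma integral_batchStep_le (hI : I.Valid) (hn : 0 < n) {ε σ τ h : ℝ} (hε : 0 < ε) (hσ : 0 < σ)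
    {a : Fin (n + 1) → Vec d → Vec d} {c : Vec d → Vec d}
    (hc : ∀ j x, ‖a j x - c x‖ ≤ τ) (j : Fin (n + 1))
    (hρ : 2 * τ / K / σ * (2 * ((K : ℝ) / (n + 1 : ℕ)) + h) ≤ 1) (t : ℕ) (s : Vec d × Vec d)
    {φ : Vec d × Vec d → ℝ} (hφ : Measurable φ) (h0 : ∀ s, 0 ≤ φ s) (h1 : ∀ s, φ s ≤ 1) :
    ∫ r, φ (batchStep I a t s r) ∂stepLaw K (n + 1) d ε σ ≤
      √((1 + 2 * (2 * τ / K / σ * ((K : ℝ) / (n + 1 : ℕ))) ^ 2)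
        * ∫ r, φ (batchStep I (fun l => a (j.succAbove l)) t s r) ^ 2 ∂stepLaw K n d ε σ)
      + Real.exp (-h) := by
  have hm : Measurable fun v => φ (acsaStep I t s v) := by
    have h2 := (measurable_acsaStep' hI t).comp (f := fun v : Vec d => (s, v)) (by fun_prop)
    have h3 := hφ.comp h2
    exact h3
  have key := integral_batchGrad_le (K := K) hn (A := fun l => a l (acsaMid I t s))
    (fun l => hc l _) hσ j hρ hm (fun _ => h0 _) (fun _ => h1 _)
  have e1 := integral_stepLaw (K := K) (σ := σ) n.succ_pos hε
    (hm.comp (measurable_batchGrad (K := K) (a := fun l => a l (acsaMid I t s))))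
  have e2 := integral_stepLaw (K := K) (σ := σ) hn hε
    ((hm.comp (measurable_batchGrad (K := K)
      (a := fun l => a (j.succAbove l) (acsaMid I t s)))).pow_const 2)
  refine (le_of_eq e1).trans (key.trans (le_of_eq ?_))
  congr 3
  exact e2.symm

/-- Induction on the number of iterations with an arbitrary test function. A root outside and a
square inside reproduce themselves: the conditional expectation of the last step is replaced by the
root of its bound, whose square is linear again. The factors multiply under one root instead of
halving the exponent at every step, and the exceptional probabilities add up. -/
lemma integral_batchRun_le (hI : I.Valid) (hn : 0 < n) {ε σ τ h : ℝ} (hε : 0 < ε) (hσ : 0 < σ)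
    {a : Fin (n + 1) → Vec d → Vec d} (ha : ∀ j, Measurable (a j)) {c : Vec d → Vec d}
    (hc : ∀ j x, ‖a j x - c x‖ ≤ τ) (j : Fin (n + 1))
    (hρ : 2 * τ / K / σ * (2 * ((K : ℝ) / (n + 1 : ℕ)) + h) ≤ 1) (t : ℕ)
    {φ : Vec d × Vec d → ℝ} (hφ : Measurable φ) (h0 : ∀ s, 0 ≤ φ s) (h1 : ∀ s, φ s ≤ 1) :
    ∫ ω, φ (batchRun I a t ω) ∂(Measure.pi fun _ : Fin t => stepLaw K (n + 1) d ε σ) ≤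
      √((1 + 2 * (2 * τ / K / σ * ((K : ℝ) / (n + 1 : ℕ))) ^ 2) ^ t
        * ∫ ω, φ (batchRun I (fun l => a (j.succAbove l)) t ω) ^ 2
          ∂(Measure.pi fun _ : Fin t => stepLaw K n d ε σ))
      + t * Real.exp (-h) := by
  have p1 := isProbabilityMeasure_stepLaw (K := K) (d := d) (σ := σ) hn hε
  have p2 := isProbabilityMeasure_stepLaw (K := K) (d := d) (σ := σ) n.succ_pos hε
  set Ac := 1 + 2 * (2 * τ / K / σ * ((K : ℝ) / (n + 1 : ℕ))) ^ 2 with hAc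
  have hAc0 : 0 ≤ Ac := by positivity
  set a' : Fin n → Vec d → Vec d := fun l => a (j.succAbove l) with ha'
  have hma' : ∀ l, Measurable (a' l) := fun l => ha _
  induction t generalizing φ with
  | zero =>
    have e : ∀ {N : ℕ} (a : Fin N → Vec d → Vec d) (ω : Fin 0 → StepRand K N d),
        batchRun I a 0 ω = (I.x₀, I.x₀) := fun a ω => chain_zero _ _ _
    simp only [e, pow_zero, one_mul, integral_const, probReal_univ, smul_eq_mul, Nat.cast_zero,
      zero_mul, add_zero, Real.sqrt_sq (h0 _), le_refl]
  | succ t ih =>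
    have hbd : ∀ s : Vec d × Vec d, s.1 ∈ I.X → s.2 ∈ I.X → |φ s| ≤ 1 := fun s _ _ => by
      rw [abs_of_nonneg (h0 s)]; exact h1 s
    have hbd2 : ∀ s : Vec d × Vec d, s.1 ∈ I.X → s.2 ∈ I.X → |φ s ^ 2| ≤ 1 := fun s _ _ => by
      rw [abs_of_nonneg (sq_nonneg _)]; exact pow_le_one₀ (h0 s) (h1 s)
    rw [integral_batchRun_succ hI n.succ_pos hε ha t hφ hbd,
      integral_batchRun_succ (φ := fun s => φ s ^ 2) hI hn hε hma' t (hφ.pow_const 2) hbd2]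
    set Φ : Vec d × Vec d → ℝ := fun s => ∫ r, φ (batchStep I a t s r) ∂stepLaw K (n + 1) d ε σ
      with hΦ
    set U : Vec d × Vec d → ℝ := fun s => ∫ r, φ (batchStep I a' t s r) ^ 2 ∂stepLaw K n d ε σ
      with hU
    have hΦm : Measurable Φ := measurable_integral_batchStep hI n.succ_pos hε ha t hφ
    have hUm : Measurable U :=
      measurable_integral_batchStep (φ := fun s => φ s ^ 2) hI hn hε hma' t (hφ.pow_const 2)
    have hstep : ∀ {N : ℕ} {a : Fin N → Vec d → Vec d} (_ : ∀ j, Measurable (a j))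
        (s : Vec d × Vec d), Measurable fun r : StepRand K N d => batchStep I a t s r :=
      fun {N} {a} ha s => by
        have := (measurable_batchStep (K := K) hI ha t).comp
          (f := fun r : StepRand K N d => (s, r)) (by fun_prop)
        exact this
    have hΦ1 : ∀ s, 0 ≤ Φ s ∧ Φ s ≤ 1 := fun s =>
      (integral_mem_unit (hφ.comp (hstep ha s)) (fun _ => h0 _) (fun _ => h1 _)).2
    have hU1 : ∀ s, 0 ≤ U s ∧ U s ≤ 1 := fun s =>
      (integral_mem_unit ((hφ.comp (hstep hma' s)).pow_const 2) (fun _ => sq_nonneg _)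
        (fun _ => pow_le_one₀ (h0 _) (h1 _))).2
    -- The truncation at 1 keeps the new test function within the range the induction hypothesis
    -- requires.
    set ψ : Vec d × Vec d → ℝ := fun s => min 1 (√(Ac * U s)) with hψ
    have hψm : Measurable ψ := measurable_const.min (hUm.const_mul Ac).sqrt
    have hψ0 : ∀ s, 0 ≤ ψ s := fun s => le_min zero_le_one (Real.sqrt_nonneg _)
    have hψ1 : ∀ s, ψ s ≤ 1 := fun s => min_le_left _ _
    have hle : ∀ s, Φ s ≤ ψ s + Real.exp (-h) := fun s => by
      have k1 := integral_batchStep_le (K := K) hI hn hε hσ hc j hρ t s hφ h0 h1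
      have k2 := (hΦ1 s).2
      have k3 := Real.exp_pos (-h)
      rcases min_choice 1 (√(Ac * U s)) with k | k <;> simp only [hψ, k]
      · linarith
      · exact k1
    have hsq : ∀ s, ψ s ^ 2 ≤ Ac * U s := fun s => by
      have k1 : ψ s ≤ √(Ac * U s) := min_le_right _ _
      calc ψ s ^ 2 ≤ √(Ac * U s) ^ 2 := pow_le_pow_left₀ (hψ0 s) k1 2
        _ = _ := Real.sq_sqrt (mul_nonneg hAc0 (hU1 s).1)
    have hrun := measurable_batchRun (K := K) hI ha t
    have hrun' := measurable_batchRun (K := K) hI hma' t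
    have i1 := (integral_mem_unit (μ := Measure.pi fun _ : Fin t => stepLaw K (n + 1) d ε σ)
      (hΦm.comp hrun) (fun _ => (hΦ1 _).1) (fun _ => (hΦ1 _).2)).1
    have i2 := (integral_mem_unit (μ := Measure.pi fun _ : Fin t => stepLaw K (n + 1) d ε σ)
      (hψm.comp hrun) (fun _ => hψ0 _) (fun _ => hψ1 _)).1
    have i3 := (integral_mem_unit (μ := Measure.pi fun _ : Fin t => stepLaw K n d ε σ)
      (hUm.comp hrun') (fun _ => (hU1 _).1) (fun _ => (hU1 _).2)).1
    have i4 := (integral_mem_unit (μ := Measure.pi fun _ : Fin t => stepLaw K n d ε σ)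
      ((hψm.comp hrun').pow_const 2) (fun _ => sq_nonneg _)
      (fun _ => pow_le_one₀ (hψ0 _) (hψ1 _))).1
    have q1 : ∫ ω, Φ (batchRun I a t ω) ∂(Measure.pi fun _ : Fin t => stepLaw K (n + 1) d ε σ) ≤
        ∫ ω, ψ (batchRun I a t ω) ∂(Measure.pi fun _ : Fin t => stepLaw K (n + 1) d ε σ)
          + Real.exp (-h) := by
      refine (integral_mono i1 (i2.add (integrable_const (Real.exp (-h))))
        fun ω => hle _).trans_eq ?_
      rw [integral_add' i2 (integrable_const _)]
      simp
    have q2 := ih hψm hψ0 hψ1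
    have q3 : ∫ ω, ψ (batchRun I a' t ω) ^ 2 ∂(Measure.pi fun _ : Fin t => stepLaw K n d ε σ) ≤
        Ac * ∫ ω, U (batchRun I a' t ω) ∂(Measure.pi fun _ : Fin t => stepLaw K n d ε σ) := by
      rw [← integral_const_mul]
      exact integral_mono i4 (i3.const_mul Ac) fun ω => hsq _
    have q4 : √(Ac ^ t * ∫ ω, ψ (batchRun I a' t ω) ^ 2
        ∂(Measure.pi fun _ : Fin t => stepLaw K n d ε σ)) ≤
        √(Ac ^ (t + 1) * ∫ ω, U (batchRun I a' t ω)
          ∂(Measure.pi fun _ : Fin t => stepLaw K n d ε σ)) := by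
      refine Real.sqrt_le_sqrt ?_
      rw [pow_succ, mul_assoc]
      gcongr
    push_cast
    linarith

end RunComparison

/-! ### Losses defined on the whole space -/

/-- A loss that is defined, bounded, Lipschitz and jointly measurable on the whole space, and convex
and smooth on `X`. -/
structure GlobalLoss {d : ℕ} {Z : Type*} [MeasurableSpace Z] (X : Set (Vec d))
    (f : Vec d → Z → ℝ) (g : Vec d → Z → Vec d) (L β R : ℝ) : Prop where
  convex : Convex ℝ X
  compact : IsCompact X
  zero_mem : (0 : Vec d) ∈ X
  diam : ∀ x ∈ X, ∀ y ∈ X, ‖x - y‖ ≤ R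
  L_pos : 0 < L
  β_nonneg : 0 ≤ β
  R_pos : 0 < R
  meas_f : Measurable fun p : Vec d × Z => f p.1 p.2
  meas_g : Measurable fun p : Vec d × Z => g p.1 p.2
  lip : ∀ z x y, |f x z - f y z| ≤ L * ‖x - y‖
  bdd : ∀ x z, |f x z| ≤ L * R
  norm_g_le : ∀ x z, ‖g x z‖ ≤ L
  first : ∀ z, FirstOrder X (fun x => f x z) (fun x => g x z) β

section Clip

variable {d m N K : ℕ} {Z : Type*} [MeasurableSpace Z] {X : Set (Vec d)} {f : Vec d → Z → ℝ}
  {g : Vec d → Z → Vec d} {L β R : ℝ}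

/-- The population gradient. -/
def popGrad (P : Measure Z) (g : Vec d → Z → Vec d) (x : Vec d) : Vec d := ∫ z, g x z ∂P

/-- The gradient of a user, replaced by the population gradient when it is an outlier. -/
def clipGrad (P : Measure Z) (g : Vec d → Z → Vec d) (τ : ℝ) (U : Fin m → Z) (x : Vec d) : Vec d :=
  if ‖(userGrad g x U).1 - popGrad P g x‖ ≤ τ then (userGrad g x U).1 else popGrad P g x

/-- The user's gradients at `x` are far from the population gradient. -/
def outlier (P : Measure Z) (g : Vec d → Z → Vec d) (τ : ℝ) (x : Vec d) : Set (Fin m → Z) :=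
  {U | τ < ‖(userGrad g x U).1 - popGrad P g x‖}

variable (H : GlobalLoss X f g L β R) (P : Measure Z) [IsProbabilityMeasure P]

lemma GlobalLoss.measurable_popGrad (H : GlobalLoss X f g L β R) : Measurable (popGrad P g) :=
  (H.meas_g.stronglyMeasurable.integral_prod_right' (ν := P)).measurable

lemma GlobalLoss.measurable_g (H : GlobalLoss X f g L β R) (x : Vec d) : Measurable (g x) := by
  have := H.meas_g.comp (f := fun z => (x, z)) (by fun_prop)
  exact this

lemma GlobalLoss.measurable_f (H : GlobalLoss X f g L β R) (x : Vec d) : Measurable (f x) := by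
  have := H.meas_f.comp (f := fun z => (x, z)) (by fun_prop)
  exact this

lemma GlobalLoss.norm_popGrad_le (H : GlobalLoss X f g L β R) (x : Vec d) :
    ‖popGrad P g x‖ ≤ L := by
  refine (norm_integral_le_of_norm_le_const (C := L)
    (Filter.Eventually.of_forall fun z => H.norm_g_le x z)).trans_eq (by simp)

lemma GlobalLoss.norm_userGrad_le (H : GlobalLoss X f g L β R) (x : Vec d) (U : Fin m → Z) :
    ‖(userGrad g x U).1‖ ≤ L := by
  have h1 := norm_sum_le_of_norm_le (H.norm_g_le x) U
  simp only [userGrad]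
  rw [norm_smul, Real.norm_of_nonneg (by positivity)]
  rcases Nat.eq_zero_or_pos m with rfl | hm
  · simpa using H.L_pos.le
  · calc 1 / (m : ℝ) * _ ≤ 1 / (m : ℝ) * (m * L) := by gcongr
      _ = L := by field_simp

lemma GlobalLoss.measurable_userGrad (H : GlobalLoss X f g L β R) :
    Measurable fun p : (Fin m → Z) × Vec d => (userGrad g p.2 p.1).1 := by
  simp only [userGrad]
  refine Measurable.fun_const_smul (Finset.measurable_sum _ fun r _ => ?_) _
  have := H.meas_g.comp (f := fun p : (Fin m → Z) × Vec d => (p.2, p.1 r)) (by fun_prop)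
  exact this

lemma GlobalLoss.measurable_dev (H : GlobalLoss X f g L β R) :
    Measurable fun p : (Fin m → Z) × Vec d => ‖(userGrad g p.2 p.1).1 - popGrad P g p.2‖ :=
  (H.measurable_userGrad.sub ((H.measurable_popGrad P).comp measurable_snd)).norm

lemma GlobalLoss.measurable_clipGrad (H : GlobalLoss X f g L β R) (τ : ℝ) :
    Measurable fun p : (Fin m → Z) × Vec d => clipGrad P g τ p.1 p.2 :=
  Measurable.ite (measurableSet_le (H.measurable_dev P) measurable_const) H.measurable_userGrad
    ((H.measurable_popGrad P).comp measurable_snd)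

lemma clipGrad_close {P : Measure Z} {g : Vec d → Z → Vec d} {τ : ℝ} (hτ : 0 ≤ τ) (U : Fin m → Z)
    (x : Vec d) : ‖clipGrad P g τ U x - popGrad P g x‖ ≤ τ := by
  unfold clipGrad
  split_ifs with h
  · exact h
  · simpa using hτ

lemma clipGrad_of_notMem {P : Measure Z} {g : Vec d → Z → Vec d} {τ : ℝ} {U : Fin m → Z}
    {x : Vec d} (h : U ∉ outlier P g τ x) : clipGrad P g τ U x = (userGrad g x U).1 :=
  if_pos (not_lt.1 h)

lemma GlobalLoss.norm_clipGrad_sub_le (H : GlobalLoss X f g L β R) (τ : ℝ) (U : Fin m → Z)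
    (x : Vec d) : ‖clipGrad P g τ U x - (userGrad g x U).1‖ ≤
      2 * L * (outlier P g τ x).indicator (fun _ => 1) U := by
  by_cases h : U ∈ outlier P g τ x
  · rw [Set.indicator_of_mem h, clipGrad, if_neg (not_le.2 h)]
    have := norm_sub_le (popGrad P g x) (userGrad g x U).1
    linarith [H.norm_popGrad_le P x, H.norm_userGrad_le x U]
  · rw [Set.indicator_of_notMem h, clipGrad_of_notMem h]
    simp

/-- A user's average gradient concentrates around the population gradient. -/
lemma GlobalLoss.measure_outlier_le (H : GlobalLoss X f g L β R) (hm : 1 ≤ m) {τ a : ℝ}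
    (hτ : τ = 2 * L * a / √m) (x : Vec d) :
    (Measure.pi fun _ : Fin m => P).real (outlier P g τ x) ≤ 2 * Real.exp (1 - a) := by
  have hL := H.L_pos
  have hm0 : (0 : ℝ) < m := by exact_mod_cast hm
  have hgi : Integrable (g x) P := integrable_of_norm_le P (H.measurable_g x) (H.norm_g_le x)
  have key := measure_norm_sum_gt_le P (X := fun z => g x z - popGrad P g x) (b := 2 * L)
    ((H.measurable_g x).sub_const _) (by positivity) (fun z => by
      have := norm_sub_le (g x z) (popGrad P g x)
      linarith [H.norm_popGrad_le P x, H.norm_g_le x z])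
    (by rw [integral_sub hgi (integrable_const _)]; simp [popGrad]) hm a
  refine le_trans (le_of_eq ?_) key
  congr 1
  ext U
  change τ < _ ↔ 2 * L * √m * a < ‖∑ r, (g x (U r) - popGrad P g x)‖
  have e : ∑ r, (g x (U r) - popGrad P g x) =
      (m : ℝ) • ((userGrad g x U).1 - popGrad P g x) := by
    rw [Finset.sum_sub_distrib, Finset.sum_const, Finset.card_univ, Fintype.card_fin, userGrad,
      smul_sub, smul_smul, mul_one_div_cancel hm0.ne', one_smul, ← Nat.cast_smul_eq_nsmul ℝ]
  rw [e, norm_smul, Real.norm_of_nonneg hm0.le, hτ]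
  have hs : √m * √m = (m : ℝ) := Real.mul_self_sqrt hm0.le
  have hs0 : 0 < √(m : ℝ) := Real.sqrt_pos.2 hm0
  rw [div_lt_iff₀ hs0, ← mul_lt_mul_iff_right₀ hs0]
  generalize ‖(userGrad g x U).1 - popGrad P g x‖ = y
  have e1 : √(m : ℝ) * (2 * L * a) = 2 * L * √m * a := by ring
  have e2 : √(m : ℝ) * (y * √m) = m * y := by
    rw [mul_comm y, ← mul_assoc, hs]
  rw [e1, e2]

/-! #### Measurability in the data and the starting point -/

/-- The phase started at `x`. -/
def PhaseInput.startAt (I : PhaseInput d) (x : Vec d) : PhaseInput d := { I with x₀ := x }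

lemma measurable_batchRun_param {I : PhaseInput d} (hI : I.Valid) {α : Type*} [MeasurableSpace α]
    {x : α → Vec d} (hx : Measurable x) {a : α → Fin N → Vec d → Vec d}
    (ha : ∀ j, Measurable fun p : α × Vec d => a p.1 j p.2) (t : ℕ) :
    Measurable fun p : α × (Fin t → StepRand K N d) =>
      batchRun (I.startAt (x p.1)) (a p.1) t p.2 := by
  unfold batchRun
  refine measurable_chain (f := fun q (i : Fin t) s r => batchStep (I.startAt (x q)) (a q) i s r)
    (s := fun q => (x q, x q)) (fun i => ?_) (by fun_prop)
  have hm : Measurable fun p : α × (Vec d × Vec d) × StepRand K N d => acsaMid I i p.2.1 :=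
    (measurable_acsaMid I i).comp (by fun_prop)
  have ha' : Measurable fun p : Fin N × α × Vec d => a p.2.1 p.1 p.2.2 :=
    measurable_from_prod_countable_right ha
  have hg : Measurable fun p : α × (Vec d × Vec d) × StepRand K N d =>
      batchGrad (fun j => a p.1 j (acsaMid I i p.2.1)) (p.2.2.1, p.2.2.2.2.2) := by
    unfold batchGrad
    refine Measurable.add (Measurable.fun_const_smul (Finset.measurable_sum _ fun k _ => ?_) _)
      (by fun_prop)
    have := ha'.comp (f := fun p : α × (Vec d × Vec d) × StepRand K N d =>
      (p.2.2.1 k, p.1, acsaMid I i p.2.1)) (by fun_prop)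
    exact this
  have := (measurable_acsaStep hI.compact hI.convex ⟨_, hI.mem⟩ i).comp
    (f := fun p : α × (Vec d × Vec d) × StepRand K N d => (x p.1, p.2.1,
      batchGrad (fun j => a p.1 j (acsaMid I i p.2.1)) (p.2.2.1, p.2.2.2.2.2))) (by fun_prop)
  exact this

lemma GlobalLoss.measurable_clipRun (H : GlobalLoss X f g L β R) {I : PhaseInput d} (hI : I.Valid)
    (τ : ℝ) (t : ℕ) :
    Measurable fun p : (Vec d × (Fin N → Fin m → Z)) × (Fin t → StepRand K N d) =>
      batchRun (I.startAt p.1.1) (fun j => clipGrad P g τ (p.1.2 j)) t p.2 :=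
  measurable_batchRun_param hI (x := fun q : Vec d × (Fin N → Fin m → Z) => q.1) measurable_fst
    (a := fun q j => clipGrad P g τ (q.2 j))
    (fun j => by
      have := (H.measurable_clipGrad P τ).comp
        (f := fun p : (Vec d × (Fin N → Fin m → Z)) × Vec d => (p.1.2 j, p.2)) (by fun_prop)
      exact this) t

lemma GlobalLoss.measurable_clipRun' (H : GlobalLoss X f g L β R) {I : PhaseInput d} (hI : I.Valid)
    (τ : ℝ) (t : ℕ) :
    Measurable fun p : (Fin N → Fin m → Z) × (Fin t → StepRand K N d) =>
      batchRun I (fun j => clipGrad P g τ (p.1 j)) t p.2 := by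
  have := (H.measurable_clipRun (N := N) (m := m) (K := K) P hI τ t).comp
    (f := fun p : (Fin N → Fin m → Z) × (Fin t → StepRand K N d) => ((I.x₀, p.1), p.2))
    (by fun_prop)
  exact this

lemma GlobalLoss.measurableSet_outlier (H : GlobalLoss X f g L β R) (τ : ℝ) :
    MeasurableSet {p : (Fin m → Z) × Vec d | p.1 ∈ outlier P g τ p.2} :=
  measurableSet_lt measurable_const (H.measurable_dev P)

/-- The indicator that a user is an outlier at the point visited by iteration `t`. -/
def outlierAt (P : Measure Z) (g : Vec d → Z → Vec d) (I : PhaseInput d) (τ : ℝ) (t : ℕ)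
    (U : Fin m → Z) (s : Vec d × Vec d) : ℝ :=
  (outlier P g τ (acsaMid I t s)).indicator (fun _ => 1) U

lemma outlierAt_nonneg (P : Measure Z) (g : Vec d → Z → Vec d) (I : PhaseInput d) (τ : ℝ) (t : ℕ)
    (U : Fin m → Z) (s : Vec d × Vec d) : 0 ≤ outlierAt P g I τ t U s :=
  Set.indicator_nonneg (fun _ _ => zero_le_one) _

lemma outlierAt_le_one (P : Measure Z) (g : Vec d → Z → Vec d) (I : PhaseInput d) (τ : ℝ) (t : ℕ)
    (U : Fin m → Z) (s : Vec d × Vec d) : outlierAt P g I τ t U s ≤ 1 :=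
  Set.indicator_le_self' (fun _ _ => zero_le_one) _

lemma outlierAt_sq (P : Measure Z) (g : Vec d → Z → Vec d) (I : PhaseInput d) (τ : ℝ) (t : ℕ)
    (U : Fin m → Z) (s : Vec d × Vec d) : outlierAt P g I τ t U s ^ 2 = outlierAt P g I τ t U s
        := by
  unfold outlierAt
  by_cases h : U ∈ outlier P g τ (acsaMid I t s) <;> simp [h]

lemma GlobalLoss.measurable_outlierAt (H : GlobalLoss X f g L β R) (I : PhaseInput d) (τ : ℝ)
    (t : ℕ) : Measurable fun p : (Fin m → Z) × (Vec d × Vec d) => outlierAt P g I τ t p.1 p.2 := by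
  have hm := measurable_acsaMid I t
  have h1 : Measurable fun p : (Fin m → Z) × Vec d =>
      (outlier P g τ p.2).indicator (fun _ => (1 : ℝ)) p.1 := by
    have : Measurable ({p : (Fin m → Z) × Vec d | p.1 ∈ outlier P g τ p.2}.indicator
        fun _ => (1 : ℝ)) := measurable_const.indicator (H.measurableSet_outlier P τ)
    exact this
  have := h1.comp (f := fun p : (Fin m → Z) × (Vec d × Vec d) => (p.1, acsaMid I t p.2))
    (by fun_prop)
  exact this

/-- A user that plays no role in a run is rarely an outlier at the point visited. -/
lemma GlobalLoss.integral_outlierAt_indep_le (H : GlobalLoss X f g L β R) (hm : 1 ≤ m) {τ a : ℝ}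
    (hτ : τ = 2 * L * a / √m) (I : PhaseInput d) (t : ℕ) {Ω : Type*} [MeasurableSpace Ω]
    (ν : Measure Ω) [IsProbabilityMeasure ν] {n : ℕ} (j : Fin (n + 1))
    {s : (Fin n → Fin m → Z) × Ω → Vec d × Vec d} (hs : Measurable s) :
    ∫ D : Fin (n + 1) → Fin m → Z, (∫ ω, outlierAt P g I τ t (D j)
        (s (fun l => D (j.succAbove l), ω)) ∂ν)
        ∂(Measure.pi fun _ => Measure.pi fun _ => P) ≤ 2 * Real.exp (1 - a) := by
  have hp := measurePreserving_piFinSuccAbove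
    (fun _ : Fin (n + 1) => Measure.pi fun _ : Fin m => P) j
  have hO := H.measurable_outlierAt (m := m) P I τ t
  have hF : Measurable fun p : ((Fin m → Z) × (Fin n → Fin m → Z)) × Ω =>
      outlierAt P g I τ t p.1.1 (s (p.1.2, p.2)) := by
    have := hO.comp (f := fun p : ((Fin m → Z) × (Fin n → Fin m → Z)) × Ω =>
      (p.1.1, s (p.1.2, p.2))) (by fun_prop)
    exact this
  have hG := (hF.stronglyMeasurable.integral_prod_right' (ν := ν)).measurable
  have e1 := hp.integral_comp' (g := fun p : (Fin m → Z) × (Fin n → Fin m → Z) =>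
    ∫ ω, outlierAt P g I τ t p.1 (s (p.2, ω)) ∂ν)
  refine (le_of_eq e1).trans ?_
  have hbd : ∀ p : (Fin m → Z) × (Fin n → Fin m → Z),
      0 ≤ ∫ ω, outlierAt P g I τ t p.1 (s (p.2, ω)) ∂ν ∧
      ∫ ω, outlierAt P g I τ t p.1 (s (p.2, ω)) ∂ν ≤ 1 := fun p => by
    have hm1 := hF.comp (f := fun ω : Ω => (p, ω)) (by fun_prop)
    exact (integral_mem_unit hm1 (fun _ => outlierAt_nonneg _ _ _ _ _ _ _)
      (fun _ => outlierAt_le_one _ _ _ _ _ _ _)).2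
  -- The held-out user is integrated first: given the other users and the randomness, the visited
  -- point is fixed and concentration at a fixed point applies.
  rw [integral_prod_symm _ (integral_mem_unit hG (fun p => (hbd p).1) (fun p => (hbd p).2)).1]
  have hin : ∀ D' : Fin n → Fin m → Z, ∫ U, (∫ ω, outlierAt P g I τ t U (s (D', ω)) ∂ν)
      ∂(Measure.pi fun _ : Fin m => P) ≤ 2 * Real.exp (1 - a) := fun D' => by
    have hm2 : Measurable fun p : (Fin m → Z) × Ω => outlierAt P g I τ t p.1 (s (D', p.2)) := by
      have := hF.comp (f := fun p : (Fin m → Z) × Ω => ((p.1, D'), p.2)) (by fun_prop)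
      exact this
    rw [integral_integral_swap (integral_mem_unit hm2 (fun _ => outlierAt_nonneg _ _ _ _ _ _ _)
      (fun _ => outlierAt_le_one _ _ _ _ _ _ _)).1]
    have hω : ∀ ω, ∫ U, outlierAt P g I τ t U (s (D', ω)) ∂(Measure.pi fun _ : Fin m => P) ≤
        2 * Real.exp (1 - a) := fun ω => by
      have hmo : MeasurableSet (outlier (m := m) P g τ (acsaMid I t (s (D', ω)))) :=
        (H.measurableSet_outlier P τ).preimage
          (f := fun U => (U, acsaMid I t (s (D', ω)))) (by fun_prop)
      have e := integral_indicator_one (μ := Measure.pi fun _ : Fin m => P) hmo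
      exact (le_of_eq e).trans (H.measure_outlier_le P hm hτ _)
    have hm3 := (hm2.comp measurable_swap).stronglyMeasurable.integral_prod_right'
      (ν := Measure.pi fun _ : Fin m => P)
    have hm4 : Measurable fun ω => ∫ U, outlierAt P g I τ t U (s (D', ω))
      ∂(Measure.pi fun _ : Fin m => P) := hm3.measurable
    refine (integral_mono (integral_mem_unit hm4
      (fun ω => integral_nonneg fun _ => outlierAt_nonneg _ _ _ _ _ _ _) (fun ω => ?_)).1
      (integrable_const (2 * Real.exp (1 - a))) hω).trans_eq (by simp)
    have hm5 := hm2.comp (f := fun U : Fin m → Z => (U, ω)) (by fun_prop)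
    exact (integral_mem_unit hm5 (fun _ => outlierAt_nonneg _ _ _ _ _ _ _)
      (fun _ => outlierAt_le_one _ _ _ _ _ _ _)).2.2
  have hm6 := (hG.comp measurable_swap).stronglyMeasurable.integral_prod_right'
    (ν := Measure.pi fun _ : Fin m => P)
  have hm7 : Measurable fun D' : Fin n → Fin m → Z => ∫ U, (∫ ω, outlierAt P g I τ t U
    (s (D', ω)) ∂ν) ∂(Measure.pi fun _ : Fin m => P) := hm6.measurable
  refine (integral_mono (integral_mem_unit hm7
      (fun D' => integral_nonneg fun U => (hbd (U, D')).1) (fun D' => ?_)).1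
      (integrable_const (2 * Real.exp (1 - a))) hin).trans_eq (by simp)
  have hm8 := hG.comp (f := fun U : Fin m → Z => (U, D')) (by fun_prop)
  exact (integral_mem_unit hm8 (fun _ => (hbd (_, D')).1) (fun _ => (hbd (_, D')).2)).2.2

end Clip

/-! ### Outliers along a run on clipped gradients -/

section ClipRun

variable {d m N K : ℕ} {Z : Type*} [MeasurableSpace Z] {X : Set (Vec d)} {f : Vec d → Z → ℝ}
  {g : Vec d → Z → Vec d} {L β R : ℝ} (P : Measure Z) [IsProbabilityMeasure P]

/-- Along a run on clipped gradients, users are rarely outliers. -/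
lemma GlobalLoss.integral_outlierAt_le (H : GlobalLoss X f g L β R) (hm : 1 ≤ m) {τ a : ℝ}
    (hτ : τ = 2 * L * a / √m) (ha : 0 ≤ a) {I : PhaseInput d} (hI : I.Valid) {n : ℕ} (hn : 0 < n)
    {ε σ h : ℝ} (hε : 0 < ε) (hσ : 0 < σ)
    (hρ : 2 * τ / K / σ * (2 * ((K : ℝ) / (n + 1 : ℕ)) + h) ≤ 1) (t : ℕ) (j : Fin (n + 1)) :
    ∫ D : Fin (n + 1) → Fin m → Z, (∫ ω, outlierAt P g I τ t (D j)
        (batchRun I (fun l => clipGrad P g τ (D l)) t ω)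
          ∂(Measure.pi fun _ : Fin t => stepLaw K (n + 1) d ε σ))
        ∂(Measure.pi fun _ => Measure.pi fun _ => P) ≤
      √((1 + 2 * (2 * τ / K / σ * ((K : ℝ) / (n + 1 : ℕ))) ^ 2) ^ t * (2 * Real.exp (1 - a)))
        + t * Real.exp (-h) := by
  have p1 := isProbabilityMeasure_stepLaw (K := K) (d := d) (σ := σ) hn hε
  have p2 := isProbabilityMeasure_stepLaw (K := K) (d := d) (σ := σ) n.succ_pos hε
  have hL := H.L_pos
  have hτ0 : 0 ≤ τ := by rw [hτ]; positivity
  set Ac := 1 + 2 * (2 * τ / K / σ * ((K : ℝ) / (n + 1 : ℕ))) ^ 2 with hAc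
  have hAc0 : 0 ≤ Ac := by positivity
  have hO := H.measurable_outlierAt (m := m) P I τ t
  have hOj : ∀ U : Fin m → Z, Measurable (outlierAt P g I τ t U) := fun U => by
    have := hO.comp (f := fun s => (U, s)) (by fun_prop)
    exact this
  have hclip : ∀ U : Fin m → Z, Measurable (clipGrad P g τ U) := fun U => by
    have := (H.measurable_clipGrad P τ).comp (f := fun x => (U, x)) (by fun_prop)
    exact this
  have hrun := H.measurable_clipRun' (N := n + 1) (m := m) (K := K) P hI τ t
  have hrun' := H.measurable_clipRun' (N := n) (m := m) (K := K) P hI τ t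
  let S : (Fin (n + 1) → Fin m → Z) → ℝ := fun D => ∫ ω, outlierAt P g I τ t (D j)
    (batchRun I (fun l => clipGrad P g τ (D l)) t ω)
      ∂(Measure.pi fun _ : Fin t => stepLaw K (n + 1) d ε σ)
  let Q : (Fin (n + 1) → Fin m → Z) → ℝ := fun D => ∫ ω, outlierAt P g I τ t (D j)
    (batchRun I (fun l => clipGrad P g τ (D (j.succAbove l))) t ω)
      ∂(Measure.pi fun _ : Fin t => stepLaw K n d ε σ)
  have hSm : Measurable S := by
    have h1 : Measurable fun p : (Fin (n + 1) → Fin m → Z) × (Fin t → StepRand K (n + 1) d) =>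
        outlierAt P g I τ t (p.1 j) (batchRun I (fun l => clipGrad P g τ (p.1 l)) t p.2) := by
      have := hO.comp (f := fun p : (Fin (n + 1) → Fin m → Z) × (Fin t → StepRand K (n + 1) d) =>
        (p.1 j, batchRun I (fun l => clipGrad P g τ (p.1 l)) t p.2)) (by fun_prop)
      exact this
    exact (h1.stronglyMeasurable.integral_prod_right'
      (ν := Measure.pi fun _ : Fin t => stepLaw K (n + 1) d ε σ)).measurable
  have hQm : Measurable Q := by
    have h2 : Measurable fun p : (Fin (n + 1) → Fin m → Z) × (Fin t → StepRand K n d) =>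
        batchRun I (fun l => clipGrad P g τ (p.1 (j.succAbove l))) t p.2 := by
      have := hrun'.comp (f := fun p : (Fin (n + 1) → Fin m → Z) × (Fin t → StepRand K n d) =>
        (fun l => p.1 (j.succAbove l), p.2)) (by fun_prop)
      exact this
    have h1 : Measurable fun p : (Fin (n + 1) → Fin m → Z) × (Fin t → StepRand K n d) =>
        outlierAt P g I τ t (p.1 j)
          (batchRun I (fun l => clipGrad P g τ (p.1 (j.succAbove l))) t p.2) := by
      have := hO.comp (f := fun p : (Fin (n + 1) → Fin m → Z) × (Fin t → StepRand K n d) =>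
        (p.1 j, batchRun I (fun l => clipGrad P g τ (p.1 (j.succAbove l))) t p.2)) (by fun_prop)
      exact this
    exact (h1.stronglyMeasurable.integral_prod_right'
      (ν := Measure.pi fun _ : Fin t => stepLaw K n d ε σ)).measurable
  have hS1 : ∀ D, 0 ≤ S D ∧ S D ≤ 1 := fun D => by
    have hm1 := (hOj (D j)).comp (measurable_batchRun (K := K) hI (fun l => hclip (D l)) t)
    exact (integral_mem_unit hm1 (fun _ => outlierAt_nonneg _ _ _ _ _ _ _)
      (fun _ => outlierAt_le_one _ _ _ _ _ _ _)).2
  have hQ1 : ∀ D, 0 ≤ Q D ∧ Q D ≤ 1 := fun D => by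
    have hm1 := (hOj (D j)).comp
      (measurable_batchRun (K := K) hI (fun l : Fin n => hclip (D (j.succAbove l))) t)
    exact (integral_mem_unit hm1 (fun _ => outlierAt_nonneg _ _ _ _ _ _ _)
      (fun _ => outlierAt_le_one _ _ _ _ _ _ _)).2
  -- For fixed data the run is compared with the one that never samples user `j`. The test function
  -- is an indicator, hence equal to its square, so the bound is linear in `Q D` under the root; in
  -- `Q` the data of user `j` are independent of the visited point.
  have hpt : ∀ D, S D ≤ √(Ac ^ t * Q D) + t * Real.exp (-h) := fun D => by
    have := integral_batchRun_le (K := K) hI hn hε hσ (a := fun l => clipGrad P g τ (D l))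
      (fun l => hclip (D l)) (c := popGrad P g) (fun l x => clipGrad_close hτ0 _ x) j hρ t
      (hOj (D j)) (fun _ => outlierAt_nonneg _ _ _ _ _ _ _)
      (fun _ => outlierAt_le_one _ _ _ _ _ _ _)
    simp_rw [outlierAt_sq] at this
    exact this
  have hQi := (integral_mem_unit (μ := Measure.pi fun _ : Fin (n + 1) =>
    Measure.pi fun _ : Fin m => P) hQm (fun D => (hQ1 D).1) (fun D => (hQ1 D).2)).1
  have hsi : Integrable (fun D => √(Ac ^ t * Q D)) (Measure.pi fun _ : Fin (n + 1) =>
      Measure.pi fun _ : Fin m => P) := by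
    refine Integrable.of_bound (C := √(Ac ^ t)) (hQm.const_mul _).sqrt.aestronglyMeasurable
      (Filter.Eventually.of_forall fun D => ?_)
    rw [Real.norm_of_nonneg (Real.sqrt_nonneg _)]
    exact Real.sqrt_le_sqrt (mul_le_of_le_one_right (pow_nonneg hAc0 t) (hQ1 D).2)
  refine (integral_mono (integral_mem_unit hSm (fun D => (hS1 D).1) (fun D => (hS1 D).2)).1
    (hsi.add (integrable_const _)) hpt).trans ?_
  rw [integral_add' hsi (integrable_const _)]
  simp only [integral_const, probReal_univ, smul_eq_mul, one_mul]
  refine add_le_add_left ((integral_sqrt_le (fun D => mul_nonneg (pow_nonneg hAc0 t) (hQ1 D).1)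
    (hQm.const_mul _) (hQi.const_mul _)).trans (Real.sqrt_le_sqrt ?_)) _
  rw [integral_const_mul]
  refine mul_le_mul_of_nonneg_left ?_ (pow_nonneg hAc0 t)
  have := H.integral_outlierAt_indep_le P hm hτ I t
    (Measure.pi fun _ : Fin t => stepLaw K n d ε σ) j
    (s := fun p : (Fin n → Fin m → Z) × (Fin t → StepRand K n d) =>
      batchRun I (fun l => clipGrad P g τ (p.1 l)) t p.2) hrun'
  exact this

end ClipRun

/-! ### Regularized empirical risk minimization -/

/-- A minimizer over a compact set depends measurably on parameters if the objective grows
quadratically away from it. -/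
lemma measurable_of_growth {d : ℕ} {α : Type*} [MeasurableSpace α] {X : Set (Vec d)}
    {Ψ : α → Vec d → ℝ} (hm : ∀ y, Measurable fun p => Ψ p y) (hcont : ∀ p, Continuous (Ψ p))
    {xh : α → Vec d} (hxh : ∀ p, xh p ∈ X) {b : ℝ} (hb : 0 < b)
    (hgr : ∀ p, ∀ y ∈ X, b * ‖y - xh p‖ ^ 2 ≤ Ψ p y - Ψ p (xh p)) : Measurable xh := by
  refine measurable_of_isClosed fun C hC => ?_
  obtain ⟨V, hVX, hVc, hV⟩ : ∃ V ⊆ X, V.Countable ∧ X ⊆ closure V := by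
    obtain ⟨V, h1, h2, h3⟩ := TopologicalSpace.IsSeparable.exists_countable_dense_subset
      (TopologicalSpace.IsSeparable.of_separableSpace X)
    exact ⟨V, h1, h2, h3⟩
  obtain ⟨W, hWX, hWc, hW⟩ : ∃ W ⊆ C ∩ X, W.Countable ∧ C ∩ X ⊆ closure W := by
    obtain ⟨V, h1, h2, h3⟩ := TopologicalSpace.IsSeparable.exists_countable_dense_subset
      (TopologicalSpace.IsSeparable.of_separableSpace (C ∩ X))
    exact ⟨V, h1, h2, h3⟩
  -- The minimizer lies in C iff C ∩ X contains almost minimizers of every precision, since growth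
  -- forces these to converge to it. Competitors and candidates are restricted to countable dense
  -- sets, so countably many measurable conditions remain.
  have key : xh ⁻¹' C = ⋂ k : ℕ, ⋃ y ∈ W, ⋂ w ∈ V, {p | Ψ p y ≤ Ψ p w + 1 / ((k : ℝ) + 1)} := by
    ext p
    simp only [Set.mem_preimage, Set.mem_iInter, Set.mem_iUnion, exists_prop]
    constructor
    · intro hp k
      have h1 : xh p ∈ closure W := hW ⟨hp, hxh p⟩
      have h2 : {y | Ψ p y < Ψ p (xh p) + 1 / ((k : ℝ) + 1)} ∈ nhds (xh p) :=
        (isOpen_lt (hcont p) continuous_const).mem_nhds (by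
          change Ψ p (xh p) < Ψ p (xh p) + _
          have : (0 : ℝ) < 1 / ((k : ℝ) + 1) := by positivity
          linarith)
      obtain ⟨y, hy1, hy2⟩ := mem_closure_iff_nhds.1 h1 _ h2
      refine ⟨y, hy2, fun w hw => ?_⟩
      have h3 := hgr p w (hVX hw)
      have h4 : 0 ≤ b * ‖w - xh p‖ ^ 2 := by positivity
      have h5 : Ψ p y < Ψ p (xh p) + 1 / ((k : ℝ) + 1) := hy1
      change Ψ p y ≤ Ψ p w + _
      linarith
    · intro hp
      choose y hy1 hy2 using hp
      have h1 : ∀ k, Ψ p (y k) ≤ Ψ p (xh p) + 1 / ((k : ℝ) + 1) := fun k => by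
        have hcl : IsClosed {w | Ψ p (y k) ≤ Ψ p w + 1 / ((k : ℝ) + 1)} :=
          isClosed_le continuous_const ((hcont p).add continuous_const)
        exact closure_minimal (fun w hw => hy2 k w hw) hcl (hV (hxh p))
      have h2 : Filter.Tendsto (fun k => b * ‖y k - xh p‖ ^ 2) Filter.atTop (nhds 0) := by
        refine squeeze_zero (fun k => by positivity) (fun k => ?_)
          tendsto_one_div_add_atTop_nhds_zero_nat
        linarith [hgr p (y k) (hWX (hy1 k)).2, h1 k]
      have h3 : Filter.Tendsto y Filter.atTop (nhds (xh p)) := by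
        rw [tendsto_iff_norm_sub_tendsto_zero]
        have h4 := (h2.const_mul (1 / b)).sqrt
        simp only [mul_zero, Real.sqrt_zero] at h4
        refine h4.congr fun k => ?_
        rw [← mul_assoc, one_div_mul_cancel hb.ne', one_mul, Real.sqrt_sq (norm_nonneg _)]
      exact hC.mem_of_tendsto h3 (Filter.Eventually.of_forall fun k => (hWX (hy1 k)).1)
  rw [key]
  refine MeasurableSet.iInter fun k => MeasurableSet.biUnion hWc fun y _ =>
    MeasurableSet.biInter hVc fun w _ => measurableSet_le (hm y) ((hm w).add_const _)

section ERM

variable {d : ℕ} {Z ι : Type*} [Fintype ι]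

/-- The empirical loss of a sample. -/
def empLoss (f : Vec d → Z → ℝ) (S : ι → Z) (x : Vec d) : ℝ :=
  (1 / ((Finset.univ : Finset ι).card : ℝ)) * ∑ i, f x (S i)

/-- The gradient of the empirical loss. -/
def empGrad (g : Vec d → Z → Vec d) (S : ι → Z) (x : Vec d) : Vec d :=
  (1 / ((Finset.univ : Finset ι).card : ℝ)) • ∑ i, g x (S i)

/-- The minimizer of the regularized empirical loss with center `c`. -/
def erm (X : Set (Vec d)) (f : Vec d → Z → ℝ) (lam : ℝ) (S : ι → Z) (c : Vec d) : Vec d :=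
  Classical.epsilon fun y => y ∈ X ∧ ∀ w ∈ X,
    regObj (empLoss f S) lam c y ≤ regObj (empLoss f S) lam c w

variable [MeasurableSpace Z] {X : Set (Vec d)} {f : Vec d → Z → ℝ}
  {g : Vec d → Z → Vec d} {L β R : ℝ}

lemma GlobalLoss.abs_empLoss_sub_le [Nonempty ι] (H : GlobalLoss X f g L β R) (S : ι → Z)
    (x y : Vec d) : |empLoss f S x - empLoss f S y| ≤ L * ‖x - y‖ := by
  have hc : (0 : ℝ) < (Finset.univ : Finset ι).card := by
    exact_mod_cast Finset.card_pos.2 Finset.univ_nonempty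
  rw [empLoss, empLoss, ← mul_sub, ← Finset.sum_sub_distrib, abs_mul,
    abs_of_nonneg (by positivity), one_div_mul_eq_div, div_le_iff₀ hc]
  refine (Finset.abs_sum_le_sum_abs _ _).trans
    ((Finset.sum_le_sum fun i _ => H.lip (S i) x y).trans_eq ?_)
  simp [mul_comm]

lemma GlobalLoss.continuous_empLoss [Nonempty ι] (H : GlobalLoss X f g L β R) (S : ι → Z) :
    Continuous (empLoss f S) :=
  (LipschitzWith.of_dist_le' (K := L) fun x y => by
    rw [Real.dist_eq, dist_eq_norm]; exact H.abs_empLoss_sub_le S x y).continuous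

lemma GlobalLoss.firstOrder_empLoss [Nonempty ι] (H : GlobalLoss X f g L β R) (S : ι → Z) :
    FirstOrder X (empLoss f S) (empGrad g S) β :=
  FirstOrder.convex_comb Finset.univ (h := fun i x => f x (S i)) (g := fun i x => g x (S i))
    (fun i _ => H.first (S i)) Finset.univ_nonempty

lemma GlobalLoss.erm_spec [Nonempty ι] (H : GlobalLoss X f g L β R) (lam : ℝ) (S : ι → Z)
    (c : Vec d) : erm X f lam S c ∈ X ∧ ∀ w ∈ X,
      regObj (empLoss f S) lam c (erm X f lam S c) ≤ regObj (empLoss f S) lam c w := by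
  refine Classical.epsilon_spec (p := fun y => y ∈ X ∧ ∀ w ∈ X,
    regObj (empLoss f S) lam c y ≤ regObj (empLoss f S) lam c w) ?_
  have hc := H.continuous_empLoss S
  obtain ⟨y, hy, h⟩ := H.compact.exists_isMinOn ⟨0, H.zero_mem⟩
    (f := regObj (empLoss f S) lam c) (by unfold regObj; fun_prop)
  exact ⟨y, hy, fun w hw => h hw⟩

lemma GlobalLoss.erm_growth [Nonempty ι] (H : GlobalLoss X f g L β R) (lam : ℝ) (S : ι → Z)
    (c : Vec d) {x : Vec d} (hx : x ∈ X) : lam / 2 * ‖x - erm X f lam S c‖ ^ 2 ≤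
      regObj (empLoss f S) lam c x - regObj (empLoss f S) lam c (erm X f lam S c) :=
  (H.firstOrder_empLoss S).growth H.convex c (H.erm_spec lam S c).1 (H.erm_spec lam S c).2 hx

lemma GlobalLoss.measurable_empLoss (H : GlobalLoss X f g L β R) :
    Measurable fun p : (ι → Z) × Vec d => empLoss f p.1 p.2 := by
  unfold empLoss
  refine Measurable.const_mul (Finset.measurable_sum _ fun i _ => ?_) _
  have := H.meas_f.comp (f := fun p : (ι → Z) × Vec d => (p.2, p.1 i)) (by fun_prop)
  exact this

lemma GlobalLoss.measurable_erm [Nonempty ι] (H : GlobalLoss X f g L β R) {lam : ℝ}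
    (hl : 0 < lam) : Measurable fun p : (ι → Z) × Vec d => erm X f lam p.1 p.2 := by
  refine measurable_of_growth (Ψ := fun p y => regObj (empLoss f p.1) lam p.2 y) (fun y => ?_)
    (fun p => ?_) (fun p => (H.erm_spec lam p.1 p.2).1) (half_pos hl)
    (fun p y hy => H.erm_growth lam p.1 p.2 hy)
  · have h1 := H.measurable_empLoss.comp (f := fun p : (ι → Z) × Vec d => (p.1, y)) (by fun_prop)
    have h2 : Measurable fun p : (ι → Z) × Vec d => empLoss f p.1 y := h1
    unfold regObj
    fun_prop
  · have := H.continuous_empLoss p.1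
    unfold regObj
    fun_prop

/-- Replacing one sample moves the minimizer by at most `2 L / (λ |ι|)`. -/
lemma GlobalLoss.erm_stable [DecidableEq ι] [Nonempty ι] (H : GlobalLoss X f g L β R) {lam : ℝ}
    (hl : 0 < lam) (S : ι → Z) (c : Vec d) (i : ι) (z : Z) :
    ‖erm X f lam (Function.update S i z) c - erm X f lam S c‖ ≤
      2 * L / (lam * (Finset.univ : Finset ι).card) := by
  have hc : (0 : ℝ) < (Finset.univ : Finset ι).card := by
    exact_mod_cast Finset.card_pos.2 Finset.univ_nonempty
  set S' := Function.update S i z with hS'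
  set x := erm X f lam S c
  set x' := erm X f lam S' c
  have h1 := H.erm_growth lam S c (H.erm_spec lam S' c).1
  have h2 := H.erm_growth lam S' c (H.erm_spec lam S c).1
  change lam / 2 * ‖x' - x‖ ^ 2 ≤ _ at h1
  change lam / 2 * ‖x - x'‖ ^ 2 ≤ _ at h2
  have hdiff : ∀ w, empLoss f S' w - empLoss f S w =
      1 / ((Finset.univ : Finset ι).card : ℝ) * (f w z - f w (S i)) := fun w => by
    rw [empLoss, empLoss, ← mul_sub, ← Finset.sum_sub_distrib]
    congr 1
    rw [Finset.sum_eq_single i]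
    · simp [hS']
    · intro k _ hk; simp [hS', hk]
    · simp
  have h3 := hdiff x
  have h4 := hdiff x'
  have h5 := (abs_le.1 (H.lip z x x')).2
  have h6 := (abs_le.1 (H.lip (S i) x' x)).2
  rw [norm_sub_rev x x'] at h2 h5
  simp only [regObj] at h1 h2
  change _ ≤ empLoss f S x' + _ - (empLoss f S x + _) at h1
  change _ ≤ empLoss f S' x + _ - (empLoss f S' x' + _) at h2
  -- Adding the growth inequalities of both minimizers cancels everything except the exchanged
  -- sample; the Lipschitz bound leaves one power of the distance to divide by.
  have h7 : lam * ‖x' - x‖ ^ 2 ≤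
      1 / ((Finset.univ : Finset ι).card : ℝ) * (2 * L * ‖x' - x‖) := by
    have : 1 / ((Finset.univ : Finset ι).card : ℝ) * ((f x z - f x' z) + (f x' (S i) - f x (S i)))
        ≤ 1 / ((Finset.univ : Finset ι).card : ℝ) * (2 * L * ‖x' - x‖) := by
      gcongr
      linarith
    linarith
  by_cases h0 : ‖x' - x‖ = 0
  · rw [h0]
    have := H.L_pos
    positivity
  · have hp : 0 < ‖x' - x‖ := lt_of_le_of_ne (norm_nonneg _) (Ne.symm h0)
    rw [le_div_iff₀ (by positivity)]
    rw [one_div_mul_eq_div, le_div_iff₀ hc] at h7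
    refine le_of_mul_le_mul_right ?_ hp
    nlinarith

/-- Exchanging one coordinate of two independent samples. -/
lemma measurePreserving_swapCoord [DecidableEq ι] (P : Measure Z) [IsProbabilityMeasure P] (i : ι) :
    MeasurePreserving (fun p : (ι → Z) × (ι → Z) =>
        (Function.update p.1 i (p.2 i), Function.update p.2 i (p.1 i)))
      ((Measure.pi fun _ => P).prod (Measure.pi fun _ => P))
      ((Measure.pi fun _ => P).prod (Measure.pi fun _ => P)) := by
  have h1 := measurePreserving_arrowProdEquivProdArrow Z Z ι (fun _ => P) (fun _ => P)
  have h2 : MeasurePreserving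
      (fun (q : ι → Z × Z) k => (if k = i then Prod.swap else id : Z × Z → Z × Z) (q k))
      (Measure.pi fun _ => P.prod P) (Measure.pi fun _ => P.prod P) := by
    refine measurePreserving_pi _ _ fun k => ?_
    split_ifs
    · exact Measure.measurePreserving_swap
    · exact MeasurePreserving.id _
  have h3 := h1.comp (h2.comp h1.symm)
  convert h3 using 1
  ext p k
  · by_cases h : k = i
    · subst h; simp [MeasurableEquiv.arrowProdEquivProdArrow, Equiv.arrowProdEquivProdArrow]
    · simp [MeasurableEquiv.arrowProdEquivProdArrow, Equiv.arrowProdEquivProdArrow, h]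
  · by_cases h : k = i
    · subst h; simp [MeasurableEquiv.arrowProdEquivProdArrow, Equiv.arrowProdEquivProdArrow]
    · simp [MeasurableEquiv.arrowProdEquivProdArrow, Equiv.arrowProdEquivProdArrow, h]

lemma GlobalLoss.integrable_f (H : GlobalLoss X f g L β R) (P : Measure Z) [IsProbabilityMeasure P]
    (x : Vec d) : Integrable (f x) P :=
  integrable_of_norm_le P (H.measurable_f x) (H.bdd x)

lemma GlobalLoss.abs_popLoss_le (H : GlobalLoss X f g L β R) (P : Measure Z)
    [IsProbabilityMeasure P] (x : Vec d) : |popLoss P f x| ≤ L * R := by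
  have := norm_integral_le_of_norm_le_const (μ := P) (f := f x) (C := L * R)
    (Filter.Eventually.of_forall fun z => H.bdd x z)
  simpa [popLoss] using this

lemma GlobalLoss.abs_popLoss_sub_le (H : GlobalLoss X f g L β R) (P : Measure Z)
    [IsProbabilityMeasure P] (x y : Vec d) :
    |popLoss P f x - popLoss P f y| ≤ L * ‖x - y‖ := by
  rw [popLoss, popLoss, ← integral_sub (H.integrable_f P x) (H.integrable_f P y)]
  have := norm_integral_le_of_norm_le_const (μ := P) (f := fun z => f x z - f y z)
    (C := L * ‖x - y‖) (Filter.Eventually.of_forall fun z => H.lip z x y)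
  simpa using this

lemma GlobalLoss.continuous_popLoss (H : GlobalLoss X f g L β R) (P : Measure Z)
    [IsProbabilityMeasure P] : Continuous (popLoss P f) :=
  (LipschitzWith.of_dist_le' (K := L) fun x y => by
    rw [Real.dist_eq, dist_eq_norm]; exact H.abs_popLoss_sub_le P x y).continuous

lemma GlobalLoss.integrable_comp (H : GlobalLoss X f g L β R) {Ω : Type*} [MeasurableSpace Ω]
    (μ : Measure Ω) [IsProbabilityMeasure μ] {x : Ω → Vec d} {z : Ω → Z} (hx : Measurable x)
    (hz : Measurable z) : Integrable (fun ω => f (x ω) (z ω)) μ := by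
  have h1 := H.meas_f.comp (hx.prodMk hz)
  exact Integrable.of_bound h1.aestronglyMeasurable (L * R)
    (Filter.Eventually.of_forall fun ω => H.bdd _ _)

/-- The generalization bound for regularized empirical risk minimization. -/
lemma GlobalLoss.integral_popLoss_erm_le [Nonempty ι] (H : GlobalLoss X f g L β R) {lam : ℝ}
    (hl : 0 < lam) (P : Measure Z) [IsProbabilityMeasure P] (c : Vec d) {y : Vec d} (hy : y ∈ X) :
    ∫ S : ι → Z, popLoss P f (erm X f lam S c) ∂(Measure.pi fun _ => P) ≤
      popLoss P f y + lam / 2 * ‖y - c‖ ^ 2 + 2 * L ^ 2 / (lam * (Finset.univ : Finset ι).card)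
          := by
  classical
  have hc : (0 : ℝ) < (Finset.univ : Finset ι).card := by
    exact_mod_cast Finset.card_pos.2 Finset.univ_nonempty
  set M : ℝ := ((Finset.univ : Finset ι).card : ℝ) with hM
  set ν := Measure.pi fun _ : ι => P with hν
  have hL := H.L_pos
  have herm : Measurable fun S : ι → Z => erm X f lam S c := by
    have := (H.measurable_erm (ι := ι) hl).comp (f := fun S => (S, c)) (by fun_prop)
    exact this
  have hpop : Measurable (popLoss P f) := (H.continuous_popLoss P).measurable
  have hrep : ∀ i : ι, ∫ S, popLoss P f (erm X f lam S c) ∂ν ≤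
      ∫ S, f (erm X f lam S c) (S i) ∂ν + L * (2 * L / (lam * M)) := fun i => by
    have e1 : ∫ S, popLoss P f (erm X f lam S c) ∂ν =
        ∫ p : (ι → Z) × (ι → Z), f (erm X f lam p.1 c) (p.2 i) ∂(ν.prod ν) := by
      rw [integral_prod (fun p : (ι → Z) × (ι → Z) => f (erm X f lam p.1 c) (p.2 i))
        (H.integrable_comp _ (herm.comp measurable_fst)
          ((measurable_pi_apply i).comp measurable_snd))]
      refine integral_congr_ae (Filter.Eventually.of_forall fun S => ?_)
      have := integral_comp_eval (μ := fun _ : ι => P) (i := i)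
        (f := fun z => f (erm X f lam S c) z) (H.measurable_f _).aestronglyMeasurable
      exact this.symm
    have hsw := measurePreserving_swapCoord P i
    have hmeas : Measurable fun p : (ι → Z) × (ι → Z) => f (erm X f lam p.1 c) (p.2 i) := by
      have := H.meas_f.comp ((herm.comp measurable_fst).prodMk
        ((measurable_pi_apply i).comp measurable_snd) : Measurable fun p : (ι → Z) × (ι → Z) =>
          (erm X f lam p.1 c, p.2 i))
      exact this
    -- Ghost sample: testing on a fresh point has the same law as putting the fresh point into the
    -- training sample and testing on the point it replaced. Stability then undoes the replacement.
    have e2 : ∫ p : (ι → Z) × (ι → Z), f (erm X f lam p.1 c) (p.2 i) ∂(ν.prod ν) =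
        ∫ p : (ι → Z) × (ι → Z), f (erm X f lam (Function.update p.1 i (p.2 i)) c) (p.1 i)
          ∂(ν.prod ν) := by
      conv_lhs => rw [hν, ← hsw.map_eq]
      rw [integral_map hsw.measurable.aemeasurable hmeas.aestronglyMeasurable]
      simp only [Function.update_self]
      rfl
    have hupd : Measurable fun p : (ι → Z) × (ι → Z) => Function.update p.1 i (p.2 i) :=
      measurable_fst.comp hsw.measurable
    have e3 : ∫ S, f (erm X f lam S c) (S i) ∂ν =
        ∫ p : (ι → Z) × (ι → Z), f (erm X f lam p.1 c) (p.1 i) ∂(ν.prod ν) := by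
      rw [integral_fun_fst (f := fun S => f (erm X f lam S c) (S i))]; simp
    rw [e1, e2, e3]
    have i1 := H.integrable_comp (ν.prod ν) (herm.comp hupd)
        ((measurable_pi_apply i).comp measurable_fst)
    have i2 := H.integrable_comp (ν.prod ν) (herm.comp measurable_fst)
        ((measurable_pi_apply i).comp measurable_fst)
    refine (integral_mono i1 (i2.add (integrable_const (L * (2 * L / (lam * M)))))
      fun p => ?_).trans_eq ?_
    · have h1 := (abs_le.1 (H.lip (p.1 i) (erm X f lam (Function.update p.1 i (p.2 i)) c)
        (erm X f lam p.1 c))).2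
      have h2 := H.erm_stable hl p.1 c i (p.2 i)
      have h3 := mul_le_mul_of_nonneg_left h2 hL.le
      change f (erm X f lam (Function.update p.1 i (p.2 i)) c) (p.1 i) ≤
        f (erm X f lam p.1 c) (p.1 i) + L * (2 * L / (lam * M))
      linarith
    · rw [integral_add' i2 (integrable_const _)]
      simp [Function.comp]
  have hi : ∀ i : ι, Integrable (fun S => f (erm X f lam S c) (S i)) ν := fun i =>
    H.integrable_comp ν herm (measurable_pi_apply i)
  have hsum : M * ∫ S, popLoss P f (erm X f lam S c) ∂ν ≤
      M * (∫ S, empLoss f S (erm X f lam S c) ∂ν + L * (2 * L / (lam * M))) := by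
    have h1 := Finset.sum_le_sum fun i (_ : i ∈ (Finset.univ : Finset ι)) => hrep i
    rw [Finset.sum_const, nsmul_eq_mul, Finset.sum_add_distrib, Finset.sum_const, nsmul_eq_mul,
      ← integral_finsetSum _ fun i _ => hi i, ← hM] at h1
    refine h1.trans_eq ?_
    simp only [empLoss, ← hM]
    rw [integral_const_mul, mul_add]
    congr 1
    rw [← mul_assoc, mul_one_div_cancel hc.ne', one_mul]
  have hle := le_of_mul_le_mul_left hsum hc
  have hiE : Integrable (fun S => empLoss f S (erm X f lam S c)) ν :=
    (integrable_finsetSum _ fun i _ => hi i).const_mul _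
  have hiy : ∀ i : ι, Integrable (fun S : ι → Z => f y (S i)) ν := fun i =>
    H.integrable_comp ν measurable_const (measurable_pi_apply i)
  have hemp : ∫ S, empLoss f S (erm X f lam S c) ∂ν ≤ popLoss P f y + lam / 2 * ‖y - c‖ ^ 2 := by
    refine (integral_mono hiE (((integrable_finsetSum Finset.univ fun i _ => hiy i).const_mul
        (1 / M)).add
      (integrable_const (lam / 2 * ‖y - c‖ ^ 2))) fun S => ?_).trans_eq ?_
    · have h1 := (H.erm_spec lam S c).2 y hy
      simp only [regObj] at h1
      have h2 : 0 ≤ lam / 2 * ‖erm X f lam S c - c‖ ^ 2 := by positivity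
      change _ ≤ empLoss f S y + lam / 2 * ‖y - c‖ ^ 2
      linarith
    · rw [integral_add' ((integrable_finsetSum Finset.univ fun i _ => hiy i).const_mul (1 / M))
        (integrable_const _), integral_const_mul, integral_finsetSum _ fun i _ => hiy i]
      have : ∀ i : ι, ∫ S : ι → Z, f y (S i) ∂ν = popLoss P f y := fun i =>
        integral_comp_eval (μ := fun _ : ι => P) (i := i) (f := f y)
          (H.measurable_f y).aestronglyMeasurable
      simp only [this, Finset.sum_const, nsmul_eq_mul, integral_const, probReal_univ, smul_eq_mul,
        one_mul]
      rw [← mul_assoc, one_div_mul_cancel hc.ne', one_mul]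
  have e : L * (2 * L / (lam * M)) = 2 * L ^ 2 / (lam * M) := by ring
  linarith

end ERM

/-! ### Convergence of a phase on clipped gradients -/

section PhaseConvergence

variable {d m N K : ℕ} {Z : Type*} [MeasurableSpace Z] {X : Set (Vec d)} {f : Vec d → Z → ℝ}
  {g : Vec d → Z → Vec d} {L β R : ℝ} (P : Measure Z) [IsProbabilityMeasure P]

/-- All samples of a family of users. -/
def samples (D : Fin N → Fin m → Z) (p : Fin N × Fin m) : Z := D p.1 p.2

lemma map_samples : (Measure.pi fun _ : Fin N => Measure.pi fun _ : Fin m => P).map samples =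
    Measure.pi fun _ : Fin N × Fin m => P := by
  have := Measure.infinitePi_map_curry_symm (fun (_ : Fin N) (_ : Fin m) => P)
  simp only [Measure.infinitePi_eq_pi] at this
  exact this

lemma measurable_samples : Measurable (samples : (Fin N → Fin m → Z) → _) := by
  unfold samples; fun_prop

lemma empGrad_samples {Z : Type*} {g : Vec d → Z → Vec d} (hN : 0 < N) (hm : 0 < m)
    (D : Fin N → Fin m → Z) (x : Vec d) :
    empGrad g (samples D) x = meanGrad fun j => (userGrad g x (D j)).1 := by
  simp only [empGrad, meanGrad, userGrad, samples, Finset.card_univ, Fintype.card_prod,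
    Fintype.card_fin, Fintype.sum_prod_type, ← Finset.smul_sum, smul_smul, Nat.cast_mul]
  congr 1
  have : (0 : ℝ) < N := by exact_mod_cast hN
  have : (0 : ℝ) < m := by exact_mod_cast hm
  field_simp

/-- Clipping alters only the gradients of outliers, each by at most 2L, so the bias is 2L times the
fraction of outliers. -/
lemma GlobalLoss.norm_bias_le (H : GlobalLoss X f g L β R) (hN : 0 < N) (hm : 0 < m)
    (D : Fin N → Fin m → Z) (τ : ℝ) (x : Vec d) :
    ‖meanGrad (fun j => clipGrad P g τ (D j) x) - empGrad g (samples D) x‖ ≤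
      1 / (N : ℝ) * ∑ j, 2 * L * (outlier P g τ x).indicator (fun _ => 1) (D j) := by
  rw [empGrad_samples hN hm, meanGrad, meanGrad, ← smul_sub, ← Finset.sum_sub_distrib, norm_smul,
    Real.norm_of_nonneg (by positivity)]
  gcongr
  exact (norm_sum_le _ _).trans (Finset.sum_le_sum fun j _ => H.norm_clipGrad_sub_le P τ _ x)

lemma GlobalLoss.measurable_integral_outlierAt (H : GlobalLoss X f g L β R) {I : PhaseInput d}
    (hI : I.Valid) (hN : 0 < N) {ε : ℝ} (hε : 0 < ε) (σ τ : ℝ) (t : ℕ) (j : Fin N) :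
    Measurable fun D : Fin N → Fin m → Z => ∫ ω, outlierAt P g I τ t (D j)
        (batchRun I (fun l => clipGrad P g τ (D l)) t ω)
          ∂(Measure.pi fun _ : Fin t => stepLaw K N d ε σ) := by
  have := isProbabilityMeasure_stepLaw (K := K) (d := d) (σ := σ) hN hε
  have hrun := H.measurable_clipRun' (N := N) (m := m) (K := K) P hI τ t
  have h1 : Measurable fun p : (Fin N → Fin m → Z) × (Fin t → StepRand K N d) =>
      outlierAt P g I τ t (p.1 j) (batchRun I (fun l => clipGrad P g τ (p.1 l)) t p.2) := by
    have := (H.measurable_outlierAt (m := m) P I τ t).comp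
      (f := fun p : (Fin N → Fin m → Z) × (Fin t → StepRand K N d) =>
        (p.1 j, batchRun I (fun l => clipGrad P g τ (p.1 l)) t p.2)) (by fun_prop)
    exact this
  exact (h1.stronglyMeasurable.integral_prod_right'
    (ν := Measure.pi fun _ : Fin t => stepLaw K N d ε σ)).measurable

lemma GlobalLoss.measurable_clipGrad' (H : GlobalLoss X f g L β R) (τ : ℝ) (U : Fin m → Z) :
    Measurable (clipGrad P g τ U) := by
  have := (H.measurable_clipGrad P τ).comp (f := fun x => (U, x)) (by fun_prop)
  exact this

lemma GlobalLoss.integral_outlierAt_mem (H : GlobalLoss X f g L β R) {I : PhaseInput d}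
    (hI : I.Valid) (hN : 0 < N) {ε : ℝ} (hε : 0 < ε) (σ τ : ℝ) (t : ℕ) (U : Fin m → Z)
    (D : Fin N → Fin m → Z) :
    Integrable (fun ω => outlierAt P g I τ t U (batchRun I (fun l => clipGrad P g τ (D l)) t ω))
        (Measure.pi fun _ : Fin t => stepLaw K N d ε σ) ∧
      0 ≤ ∫ ω, outlierAt P g I τ t U (batchRun I (fun l => clipGrad P g τ (D l)) t ω)
          ∂(Measure.pi fun _ : Fin t => stepLaw K N d ε σ) ∧
      ∫ ω, outlierAt P g I τ t U (batchRun I (fun l => clipGrad P g τ (D l)) t ω)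
          ∂(Measure.pi fun _ : Fin t => stepLaw K N d ε σ) ≤ 1 := by
  have := isProbabilityMeasure_stepLaw (K := K) (d := d) (σ := σ) hN hε
  have hO : Measurable (outlierAt P g I τ t U) := by
    have := (H.measurable_outlierAt (m := m) P I τ t).comp (f := fun s => (U, s)) (by fun_prop)
    exact this
  have hm1 := hO.comp (measurable_batchRun (K := K) hI (fun l => H.measurable_clipGrad' P τ
      (D l)) t)
  exact integral_mem_unit hm1 (fun _ => outlierAt_nonneg _ _ _ _ _ _ _)
    (fun _ => outlierAt_le_one _ _ _ _ _ _ _)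

/-- Expected suboptimality for the regularized empirical loss after a phase on clipped
gradients. -/
lemma GlobalLoss.phase_convergence (H : GlobalLoss X f g L β R) (hm : 0 < m) {I : PhaseInput d}
    (hI : I.Valid) (hX : I.X = X) (hβ : I.β = β) (hN : 0 < N) (hK : 0 < K)
    {ε σ τ pb : ℝ} (hε : 0 < ε) (hτ : 0 ≤ τ) (hN₀ : 0 < I.N₀)
    (hstage : 32 * ((I.β + I.lam) / I.lam) ≤ (I.N₀ : ℝ) ^ 2) (S : ℕ)
    (hpb : ∀ t < S * I.N₀, ∀ j : Fin N,
      ∫ D : Fin N → Fin m → Z, (∫ ω, outlierAt P g I τ t (D j)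
        (batchRun I (fun l => clipGrad P g τ (D l)) t ω)
          ∂(Measure.pi fun _ : Fin t => stepLaw K N d ε σ))
        ∂(Measure.pi fun _ => Measure.pi fun _ => P) ≤ pb) :
    ∫ D : Fin N → Fin m → Z, (∫ ω,
        ‖(batchRun I (fun l => clipGrad P g τ (D l)) (S * I.N₀) ω).1
          - erm X f I.lam (samples D) I.x₀‖ ^ 2
          ∂(Measure.pi fun _ => stepLaw K N d ε σ))
        ∂(Measure.pi fun _ => Measure.pi fun _ => P) ≤
      2 / I.lam * (L * R / 8 ^ S + 2 * (2 * (τ ^ 2 / K + d * σ ^ 2) / (I.lam * I.N₀)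
        + R * ((S * I.N₀ : ℕ) * (2 * L * pb)))) := by
  have p1 := isProbabilityMeasure_stepLaw (K := K) (d := d) (σ := σ) hN hε
  have : Nonempty (Fin N × Fin m) := ⟨⟨0, hN⟩, ⟨0, hm⟩⟩
  have hl := hI.lam_pos
  have hL := H.L_pos
  have hR := H.R_pos
  have hNr : (0 : ℝ) < N := by exact_mod_cast hN
  set T := S * I.N₀ with hT
  let O : ℕ → Fin N → (Fin N → Fin m → Z) → ℝ := fun t j D =>
    ∫ ω, outlierAt P g I τ t (D j) (batchRun I (fun l => clipGrad P g τ (D l)) t ω)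
      ∂(Measure.pi fun _ : Fin t => stepLaw K N d ε σ)
  have hOm : ∀ t j, Measurable (O t j) := fun t j =>
    H.measurable_integral_outlierAt P hI hN hε σ τ t j
  have hO : ∀ t j D, 0 ≤ O t j D ∧ O t j D ≤ 1 := fun t j D =>
    (H.integral_outlierAt_mem P hI hN hε σ τ t (D j) D).2
  have hOi : ∀ t j, Integrable (O t j) (Measure.pi fun _ => Measure.pi fun _ => P) := fun t j =>
    (integral_mem_unit (hOm t j) (fun D => (hO t j D).1) (fun D => (hO t j D).2)).1
  -- The AC-SA analysis is run for each fixed data set and needs one bound for the biases of all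
  -- iterations. Their sum is a crude choice, but easy to integrate over the data; the loss of a
  -- factor T is harmless as outliers are polynomially rare.
  let η : (Fin N → Fin m → Z) → ℝ := fun D =>
    ∑ t ∈ Finset.range T, 1 / (N : ℝ) * ∑ j, 2 * L * O t j D
  have hterm : ∀ t D, 0 ≤ 1 / (N : ℝ) * ∑ j, 2 * L * O t j D := fun t D =>
    mul_nonneg (by positivity) (Finset.sum_nonneg fun j _ =>
      mul_nonneg (by positivity) (hO t j D).1)
  have hη0 : ∀ D, 0 ≤ η D := fun D => Finset.sum_nonneg fun t _ => hterm t D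
  have hηt : ∀ t, Integrable (fun D => 1 / (N : ℝ) * ∑ j, 2 * L * O t j D)
      (Measure.pi fun _ => Measure.pi fun _ => P) := fun t =>
    (integrable_finsetSum Finset.univ fun j _ => (hOi t j).const_mul (2 * L)).const_mul _
  have hηi : Integrable η (Measure.pi fun _ => Measure.pi fun _ => P) :=
    integrable_finsetSum _ fun t _ => hηt t
  have hη : ∫ D, η D ∂(Measure.pi fun _ => Measure.pi fun _ => P) ≤ T * (2 * L * pb) := by
    rw [integral_finsetSum _ fun t _ => hηt t]
    refine (Finset.sum_le_sum (g := fun _ => 2 * L * pb) fun t ht => ?_).trans_eq (by simp)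
    rw [integral_const_mul, integral_finsetSum _ fun j _ => (hOi t j).const_mul (2 * L)]
    simp_rw [integral_const_mul]
    calc _ ≤ 1 / (N : ℝ) * ∑ _j : Fin N, 2 * L * pb := by
          gcongr with j
          exact hpb t (Finset.mem_range.1 ht) j
      _ = _ := by
          rw [Finset.sum_const, Finset.card_univ, Fintype.card_fin, nsmul_eq_mul]
          field_simp
  have hsetup : ∀ D : Fin N → Fin m → Z, BatchSetup I K N T ε σ τ R (η D) (empLoss f (samples D))
      (empGrad g (samples D)) (fun l => clipGrad P g τ (D l)) (popGrad P g) := fun D =>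
    { valid := hI
      N_pos := hN
      K_pos := hK
      ε_pos := hε
      cont := H.continuous_empLoss _
      firstOrder := by rw [hX, hβ]; exact H.firstOrder_empLoss _
      meas_g := by
        have := H.measurable_userGrad (m := m)
        have h1 : ∀ j, Measurable fun x => (userGrad g x (D j)).1 := fun j => by
          have := this.comp (f := fun x => (D j, x)) (by fun_prop)
          exact this
        have h2 : empGrad g (samples D) = fun x => meanGrad fun j => (userGrad g x (D j)).1 :=
          funext fun x => empGrad_samples hN hm D x
        rw [h2]
        unfold meanGrad
        fun_prop
      meas := fun j => H.measurable_clipGrad' P τ (D j)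
      diam := by rw [hX]; exact H.diam
      close := fun j x _ => clipGrad_close hτ _ x
      bdd := by
        refine ⟨1 / (N : ℝ) * ∑ _j : Fin N, 2 * L, fun x _ =>
          (H.norm_bias_le P hN hm D τ x).trans ?_⟩
        refine mul_le_mul_of_nonneg_left (Finset.sum_le_sum fun j _ => ?_) (by positivity)
        have h1 : (outlier P g τ x).indicator (fun _ => (1 : ℝ)) (D j) ≤ 1 :=
          Set.indicator_le_self' (fun _ _ => zero_le_one) _
        exact mul_le_of_le_one_right (show 0 ≤ 2 * L by positivity) h1
      bias := fun t ht => by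
        have h1 : ∀ ω : Fin t → StepRand K N d,
            ‖meanGrad (fun j => clipGrad P g τ (D j)
              (acsaMid I t (batchRun I (fun l => clipGrad P g τ (D l)) t ω)))
              - empGrad g (samples D) (acsaMid I t (batchRun I (fun l => clipGrad P g τ (D l)) t
                  ω))‖
            ≤ 1 / (N : ℝ) * ∑ j, 2 * L * outlierAt P g I τ t (D j)
              (batchRun I (fun l => clipGrad P g τ (D l)) t ω) := fun ω =>
          H.norm_bias_le P hN hm D τ _
        have hi : ∀ j : Fin N, Integrable (fun ω : Fin t → StepRand K N d => 2 * L *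
            outlierAt P g I τ t (D j) (batchRun I (fun l => clipGrad P g τ (D l)) t ω))
            (Measure.pi fun _ => stepLaw K N d ε σ) := fun j =>
          (H.integral_outlierAt_mem P hI hN hε σ τ t (D j) D).1.const_mul _
        refine (integral_mono_of_nonneg (Filter.Eventually.of_forall fun ω => norm_nonneg _)
          ((integrable_finsetSum Finset.univ fun j _ => hi j).const_mul (1 / (N : ℝ)))
          (Filter.Eventually.of_forall h1)).trans ?_
        rw [integral_const_mul, integral_finsetSum _ fun j _ => hi j]
        simp_rw [integral_const_mul]
        exact Finset.single_le_sum (f := fun t => 1 / (N : ℝ) * ∑ j, 2 * L * O t j D)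
          (fun t _ => hterm t D) (Finset.mem_range.2 ht) }
  set C := L * R / 8 ^ S with hC
  set V := 2 * (τ ^ 2 / K + d * σ ^ 2) / (I.lam * I.N₀) with hV
  have hpt : ∀ D : Fin N → Fin m → Z, ∫ ω,
      ‖(batchRun I (fun l => clipGrad P g τ (D l)) T ω).1 - erm X f I.lam (samples D) I.x₀‖ ^ 2
          ∂(Measure.pi fun _ => stepLaw K N d ε σ) ≤ 2 / I.lam * (C + 2 * (V + R * η D)) := by
    intro D
    set xh := erm X f I.lam (samples D) I.x₀ with hxh
    obtain ⟨hx1, hx2⟩ := H.erm_spec I.lam (samples D) I.x₀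
    have hconv := (hsetup D).convergence (y := xh) (by rw [hX]; exact hx1) hR.le (hη0 D) hN₀ hstage
      (by rw [hX]; exact hx2) S le_rfl
    have hgap : regObj (empLoss f (samples D)) I.lam I.x₀ I.x₀
        - regObj (empLoss f (samples D)) I.lam I.x₀ xh ≤ L * R := by
      have h1 := (abs_le.1 (H.abs_empLoss_sub_le (samples D) I.x₀ xh)).2
      have h2 := H.diam I.x₀ (hX ▸ hI.mem) xh hx1
      have h3 := mul_le_mul_of_nonneg_left h2 hL.le
      have h4 : 0 ≤ I.lam / 2 * ‖xh - I.x₀‖ ^ 2 := by positivity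
      simp only [regObj, sub_self, norm_zero]
      linarith
    have hcg : Continuous fun s : Vec d × Vec d => regObj (empLoss f (samples D)) I.lam I.x₀ s.1
        - regObj (empLoss f (samples D)) I.lam I.x₀ xh := by
      have := H.continuous_empLoss (samples D)
      unfold regObj; fun_prop
    obtain ⟨M1, hM1⟩ := exists_bound_on_iterates hI.compact hcg
    have hi1 := integrable_batchRun (K := K) (σ := σ) hI hN hε
      (fun l => H.measurable_clipGrad' P τ (D l)) T hcg.measurable hM1
    have h5 : ∫ ω, ‖(batchRun I (fun l => clipGrad P g τ (D l)) T ω).1 - xh‖ ^ 2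
        ∂(Measure.pi fun _ => stepLaw K N d ε σ) ≤ 2 / I.lam *
        ∫ ω, (regObj (empLoss f (samples D)) I.lam I.x₀
          (batchRun I (fun l => clipGrad P g τ (D l)) T ω).1
          - regObj (empLoss f (samples D)) I.lam I.x₀ xh)
          ∂(Measure.pi fun _ => stepLaw K N d ε σ) := by
      rw [← integral_const_mul]
      refine integral_mono_of_nonneg (Filter.Eventually.of_forall fun ω => sq_nonneg _)
        (hi1.const_mul _) (Filter.Eventually.of_forall fun ω => ?_)
      have h6 := H.erm_growth I.lam (samples D) I.x₀
        (x := (batchRun I (fun l => clipGrad P g τ (D l)) T ω).1)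
        (by rw [← hX]; exact (batchRun_mem hI _ T ω).1)
      have h7 := mul_le_mul_of_nonneg_left h6 (show 0 ≤ 2 / I.lam by positivity)
      refine le_of_eq_of_le ?_ h7
      rw [← hxh]
      field_simp
    refine h5.trans (mul_le_mul_of_nonneg_left (hconv.trans (add_le_add_left ?_ _)) (by positivity))
    exact div_le_div_of_nonneg_right hgap (by positivity)
  have hi2 := hηi.const_mul R
  have hi3 : Integrable (fun D => V + R * η D) (Measure.pi fun _ => Measure.pi fun _ => P) :=
    (integrable_const V).add hi2
  have hi4 : Integrable (fun D => C + 2 * (V + R * η D))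
      (Measure.pi fun _ => Measure.pi fun _ => P) := (integrable_const C).add (hi3.const_mul 2)
  refine (integral_mono_of_nonneg
    (Filter.Eventually.of_forall fun D => integral_nonneg fun ω => sq_nonneg _)
    (hi4.const_mul (2 / I.lam)) (Filter.Eventually.of_forall hpt)).trans ?_
  rw [integral_const_mul, integral_add (integrable_const _) (hi3.const_mul 2),
    integral_const_mul, integral_add (integrable_const _) hi2, integral_const_mul]
  simp only [integral_const, probReal_univ, smul_eq_mul, one_mul]
  gcongr

end PhaseConvergence

/-! ### The phase with outlier removal -/

section RealPhase

variable {d m N K T : ℕ} {Z : Type*} {I : PhaseInput d} {g : Vec d → Z → Vec d}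

/-- The gradients of the sampled users. -/
def sampledGrad (g : Vec d → Z → Vec d) (D : Fin N → Fin m → Z) (x : Vec d) (idx : Fin K → Fin N)
    (k : Fin K) : Vec d :=
  (userGrad g x (D (idx k))).1

/-- The average of the kept gradients. -/
def keptGrad (q : Fin K → Vec d) (τ : ℝ) (u : Fin K → ℝ) : Vec d :=
  (1 / ((inliers q τ u).card : ℝ)) • ∑ k ∈ inliers q τ u, q k

open Classical in
/-- An iteration with outlier removal, on the iterates and the flag recording that the phase was
halted. -/
def removalStep (I : PhaseInput d) (g : Vec d → Z → Vec d) (D : Fin N → Fin m → Z) (ξ : ℝ) (t : ℕ)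
    (s : (Vec d × Vec d) × Bool) (r : StepRand K N d) : (Vec d × Vec d) × Bool :=
  if s.2 = true then s else
    if 4 * K / 5 + ξ ≤ concentration (sampledGrad g D (acsaMid I t s.1) r.1) I.τ + r.2.1 then
      (acsaStep I t s.1 (keptGrad (sampledGrad g D (acsaMid I t s.1) r.1) I.τ r.2.2.1 + r.2.2.2),
        false)
    else (s.1, true)

/-- The output of a phase with outlier removal. -/
def removalRun (I : PhaseInput d) (g : Vec d → Z → Vec d) (D : Fin N → Fin m → Z)
    (ω : PhaseRand T K N d) : Vec d :=
  let s := chain (fun t : Fin T => removalStep I g D ω.1 t) ((I.x₀, I.x₀), false) ω.2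
  if s.2 = true then 0 else s.1.1

open Classical in
lemma sgdStep_of_not_halted (D : Fin N → Fin m → Z) (ξ : ℝ) (t : ℕ) (r : StepRand K N d)
    {st : SgdState d} (h : ¬ st.halted) :
    sgdStep I g D ξ t r st =
      if 4 * K / 5 + ξ ≤ concentration (sampledGrad g D (acsaMid I t (st.xag, st.x)) r.1) I.τ
          + r.2.1 then
        { xag := (acsaStep I t (st.xag, st.x) (keptGrad (sampledGrad g D
            (acsaMid I t (st.xag, st.x)) r.1) I.τ r.2.2.1 + r.2.2.2)).1
          x := (acsaStep I t (st.xag, st.x) (keptGrad (sampledGrad g D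
            (acsaMid I t (st.xag, st.x)) r.1) I.τ r.2.2.1 + r.2.2.2)).2
          halted := False
          evals := st.evals
            + ∑ k, (userGrad g (acsaMid I t (st.xag, st.x)) (D (r.1 k))).2 }
      else { st with
        halted := True
        evals := st.evals
          + ∑ k, (userGrad g (acsaMid I t (st.xag, st.x)) (D (r.1 k))).2 } := by
  unfold sgdStep
  rw [if_neg h]
  rfl

/-- Drops the evaluation counter and turns the halting proposition into a Boolean, giving a state
space on which measurability can be discussed. -/
lemma runPhase_fst (D : Fin N → Fin m → Z) (ω : PhaseRand T K N d) :
    (runPhase I g D ω).1 = removalRun I g D ω := by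
  classical
  have h := chain_rel (S := SgdState d) (S' := (Vec d × Vec d) × Bool)
    (f := fun (t : Fin T) st r => sgdStep I g D ω.1 t r st)
    (f' := fun t : Fin T => removalStep I g D ω.1 t)
    (R := fun st s => st.xag = s.1.1 ∧ st.x = s.1.2 ∧ (st.halted ↔ s.2 = true))
    (s := { xag := I.x₀, x := I.x₀, halted := False, evals := 0 })
    (s' := ((I.x₀, I.x₀), false)) ⟨rfl, rfl, by simp⟩ ω.2 ω.2 (by
      rintro t ⟨xag, x, halted, evals⟩ ⟨⟨y1, y2⟩, b⟩ ⟨h1, h2, h3⟩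
      simp only at h1 h2 h3
      subst h1 h2
      by_cases hb : b = true
      · have : halted := h3.2 hb
        simp [sgdStep, removalStep, this, hb]
      · have hh : ¬ halted := fun hh => hb (h3.1 hh)
        rw [sgdStep_of_not_halted _ _ _ _ hh, removalStep, if_neg hb]
        split_ifs <;> exact ⟨rfl, rfl, by simp⟩)
  have e : (runPhase I g D ω).1 =
      if (chain (fun (t : Fin T) st r => sgdStep I g D ω.1 t r st)
        { xag := I.x₀, x := I.x₀, halted := False, evals := 0 } ω.2).halted then 0 else
      (chain (fun (t : Fin T) st r => sgdStep I g D ω.1 t r st)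
        { xag := I.x₀, x := I.x₀, halted := False, evals := 0 } ω.2).xag := rfl
  rw [e]
  simp only [removalRun]
  generalize chain (fun t : Fin T => removalStep I g D ω.1 t) ((I.x₀, I.x₀), false) ω.2 = s at h ⊢
  generalize chain (fun (t : Fin T) st r => sgdStep I g D ω.1 t r st)
    { xag := I.x₀, x := I.x₀, halted := False, evals := 0 } ω.2 = st at h ⊢
  obtain ⟨h1, h2, h3⟩ := h
  by_cases hb : st.halted
  · rw [if_pos hb, if_pos (h3.1 hb)]
  · rw [if_neg hb, if_neg (fun hh => hb (h3.2 hh)), h1]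

/-- If all sampled users are close to each other, none is removed. -/
lemma removalStep_eq (hK : 0 < K) {D : Fin N → Fin m → Z} {ξ : ℝ} {t : ℕ} {s : Vec d × Vec d}
    {r : StepRand K N d} (c : Vec d)
    (hc : ∀ j, ‖(userGrad g (acsaMid I t s) (D j)).1 - c‖ ≤ I.τ) (hξ : ξ ≤ K / 10)
    (hv : -((K : ℝ) / 10) ≤ r.2.1) (hu : ∀ k, r.2.2.1 k < 1) :
    removalStep I g D ξ t (s, false) r =
      (acsaStep I t s (batchGrad (fun j => (userGrad g (acsaMid I t s) (D j)).1)
        (r.1, r.2.2.2)), false) := by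
  classical
  have hK' : (0 : ℝ) < K := by exact_mod_cast hK
  set q := sampledGrad g D (acsaMid I t s) r.1 with hq
  have hcount : ∀ k, closeCount q I.τ k = K := fun k => by
    have : ∀ k', ‖q k - q k'‖ ≤ 2 * I.τ := fun k' => by
      have h1 := norm_sub_le (q k - c) (q k' - c)
      rw [sub_sub_sub_cancel_right] at h1
      have h2 := hc (r.1 k)
      have h3 := hc (r.1 k')
      change ‖q k - c‖ ≤ _ at h2
      change ‖q k' - c‖ ≤ _ at h3
      linarith
    simp [closeCount, this]
  have hconc : concentration q I.τ = K := by
    simp [concentration, hcount]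
    field_simp
  have hin : inliers q I.τ r.2.2.1 = Finset.univ := by
    ext k
    have h1 : ¬ ((K : ℝ) < K / 2) := by linarith
    have h2 : 2 * (K : ℝ) / 3 ≤ K := by linarith
    simp [inliers, hcount, keepProb, h1, h2, hu k]
  unfold removalStep
  simp only [Bool.false_eq_true, if_false]
  -- Full agreement scores K, the step noise is at least -K/10 and the threshold at most 4K/5 +
  -- K/10, so the test passes.
  rw [if_pos (by rw [hconc]; linarith)]
  have : keptGrad q I.τ r.2.2.1 + r.2.2.2 =
      batchGrad (fun j => (userGrad g (acsaMid I t s) (D j)).1) (r.1, r.2.2.2) := by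
    simp only [keptGrad, hin, Finset.card_univ, Fintype.card_fin, batchGrad]
    rfl
  rw [this]

lemma removalStep_mem (hI : I.Valid) (D : Fin N → Fin m → Z) (ξ : ℝ) (t : ℕ)
    (s : (Vec d × Vec d) × Bool) (r : StepRand K N d) (h : s.1.1 ∈ I.X ∧ s.1.2 ∈ I.X) :
    (removalStep I g D ξ t s r).1.1 ∈ I.X ∧ (removalStep I g D ξ t s r).1.2 ∈ I.X := by
  unfold removalStep
  split_ifs
  · exact h
  · exact acsaStep_mem hI t _ h.1
  · exact h

lemma removalRun_mem (hI : I.Valid) (h0 : (0 : Vec d) ∈ I.X) (D : Fin N → Fin m → Z)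
    (ω : PhaseRand T K N d) : removalRun I g D ω ∈ I.X := by
  have := chain_induction (f := fun t : Fin T => removalStep I g D ω.1 t)
    (p := fun s => s.1.1 ∈ I.X ∧ s.1.2 ∈ I.X)
    (fun t s r h => removalStep_mem hI D ω.1 t s r h) (s := ((I.x₀, I.x₀), false))
    ⟨hI.mem, hI.mem⟩ ω.2
  simp only [removalRun]
  split_ifs
  · exact h0
  · exact this.1

/-- Only the gradients on `X` matter. -/
lemma removalRun_congr (hI : I.Valid) {g' : Vec d → Z → Vec d}
    (hg : ∀ x ∈ I.X, ∀ z, g x z = g' x z) (D : Fin N → Fin m → Z) (ω : PhaseRand T K N d) :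
    removalRun I g D ω = removalRun I g' D ω := by
  have := chain_rel (f := fun t : Fin T => removalStep I g D ω.1 t)
    (f' := fun t : Fin T => removalStep I g' D ω.1 t)
    (R := fun s s' => s = s' ∧ s.1.1 ∈ I.X ∧ s.1.2 ∈ I.X) (s := ((I.x₀, I.x₀), false))
    (s' := ((I.x₀, I.x₀), false)) ⟨rfl, hI.mem, hI.mem⟩ ω.2 ω.2 (by
      rintro t s s' ⟨rfl, h1, h2⟩
      refine ⟨?_, removalStep_mem hI D ω.1 t s _ ⟨h1, h2⟩⟩
      have e : sampledGrad g D (acsaMid I t s.1) (ω.2 t).1 =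
          sampledGrad g' D (acsaMid I t s.1) (ω.2 t).1 := by
        funext k
        simp only [sampledGrad, userGrad, hg _ (acsaMid_mem hI t h1 h2)]
      simp only [removalStep, e])
  simp only [removalRun, this.1]

end RealPhase

/-! ### Measurability of a phase with outlier removal -/

section Measurability

variable {d m N K T : ℕ} {Z : Type*} [MeasurableSpace Z] {X : Set (Vec d)} {f : Vec d → Z → ℝ}
  {g : Vec d → Z → Vec d} {L β R : ℝ}

lemma measurable_closeCount {α : Type*} [MeasurableSpace α] {q : α → Fin K → Vec d}
    (hq : ∀ k, Measurable fun p => q p k) (τ : ℝ) (k : Fin K) :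
    Measurable fun p => closeCount (q p) τ k := by
  unfold closeCount
  refine Finset.measurable_sum _ fun k' _ => Measurable.ite ?_ measurable_const measurable_const
  exact measurableSet_le ((hq k).sub (hq k')).norm measurable_const

lemma measurable_keepProb (K : ℕ) : Measurable (keepProb K) := by
  unfold keepProb
  refine Measurable.ite (measurableSet_lt measurable_id measurable_const) measurable_const
    (Measurable.ite (measurableSet_le measurable_const measurable_id) measurable_const ?_)
  fun_prop

/-- The set of kept users is random; its size and the sum over it are rewritten as sums of
indicators over all sampled users. -/
lemma measurable_keptGrad {α : Type*} [MeasurableSpace α] {q : α → Fin K → Vec d}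
    {u : α → Fin K → ℝ} (hq : ∀ k, Measurable fun p => q p k) (hu : ∀ k, Measurable fun p => u p k)
    (τ : ℝ) : Measurable fun p => keptGrad (q p) τ (u p) := by
  classical
  have hset : ∀ k, MeasurableSet {p | u p k < keepProb K (closeCount (q p) τ k)} := fun k =>
    measurableSet_lt (hu k) ((measurable_keepProb K).comp (measurable_closeCount hq τ k))
  have e : (fun p => keptGrad (q p) τ (u p)) = fun p =>
      (1 / ∑ k, if u p k < keepProb K (closeCount (q p) τ k) then (1 : ℝ) else 0) •
        ∑ k, if u p k < keepProb K (closeCount (q p) τ k) then q p k else 0 := by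
    funext p
    simp only [keptGrad, inliers, Finset.sum_filter, Finset.card_filter, Nat.cast_sum,
      Nat.cast_ite, Nat.cast_one, Nat.cast_zero]
  rw [e]
  have h1 : Measurable fun p => ∑ k, if u p k < keepProb K (closeCount (q p) τ k) then (1 : ℝ)
      else 0 := Finset.measurable_sum _ fun k _ =>
    Measurable.ite (hset k) measurable_const measurable_const
  have h2 : Measurable fun p => ∑ k, if u p k < keepProb K (closeCount (q p) τ k) then q p k
      else 0 := Finset.measurable_sum _ fun k _ => Measurable.ite (hset k) (hq k) measurable_const
  exact (h1.const_div 1).smul h2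

lemma GlobalLoss.measurable_removalRun (H : GlobalLoss X f g L β R) {I : PhaseInput d}
    (hI : I.Valid) :
    Measurable fun p : Vec d × (Fin N → Fin m → Z) × PhaseRand T K N d =>
      removalRun (I.startAt p.1) g p.2.1 p.2.2 := by
  classical
  have hstep : ∀ t : ℕ, Measurable fun p : (Vec d × (Fin N → Fin m → Z) × ℝ) ×
      ((Vec d × Vec d) × Bool) × StepRand K N d =>
      removalStep (I.startAt p.1.1) g p.1.2.1 p.1.2.2 t p.2.1 p.2.2 := fun t => by
    have hmid : Measurable fun p : (Vec d × (Fin N → Fin m → Z) × ℝ) ×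
        ((Vec d × Vec d) × Bool) × StepRand K N d => acsaMid I t p.2.1.1 :=
      (measurable_acsaMid I t).comp (by fun_prop)
    have hu : Measurable fun p : Fin N × (Fin N → Fin m → Z) × Vec d =>
        (userGrad g p.2.2 (p.2.1 p.1)).1 :=
      measurable_from_prod_countable_right fun j => by
        have := (H.measurable_userGrad (m := m)).comp
          (f := fun p : (Fin N → Fin m → Z) × Vec d => (p.1 j, p.2)) (by fun_prop)
        exact this
    have hq : ∀ k, Measurable fun p : (Vec d × (Fin N → Fin m → Z) × ℝ) ×
        ((Vec d × Vec d) × Bool) × StepRand K N d =>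
        sampledGrad g p.1.2.1 (acsaMid I t p.2.1.1) p.2.2.1 k := fun k => by
      have := hu.comp (f := fun p : (Vec d × (Fin N → Fin m → Z) × ℝ) ×
        ((Vec d × Vec d) × Bool) × StepRand K N d => (p.2.2.1 k, p.1.2.1, acsaMid I t p.2.1.1))
        (by fun_prop)
      exact this
    have hkept := measurable_keptGrad hq (u := fun p : (Vec d × (Fin N → Fin m → Z) × ℝ) ×
        ((Vec d × Vec d) × Bool) × StepRand K N d => p.2.2.2.2.1) (fun k => by fun_prop) I.τ
    have hconc : Measurable fun p : (Vec d × (Fin N → Fin m → Z) × ℝ) ×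
        ((Vec d × Vec d) × Bool) × StepRand K N d =>
        concentration (sampledGrad g p.1.2.1 (acsaMid I t p.2.1.1) p.2.2.1) I.τ := by
      unfold concentration
      exact (Finset.measurable_sum _ fun k _ => measurable_closeCount hq I.τ k).const_mul _
    have hnew : Measurable fun p : (Vec d × (Fin N → Fin m → Z) × ℝ) ×
        ((Vec d × Vec d) × Bool) × StepRand K N d => acsaStep (I.startAt p.1.1) t p.2.1.1
          (keptGrad (sampledGrad g p.1.2.1 (acsaMid I t p.2.1.1) p.2.2.1) I.τ p.2.2.2.2.1
            + p.2.2.2.2.2) := by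
      have := (measurable_acsaStep hI.compact hI.convex ⟨_, hI.mem⟩ t).comp
        (f := fun p : (Vec d × (Fin N → Fin m → Z) × ℝ) ×
          ((Vec d × Vec d) × Bool) × StepRand K N d => (p.1.1, p.2.1.1,
          keptGrad (sampledGrad g p.1.2.1 (acsaMid I t p.2.1.1) p.2.2.1) I.τ p.2.2.2.2.1
            + p.2.2.2.2.2)) (by fun_prop)
      exact this
    unfold removalStep
    refine Measurable.ite ?_ (by fun_prop) (Measurable.ite ?_ ?_ ?_)
    · exact (measurableSet_singleton true).preimage
        (f := fun p : (Vec d × (Fin N → Fin m → Z) × ℝ) ×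
          ((Vec d × Vec d) × Bool) × StepRand K N d => p.2.1.2) (by fun_prop)
    · have := measurableSet_le
        (f := fun p : (Vec d × (Fin N → Fin m → Z) × ℝ) ×
          ((Vec d × Vec d) × Bool) × StepRand K N d => 4 * (K : ℝ) / 5 + p.1.2.2)
        (g := fun p : (Vec d × (Fin N → Fin m → Z) × ℝ) ×
          ((Vec d × Vec d) × Bool) × StepRand K N d =>
          concentration (sampledGrad g p.1.2.1 (acsaMid I t p.2.1.1) p.2.2.1) I.τ + p.2.2.2.1)
        (by fun_prop) (by fun_prop)
      exact this
    · exact hnew.prodMk measurable_const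
    · fun_prop
  have hch := measurable_chain (α := Vec d × (Fin N → Fin m → Z) × ℝ)
    (f := fun q (t : Fin T) s r => removalStep (K := K) (I.startAt q.1) g q.2.1 q.2.2 t s r)
    (s := fun q => ((q.1, q.1), false)) (fun t => hstep t) (by fun_prop)
  have hch2 : Measurable fun p : Vec d × (Fin N → Fin m → Z) × PhaseRand T K N d =>
      chain (fun t : Fin T => removalStep (I.startAt p.1) g p.2.1 p.2.2.1 t)
        ((p.1, p.1), false) p.2.2.2 := by
    have := hch.comp (f := fun p : Vec d × (Fin N → Fin m → Z) × PhaseRand T K N d =>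
      ((p.1, p.2.1, p.2.2.1), p.2.2.2)) (by fun_prop)
    exact this
  simp only [removalRun]
  refine Measurable.ite ?_ measurable_const ?_
  · have := (measurableSet_singleton true).preimage hch2.snd
    exact this
  · exact hch2.fst.fst

end Measurability

/-! ### Probability that a phase deviates from the phase on clipped gradients -/

section Failure

variable {d m N K T : ℕ} {Z : Type*} [MeasurableSpace Z] {X : Set (Vec d)} {f : Vec d → Z → ℝ}
  {g : Vec d → Z → Vec d} {L β R : ℝ}

/-- The output of a phase on clipped gradients. -/
def clipRun (P : Measure Z) (I : PhaseInput d) (g : Vec d → Z → Vec d) (D : Fin N → Fin m → Z)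
    (ω : PhaseRand T K N d) : Vec d :=
  (batchRun I (fun l => clipGrad P g I.τ (D l)) T ω.2).1

lemma isProbabilityMeasure_phaseLaw (hN : 0 < N) {ε : ℝ} (hε : 0 < ε) (σ : ℝ) :
    IsProbabilityMeasure (phaseLaw T K N d ε σ) := by
  have := isProbabilityMeasure_stepLaw (K := K) (d := d) (σ := σ) hN hε
  have := isProbabilityMeasure_laplace (b := 8 / ε) (by positivity)
  unfold phaseLaw
  infer_instance

/-- The events of an iteration that make outlier removal act. -/
def removalFail (P : Measure Z) (I : PhaseInput d) (g : Vec d → Z → Vec d) (D : Fin N → Fin m → Z)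
    (t : ℕ) : Set ((Vec d × Vec d) × StepRand K N d) :=
  {p | ∃ j, D j ∈ outlier P g I.τ (acsaMid I t p.1)} ∪
    ({p | p.2.2.1 < -((K : ℝ) / 10)} ∪ {p | ∃ k, 1 ≤ p.2.2.2.1 k})

lemma removalStep_eq_batchStep (P : Measure Z) {I : PhaseInput d} (hK : 0 < K)
    {D : Fin N → Fin m → Z} {ξ : ℝ}
    (hξ : ξ ≤ K / 10) {t : ℕ} {s : Vec d × Vec d} {r : StepRand K N d}
    (h : (s, r) ∉ removalFail P I g D t) :
    removalStep I g D ξ t (s, false) r =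
      (batchStep I (fun l => clipGrad P g I.τ (D l)) t s r, false) := by
  simp only [removalFail, Set.mem_union, not_or] at h
  obtain ⟨h1, h2, h3⟩ := h
  have h1' : ∀ j, D j ∉ outlier P g I.τ (acsaMid I t s) := fun j hj => h1 ⟨j, hj⟩
  have h3' : ∀ k, r.2.2.1 k < 1 := fun k => not_le.1 fun hk => h3 ⟨k, hk⟩
  rw [removalStep_eq hK (popGrad P g (acsaMid I t s)) (fun j => not_lt.1 (h1' j)) hξ (not_lt.1 h2)
    h3', batchStep]
  congr 3
  funext j
  exact (clipGrad_of_notMem (h1' j)).symm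

lemma stepLaw_noise_le (hN : 0 < N) {ε : ℝ} (hε : 0 < ε) (σ : ℝ) :
    stepLaw K N d ε σ {r | r.2.1 < -((K : ℝ) / 10)} ≤
      ENNReal.ofReal (Real.exp (-(K * ε / 160))) := by
  have := isProbabilityMeasure_uniform hN
  have := isProbabilityMeasure_laplace (b := 16 / ε) (by positivity)
  have := isProbabilityMeasure_unitInterval
  have hp : MeasurePreserving (fun r : StepRand K N d => r.2.1) (stepLaw K N d ε σ)
      (laplace (16 / ε)) := measurePreserving_fst.comp measurePreserving_snd
  have e : {r : StepRand K N d | r.2.1 < -((K : ℝ) / 10)} =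
      (fun r : StepRand K N d => r.2.1) ⁻¹' Set.Iio (-((K : ℝ) / 10)) := rfl
  rw [e, hp.measure_preimage measurableSet_Iio.nullMeasurableSet]
  refine (measure_mono Set.Iio_subset_Iic_self).trans ?_
  rw [laplace_Iic (by positivity) (by positivity)]
  refine ENNReal.ofReal_le_ofReal ?_
  have : (K : ℝ) / 10 / (16 / ε) = K * ε / 160 := by
    field_simp; ring
  rw [this]
  linarith [Real.exp_pos (-(K * ε / 160))]

lemma stepLaw_uniform_eq_zero (hN : 0 < N) {ε : ℝ} (hε : 0 < ε) (σ : ℝ) :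
    stepLaw K N d ε σ {r | ∃ k, 1 ≤ r.2.2.1 k} = 0 := by
  have := isProbabilityMeasure_uniform hN
  have := isProbabilityMeasure_laplace (b := 16 / ε) (by positivity)
  have := isProbabilityMeasure_unitInterval
  have hp : ∀ k, MeasurePreserving (fun r : StepRand K N d => r.2.2.1 k) (stepLaw K N d ε σ)
      ((volume : Measure ℝ).restrict (Set.Icc 0 1)) := fun k =>
    (measurePreserving_eval (fun _ : Fin K => (volume : Measure ℝ).restrict (Set.Icc 0 1)) k).comp
      (measurePreserving_fst.comp (measurePreserving_snd.comp measurePreserving_snd))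
  have e : {r : StepRand K N d | ∃ k, 1 ≤ r.2.2.1 k} =
      ⋃ k, (fun r : StepRand K N d => r.2.2.1 k) ⁻¹' Set.Ici 1 := by
    ext r; simp
  rw [e, measure_iUnion_null_iff]
  intro k
  rw [(hp k).measure_preimage measurableSet_Ici.nullMeasurableSet,
    Measure.restrict_apply measurableSet_Ici]
  have : Set.Ici (1 : ℝ) ∩ Set.Icc 0 1 = {1} := by
    ext x; simp only [Set.mem_inter_iff, Set.mem_Ici, Set.mem_Icc, Set.mem_singleton_iff]
    constructor
    · rintro ⟨h1, h2, h3⟩; linarith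
    · rintro rfl; norm_num
  rw [this]; simp

/-- For given data, the phase with outlier removal deviates from the phase on clipped gradients only
if some user is an outlier or some noise variable is large. -/
lemma GlobalLoss.measure_removalRun_ne_le (H : GlobalLoss X f g L β R) (P : Measure Z)
    [IsProbabilityMeasure P] {I : PhaseInput d}
    (hI : I.Valid) (hN : 0 < N) (hK : 0 < K) {ε : ℝ} (hε : 0 < ε) (σ : ℝ)
    (D : Fin N → Fin m → Z) :
    phaseLaw T K N d ε σ {ω | removalRun I g D ω ≠ clipRun P I g D ω} ≤
      ENNReal.ofReal (Real.exp (-(K * ε / 80))) +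
      ∑ t : Fin T, (∑ j, ENNReal.ofReal (∫ ω, outlierAt P g I I.τ t (D j)
          (batchRun I (fun l => clipGrad P g I.τ (D l)) t ω)
            ∂(Measure.pi fun _ : Fin t => stepLaw K N d ε σ))
        + ENNReal.ofReal (Real.exp (-(K * ε / 160)))) := by
  have p1 := isProbabilityMeasure_stepLaw (K := K) (d := d) (σ := σ) hN hε
  have p2 := isProbabilityMeasure_laplace (b := 8 / ε) (by positivity)
  set E : Set (PhaseRand T K N d) := {ω | removalRun I g D ω ≠ clipRun P I g D ω} with hE
  have hEm : MeasurableSet E := by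
    have h1 : Measurable fun ω : PhaseRand T K N d => removalRun I g D ω := by
      have := (H.measurable_removalRun (N := N) (m := m) (K := K) (T := T) hI).comp
        (f := fun ω : PhaseRand T K N d => (I.x₀, D, ω)) (by fun_prop)
      exact this
    have h2 : Measurable fun ω : PhaseRand T K N d => clipRun P I g D ω := by
      have := (measurable_batchRun (K := K) hI
        (fun l => H.measurable_clipGrad' P I.τ (D l)) T).fst.comp
        (f := fun ω : PhaseRand T K N d => ω.2) (by fun_prop)
      exact this
    exact (measurableSet_eq_fun h1 h2).compl
  set c := ∑ t : Fin T, (∑ j, ENNReal.ofReal (∫ ω, outlierAt P g I I.τ t (D j)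
          (batchRun I (fun l => clipGrad P g I.τ (D l)) t ω)
            ∂(Measure.pi fun _ : Fin t => stepLaw K N d ε σ))
        + ENNReal.ofReal (Real.exp (-(K * ε / 160)))) with hc
  have hsec : ∀ ξ : ℝ, ξ ≤ K / 10 →
      (Measure.pi fun _ : Fin T => stepLaw K N d ε σ) (Prod.mk ξ ⁻¹' E) ≤ c := fun ξ hξ => by
    -- The clipped run is the reference chain, so the failure events are evaluated at its iterates.
    -- It never uses the threshold noise, so ξ can be held fixed here.
    have key := measure_chain_not_rel_le (fun _ : Fin T => stepLaw K N d ε σ)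
      (f := fun t : Fin T => batchStep I (fun l => clipGrad P g I.τ (D l)) t)
      (f' := fun t : Fin T => removalStep I g D ξ t)
      (R := fun s s' => s' = (s, false)) (s := (I.x₀, I.x₀)) (s' := ((I.x₀, I.x₀), false)) rfl
      (fun t => removalFail P I g D t) (by
        rintro t s _ r rfl hf
        exact removalStep_eq_batchStep P hK hξ hf)
    refine (measure_mono ?_).trans (key.trans (Finset.sum_le_sum fun t _ => ?_))
    · intro ω hω hrel
      apply hω
      simp only [removalRun, clipRun]
      rw [hrel]
      simp [batchRun]
    · have e : {p : (Fin t → StepRand K N d) × StepRand K N d |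
          (chain (fun j : Fin t => batchStep (K := K) I (fun l => clipGrad P g I.τ (D l))
            (Fin.castLE t.is_lt.le j)) (I.x₀, I.x₀) p.1, p.2) ∈ removalFail P I g D t} ⊆
          ({ω | ∃ j, D j ∈ outlier P g I.τ (acsaMid I t
              (batchRun I (fun l => clipGrad P g I.τ (D l)) t ω))} ×ˢ Set.univ) ∪
          ((Set.univ ×ˢ {r | r.2.1 < -((K : ℝ) / 10)}) ∪
            (Set.univ ×ˢ {r | ∃ k, 1 ≤ r.2.2.1 k})) := by
        rintro p (hp | hp | hp)
        · exact Or.inl ⟨hp, trivial⟩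
        · exact Or.inr (Or.inl ⟨trivial, hp⟩)
        · exact Or.inr (Or.inr ⟨trivial, hp⟩)
      refine (measure_mono e).trans ((measure_union_le _ _).trans (add_le_add ?_
        ((measure_union_le _ _).trans ?_)))
      · rw [Measure.prod_prod, measure_univ, mul_one]
        have e2 : {ω : Fin t → StepRand K N d | ∃ j, D j ∈ outlier P g I.τ (acsaMid I t
              (batchRun I (fun l => clipGrad P g I.τ (D l)) t ω))} = ⋃ j,
            {ω | D j ∈ outlier P g I.τ (acsaMid I t
              (batchRun I (fun l => clipGrad P g I.τ (D l)) t ω))} := by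
          ext ω; simp
        rw [e2]
        refine (measure_iUnion_le _).trans ?_
        rw [tsum_fintype]
        refine Finset.sum_le_sum fun j _ => ?_
        have hms : MeasurableSet {ω : Fin t → StepRand K N d | D j ∈ outlier P g I.τ (acsaMid I t
              (batchRun I (fun l => clipGrad P g I.τ (D l)) t ω))} := by
          have hr := measurable_batchRun (K := K) hI
            (fun l => H.measurable_clipGrad' P I.τ (D l)) t
          have hr2 := (measurable_acsaMid I t).comp hr
          have := (H.measurableSet_outlier (m := m) P I.τ).preimage
            ((measurable_const (a := D j)).prodMk hr2)
          exact this
        have hint := integral_indicator_one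
          (μ := Measure.pi fun _ : Fin t => stepLaw K N d ε σ) hms
        have hint2 : ∫ ω, outlierAt P g I I.τ t (D j)
          (batchRun I (fun l => clipGrad P g I.τ (D l)) t ω)
            ∂(Measure.pi fun _ : Fin t => stepLaw K N d ε σ) =
            (Measure.pi fun _ : Fin t => stepLaw K N d ε σ).real _ := hint
        rw [hint2, ofReal_measureReal]
      · rw [Measure.prod_prod, Measure.prod_prod, stepLaw_uniform_eq_zero hN hε, mul_zero, add_zero,
          measure_univ, one_mul]
        exact stepLaw_noise_le hN hε σ
  rw [phaseLaw, Measure.prod_apply hEm]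
  -- The threshold noise is drawn once per phase and is charged once; beyond K/10 the trivial bound
  -- 1 is used.
  calc ∫⁻ ξ, (Measure.pi fun _ : Fin T => stepLaw K N d ε σ) (Prod.mk ξ ⁻¹' E) ∂laplace (8 / ε)
      ≤ ∫⁻ ξ, ((Set.Ioi ((K : ℝ) / 10)).indicator 1 ξ + c) ∂laplace (8 / ε) := by
        refine lintegral_mono fun ξ => ?_
        by_cases hξ : ξ ≤ K / 10
        · exact (hsec ξ hξ).trans le_add_self
        · rw [Set.indicator_of_mem (show ξ ∈ Set.Ioi ((K : ℝ) / 10) from not_le.1 hξ)]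
          exact prob_le_one.trans le_self_add
    _ = laplace (8 / ε) (Set.Ioi ((K : ℝ) / 10)) + c := by
        rw [lintegral_add_right _ measurable_const, lintegral_indicator_one measurableSet_Ioi,
          lintegral_const, measure_univ, mul_one]
    _ ≤ _ := by
        refine add_le_add ?_ le_rfl
        rw [laplace_Ioi (by positivity) (by positivity)]
        refine ENNReal.ofReal_le_ofReal ?_
        have : (K : ℝ) / 10 / (8 / ε) = K * ε / 80 := by
          field_simp; ring
        rw [this]
        linarith [Real.exp_pos (-(K * ε / 80))]

/-- The failure probability of a phase, over the data and the randomness. -/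
lemma GlobalLoss.measure_phase_ne_le (H : GlobalLoss X f g L β R) (P : Measure Z)
    [IsProbabilityMeasure P] {I : PhaseInput d}
    (hI : I.Valid) (hN : 0 < N) (hK : 0 < K) {ε : ℝ} (hε : 0 < ε) (σ : ℝ) {pb : ℝ} (hpb0 : 0 ≤ pb)
    (hpb : ∀ t < T, ∀ j : Fin N,
      ∫ D : Fin N → Fin m → Z, (∫ ω, outlierAt P g I I.τ t (D j)
        (batchRun I (fun l => clipGrad P g I.τ (D l)) t ω)
          ∂(Measure.pi fun _ : Fin t => stepLaw K N d ε σ))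
        ∂(Measure.pi fun _ => Measure.pi fun _ => P) ≤ pb) :
    ((Measure.pi fun _ : Fin N => Measure.pi fun _ : Fin m => P).prod (phaseLaw T K N d ε σ))
        {W | removalRun I g W.1 W.2 ≠ clipRun P I g W.1 W.2} ≤
      ENNReal.ofReal (Real.exp (-(K * ε / 80))
        + T * (N * pb + Real.exp (-(K * ε / 160)))) := by
  have p1 := isProbabilityMeasure_stepLaw (K := K) (d := d) (σ := σ) hN hε
  have p2 := isProbabilityMeasure_phaseLaw (T := T) (K := K) (d := d) hN hε σ
  have hm1 : Measurable fun W : (Fin N → Fin m → Z) × PhaseRand T K N d =>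
      removalRun I g W.1 W.2 := by
    have := (H.measurable_removalRun (N := N) (m := m) (K := K) (T := T) hI).comp
      (f := fun W : (Fin N → Fin m → Z) × PhaseRand T K N d => (I.x₀, W)) (by fun_prop)
    exact this
  have hm2 : Measurable fun W : (Fin N → Fin m → Z) × PhaseRand T K N d =>
      clipRun P I g W.1 W.2 := by
    have := (H.measurable_clipRun' (N := N) (m := m) (K := K) P hI I.τ T).fst.comp
      (f := fun W : (Fin N → Fin m → Z) × PhaseRand T K N d => (W.1, W.2.2)) (by fun_prop)
    exact this
  have hms : MeasurableSet {W : (Fin N → Fin m → Z) × PhaseRand T K N d |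
      removalRun I g W.1 W.2 ≠ clipRun P I g W.1 W.2} := (measurableSet_eq_fun hm1 hm2).compl
  rw [Measure.prod_apply hms]
  refine (lintegral_mono fun D => H.measure_removalRun_ne_le P hI hN hK hε σ D).trans ?_
  have hOm := fun (t : Fin T) (j : Fin N) =>
    H.measurable_integral_outlierAt (K := K) (m := m) P hI hN hε σ I.τ t j
  rw [lintegral_add_left measurable_const, lintegral_const, measure_univ, mul_one,
    ENNReal.ofReal_add (Real.exp_pos _).le (by positivity)]
  refine add_le_add le_rfl ?_
  rw [lintegral_finsetSum _ fun t _ => (Finset.measurable_sum _ fun j _ =>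
    (hOm t j).ennreal_ofReal).add_const _]
  refine (Finset.sum_le_sum (g := fun _ => ENNReal.ofReal (N * pb + Real.exp (-(K * ε / 160))))
    fun t _ => ?_).trans_eq ?_
  · rw [lintegral_add_right _ measurable_const, lintegral_const, measure_univ, mul_one,
      ENNReal.ofReal_add (by positivity) (Real.exp_pos _).le]
    refine add_le_add ?_ le_rfl
    rw [lintegral_finsetSum _ fun j _ => (hOm t j).ennreal_ofReal]
    refine (Finset.sum_le_sum (g := fun _ => ENNReal.ofReal pb) fun j _ => ?_).trans_eq ?_
    · have hmem := fun D : Fin N → Fin m → Z =>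
        (H.integral_outlierAt_mem (K := K) P hI hN hε σ I.τ t (D j) D).2
      rw [← ofReal_integral_eq_lintegral_ofReal
        (integral_mem_unit (hOm t j) (fun D => (hmem D).1) (fun D => (hmem D).2)).1
        (Filter.Eventually.of_forall fun D => (hmem D).1)]
      exact ENNReal.ofReal_le_ofReal (hpb t t.2 j)
    · simp [ENNReal.ofReal_mul]
  · rw [Finset.sum_const, Finset.card_univ, Fintype.card_fin, nsmul_eq_mul,
      ENNReal.ofReal_mul (by positivity)]
    simp

end Failure

/-! ### Composition of the phases -/

section Phased

variable {d : ℕ} {X : Set (Vec d)} {F : Vec d → ℝ} {L R M : ℝ}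

/-- A sequence of randomized phases `ideal i`, each of which approximates a point `hat i` that nearly
minimizes `F` up to a regularizer with weight `lam i` around the starting point of the phase. -/
structure PhaseSequence {T : ℕ} (X : Set (Vec d)) (F : Vec d → ℝ) {Ω : Fin T → Type*}
    [∀ i, MeasurableSpace (Ω i)] (μ : ∀ i, Measure (Ω i)) (ideal hat : ∀ i, Vec d → Ω i → Vec d)
    (lam gen e : ℕ → ℝ) : Prop where
  meas_ideal : ∀ i, Measurable fun p : Vec d × Ω i => ideal i p.1 p.2
  meas_hat : ∀ i, Measurable fun p : Vec d × Ω i => hat i p.1 p.2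
  ideal_mem : ∀ i, ∀ x ∈ X, ∀ w, ideal i x w ∈ X
  hat_mem : ∀ i, ∀ x ∈ X, ∀ w, hat i x w ∈ X
  close : ∀ i, ∀ x ∈ X, ∫ w, ‖ideal i x w - hat i x w‖ ^ 2 ∂μ i ≤ e (i + 1)
  erm : ∀ i, ∀ x ∈ X, ∀ y ∈ X,
    ∫ w, F (hat i x w) ∂μ i ≤ F y + lam i / 2 * ‖y - x‖ ^ 2 + gen i

lemma PhaseSequence.castSucc {T : ℕ} {Ω : Fin (T + 1) → Type*} [∀ i, MeasurableSpace (Ω i)]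
    {μ : ∀ i, Measure (Ω i)} {ideal hat : ∀ i, Vec d → Ω i → Vec d} {lam gen e : ℕ → ℝ}
    (H : PhaseSequence X F μ ideal hat lam gen e) :
    PhaseSequence X F (fun i : Fin T => μ i.castSucc) (fun i => ideal i.castSucc)
      (fun i => hat i.castSucc) lam gen e where
  meas_ideal i := H.meas_ideal i.castSucc
  meas_hat i := H.meas_hat i.castSucc
  ideal_mem i := H.ideal_mem i.castSucc
  hat_mem i := H.hat_mem i.castSucc
  close i := H.close i.castSucc
  erm i := H.erm i.castSucc

/-- The chain of pairs of a phase output and the point that it approximates. -/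
def pairStep {T : ℕ} {Ω : Fin T → Type*} (ideal hat : ∀ i, Vec d → Ω i → Vec d) (i : Fin T)
    (s : Vec d × Vec d) (w : Ω i) : Vec d × Vec d :=
  (ideal i s.1 w, hat i s.1 w)

/-- Each phase is compared with the minimizer of the previous phase, which is independent of its
data; the losses telescope and the regularizer contributes λ/2 times the squared distance from the
previous output to the previous minimizer. The comparator `y₀` acts as minimizer of a fictitious
phase 0 with output `x₀`. Both claims concern the same chain of pairs, so they are proved in one
induction. -/
lemma PhaseSequence.integral_le {T : ℕ} {Ω : Fin T → Type*} [∀ i, MeasurableSpace (Ω i)]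
    {μ : ∀ i, Measure (Ω i)} [∀ i, IsProbabilityMeasure (μ i)]
    {ideal hat : ∀ i, Vec d → Ω i → Vec d} {lam gen e : ℕ → ℝ}
    (H : PhaseSequence X F μ ideal hat lam gen e) (hF : Continuous F) (hM : ∀ x, |F x| ≤ M)
    (hX : ∀ x ∈ X, ∀ y ∈ X, ‖x - y‖ ≤ R) (hlam : ∀ i, 0 ≤ lam i) {x₀ y₀ : Vec d} (hx₀ : x₀ ∈ X)
    (hy₀ : y₀ ∈ X) (he : ‖x₀ - y₀‖ ^ 2 ≤ e 0) :
    (∀ ω, (chain (pairStep ideal hat) (x₀, y₀) ω).1 ∈ X ∧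
      (chain (pairStep ideal hat) (x₀, y₀) ω).2 ∈ X) ∧
    (Measurable fun ω => chain (pairStep ideal hat) (x₀, y₀) ω) ∧
    ∫ ω, F (chain (pairStep ideal hat) (x₀, y₀) ω).2 ∂Measure.pi μ ≤
      F y₀ + ∑ i ∈ Finset.range T, (lam i / 2 * e i + gen i) ∧
    ∫ ω, ‖(chain (pairStep ideal hat) (x₀, y₀) ω).1 - (chain (pairStep ideal hat) (x₀, y₀) ω).2‖ ^ 2
      ∂Measure.pi μ ≤ e T := by
  have hmem : ∀ {T : ℕ} {Ω : Fin T → Type _} [∀ i, MeasurableSpace (Ω i)]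
      {μ : ∀ i, Measure (Ω i)} {ideal hat : ∀ i, Vec d → Ω i → Vec d}
      (_ : PhaseSequence X F μ ideal hat lam gen e) (ω : ∀ i, Ω i),
      (chain (pairStep ideal hat) (x₀, y₀) ω).1 ∈ X ∧
      (chain (pairStep ideal hat) (x₀, y₀) ω).2 ∈ X := fun H ω =>
    chain_induction (p := fun s : Vec d × Vec d => s.1 ∈ X ∧ s.2 ∈ X)
      (fun i s r h => ⟨H.ideal_mem i _ h.1 _, H.hat_mem i _ h.1 _⟩) ⟨hx₀, hy₀⟩ ω
  have hstep : ∀ i, Measurable fun p : (Vec d × Vec d) × Ω i =>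
      pairStep ideal hat i p.1 p.2 := fun i => by
    have h1 := (H.meas_ideal i).comp
      (f := fun p : (Vec d × Vec d) × Ω i => (p.1.1, p.2)) (by fun_prop)
    have h2 := (H.meas_hat i).comp
      (f := fun p : (Vec d × Vec d) × Ω i => (p.1.1, p.2)) (by fun_prop)
    exact h1.prodMk h2
  refine ⟨hmem H, measurable_chain' _ hstep, ?_⟩
  induction T with
  | zero => simpa [chain_zero] using he
  | succ T ih =>
    have ih := ih H.castSucc (fun i => hstep i.castSucc)
    have hR2 : ∀ (x y : Vec d), x ∈ X → y ∈ X → ‖x - y‖ ^ 2 ≤ R ^ 2 := fun x y hx hy =>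
      pow_le_pow_left₀ (norm_nonneg _) (hX x hx y hy) 2
    have hmeas' := measurable_chain' (f := pairStep (fun i : Fin T => ideal i.castSucc)
      (fun i => hat i.castSucc)) (x₀, y₀) (fun i => hstep i.castSucc)
    set c : (∀ i : Fin T, Ω i.castSucc) → Vec d × Vec d := fun ω =>
      chain (pairStep (fun i : Fin T => ideal i.castSucc) (fun i => hat i.castSucc)) (x₀, y₀) ω
      with hc
    have hcm : ∀ ω, (c ω).1 ∈ X ∧ (c ω).2 ∈ X := hmem H.castSucc
    set μ' := Measure.pi fun i : Fin T => μ i.castSucc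
    constructor
    · have e1 := integral_chain_succ μ (f := pairStep ideal hat) (x₀, y₀) hstep
        (φ := fun s => F s.2) (hF.measurable.comp measurable_snd) (M := M) (fun ω => hM _)
      rw [e1]
      have i1 : Integrable (fun ω => F (c ω).2) μ' :=
        Integrable.of_bound (hF.measurable.comp hmeas'.snd).aestronglyMeasurable M
          (Filter.Eventually.of_forall fun ω => hM _)
      have i2 : Integrable (fun ω => ‖(c ω).1 - (c ω).2‖ ^ 2) μ' := by
        refine Integrable.of_bound ((hmeas'.fst.sub hmeas'.snd).norm.pow_const
            2).aestronglyMeasurable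
          (R ^ 2) (Filter.Eventually.of_forall fun ω => ?_)
        rw [Real.norm_of_nonneg (sq_nonneg _)]
        exact hR2 _ _ (hcm ω).1 (hcm ω).2
      have i3 : Integrable (fun ω => ∫ r, F (pairStep ideal hat (Fin.last T) (c ω) r).2
          ∂μ (Fin.last T)) μ' := by
        have h1 := (hF.measurable.comp measurable_snd).comp (hstep (Fin.last T))
        have h2 := h1.comp (f := fun p : (∀ i : Fin T, Ω i.castSucc) × Ω (Fin.last T) =>
          (c p.1, p.2)) ((hmeas'.comp measurable_fst).prodMk measurable_snd)
        have h3 := h2.stronglyMeasurable.integral_prod_right' (ν := μ (Fin.last T))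
        refine Integrable.of_bound h3.aestronglyMeasurable M
          (Filter.Eventually.of_forall fun ω => ?_)
        exact (norm_integral_le_of_norm_le_const (C := M)
          (Filter.Eventually.of_forall fun r => hM _)).trans_eq (by simp)
      have i4 : Integrable (fun ω => lam T / 2 * ‖(c ω).1 - (c ω).2‖ ^ 2) μ' := i2.const_mul _
      have i5 : Integrable (fun ω => F (c ω).2 + lam T / 2 * ‖(c ω).1 - (c ω).2‖ ^ 2) μ' :=
          i1.add i4
      have hle : ∀ ω, ∫ r, F (pairStep ideal hat (Fin.last T) (c ω) r).2 ∂μ (Fin.last T) ≤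
          F (c ω).2 + lam T / 2 * ‖(c ω).1 - (c ω).2‖ ^ 2 + gen T := fun ω => by
        have := H.erm (Fin.last T) (c ω).1 (hcm ω).1 (c ω).2 (hcm ω).2
        rw [norm_sub_rev] at this
        simp only [Fin.val_last] at this
        exact this
      refine (integral_mono i3 (i5.add (integrable_const (gen T))) hle).trans ?_
      rw [integral_add' i5 (integrable_const _), integral_add i1 i4, integral_const_mul,
        Finset.sum_range_succ]
      simp only [integral_const, probReal_univ, smul_eq_mul, one_mul]
      have h5 := mul_le_mul_of_nonneg_left ih.2 (show 0 ≤ lam T / 2 by linarith [hlam T])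
      linarith [ih.1]
    · have e1 := integral_chain_succ μ (f := pairStep ideal hat) (x₀, y₀) hstep
        (φ := fun s => ‖s.1 - s.2‖ ^ 2) (by fun_prop) (M := R ^ 2) (fun ω => by
          rw [abs_of_nonneg (sq_nonneg _)]
          exact hR2 _ _ (hmem H ω).1 (hmem H ω).2)
      rw [e1]
      have hle : ∀ ω, ∫ r, ‖(pairStep ideal hat (Fin.last T) (c ω) r).1
          - (pairStep ideal hat (Fin.last T) (c ω) r).2‖ ^ 2 ∂μ (Fin.last T) ≤ e (T + 1) :=
        fun ω => H.close (Fin.last T) (c ω).1 (hcm ω).1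
      refine (integral_mono_of_nonneg (Filter.Eventually.of_forall fun ω =>
        integral_nonneg fun _ => sq_nonneg _) (integrable_const (e (T + 1)))
        (Filter.Eventually.of_forall hle)).trans_eq (by simp)

/-- Excess risk of phases `real i` that deviate from the phases `ideal i` with small probability. -/
lemma PhaseSequence.excess_le {T : ℕ} {Ω : Fin T → Type*} [∀ i, MeasurableSpace (Ω i)]
    {μ : ∀ i, Measure (Ω i)} [∀ i, IsProbabilityMeasure (μ i)]
    {ideal hat real : ∀ i, Vec d → Ω i → Vec d} {lam gen e pf : ℕ → ℝ}
    (H : PhaseSequence X F μ ideal hat lam gen e) (hF : Continuous F) (hM : ∀ x, |F x| ≤ M)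
    (hL : 0 ≤ L) (hR : 0 ≤ R) (hlip : ∀ x y, |F x - F y| ≤ L * ‖x - y‖)
    (hX : ∀ x ∈ X, ∀ y ∈ X, ‖x - y‖ ≤ R) (hlam : ∀ i, 0 ≤ lam i)
    (hreal : ∀ i, Measurable fun p : Vec d × Ω i => real i p.1 p.2)
    (hrealm : ∀ i, ∀ x ∈ X, ∀ w, real i x w ∈ X) (hpf0 : ∀ i, 0 ≤ pf i)
    (hpf : ∀ i, ∀ x ∈ X, μ i {w | real i x w ≠ ideal i x w} ≤ ENNReal.ofReal (pf i))
    {x₀ y₀ : Vec d} (hx₀ : x₀ ∈ X) (hy₀ : y₀ ∈ X) (he : ‖x₀ - y₀‖ ^ 2 ≤ e 0) :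
    ∫ ω, F (chain real x₀ ω) ∂Measure.pi μ ≤
      F y₀ + ∑ i ∈ Finset.range T, (lam i / 2 * e i + gen i) + L * √(e T)
        + L * R * ∑ i ∈ Finset.range T, pf i := by
  obtain ⟨hm, hmeas, h1, h2⟩ := H.integral_le hF hM hX hlam hx₀ hy₀ he
  have hpair : ∀ {T : ℕ} {Ω : Fin T → Type _} (ideal hat : ∀ i, Vec d → Ω i → Vec d)
      (ω : ∀ i, Ω i),
      (chain (pairStep ideal hat) (x₀, y₀) ω).1 = chain ideal x₀ ω := fun ideal hat ω =>
    chain_rel (f := pairStep ideal hat) (f' := ideal) (R := fun s x => s.1 = x) rfl ω ω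
      (by rintro i s _ rfl; rfl)
  set c := fun ω => chain (pairStep ideal hat) (x₀, y₀) ω with hc
  have hrm := measurable_chain' x₀ hreal
  have hrX : ∀ ω, chain real x₀ ω ∈ X := fun ω =>
    chain_induction (p := fun x => x ∈ X) (fun i x w h => hrealm i x h w) hx₀ ω
  have him : Measurable fun ω => chain ideal x₀ ω := measurable_chain' x₀ H.meas_ideal
  have hiX : ∀ ω, chain ideal x₀ ω ∈ X := fun ω =>
    chain_induction (p := fun x => x ∈ X) (fun i x w h => H.ideal_mem i x h w) hx₀ ω
  -- the coupling
  set E : Set (∀ i, Ω i) := {ω | chain real x₀ ω ≠ chain ideal x₀ ω} with hE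
  have hEm : MeasurableSet E := (measurableSet_eq_fun hrm him).compl
  have hEle : (Measure.pi μ).real E ≤ ∑ i ∈ Finset.range T, pf i := by
    -- With the ideal chain as reference, a phase fails with probability at most `pf i` from
    -- whatever point of X the ideal chain has reached.
    have key := measure_chain_not_rel_le μ (f := ideal) (f' := real) (R := fun x y => x = y)
      (s := x₀) rfl (fun i => {p | real i p.1 p.2 ≠ ideal i p.1 p.2}) (by
        rintro i s _ w rfl hf
        exact (not_not.1 hf).symm)
    have hb : ∀ i : Fin T, ((Measure.pi fun j : Fin i => μ (Fin.castLE i.is_lt.le j)).prod (μ i))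
        {p | (chain (fun j : Fin i => ideal (Fin.castLE i.is_lt.le j)) x₀ p.1, p.2) ∈
          {p : Vec d × Ω i | real i p.1 p.2 ≠ ideal i p.1 p.2}} ≤ ENNReal.ofReal (pf i) := fun i
              => by
      have hch := measurable_chain' (f := fun j : Fin i => ideal (Fin.castLE i.is_lt.le j)) x₀
        (fun j => H.meas_ideal _)
      have hms : MeasurableSet {p : Vec d × Ω i | real i p.1 p.2 ≠ ideal i p.1 p.2} :=
        (measurableSet_eq_fun (hreal i) (H.meas_ideal i)).compl
      have hms2 := hms.preimage (((hch.comp measurable_fst).prodMk measurable_snd) :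
        Measurable fun p : (∀ j : Fin i, Ω (Fin.castLE i.is_lt.le j)) × Ω i =>
          (chain (fun j : Fin i => ideal (Fin.castLE i.is_lt.le j)) x₀ p.1, p.2))
      have e1 := Measure.prod_apply (μ := Measure.pi fun j : Fin i => μ (Fin.castLE i.is_lt.le j))
        (ν := μ i) hms2
      refine (le_of_eq e1).trans ?_
      refine (lintegral_mono (g := fun _ => ENNReal.ofReal (pf i)) fun ω => ?_).trans_eq (by simp)
      exact hpf i _ (chain_induction (p := fun x => x ∈ X)
        (fun j x w h => H.ideal_mem _ x h w) hx₀ ω)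
    have h3 : Measure.pi μ E ≤ ENNReal.ofReal (∑ i ∈ Finset.range T, pf i) := by
      rw [Finset.sum_range, ENNReal.ofReal_sum_of_nonneg (f := fun i : Fin T => pf i) fun i _ =>
          hpf0 _]
      refine le_trans (measure_mono fun ω hω => ?_) (key.trans (Finset.sum_le_sum fun i _ => hb i))
      exact fun h => hω h.symm
    exact ENNReal.toReal_le_of_le_ofReal (Finset.sum_nonneg fun i _ => hpf0 i) h3
  have ic2 : Integrable (fun ω => F (c ω).2) (Measure.pi μ) :=
    Integrable.of_bound (hF.measurable.comp hmeas.snd).aestronglyMeasurable M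
      (Filter.Eventually.of_forall fun ω => hM _)
  have isq : Integrable (fun ω => ‖(c ω).1 - (c ω).2‖ ^ 2) (Measure.pi μ) := by
    refine Integrable.of_bound ((hmeas.fst.sub hmeas.snd).norm.pow_const 2).aestronglyMeasurable
      (R ^ 2) (Filter.Eventually.of_forall fun ω => ?_)
    rw [Real.norm_of_nonneg (sq_nonneg _)]
    exact pow_le_pow_left₀ (norm_nonneg _) (hX _ (hm ω).1 _ (hm ω).2) 2
  have ino : Integrable (fun ω => ‖(c ω).1 - (c ω).2‖) (Measure.pi μ) := by
    refine Integrable.of_bound (hmeas.fst.sub hmeas.snd).norm.aestronglyMeasurable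
      R (Filter.Eventually.of_forall fun ω => ?_)
    rw [Real.norm_of_nonneg (norm_nonneg _)]
    exact hX _ (hm ω).1 _ (hm ω).2
  have ire : Integrable (fun ω => F (chain real x₀ ω)) (Measure.pi μ) :=
    Integrable.of_bound (hF.measurable.comp hrm).aestronglyMeasurable M
      (Filter.Eventually.of_forall fun ω => hM _)
  have iE : Integrable (E.indicator fun _ => (1 : ℝ)) (Measure.pi μ) :=
    (integrable_const 1).indicator hEm
  have hnorm : ∫ ω, ‖(c ω).1 - (c ω).2‖ ∂Measure.pi μ ≤ √(e T) := by
    have h4 := integral_sqrt_le (μ := Measure.pi μ) (f := fun ω => ‖(c ω).1 - (c ω).2‖ ^ 2)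
      (fun ω => sq_nonneg _) ((hmeas.fst.sub hmeas.snd).norm.pow_const 2) isq
    simp only [Real.sqrt_sq (norm_nonneg _)] at h4
    exact h4.trans (Real.sqrt_le_sqrt h2)
  -- Off the coupling event the output is that of the ideal chain; on it the iterates remain in X,
  -- so the additional loss is at most LR.
  have hpt : ∀ ω, F (chain real x₀ ω) ≤ F (c ω).2 + L * ‖(c ω).1 - (c ω).2‖
      + L * R * E.indicator (fun _ => 1) ω := fun ω => by
    have k1 := (abs_le.1 (hlip (c ω).1 (c ω).2)).2
    by_cases hω : ω ∈ E
    · rw [Set.indicator_of_mem hω]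
      have k2 := (abs_le.1 (hlip (chain real x₀ ω) (c ω).1)).2
      have k3 := mul_le_mul_of_nonneg_left (hX _ (hrX ω) _ (hm ω).1) hL
      linarith
    · rw [Set.indicator_of_notMem hω]
      have k2 : chain real x₀ ω = (c ω).1 := (not_not.1 hω).trans (hpair ideal hat ω).symm
      rw [k2]
      linarith
  have i6 := ic2.add (ino.const_mul L)
  refine (integral_mono ire (i6.add (iE.const_mul (L * R))) hpt).trans ?_
  rw [integral_add' i6 (iE.const_mul (L * R)), integral_add' ic2 (ino.const_mul L),
    integral_const_mul, integral_const_mul]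
  have e3 : ∫ ω, E.indicator (fun _ => (1 : ℝ)) ω ∂Measure.pi μ = (Measure.pi μ).real E :=
    integral_indicator_one hEm
  rw [e3]
  gcongr

end Phased

/-! ### Extension of a loss to the whole space -/

section Globalize

variable {d : ℕ} {Z : Type*} {X : Set (Vec d)} {f : Vec d → Z → ℝ} {gradf : Vec d → Z → Vec d}
  {L β R : ℝ}

/-- The normalized loss, extended to the whole space by projection to `X`. -/
def extLoss (X : Set (Vec d)) (f : Vec d → Z → ℝ) (x : Vec d) (z : Z) : ℝ :=
  f (proj X x) z - f 0 z

/-- The gradient field, extended to the whole space by projection to `X`. -/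
def extGrad (X : Set (Vec d)) (gradf : Vec d → Z → Vec d) (x : Vec d) (z : Z) : Vec d :=
  gradf (proj X x) z

/-- A smooth function is determined by the Riemann sums of its gradient along a segment. -/
lemma FirstOrder.abs_sub_riemann_le (hX : Convex ℝ X) (h0 : (0 : Vec d) ∈ X) {h : Vec d → ℝ}
    {g : Vec d → Vec d} (H : FirstOrder X h g β) {x : Vec d} (hx : x ∈ X) (N : ℕ) :
    |h x - h 0 - ∑ k ∈ Finset.range (N + 1), inner ℝ (g (((k : ℝ) / (N + 1)) • x))
      ((1 / ((N : ℝ) + 1)) • x)| ≤ β / 2 * ‖x‖ ^ 2 * (1 / ((N : ℝ) + 1)) := by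
  have hN : (0 : ℝ) < (N : ℝ) + 1 := by positivity
  set y : ℕ → Vec d := fun k => ((k : ℝ) / (N + 1)) • x with hy
  have hyX : ∀ k ≤ N + 1, y k ∈ X := fun k hk => by
    refine hX.smul_mem_of_zero_mem h0 hx ⟨by positivity, ?_⟩
    rw [div_le_one hN]
    exact_mod_cast hk
  have hd : ∀ k, y (k + 1) - y k = (1 / ((N : ℝ) + 1)) • x := fun k => by
    simp only [hy, ← sub_smul]
    congr 1
    push_cast
    field_simp
    ring
  have htel := Finset.sum_range_sub (fun k => h (y k)) (N + 1)
  have hy0 : y 0 = 0 := by simp [hy]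
  have hy1 : y (N + 1) = x := by simp [hy, div_self hN.ne']
  rw [hy0, hy1] at htel
  rw [← htel, ← Finset.sum_sub_distrib]
  refine (Finset.abs_sum_le_sum_abs _ _).trans ?_
  have hb : ∀ k ∈ Finset.range (N + 1), |h (y (k + 1)) - h (y k) - inner ℝ (g (y k))
      ((1 / ((N : ℝ) + 1)) • x)| ≤ β / 2 * ‖x‖ ^ 2 * (1 / ((N : ℝ) + 1)) ^ 2 := fun k hk => by
    have hk' : k < N + 1 := Finset.mem_range.1 hk
    have h1 := H.lower (y k) (hyX k hk'.le) (y (k + 1)) (hyX _ hk')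
    have h2 := H.upper (y k) (hyX k hk'.le) (y (k + 1)) (hyX _ hk')
    rw [hd k] at h1 h2
    rw [norm_smul, Real.norm_of_nonneg (by positivity), mul_pow] at h2
    rw [abs_of_nonneg (by linarith)]
    linarith
  refine (Finset.sum_le_sum hb).trans_eq ?_
  rw [Finset.sum_const, Finset.card_range, nsmul_eq_mul]
  push_cast
  field_simp

variable [MeasurableSpace Z] {P : Measure Z}

lemma IsLoss.firstOrder (h : IsLoss P X f gradf L β) (hX : Convex ℝ X) (z : Z) :
    FirstOrder X (fun x => f x z) (fun x => gradf x z) β :=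
  FirstOrder.of_hasGradientWithinAt hX (h.convex z) (h.hasGradient z) (h.smooth z)

/-- Integrability gives measurability of the loss only almost everywhere, which is too weak for
compositions with data-dependent points. Differences of losses are limits of Riemann sums of the
gradient along the segment from 0, hence measurable outright. -/
lemma IsLoss.measurable_sub (h : IsLoss P X f gradf L β) (hX : Convex ℝ X)
    (h0 : (0 : Vec d) ∈ X) {x : Vec d} (hx : x ∈ X) : Measurable fun z => f x z - f 0 z := by
  refine measurable_of_tendsto_metrizable (f := fun (N : ℕ) z => ∑ k ∈ Finset.range (N + 1),
    inner ℝ (gradf (((k : ℝ) / (N + 1)) • x) z) ((1 / ((N : ℝ) + 1)) • x)) (fun N => ?_) ?_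
  · refine Finset.measurable_sum _ fun k hk => ?_
    have hm : ((k : ℝ) / (N + 1)) • x ∈ X := by
      refine hX.smul_mem_of_zero_mem h0 hx ⟨by positivity, ?_⟩
      rw [div_le_one (by positivity)]
      exact_mod_cast (Finset.mem_range.1 hk).le
    exact (h.measurable_grad _ hm).inner_const
  · rw [tendsto_pi_nhds]
    intro z
    rw [tendsto_iff_norm_sub_tendsto_zero]
    have hlim : Filter.Tendsto (fun N : ℕ => β / 2 * ‖x‖ ^ 2 * (1 / ((N : ℝ) + 1))) Filter.atTop
        (nhds 0) := by
      have := (tendsto_one_div_add_atTop_nhds_zero_nat (𝕜 := ℝ)).const_mul (β / 2 * ‖x‖ ^ 2)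
      rwa [mul_zero] at this
    refine squeeze_zero (fun _ => norm_nonneg _) (fun N => ?_) hlim
    rw [norm_sub_rev]
    exact (h.firstOrder hX z).abs_sub_riemann_le hX h0 hx N

/-- Projecting makes the loss and the gradient Lipschitz on the whole space, hence jointly
measurable with the sample. Subtracting the loss at 0 gives the bound LR and, by
`IsLoss.measurable_sub`, measurability in the sample. -/
lemma IsLoss.globalLoss (h : IsLoss P X f gradf L β) (hX : Convex ℝ X) (hc : IsCompact X)
    (h0 : (0 : Vec d) ∈ X) (hd : ∀ x ∈ X, ∀ y ∈ X, ‖x - y‖ ≤ R) (hL : 0 < L) (hβ : 0 ≤ β)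
    (hR : 0 < R) : GlobalLoss X (extLoss X f) (extGrad X gradf) L β R := by
  have hp := fun x => (proj_spec hc ⟨0, h0⟩ x).1
  have hpl := proj_lipschitz hc hX ⟨0, h0⟩
  have hpc := continuous_proj hc hX ⟨0, h0⟩
  have hlip : ∀ z x y, |extLoss X f x z - extLoss X f y z| ≤ L * ‖x - y‖ := fun z x y => by
    rw [extLoss, extLoss, sub_sub_sub_cancel_right]
    exact (h.lipschitz z _ (hp x) _ (hp y)).trans (mul_le_mul_of_nonneg_left (hpl x y) hL.le)
  refine ⟨hX, hc, h0, hd, hL, hβ, hR, ?_, ?_, hlip, fun x z => ?_, fun x z => ?_, fun z => ?_⟩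
  · have := measurable_uncurry_of_continuous_of_measurable (u := extLoss X f)
      (fun z => (LipschitzWith.of_dist_le' (K := L) fun x y => by
        rw [Real.dist_eq, dist_eq_norm]; exact hlip z x y).continuous)
      (fun x => h.measurable_sub hX h0 (hp x))
    exact this
  · have := measurable_uncurry_of_continuous_of_measurable (u := extGrad X gradf)
      (fun z => (LipschitzWith.of_dist_le' (K := β) fun x y => by
        rw [dist_eq_norm, dist_eq_norm]
        exact (h.smooth z _ (hp x) _ (hp y)).trans
          (mul_le_mul_of_nonneg_left (hpl x y) hβ)).continuous)
      (fun x => h.measurable_grad _ (hp x))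
    exact this
  · exact (h.lipschitz z _ (hp x) _ h0).trans (mul_le_mul_of_nonneg_left (hd _ (hp x) _ h0) hL.le)
  · exact h.norm_grad_le z _ (hp x)
  · have hF := h.firstOrder hX z
    constructor
    · intro x hx y hy
      simp only [extLoss, extGrad, proj_eq_self hc hx, proj_eq_self hc hy]
      linarith [hF.lower x hx y hy]
    · intro x hx y hy
      simp only [extLoss, extGrad, proj_eq_self hc hx, proj_eq_self hc hy]
      linarith [hF.upper x hx y hy]

lemma IsLoss.popLoss_eq (h : IsLoss P X f gradf L β) (hc : IsCompact X) (h0 : (0 : Vec d) ∈ X)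
    {x : Vec d} (hx : x ∈ X) : popLoss P f x = popLoss P (extLoss X f) x + popLoss P f 0 := by
  simp only [popLoss, extLoss, proj_eq_self hc hx]
  rw [integral_sub (h.integrable x hx) (h.integrable 0 h0)]
  ring

end Globalize

/-! ### Law of the data and of the randomness of the phases -/

section ProductLaws

/-- Distinct coordinates of an i.i.d. family are an i.i.d. family. -/
lemma measurePreserving_precomp {ι κ Y : Type*} [Fintype ι] [Fintype κ] [MeasurableSpace Y]
    (ν : Measure Y) [IsProbabilityMeasure ν] {e : κ → ι} (he : Function.Injective e) :
    MeasurePreserving (fun (D : ι → Y) a => D (e a)) (Measure.pi fun _ => ν)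
      (Measure.pi fun _ => ν) := by
  classical
  have hm : Measurable fun (D : ι → Y) a => D (e a) := by fun_prop
  refine ⟨hm, (Measure.pi_eq fun s hs => ?_).symm⟩
  rw [Measure.map_apply hm (MeasurableSet.univ_pi hs)]
  have h1 : (fun (D : ι → Y) a => D (e a)) ⁻¹' Set.univ.pi s =
      Set.univ.pi (Function.extend e s fun _ => Set.univ) := by
    ext D
    simp only [Set.mem_preimage, Set.mem_univ_pi]
    constructor
    · intro h i
      by_cases hi : ∃ a, e a = i
      · obtain ⟨a, rfl⟩ := hi
        rw [he.extend_apply]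
        exact h a
      · rw [Function.extend_apply' _ _ _ hi]
        trivial
    · intro h a
      have := h (e a)
      rwa [he.extend_apply] at this
  rw [h1, Measure.pi_pi]
  refine (Fintype.prod_of_injective e he _ _ (fun i hi => ?_) fun a => ?_).symm
  · rw [Function.extend_apply' _ _ _ hi, measure_univ]
  · rw [he.extend_apply]

/-- Injectivity on the sigma type says that no user serves twice, within or across phases; currying
then regroups i.i.d. coordinates into independent phase data sets. -/
lemma measurePreserving_piSelect {ι Y : Type*} [Fintype ι] [MeasurableSpace Y] (ν : Measure Y)
    [IsProbabilityMeasure ν] {T : ℕ} {N : Fin T → ℕ} {sel : ∀ i, Fin (N i) → ι}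
    (h : Function.Injective fun a : (i : Fin T) × Fin (N i) => sel a.1 a.2) :
    MeasurePreserving (fun (D : ι → Y) i j => D (sel i j)) (Measure.pi fun _ => ν)
      (Measure.pi fun i => Measure.pi fun _ : Fin (N i) => ν) := by
  have h1 := measurePreserving_precomp ν h
  have h2 := Measure.infinitePi_map_piCurry (X := fun (i : Fin T) (_ : Fin (N i)) => Y)
    fun (i : Fin T) (_ : Fin (N i)) => ν
  simp only [Measure.infinitePi_eq_pi] at h2
  have h3 : MeasurePreserving (MeasurableEquiv.piCurry fun (i : Fin T) (_ : Fin (N i)) => Y)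
      (Measure.pi fun _ => ν) (Measure.pi fun i => Measure.pi fun _ : Fin (N i) => ν) :=
    ⟨MeasurableEquiv.measurable _, h2⟩
  exact h3.comp h1

lemma measurePreserving_piProd {ι : Type*} [Fintype ι] {α β : ι → Type*}
    [∀ i, MeasurableSpace (α i)] [∀ i, MeasurableSpace (β i)] (μ : ∀ i, Measure (α i))
    (ν : ∀ i, Measure (β i)) [∀ i, IsProbabilityMeasure (μ i)] [∀ i, IsProbabilityMeasure (ν i)] :
    MeasurePreserving (fun (p : (∀ i, α i) × ∀ i, β i) i => (p.1 i, p.2 i))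
      ((Measure.pi μ).prod (Measure.pi ν)) (Measure.pi fun i => (μ i).prod (ν i)) := by
  have hm : Measurable fun (p : (∀ i, α i) × ∀ i, β i) i => (p.1 i, p.2 i) := by fun_prop
  refine ⟨hm, (Measure.pi_eq_generateFrom (C := fun i => Set.image2 (· ×ˢ ·)
    {s : Set (α i) | MeasurableSet s} {t : Set (β i) | MeasurableSet t})
    (fun i => generateFrom_prod) (fun i => isPiSystem_prod)
    (fun i => ⟨fun _ => Set.univ, fun _ => ⟨Set.univ, .univ, Set.univ, .univ, by simp⟩,
      fun _ => measure_lt_top _ _, Set.iUnion_const _⟩) fun s hs => ?_).symm⟩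
  choose a ha b hb hab using hs
  obtain rfl : (fun i => a i ×ˢ b i) = s := funext hab
  have ha' : ∀ i, MeasurableSet (a i) := ha
  have hb' : ∀ i, MeasurableSet (b i) := hb
  rw [Measure.map_apply hm (MeasurableSet.univ_pi fun i => (ha' i).prod (hb' i))]
  have h1 : (fun (p : (∀ i, α i) × ∀ i, β i) i => (p.1 i, p.2 i)) ⁻¹'
      Set.univ.pi (fun i => a i ×ˢ b i) = Set.univ.pi a ×ˢ Set.univ.pi b := by
    ext p
    simp [Set.mem_prod, forall_and]
  rw [h1, Measure.prod_prod, Measure.pi_pi, Measure.pi_pi, ← Finset.prod_mul_distrib]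
  exact Finset.prod_congr rfl fun i _ => (Measure.prod_prod _ _).symm

end ProductLaws

/-! ### Counting gradient evaluations -/

lemma chain_le_add_sum {S : Type*} {T : ℕ} {Ω : Fin T → Type*} {f : ∀ i, S → Ω i → S}
    {φ : S → ℕ} {b : Fin T → ℕ} (h : ∀ i s w, φ (f i s w) ≤ φ s + b i) (s : S) (ω : ∀ i, Ω i) :
    φ (chain f s ω) ≤ φ s + ∑ i, b i := by
  induction T with
  | zero => simp [chain_zero]
  | succ T ih =>
    rw [chain_succ, Fin.sum_univ_castSucc, ← add_assoc]
    exact (h _ _ _).trans (Nat.add_le_add_right (ih (fun i s w => h i.castSucc s w) _) _)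

lemma evals_sgdStep_le {d m N K : ℕ} {Z : Type*} (I : PhaseInput d) (g : Vec d → Z → Vec d)
    (D : Fin N → Fin m → Z) (ξ : ℝ) (t : ℕ) (r : StepRand K N d) (st : SgdState d) :
    (sgdStep I g D ξ t r st).evals ≤ st.evals + K * m := by
  classical
  by_cases h : st.halted
  · simp [sgdStep, h]
  · simp only [sgdStep, if_neg h, userGrad]
    split_ifs <;> simp

lemma runPhase_snd_le {d m N K T : ℕ} {Z : Type*} (I : PhaseInput d) (g : Vec d → Z → Vec d)
    (D : Fin N → Fin m → Z) (ω : PhaseRand T K N d) :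
    (runPhase I g D ω).2 ≤ T * (K * m) := by
  have := chain_le_add_sum (φ := SgdState.evals)
    (f := fun (t : Fin T) st (r : StepRand K N d) => sgdStep I g D ω.1 t r st) (b := fun _ => K * m)
    (fun t st r => evals_sgdStep_le I g D ω.1 t r st)
    { xag := I.x₀, x := I.x₀, halted := False, evals := 0 } ω.2
  simp only [zero_add, Finset.sum_const, Finset.card_univ, Fintype.card_fin, smul_eq_mul] at this
  exact this

/-! ### The algorithm as a chain of independent phases -/

namespace Params

variable (A : Params) {Z : Type*}

/-- The input of phase `i`, started at `x`. -/
def phaseInput (c : ℝ) (X : Set (Vec A.d)) (i : ℕ) (x : Vec A.d) : PhaseInput A.d :=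
  { X := X, β := A.β, lam := A.lamPh i, N₀ := A.stageLen i, τ := A.tau c, x₀ := x }

lemma phasedERM_snd_le (c : ℝ) (X : Set (Vec A.d)) (gradf : Vec A.d → Z → Vec A.d)
    (x₀ : Vec A.d) (sel : A.Selection) (D : A.Data Z) (ω : A.Rand) :
    (A.phasedERM c X gradf x₀ sel D ω).2 ≤
      ∑ i : Fin A.phases, A.iters (i + 1) * (A.batch (i + 1) * A.m) := by
  have := chain_le_add_sum (φ := fun st : Vec A.d × ℕ => st.2)
    (f := fun (i : Fin A.phases) (st : Vec A.d × ℕ)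
        (w : (Fin (A.users (i + 1)) → Fin A.m → Z) × PhaseRand (A.iters (i + 1)) (A.batch (i + 1))
          (A.users (i + 1)) A.d) =>
      ((runPhase (A.phaseInput c X (i + 1) st.1) gradf w.1 w.2).1,
        st.2 + (runPhase (A.phaseInput c X (i + 1) st.1) gradf w.1 w.2).2))
    (b := fun i => A.iters (i + 1) * (A.batch (i + 1) * A.m))
    (fun i st w => Nat.add_le_add_left (runPhase_snd_le _ _ _ _) _) (x₀, 0)
    (fun i => (fun j => D (sel i j), ω i))
  rw [zero_add] at this
  exact this

/-- The data and the randomness of phase `i + 1`. -/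
abbrev PhaseSpace (Z : Type*) (i : Fin A.phases) :=
  (Fin (A.users (i + 1)) → Fin A.m → Z) ×
    PhaseRand (A.iters (i + 1)) (A.batch (i + 1)) (A.users (i + 1)) A.d

/-- The law of the data and of the randomness of phase `i + 1`. -/
def phaseMeasure [MeasurableSpace Z] (c : ℝ) (P : Measure Z) (i : Fin A.phases) :
    Measure (A.PhaseSpace Z i) :=
  (Measure.pi fun _ => Measure.pi fun _ => P).prod
    (phaseLaw (A.iters (i + 1)) (A.batch (i + 1)) (A.users (i + 1)) A.d A.ε (A.sigma c (i + 1)))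

/-- The phases with outlier removal. -/
def phaseStep (c : ℝ) (X : Set (Vec A.d)) (g : Vec A.d → Z → Vec A.d) (i : Fin A.phases)
    (x : Vec A.d) (w : A.PhaseSpace Z i) : Vec A.d :=
  removalRun (A.phaseInput c X (i + 1) x) g w.1 w.2

/-- The data of a phase are moved into its driving randomness. The given gradient field may be
replaced by any other that agrees with it on X, because all iterates stay in X. -/
lemma phasedERM_fst {c : ℝ} {X : Set (Vec A.d)} (hI : ∀ i, ∀ x ∈ X, (A.phaseInput c X i x).Valid)
    (h0 : (0 : Vec A.d) ∈ X) {gradf g : Vec A.d → Z → Vec A.d}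
    (hg : ∀ x ∈ X, ∀ z, gradf x z = g x z) {x₀ : Vec A.d} (hx₀ : x₀ ∈ X) (sel : A.Selection)
    (D : A.Data Z) (ω : A.Rand) :
    (A.phasedERM c X gradf x₀ sel D ω).1 =
      chain (A.phaseStep c X g) x₀ (fun i => (fun j => D (sel i j), ω i)) := by
  have := chain_rel
    (f := fun (i : Fin A.phases) (st : Vec A.d × ℕ) (w : A.PhaseSpace Z i) =>
      ((runPhase (A.phaseInput c X (i + 1) st.1) gradf w.1 w.2).1,
        st.2 + (runPhase (A.phaseInput c X (i + 1) st.1) gradf w.1 w.2).2))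
    (f' := A.phaseStep c X g) (R := fun st x => st.1 = x ∧ x ∈ X) (s := (x₀, 0)) (s' := x₀)
    ⟨rfl, hx₀⟩ (fun i => (fun j => D (sel i j), ω i)) (fun i => (fun j => D (sel i j), ω i)) (by
      rintro i st _ ⟨rfl, hx⟩
      refine ⟨?_, removalRun_mem (hI _ _ hx) h0 _ _⟩
      simp only [runPhase_fst, phaseStep]
      exact removalRun_congr (hI _ _ hx) hg _ _)
  exact this.1

lemma isProbabilityMeasure_phaseMeasure [MeasurableSpace Z] (c : ℝ) (P : Measure Z)
    [IsProbabilityMeasure P] (hε : 0 < A.ε) {i : Fin A.phases} (hN : 0 < A.users (i + 1)) :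
    IsProbabilityMeasure (A.phaseMeasure c P i) := by
  have := isProbabilityMeasure_phaseLaw (T := A.iters (i + 1)) (K := A.batch (i + 1)) (d := A.d)
    hN hε (A.sigma c (i + 1))
  unfold phaseMeasure
  infer_instance

/-- This is where disjointness of the user sets enters: it makes the phases independent, so a phase
may be analysed from a fixed starting point. -/
lemma measurePreserving_jointLaw [MeasurableSpace Z] (c : ℝ) (P : Measure Z)
    [IsProbabilityMeasure P] (hε : 0 < A.ε) (hN : ∀ i : Fin A.phases, 0 < A.users (i + 1))
    {sel : A.Selection} (hsel : A.IsDisjoint sel) :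
    MeasurePreserving (fun (W : A.Data Z × A.Rand) i =>
        ((fun j => W.1 (sel i j), W.2 i) : A.PhaseSpace Z i))
      (A.jointLaw c P) (Measure.pi (A.phaseMeasure c P)) := by
  have hp : ∀ i : Fin A.phases, IsProbabilityMeasure (phaseLaw (A.iters (i + 1)) (A.batch (i + 1))
      (A.users (i + 1)) A.d A.ε (A.sigma c (i + 1))) := fun i =>
    isProbabilityMeasure_phaseLaw (hN i) hε _
  have h1 := measurePreserving_piSelect (Measure.pi fun _ : Fin A.m => P) hsel
  have : IsProbabilityMeasure (A.randLaw c) := by unfold randLaw; infer_instance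
  have h2 := h1.prod (MeasurePreserving.id (A.randLaw c))
  have h3 := measurePreserving_piProd
    (fun i : Fin A.phases => Measure.pi fun _ : Fin (A.users (i + 1)) => Measure.pi
      fun _ : Fin A.m => P)
    (fun i : Fin A.phases => phaseLaw (A.iters (i + 1)) (A.batch (i + 1))
      (A.users (i + 1)) A.d A.ε (A.sigma c (i + 1)))
  exact h3.comp h2

end Params

/-! ### Composition of the clipped phases for the given parameters -/

namespace Params

variable (A : Params) {Z : Type*} [MeasurableSpace Z] {P : Measure Z} [IsProbabilityMeasure P]
  {X : Set (Vec A.d)} {f : Vec A.d → Z → ℝ} {g : Vec A.d → Z → Vec A.d} {c : ℝ} {pb : ℕ → ℝ}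

/-- The number of stages of each phase. -/
def stages : ℕ := ⌈4 * Real.logb 2 (A.n * A.m)⌉₊

/-- Bound for the expected squared distance of the output of phase `i` to the regularized empirical
risk minimizer, if users are outliers in phase `i` with probability at most `pb i`. -/
def errSq (c : ℝ) (pb : ℕ → ℝ) : ℕ → ℝ
  | 0 => A.R ^ 2
  | i + 1 => 2 / A.lamPh (i + 1) * (A.L * A.R / 8 ^ A.stages
      + 2 * (2 * (A.tau c ^ 2 / A.batch (i + 1) + A.d * A.sigma c (i + 1) ^ 2)
          / (A.lamPh (i + 1) * A.stageLen (i + 1))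
        + A.R * (A.iters (i + 1) * (2 * A.L * pb (i + 1)))))

/-- Bound for the probability that outlier removal acts in phase `i`. -/
def failProb (pb : ℕ → ℝ) (i : ℕ) : ℝ :=
  Real.exp (-(A.batch i * A.ε / 80))
    + A.iters i * (A.users i * pb i + Real.exp (-(A.batch i * A.ε / 160)))

/-- The parameters are such that users are outliers in phase `i` with probability at most `pb i`. -/
def OutlierBound (P : Measure Z) (X : Set (Vec A.d)) (g : Vec A.d → Z → Vec A.d) (c : ℝ)
    (pb : ℕ → ℝ) : Prop :=
  ∀ i : Fin A.phases, ∀ x ∈ X, ∀ t < A.iters (i + 1), ∀ j : Fin (A.users (i + 1)),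
    ∫ D : Fin (A.users (i + 1)) → Fin A.m → Z,
      (∫ ω, outlierAt P g (A.phaseInput c X (i + 1) x) (A.tau c) t (D j)
        (batchRun (A.phaseInput c X (i + 1) x) (fun l => clipGrad P g (A.tau c) (D l)) t ω)
          ∂(Measure.pi fun _ : Fin t =>
            stepLaw (A.batch (i + 1)) (A.users (i + 1)) A.d A.ε (A.sigma c (i + 1))))
        ∂(Measure.pi fun _ => Measure.pi fun _ => P) ≤ pb (i + 1)

variable {A}

lemma lamPh_pos (h : 0 < A.lam) (i : ℕ) : 0 < A.lamPh i := by
  unfold lamPh; positivity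

lemma valid_phaseInput (H : GlobalLoss X f g A.L A.β A.R) (hl : 0 < A.lam) (i : ℕ) {x : Vec A.d}
    (hx : x ∈ X) : (A.phaseInput c X i x).Valid :=
  ⟨H.convex, H.compact, hx, H.β_nonneg, lamPh_pos hl i⟩

/-- The phases on clipped gradients. -/
def clipStep (A : Params) (P : Measure Z) (c : ℝ) (X : Set (Vec A.d)) (g : Vec A.d → Z → Vec A.d)
    (i : Fin A.phases) (x : Vec A.d) (w : A.PhaseSpace Z i) : Vec A.d :=
  clipRun P (A.phaseInput c X (i + 1) x) g w.1 w.2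

/-- The regularized empirical risk minimizers of the phases. -/
def ermStep {Z : Type*} (A : Params) (X : Set (Vec A.d)) (f : Vec A.d → Z → ℝ) (i : Fin A.phases)
    (x : Vec A.d) (w : A.PhaseSpace Z i) : Vec A.d :=
  erm X f (A.lamPh (i + 1)) (samples w.1) x

lemma measurable_phaseStep (H : GlobalLoss X f g A.L A.β A.R) (hl : 0 < A.lam) (i : Fin A.phases) :
    Measurable fun p : Vec A.d × A.PhaseSpace Z i => A.phaseStep c X g i p.1 p.2 := by
  have h1 := H.measurable_removalRun (T := A.iters (i + 1)) (K := A.batch (i + 1))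
    (N := A.users (i + 1)) (m := A.m) (valid_phaseInput (c := c) H hl (i + 1) H.zero_mem)
  have h2 := h1.comp (f := fun p : Vec A.d × A.PhaseSpace Z i => (p.1, p.2.1, p.2.2))
    (by fun_prop)
  exact h2

lemma measurable_clipStep (H : GlobalLoss X f g A.L A.β A.R) (hl : 0 < A.lam) (i : Fin A.phases) :
    Measurable fun p : Vec A.d × A.PhaseSpace Z i => A.clipStep P c X g i p.1 p.2 := by
  have h1 := H.measurable_clipRun (K := A.batch (i + 1)) (N := A.users (i + 1))
    (m := A.m) P (valid_phaseInput (c := c) H hl (i + 1) H.zero_mem) (A.tau c) (A.iters (i + 1))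
  have h2 := h1.fst.comp (f := fun p : Vec A.d × A.PhaseSpace Z i => ((p.1, p.2.1), p.2.2.2))
    (by fun_prop)
  exact h2

lemma measurable_ermStep (H : GlobalLoss X f g A.L A.β A.R) (hl : 0 < A.lam) (i : Fin A.phases)
    (hN : 0 < A.users (i + 1)) (hm : 0 < A.m) :
    Measurable fun p : Vec A.d × A.PhaseSpace Z i => A.ermStep X f i p.1 p.2 := by
  have : Nonempty (Fin (A.users (i + 1)) × Fin A.m) := ⟨⟨0, hN⟩, ⟨0, hm⟩⟩
  have h1 := H.measurable_erm (ι := Fin (A.users (i + 1)) × Fin A.m) (lamPh_pos hl (i + 1))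
  have h2 := (measurable_samples (Z := Z) (N := A.users (i + 1)) (m := A.m)).comp
    (f := fun p : Vec A.d × A.PhaseSpace Z i => p.2.1) (by fun_prop)
  have h3 := h1.comp (f := fun p : Vec A.d × A.PhaseSpace Z i => (samples p.2.1, p.1))
    (h2.prodMk measurable_fst)
  exact h3

/-- Instance of `GlobalLoss.phase_convergence`; the threshold noise, on which the clipped phase does
not depend, integrates out. -/
lemma integral_clipStep_sub_ermStep_le (H : GlobalLoss X f g A.L A.β A.R) (hl : 0 < A.lam)
    (hε : 0 < A.ε) (hm : 0 < A.m) (i : Fin A.phases) (hN : 0 < A.users (i + 1))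
    (hK : 0 < A.batch (i + 1)) (hτ : 0 ≤ A.tau c) (hs0 : 0 < A.stageLen (i + 1))
    (hs : 32 * ((A.β + A.lamPh (i + 1)) / A.lamPh (i + 1)) ≤ (A.stageLen (i + 1) : ℝ) ^ 2)
    (hpb : A.OutlierBound P X g c pb) {x : Vec A.d} (hx : x ∈ X) :
    ∫ w, ‖A.clipStep P c X g i x w - A.ermStep X f i x w‖ ^ 2 ∂A.phaseMeasure c P i ≤
      A.errSq c pb (i + 1) := by
  have p0 : Nonempty (Fin (A.users (i + 1)) × Fin A.m) := ⟨⟨0, hN⟩, ⟨0, hm⟩⟩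
  have p1 := isProbabilityMeasure_stepLaw (K := A.batch (i + 1)) (d := A.d)
    (σ := A.sigma c (i + 1)) hN hε
  have p2 := isProbabilityMeasure_laplace (b := 8 / A.ε) (by positivity)
  have p3 := isProbabilityMeasure_phaseLaw (T := A.iters (i + 1)) (K := A.batch (i + 1)) (d := A.d)
    hN hε (A.sigma c (i + 1))
  have hv := valid_phaseInput (c := c) H hl (i + 1) hx
  have key := H.phase_convergence (N := A.users (i + 1)) (K := A.batch (i + 1)) (ε := A.ε)
    (σ := A.sigma c (i + 1)) (τ := A.tau c) (pb := pb (i + 1)) P hm hv rfl rfl hN hK hε hτ hs0 hs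
        A.stages
    (hpb i x hx)
  refine le_trans (le_of_eq ?_) key
  have hmeas : Measurable fun w : A.PhaseSpace Z i =>
      ‖A.clipStep P c X g i x w - A.ermStep X f i x w‖ ^ 2 := by
    have h1 := (measurable_clipStep (P := P) (c := c) H hl i).comp
      (f := fun w : A.PhaseSpace Z i => (x, w)) (by fun_prop)
    have h2 := (measurable_ermStep H hl i hN hm).comp
      (f := fun w : A.PhaseSpace Z i => (x, w)) (by fun_prop)
    exact (h1.sub h2).norm.pow_const 2
  have hint : Integrable (fun w : A.PhaseSpace Z i =>
      ‖A.clipStep P c X g i x w - A.ermStep X f i x w‖ ^ 2) (A.phaseMeasure c P i) := by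
    have := A.isProbabilityMeasure_phaseMeasure c P hε hN
    refine Integrable.of_bound hmeas.aestronglyMeasurable (A.R ^ 2)
      (Filter.Eventually.of_forall fun w => ?_)
    rw [Real.norm_of_nonneg (sq_nonneg _)]
    exact pow_le_pow_left₀ (norm_nonneg _) (H.diam _ (batchRun_mem hv _ _ _).1 _
      (H.erm_spec _ _ _).1) 2
  unfold phaseMeasure at hint ⊢
  rw [integral_prod _ hint]
  refine integral_congr_ae (Filter.Eventually.of_forall fun D => ?_)
  have e2 := integral_fun_snd (μ := laplace (8 / A.ε)) (ν := Measure.pi fun _ : Fin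
      (A.iters (i + 1))
    => stepLaw (A.batch (i + 1)) (A.users (i + 1)) A.d A.ε (A.sigma c (i + 1)))
    (fun ω => ‖(batchRun (A.phaseInput c X (i + 1) x) (fun l => clipGrad P g (A.tau c) (D l))
      (A.iters (i + 1)) ω).1 - erm X f (A.lamPh (i + 1)) (samples D) x‖ ^ 2)
  rw [probReal_univ, one_smul] at e2
  exact e2

lemma integral_popLoss_ermStep_le (H : GlobalLoss X f g A.L A.β A.R) (hl : 0 < A.lam)
    (hε : 0 < A.ε) (hm : 0 < A.m) (i : Fin A.phases) (hN : 0 < A.users (i + 1)) (x : Vec A.d)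
    {y : Vec A.d} (hy : y ∈ X) :
    ∫ w, popLoss P f (A.ermStep X f i x w) ∂A.phaseMeasure c P i ≤
      popLoss P f y + A.lamPh (i + 1) / 2 * ‖y - x‖ ^ 2
        + 2 * A.L ^ 2 / (A.lamPh (i + 1) * (A.users (i + 1) * A.m)) := by
  have p0 : Nonempty (Fin (A.users (i + 1)) × Fin A.m) := ⟨⟨0, hN⟩, ⟨0, hm⟩⟩
  have p3 := isProbabilityMeasure_phaseLaw (T := A.iters (i + 1)) (K := A.batch (i + 1)) (d := A.d)
    hN hε (A.sigma c (i + 1))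
  have key := H.integral_popLoss_erm_le (ι := Fin (A.users (i + 1)) × Fin A.m)
    (lamPh_pos hl (i + 1)) P x hy
  have e1 := integral_fun_fst (μ := Measure.pi fun _ : Fin (A.users (i + 1)) => Measure.pi
    fun _ : Fin A.m => P) (ν := phaseLaw (A.iters (i + 1)) (A.batch (i + 1)) (A.users (i + 1)) A.d
    A.ε (A.sigma c (i + 1))) (fun D => popLoss P f (erm X f (A.lamPh (i + 1)) (samples D) x))
  rw [probReal_univ, one_smul] at e1
  refine (le_of_eq e1).trans ?_
  have hme : Measurable fun S : Fin (A.users (i + 1)) × Fin A.m → Z =>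
      popLoss P f (erm X f (A.lamPh (i + 1)) S x) := by
    have := (H.measurable_erm (ι := Fin (A.users (i + 1)) × Fin A.m) (lamPh_pos hl (i + 1))).comp
      (f := fun S : Fin (A.users (i + 1)) × Fin A.m → Z => (S, x)) (by fun_prop)
    exact (H.continuous_popLoss P).measurable.comp this
  rw [← map_samples P, integral_map measurable_samples.aemeasurable hme.aestronglyMeasurable] at key
  simpa using key

/-- Excess risk of the phased algorithm in terms of the errors of its phases. -/
lemma integral_popLoss_phases_le (H : GlobalLoss X f g A.L A.β A.R) (hl : 0 < A.lam)
    (hε : 0 < A.ε) (hm : 0 < A.m) (hN : ∀ i : Fin A.phases, 0 < A.users (i + 1))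
    (hK : ∀ i : Fin A.phases, 0 < A.batch (i + 1)) (hτ : 0 ≤ A.tau c)
    (hs0 : ∀ i : Fin A.phases, 0 < A.stageLen (i + 1))
    (hs : ∀ i : Fin A.phases,
      32 * ((A.β + A.lamPh (i + 1)) / A.lamPh (i + 1)) ≤ (A.stageLen (i + 1) : ℝ) ^ 2)
    (hpb0 : ∀ i, 0 ≤ pb i) (hpb : A.OutlierBound P X g c pb) {x₀ y₀ : Vec A.d} (hx₀ : x₀ ∈ X)
    (hy₀ : y₀ ∈ X) :
    ∫ ω, popLoss P f (chain (A.phaseStep c X g) x₀ ω) ∂Measure.pi (A.phaseMeasure c P) ≤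
      popLoss P f y₀ + ∑ i ∈ Finset.range A.phases, (A.lamPh (i + 1) / 2 * A.errSq c pb i
          + 2 * A.L ^ 2 / (A.lamPh (i + 1) * (A.users (i + 1) * A.m)))
        + A.L * √(A.errSq c pb A.phases)
        + A.L * A.R * ∑ i ∈ Finset.range A.phases, A.failProb pb (i + 1) := by
  have hprob : ∀ i, IsProbabilityMeasure (A.phaseMeasure c P i) := fun i =>
    A.isProbabilityMeasure_phaseMeasure c P hε (hN i)
  have hp0 : ∀ i : Fin A.phases, Nonempty (Fin (A.users (i + 1)) × Fin A.m) := fun i =>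
    ⟨⟨0, hN i⟩, ⟨0, hm⟩⟩
  have hseq : PhaseSequence X (popLoss P f) (A.phaseMeasure c P) (A.clipStep P c X g)
      (A.ermStep X f) (fun i => A.lamPh (i + 1))
      (fun i => 2 * A.L ^ 2 / (A.lamPh (i + 1) * (A.users (i + 1) * A.m))) (A.errSq c pb) :=
    { meas_ideal := fun i => measurable_clipStep H hl i
      meas_hat := fun i => measurable_ermStep H hl i (hN i) hm
      ideal_mem := fun i x hx w => (batchRun_mem (valid_phaseInput H hl (i + 1) hx) _ _ _).1
      hat_mem := fun i x _ w => have := hp0 i; (H.erm_spec _ _ _).1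
      close := fun i x hx => integral_clipStep_sub_ermStep_le H hl hε hm i (hN i) (hK i) hτ (hs0 i)
        (hs i) hpb hx
      erm := fun i x _ y hy => integral_popLoss_ermStep_le H hl hε hm i (hN i) x hy }
  refine hseq.excess_le (real := A.phaseStep c X g) (pf := fun i => A.failProb pb (i + 1))
    (H.continuous_popLoss P) (H.abs_popLoss_le P) H.L_pos.le H.R_pos.le (H.abs_popLoss_sub_le P)
    H.diam (fun i => (lamPh_pos hl _).le) (fun i => measurable_phaseStep H hl i)
    (fun i x hx w => removalRun_mem (valid_phaseInput H hl (i + 1) hx) H.zero_mem _ _)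
    (fun i => ?_) (fun i x hx => ?_) hx₀ hy₀ ?_
  · have := hpb0 (i + 1)
    unfold failProb; positivity
  · exact H.measure_phase_ne_le P (valid_phaseInput (c := c) H hl (i + 1) hx) (hN i) (hK i) hε
      (A.sigma c (i + 1)) (hpb0 _) (hpb i x hx)
  -- The error of the fictitious phase 0 is the squared diameter.
  · exact pow_le_pow_left₀ (norm_nonneg _) (H.diam _ hx₀ _ hy₀) 2

end Params

namespace Params

variable {A : Params}

/-! ### Elementary consequences of the conditions on the parameters -/

/-- The fraction `1 - 2^{-q}`. -/
def gap (A : Params) : ℝ := 1 - (1 / 2 : ℝ) ^ A.q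

namespace Admissible

lemma gap_pos (h : A.Admissible) : 0 < A.gap := by
  have := Real.rpow_lt_one (x := 1 / 2) (by norm_num) (by norm_num) h.q_pos
  unfold gap
  linarith

lemma gap_lt_one (_ : A.Admissible) : A.gap < 1 := by
  have := Real.rpow_pos_of_pos (x := 1 / 2) (by norm_num) A.q
  unfold gap
  linarith

lemma n_pos (h : A.Admissible) : (0 : ℝ) < A.n := by exact_mod_cast h.one_le_n

lemma m_ge (h : A.Admissible) : (1 : ℝ) ≤ A.m := by exact_mod_cast h.one_le_m

lemma d_ge (h : A.Admissible) : (1 : ℝ) ≤ A.d := by exact_mod_cast h.one_le_d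

lemma n_ge (h : A.Admissible) : (1 : ℝ) ≤ A.n := by exact_mod_cast h.one_le_n

lemma log_inv_δ_gt (h : A.Admissible) : Real.log (A.n * A.m) < Real.log (1 / A.δ) := by
  have hn := h.n_pos
  have hm := h.m_ge
  refine Real.log_lt_log (by positivity) ?_
  rw [lt_one_div (by positivity) h.δ_pos]
  have := h.δ_lt
  rwa [mul_comm (A.n : ℝ)]

/-- Privacy requires many users in every phase. -/
lemma users_large' (h : A.Admissible) :
    100 * ((A.ε + 3) / A.ε) / A.gap < (A.n : ℝ) ^ (1 - A.q) := by
  have hn := h.n_ge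
  have hm := h.m_ge
  have hd := h.d_ge
  have hε := h.ε_pos
  have hδ := h.δ_pos
  have hg := h.gap_pos
  refine lt_of_le_of_lt ?_ h.users_large
  have h1 : A.ε + 3 ≤ Real.log (20 * A.n * A.m * A.d * Real.exp A.ε / A.δ) := by
    rw [Real.le_log_iff_exp_le (by positivity), Real.exp_add, le_div_iff₀ hδ]
    have h3 : Real.exp 3 ≤ 20.1 := by
      have := Real.exp_one_lt_d9
      have e : Real.exp 3 = Real.exp 1 ^ 3 := by rw [← Real.exp_nat_mul]; norm_num
      rw [e]
      calc Real.exp 1 ^ 3 ≤ 2.7182818286 ^ 3 := by gcongr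
        _ ≤ 20.1 := by norm_num
    have hδn : A.δ * (A.n * A.m) ≤ 1 := by
      have := h.δ_lt
      rw [lt_div_iff₀ (by positivity), mul_comm (A.m : ℝ)] at this
      exact this.le
    have hnm : (1 : ℝ) ≤ A.n * A.m := one_le_mul_of_one_le_of_one_le hn hm
    have hδ1 : A.δ ≤ 1 := le_trans (le_mul_of_one_le_right hδ.le hnm) hδn
    have hnn : A.δ * 20.1 ≤ 20 * (A.n * A.m * A.d) := by
      have : (1 : ℝ) ≤ A.n * A.m * A.d := one_le_mul_of_one_le_of_one_le hnm hd
      -- Bounding e³ by 20.1 instead of 20 costs something only when nm = 1, and that case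
      -- contradicts the condition on the number of users, whose right side would be 1.
      by_cases h2 : (2 : ℝ) ≤ A.n * A.m
      · nlinarith
      · have h4 : A.n * A.m < 2 := by exact_mod_cast not_le.1 h2
        have h5 : A.n * A.m = 1 := by
          have := h.one_le_n
          have := h.one_le_m
          nlinarith
        exfalso
        have h6 : A.n = 1 := Nat.eq_one_of_mul_eq_one_right h5
        have h7 := h.users_large
        rw [h6] at h7
        simp only [Nat.cast_one, Real.one_rpow] at h7
        rw [div_lt_one (by have := h.gap_pos; unfold gap at this; positivity)] at h7
        have h8 : A.ε ≤ Real.log (20 * 1 * A.m * A.d * Real.exp A.ε / A.δ) := by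
          rw [Real.le_log_iff_exp_le (by positivity), le_div_iff₀ hδ]
          have : (1 : ℝ) ≤ 20 * 1 * A.m * A.d := by nlinarith
          nlinarith [Real.exp_pos A.ε]
        have h9 := h.gap_lt_one
        unfold gap at h9
        nlinarith
    calc Real.exp A.ε * Real.exp 3 * A.δ ≤ Real.exp A.ε * 20.1 * A.δ := by gcongr
      _ = Real.exp A.ε * (A.δ * 20.1) := by ring
      _ ≤ Real.exp A.ε * (20 * (A.n * A.m * A.d)) := by gcongr
      _ = _ := by ring
  have e : 100 * ((A.ε + 3) / A.ε) / A.gap = 100 * (A.ε + 3) / (A.ε * A.gap) := by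
    field_simp
  rw [e]
  unfold gap at hg ⊢
  gcongr

lemma one_lt_rpow (h : A.Admissible) : (100 : ℝ) < A.gap * (A.n : ℝ) ^ (1 - A.q) := by
  have h1 := h.users_large'
  have hg := h.gap_pos
  have hε := h.ε_pos
  rw [div_lt_iff₀ hg] at h1
  have : 1 ≤ (A.ε + 3) / A.ε := by rw [le_div_iff₀ hε]; linarith
  nlinarith

lemma one_lt_ε_mul (h : A.Admissible) : 300 < A.ε * (A.gap * (A.n : ℝ) ^ (1 - A.q)) := by
  have h1 := h.users_large'
  have hg := h.gap_pos
  have hε := h.ε_pos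
  rw [div_lt_iff₀ hg, ← mul_div_assoc, div_lt_iff₀ hε] at h1
  nlinarith

lemma rpow_le_n (h : A.Admissible) : (A.n : ℝ) ^ (1 - A.q) ≤ A.n := by
  have := Real.rpow_le_rpow_of_exponent_le h.n_ge (show 1 - A.q ≤ 1 by linarith [h.q_pos])
  rwa [Real.rpow_one] at this

lemma hundred_lt_n (h : A.Admissible) : (100 : ℝ) < A.n := by
  have h1 := h.one_lt_rpow
  have := h.gap_lt_one
  have := h.rpow_le_n
  have h0 := Real.rpow_pos_of_pos h.n_pos (1 - A.q)
  nlinarith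

lemma one_le_ε_mul_n (h : A.Admissible) : 1 ≤ A.ε * A.n := by
  have h1 := h.one_lt_ε_mul
  have h2 := h.gap_lt_one
  have h3 := h.rpow_le_n
  have hε := h.ε_pos
  have h0 := Real.rpow_pos_of_pos h.n_pos (1 - A.q)
  have : A.gap * (A.n : ℝ) ^ (1 - A.q) ≤ A.n := by nlinarith
  nlinarith

lemma hundred_le_mul (h : A.Admissible) : (100 : ℝ) ≤ A.n * A.m := by
  nlinarith [h.hundred_lt_n, h.m_ge]

lemma four_le_log (h : A.Admissible) : 4 ≤ Real.log (A.n * A.m) := by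
  have h1 := h.hundred_le_mul
  rw [Real.le_log_iff_exp_le (by linarith)]
  have := Real.exp_one_lt_d9
  have e : Real.exp 4 = Real.exp 1 ^ 4 := by rw [← Real.exp_nat_mul]; norm_num
  rw [e]
  calc Real.exp 1 ^ 4 ≤ 2.7182818286 ^ 4 := by gcongr
    _ ≤ 100 := by norm_num
    _ ≤ _ := h1

lemma logFactor_eq (h : A.Admissible) : A.logFactor =
    Real.log (A.n * A.m) + Real.log A.d + Real.log (1 + A.β * A.R / A.L) + Real.log (1 / A.δ) := by
  have hn := h.n_pos
  have hm := h.m_ge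
  have hd := h.d_ge
  have hδ := h.δ_pos
  have hb : 0 ≤ A.β * A.R / A.L := by
    have := h.β_nonneg; have := h.R_pos; have := h.L_pos; positivity
  unfold logFactor
  rw [← Real.log_mul (by positivity) (by positivity), ← Real.log_mul (by positivity)
      (by positivity),
    ← Real.log_mul (by positivity) (by positivity), mul_one_div]

lemma kappa_nonneg (h : A.Admissible) : 0 ≤ A.β * A.R / A.L := by
  have := h.β_nonneg; have := h.R_pos; have := h.L_pos; positivity

lemma log_d_nonneg (h : A.Admissible) : 0 ≤ Real.log A.d := Real.log_nonneg h.d_ge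

lemma log_kappa_nonneg (h : A.Admissible) : 0 ≤ Real.log (1 + A.β * A.R / A.L) :=
  Real.log_nonneg (by linarith [h.kappa_nonneg])

lemma eight_le_logFactor (h : A.Admissible) : 8 ≤ A.logFactor := by
  rw [h.logFactor_eq]
  linarith [h.four_le_log, h.log_inv_δ_gt, h.log_d_nonneg, h.log_kappa_nonneg]

lemma one_le_log_inv_δ (h : A.Admissible) : 1 ≤ Real.log (1 / A.δ) := by
  linarith [h.four_le_log, h.log_inv_δ_gt]

lemma two_pow_phases_le (h : A.Admissible) : (2 : ℝ) ^ A.phases ≤ A.n := by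
  exact_mod_cast Nat.pow_log_le_self 2 (Nat.one_le_iff_ne_zero.1 h.one_le_n)

lemma n_lt_two_pow (_ : A.Admissible) : (A.n : ℝ) < 2 * 2 ^ A.phases := by
  have := Nat.lt_pow_succ_log_self (b := 2) (by norm_num) A.n
  rw [pow_succ, mul_comm] at this
  exact_mod_cast this

lemma phases_le (h : A.Admissible) : (A.phases : ℝ) ≤ 2 * A.logFactor := by
  have h1 := Real.log_le_log (by positivity) h.two_pow_phases_le
  rw [Real.log_pow] at h1
  have h2 := Real.log_two_gt_d9
  have h3 : Real.log A.n ≤ A.logFactor := by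
    rw [h.logFactor_eq, Real.log_mul h.n_pos.ne' (by linarith [h.m_ge])]
    linarith [h.one_le_log_inv_δ, h.log_d_nonneg, h.log_kappa_nonneg, Real.log_nonneg h.m_ge]
  have : (0 : ℝ) ≤ A.phases := Nat.cast_nonneg _
  nlinarith

lemma one_le_phases (h : A.Admissible) : 1 ≤ A.phases := by
  refine Nat.log_pos (by norm_num) ?_
  have := h.hundred_lt_n
  have : 100 < A.n := by exact_mod_cast this
  omega

lemma two_rpow_le (h : A.Admissible) {i : ℕ} (hi : i ≤ A.phases) :
    (2 : ℝ) ^ ((i : ℝ) * A.q) ≤ (A.n : ℝ) ^ A.q := by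
  rw [Real.rpow_mul (by norm_num), Real.rpow_natCast]
  refine Real.rpow_le_rpow (by positivity) ?_ h.q_pos.le
  exact (pow_le_pow_right₀ (by norm_num) hi).trans h.two_pow_phases_le

lemma users_arg_ge (h : A.Admissible) {i : ℕ} (hi : i ≤ A.phases) :
    A.gap * (A.n : ℝ) ^ (1 - A.q) ≤ A.gap * A.n / (2 : ℝ) ^ ((i : ℝ) * A.q) := by
  have hn := h.n_pos
  have hg := h.gap_pos
  rw [Real.rpow_sub hn, Real.rpow_one, ← mul_div_assoc]
  exact div_le_div_of_nonneg_left (by positivity) (by positivity) (h.two_rpow_le hi)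

/-- The rounded quantity exceeds 100 in every phase, because 2^{iq} ≤ n^q there; rounding down loses
far less than half of it. -/
lemma users_ge (h : A.Admissible) {i : ℕ} (hi : i ≤ A.phases) :
    A.gap * A.n / (2 : ℝ) ^ ((i : ℝ) * A.q) / 2 ≤ A.users i := by
  have h1 := h.users_arg_ge hi
  have h2 := h.one_lt_rpow
  have h3 := Nat.lt_floor_add_one (A.gap * A.n / (2 : ℝ) ^ ((i : ℝ) * A.q))
  have e : A.users i = ⌊A.gap * A.n / (2 : ℝ) ^ ((i : ℝ) * A.q)⌋₊ := rfl
  rw [e]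
  linarith

lemma fifty_le_users (h : A.Admissible) {i : ℕ} (hi : i ≤ A.phases) : (50 : ℝ) ≤ A.users i := by
  linarith [h.users_arg_ge hi, h.one_lt_rpow, h.users_ge hi]

lemma users_le (h : A.Admissible) (i : ℕ) : (A.users i : ℝ) ≤ A.n := by
  have hn := h.n_pos
  have hg := h.gap_pos
  have h0 : (1 : ℝ) ≤ (2 : ℝ) ^ ((i : ℝ) * A.q) :=
    Real.one_le_rpow (by norm_num) (mul_nonneg (Nat.cast_nonneg _) h.q_pos.le)
  have h1 : (A.users i : ℝ) ≤ A.gap * A.n / (2 : ℝ) ^ ((i : ℝ) * A.q) :=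
    Nat.floor_le (by positivity)
  refine h1.trans ?_
  rw [div_le_iff₀ (by positivity)]
  nlinarith [h.gap_lt_one]

lemma base_pos (h : A.Admissible) : 0 < 1 / √(A.n * A.m : ℝ) := by
  have := h.n_pos; have := h.m_ge; positivity

lemma noise_pos (h : A.Admissible) : 0 < √(A.d : ℝ) / (A.ε * A.n * √(A.m : ℝ)) := by
  have := h.n_pos; have := h.m_ge; have := h.d_ge; have := h.ε_pos; positivity

lemma lam_pos (h : A.Admissible) : 0 < A.lam := by
  have := h.L_pos; have := h.R_pos; have := h.base_pos; have := h.noise_pos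
  unfold lam; positivity

lemma lam_ge_base (h : A.Admissible) : A.L / A.R * (1 / √(A.n * A.m : ℝ)) ≤ A.lam := by
  have := h.L_pos; have := h.R_pos; have := h.noise_pos
  unfold lam; gcongr; linarith

lemma lam_ge_noise (h : A.Admissible) :
    A.L / A.R * (√(A.d : ℝ) / (A.ε * A.n * √(A.m : ℝ))) ≤ A.lam := by
  have := h.L_pos; have := h.R_pos; have := h.base_pos
  unfold lam; gcongr; linarith

lemma lam_mul_sq_le (h : A.Admissible) : A.lam * A.R ^ 2 ≤ A.L * A.R * A.rate := by
  have hL := h.L_pos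
  have hR := h.R_pos
  have hε := h.ε_pos
  have hn := h.n_pos
  have e : A.lam * A.R ^ 2 = A.L * A.R * (1 / √(A.n * A.m : ℝ)
      + √(A.d : ℝ) / (A.ε * A.n * √(A.m : ℝ))) := by
    unfold lam; field_simp
  rw [e, rate, mul_comm (A.m : ℝ) A.n]
  gcongr
  have := h.one_le_log_inv_δ
  nlinarith [h.d_ge]

lemma p_ge (h : A.Admissible) : 3 * A.q + 2.5 ≤ A.p := by
  have h1 := h.p_large
  have h2 : 0 ≤ Real.logb A.n √(A.m : ℝ) := by
    refine Real.logb_nonneg (by linarith [h.hundred_lt_n]) ?_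
    rw [Real.one_le_sqrt]
    exact h.m_ge
  linarith

/-- The summand log_n √m in the lower bound for p becomes a factor √m here; the last phase needs it
to beat the total number of samples. -/
lemma n_rpow_p_ge (h : A.Admissible) :
    (A.n : ℝ) ^ (2.5 : ℝ) * √(A.m : ℝ) ≤ (A.n : ℝ) ^ (A.p - A.q) := by
  have hn := h.n_pos
  have hm := h.m_ge
  have h1 : (A.n : ℝ) ^ Real.logb A.n √(A.m : ℝ) = √(A.m : ℝ) :=
    Real.rpow_logb hn (by linarith [h.hundred_lt_n]) (by positivity)
  rw [← h1, ← Real.rpow_add hn]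
  refine Real.rpow_le_rpow_of_exponent_le h.n_ge ?_
  linarith [h.p_large, h.q_pos]

end Admissible

end Params

namespace Params

variable {A : Params}

/-! ### Length of the phases and size of the batches -/

/-- The argument of the logarithm in the size of the batches. -/
def batchArg (A : Params) (i : ℕ) : ℝ :=
  max ((A.users i : ℝ) ^ 2 * (A.m : ℝ) ^ 2) (A.iters i) * Real.exp A.ε / A.δ

/-- Bound for the probability of an outlier in phase `i`. -/
def outlierProb (A : Params) (i : ℕ) : ℝ := 5 / ((A.n * A.m : ℝ) ^ 6 * (A.iters i : ℝ) ^ 5)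

namespace Admissible

lemma cond_ge_one (h : A.Admissible) (i : ℕ) : 1 ≤ (A.β + A.lamPh i) / A.lamPh i := by
  have := lamPh_pos h.lam_pos i
  rw [one_le_div this]
  linarith [h.β_nonneg]

lemma stageLen_sq_ge (h : A.Admissible) (i : ℕ) :
    32 * ((A.β + A.lamPh i) / A.lamPh i) ≤ (A.stageLen i : ℝ) ^ 2 := by
  have h1 := Nat.le_ceil (4 * √(2 * (A.β + A.lamPh i) / A.lamPh i))
  have h2 := pow_le_pow_left₀ (by positivity) h1 2
  have h3 := h.cond_ge_one i
  rw [mul_pow, mul_div_assoc, Real.sq_sqrt (by linarith)] at h2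
  unfold stageLen
  rw [mul_div_assoc]
  linarith

lemma stageLen_pos (h : A.Admissible) (i : ℕ) : 0 < A.stageLen i := by
  rcases Nat.eq_zero_or_pos (A.stageLen i) with h0 | h0
  · have := h.stageLen_sq_ge i
    rw [h0] at this
    norm_num at this
    linarith [h.cond_ge_one i]
  · exact h0

lemma stageLen_le (h : A.Admissible) (i : ℕ) :
    (A.stageLen i : ℝ) ≤ 7 * √((A.β + A.lamPh i) / A.lamPh i) := by
  have h1 := (Nat.ceil_lt_add_one (show 0 ≤ 4 * √(2 * (A.β + A.lamPh i) / A.lamPh i) by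
    positivity)).le
  have h3 : 1 ≤ √((A.β + A.lamPh i) / A.lamPh i) := Real.one_le_sqrt.2 (h.cond_ge_one i)
  rw [mul_div_assoc, Real.sqrt_mul (by norm_num)] at h1
  unfold stageLen
  rw [mul_div_assoc, Real.sqrt_mul (by norm_num)]
  have h4 : √(2 : ℝ) ≤ 1.5 := Real.sqrt_le_iff.2 ⟨by norm_num, by norm_num⟩
  nlinarith

lemma four_logb_le_stages (_ : A.Admissible) :
    4 * (Real.log (A.n * A.m) / Real.log 2) ≤ A.stages := Nat.le_ceil _

lemma four_log_le_stages (h : A.Admissible) : 4 * Real.log (A.n * A.m) ≤ A.stages := by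
  have h1 := h.four_logb_le_stages
  have h2 := Real.log_two_lt_d9
  have h3 := Real.log_two_gt_d9
  have h4 := h.four_le_log
  rw [← mul_div_assoc, div_le_iff₀ (by linarith)] at h1
  have : (0 : ℝ) ≤ A.stages := Nat.cast_nonneg _
  nlinarith

/-- Contraction by 8 per stage reduces the initial gap LR to LR/(nm)⁶, which is negligible
everywhere below. -/
lemma pow_le_eight_pow_stages (h : A.Admissible) : (A.n * A.m : ℝ) ^ 6 ≤ 8 ^ A.stages := by
  have h1 := h.hundred_le_mul
  rw [← Real.log_le_log_iff (by positivity) (by positivity), Real.log_pow, Real.log_pow]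
  have h3 := h.four_log_le_stages
  have h5 : 2 ≤ Real.log 8 := by
    have e : Real.log 8 = 3 * Real.log 2 := by
      rw [show (8 : ℝ) = 2 ^ 3 by norm_num, Real.log_pow]; norm_num
    rw [e]
    linarith [Real.log_two_gt_d9]
  push_cast
  nlinarith [h.four_le_log]

lemma one_le_stages (h : A.Admissible) : (1 : ℝ) ≤ A.stages := by
  linarith [h.four_log_le_stages, h.four_le_log]

lemma stages_le (h : A.Admissible) : (A.stages : ℝ) ≤ 7 * A.logFactor := by
  have h4 := h.four_le_log
  have h3 := Real.log_two_gt_d9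
  have h0 : 0 ≤ 4 * Real.logb 2 (A.n * A.m) :=
    mul_nonneg (by norm_num) (div_nonneg (by linarith) (by linarith))
  have h1 := (Nat.ceil_lt_add_one h0).le
  have h2 : Real.logb 2 (A.n * A.m) ≤ 1.5 * Real.log (A.n * A.m) := by
    unfold Real.logb
    rw [div_le_iff₀ (by linarith)]
    nlinarith
  have h5 := h.logFactor_eq
  have : (A.stages : ℝ) ≤ 4 * Real.logb 2 (A.n * A.m) + 1 := h1
  linarith [h.log_inv_δ_gt, h.log_d_nonneg, h.log_kappa_nonneg]

lemma iters_eq (_ : A.Admissible) (i : ℕ) : (A.iters i : ℝ) = A.stages * A.stageLen i := by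
  unfold iters stages
  push_cast
  rfl

lemma one_le_iters (h : A.Admissible) (i : ℕ) : (1 : ℝ) ≤ A.iters i := by
  rw [h.iters_eq]
  have : (1 : ℝ) ≤ A.stageLen i := by exact_mod_cast h.stageLen_pos i
  nlinarith [h.one_le_stages]

lemma p_pos (h : A.Admissible) : 0 < A.p := by linarith [h.p_ge, h.q_pos]

lemma lamPh_mono (h : A.Admissible) {i j : ℕ} (hij : i ≤ j) : A.lamPh i ≤ A.lamPh j := by
  have := h.lam_pos
  have := h.p_pos
  unfold lamPh
  gcongr
  norm_num

lemma lam_le_lamPh (h : A.Admissible) (i : ℕ) : A.lam ≤ A.lamPh i := by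
  have := h.lamPh_mono (Nat.zero_le i)
  simpa [lamPh] using this

lemma cond_anti (h : A.Admissible) {i j : ℕ} (hij : i ≤ j) :
    (A.β + A.lamPh j) / A.lamPh j ≤ (A.β + A.lamPh i) / A.lamPh i := by
  have h1 := lamPh_pos h.lam_pos i
  have h2 := lamPh_pos h.lam_pos j
  rw [add_div, add_div, div_self h1.ne', div_self h2.ne']
  have := h.β_nonneg
  have := h.lamPh_mono hij
  gcongr

lemma iters_anti (h : A.Admissible) {i j : ℕ} (hij : i ≤ j) : (A.iters j : ℝ) ≤ A.iters i := by
  rw [h.iters_eq, h.iters_eq]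
  have : A.stageLen j ≤ A.stageLen i := by
    unfold stageLen
    refine Nat.ceil_mono ?_
    rw [mul_div_assoc, mul_div_assoc]
    have := h.cond_anti hij
    gcongr
  gcongr

lemma iters_le (h : A.Admissible) (i : ℕ) :
    (A.iters i : ℝ) ≤ 49 * A.logFactor * √((A.β + A.lam) / A.lam) := by
  have h1 := h.stages_le
  have h2 := h.stageLen_le i
  have h3 := h.cond_anti (Nat.zero_le i)
  have e : A.lamPh 0 = A.lam := by simp [lamPh]
  rw [e] at h3
  have h4 := Real.sqrt_le_sqrt h3
  rw [h.iters_eq]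
  calc (A.stages : ℝ) * A.stageLen i
      ≤ 7 * A.logFactor * (7 * √((A.β + A.lam) / A.lam)) := by
        refine mul_le_mul h1 (h2.trans (by linarith)) (Nat.cast_nonneg _) ?_
        linarith [h.eight_le_logFactor]
    _ = _ := by ring

/-- Since λ ≥ (L/R)/√(nm), the condition number is at most √(nm)(1 + βR/L), so the iteration count
is polynomial in quantities inside Λ. Its own prefactor 49Λ is absorbed using Λ ≥ 8. -/
lemma log_iters_le (h : A.Admissible) (i : ℕ) : Real.log (A.iters i) ≤ 2 * A.logFactor := by
  have hΛ := h.eight_le_logFactor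
  have hl := h.lam_pos
  have hnm := h.hundred_le_mul
  have hk := h.kappa_nonneg
  have h1 : (A.β + A.lam) / A.lam ≤ √(A.n * A.m : ℝ) * (1 + A.β * A.R / A.L) := by
    have hs : 1 ≤ √(A.n * A.m : ℝ) := Real.one_le_sqrt.2 (by linarith)
    have h2 : A.β / A.lam ≤ √(A.n * A.m : ℝ) * (A.β * A.R / A.L) := by
      have hL := h.L_pos
      have hR := h.R_pos
      have h3 := h.lam_ge_base
      have hβ := h.β_nonneg
      rw [div_le_iff₀ hl]
      calc A.β = √(A.n * A.m : ℝ) * (A.β * A.R / A.L) * (A.L / A.R * (1 / √(A.n * A.m : ℝ))) := by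
            field_simp
        _ ≤ _ := by gcongr
    rw [add_div, div_self hl.ne']
    nlinarith
  have h2 := h.iters_le i
  have h3 : (A.β + A.lam) / A.lam ≤ (A.n * A.m : ℝ) * (1 + A.β * A.R / A.L) := by
    refine h1.trans ?_
    gcongr
    exact Real.sqrt_le_iff.2 ⟨by linarith, by nlinarith⟩
  have h4 : (A.iters i : ℝ) ≤ 49 * A.logFactor * (A.n * A.m * (1 + A.β * A.R / A.L)) := by
    refine h2.trans ?_
    have : 1 ≤ A.n * A.m * (1 + A.β * A.R / A.L) := by nlinarith
    gcongr
    exact Real.sqrt_le_iff.2 ⟨by linarith, h3.trans (by nlinarith)⟩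
  have h5 := Real.log_le_log (by linarith [h.one_le_iters i]) h4
  rw [Real.log_mul (by positivity) (by positivity),
    Real.log_mul (x := (A.n * A.m : ℝ)) (by positivity) (by positivity)] at h5
  have h6 : Real.log (49 * A.logFactor) ≤ A.logFactor := by
    rw [Real.log_le_iff_le_exp (by positivity)]
    have e1 : Real.exp A.logFactor = Real.exp (A.logFactor / 4) ^ 4 := by
      rw [← Real.exp_nat_mul]; congr 1; push_cast; ring
    have e2 := Real.add_one_le_exp (A.logFactor / 4)
    have e3 : 3 ≤ A.logFactor / 4 + 1 := by linarith
    have e4 : 7.38 ≤ Real.exp 2 := by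
      have := Real.exp_one_gt_d9
      have e : Real.exp 2 = Real.exp 1 ^ 2 := by rw [← Real.exp_nat_mul]; norm_num
      rw [e]
      calc (7.38 : ℝ) ≤ 2.7182818283 ^ 2 := by norm_num
        _ ≤ _ := by gcongr
    have e5 : Real.exp A.logFactor = Real.exp 8 * Real.exp (A.logFactor - 8) := by
      rw [← Real.exp_add]; congr 1; ring
    have e6 : 2900 ≤ Real.exp 8 := by
      have e : Real.exp 8 = Real.exp 2 ^ 4 := by rw [← Real.exp_nat_mul]; norm_num
      rw [e]
      calc (2900 : ℝ) ≤ 7.38 ^ 4 := by norm_num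
        _ ≤ _ := by gcongr
    have e7 := Real.add_one_le_exp (A.logFactor - 8)
    rw [e5]
    nlinarith
  have h7 := h.logFactor_eq
  linarith [h.one_le_log_inv_δ, h.log_d_nonneg]

/-- The lower bounds feed the failure probabilities, where powers of 1/Q must beat T_i and nm. The
upper bound, relying on ε ≤ 10, feeds the gradient count. -/
lemma one_le_batchArg (h : A.Admissible) (i : ℕ) : 1 / A.δ ≤ A.batchArg i ∧
    Real.log (A.iters i) + Real.log (1 / A.δ) ≤ Real.log (A.batchArg i) ∧
    A.iters i ≤ A.batchArg i ∧ Real.log (A.batchArg i) ≤ 5 * A.logFactor := by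
  have hδ := h.δ_pos
  have hT := h.one_le_iters i
  have he : 1 ≤ Real.exp A.ε := Real.one_le_exp h.ε_pos.le
  set M := max ((A.users i : ℝ) ^ 2 * (A.m : ℝ) ^ 2) (A.iters i) with hM
  have hM1 : (A.iters i : ℝ) ≤ M := le_max_right _ _
  have h1 : A.iters i * (1 / A.δ) ≤ A.batchArg i := by
    unfold batchArg
    rw [mul_one_div]
    gcongr
    nlinarith
  have hδ1 : 1 ≤ 1 / A.δ := by
    have h2 := h.one_le_log_inv_δ
    have h3 := Real.add_one_le_exp (Real.log (1 / A.δ))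
    rw [Real.exp_log (by positivity)] at h3
    linarith
  refine ⟨?_, ?_, ?_, ?_⟩
  · nlinarith
  · rw [← Real.log_mul (by linarith) (by linarith)]
    exact Real.log_le_log (by positivity) h1
  · nlinarith
  · unfold batchArg
    rw [← mul_one_div, Real.log_mul (by positivity) (by positivity),
      Real.log_mul (by linarith) (by positivity), Real.log_exp]
    have h4 : Real.log M ≤ 2 * A.logFactor := by
      rw [hM]
      rcases max_choice ((A.users i : ℝ) ^ 2 * (A.m : ℝ) ^ 2) (A.iters i : ℝ) with h5 | h5
      · rw [h5]
        by_cases h6 : A.users i = 0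
        · rw [h6]; simp
          linarith [h.eight_le_logFactor]
        · have hu : (0 : ℝ) < A.users i := by exact_mod_cast Nat.pos_of_ne_zero h6
          have hm := h.m_ge
          rw [← mul_pow, Real.log_pow]
          have h7 : Real.log (A.users i * A.m) ≤ Real.log (A.n * A.m) :=
            Real.log_le_log (by positivity) (mul_le_mul_of_nonneg_right (h.users_le i)
                (by linarith))
          have h8 := h.logFactor_eq
          push_cast
          linarith [h.one_le_log_inv_δ, h.log_d_nonneg, h.log_kappa_nonneg]
      · rw [h5]
        exact h.log_iters_le i
    have h8 := h.logFactor_eq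
    linarith [h.ε_le, h.four_le_log, h.log_d_nonneg, h.log_kappa_nonneg, h.eight_le_logFactor]

lemma four_le_log_batchArg (h : A.Admissible) (i : ℕ) : 4 ≤ Real.log (A.batchArg i) := by
  have := (h.one_le_batchArg i).2.1
  linarith [Real.log_nonneg (h.one_le_iters i), h.four_le_log, h.log_inv_δ_gt]

lemma batch_ge (_ : A.Admissible) (i : ℕ) : 500 * Real.log (A.batchArg i)
    * (1 / A.ε + A.users i * A.ε / √(A.iters i * Real.log (1 / A.δ))) ≤ A.batch i := by
  have h1 := Nat.le_ceil (500 * Real.log (A.batchArg i)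
    * (1 / A.ε + A.users i * A.ε / √(A.iters i * Real.log (1 / A.δ))))
  refine h1.trans ?_
  unfold batch batchArg
  exact_mod_cast le_max_left _ _

/-- From the summand 1/ε of the batch size: K ε is large enough for all Laplace variables to stay
below K/10. -/
lemma batch_ge_eps (h : A.Admissible) (i : ℕ) :
    500 * Real.log (A.batchArg i) ≤ A.batch i * A.ε := by
  have h1 := h.batch_ge i
  have h2 := h.four_le_log_batchArg i
  have hε := h.ε_pos
  rw [mul_add] at h1
  have h3 : 0 ≤ 500 * Real.log (A.batchArg i) *
    (A.users i * A.ε / √(A.iters i * Real.log (1 / A.δ))) := by positivity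
  have h4 : 500 * Real.log (A.batchArg i) * (1 / A.ε) ≤ A.batch i := by linarith
  rwa [mul_one_div, div_le_iff₀ hε] at h4

/-- From the other summand: even if a user is drawn logarithmically more often than expected, its
weight in the average stays below the noise level. -/
lemma batch_ge_noise (h : A.Admissible) (i : ℕ) :
    500 * Real.log (A.batchArg i) * (A.users i * A.ε) ≤
      A.batch i * (√(A.iters i : ℝ) * √(Real.log (1 / A.δ))) := by
  have h1 := h.batch_ge i
  have h2 := h.four_le_log_batchArg i
  have hε := h.ε_pos
  have hT := h.one_le_iters i
  have hδ := h.one_le_log_inv_δ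
  rw [mul_add, Real.sqrt_mul (by linarith)] at h1
  have h3 : 0 ≤ 500 * Real.log (A.batchArg i) * (1 / A.ε) := by positivity
  have h4 : 500 * Real.log (A.batchArg i) *
    (A.users i * A.ε / (√(A.iters i : ℝ) * √(Real.log (1 / A.δ)))) ≤ A.batch i := by linarith
  rwa [← mul_div_assoc, div_le_iff₀ (by positivity)] at h4

/-- From the second entry of the maximum: a phase draws at least n_i users in total, which keeps the
sampling error at the statistical level. -/
lemma users_le_batch_mul (h : A.Admissible) (i : ℕ) :
    (A.users i : ℝ) ≤ A.batch i * A.iters i := by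
  have h1 := Nat.le_ceil ((A.users i : ℝ) / A.iters i)
  have h2 : (⌈(A.users i : ℝ) / A.iters i⌉₊ : ℝ) ≤ A.batch i := by
    unfold batch
    exact_mod_cast le_max_right _ _
  have := h1.trans h2
  rwa [div_le_iff₀ (by linarith [h.one_le_iters i])] at this

lemma batch_pos (h : A.Admissible) (i : ℕ) : 0 < A.batch i := by
  have h1 := h.batch_ge_eps i
  have h2 := h.four_le_log_batchArg i
  have hε := h.ε_pos
  by_contra h3
  have : A.batch i = 0 := by omega
  rw [this] at h1
  norm_num at h1
  linarith

/-- The logarithm in the threshold. -/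
lemma log_threshold (h : A.Admissible) :
    Real.log (A.n * A.m) ≤ Real.log (max (A.n * A.d * A.m : ℝ) (A.iters 1)) ∧
    Real.log (A.iters 1) ≤ Real.log (max (A.n * A.d * A.m : ℝ) (A.iters 1)) ∧
    Real.log (max (A.n * A.d * A.m : ℝ) (A.iters 1)) ≤ 2 * A.logFactor := by
  have hn := h.n_pos
  have hm := h.m_ge
  have hd := h.d_ge
  have hT := h.one_le_iters 1
  refine ⟨?_, ?_, ?_⟩
  · refine Real.log_le_log (by positivity) (le_trans ?_ (le_max_left _ _))
    nlinarith [mul_pos hn (show (0 : ℝ) < A.m by linarith)]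
  · exact Real.log_le_log (by linarith) (le_max_right _ _)
  · rcases max_choice (A.n * A.d * A.m : ℝ) (A.iters 1 : ℝ) with h5 | h5
    · rw [h5, mul_right_comm, Real.log_mul (by positivity) (by positivity)]
      have h8 := h.logFactor_eq
      linarith [h.one_le_log_inv_δ, h.log_d_nonneg, h.log_kappa_nonneg, h.four_le_log]
    · rw [h5]
      exact h.log_iters_le 1

lemma log_noise (h : A.Admissible) :
    A.ε ≤ Real.log (A.n * A.d * Real.exp A.ε / A.δ) ∧
    Real.log (1 / A.δ) ≤ Real.log (A.n * A.d * Real.exp A.ε / A.δ) ∧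
    Real.log (A.n * A.d * Real.exp A.ε / A.δ) ≤ 3 * A.logFactor := by
  have hn := h.n_pos
  have hm := h.m_ge
  have hd := h.d_ge
  have hδ := h.δ_pos
  have h8 := h.logFactor_eq
  rw [Real.log_mul (by positivity) (by positivity)] at h8
  have h1 := Real.log_nonneg h.n_ge
  have h2 := Real.log_nonneg hm
  have h3 := h.log_d_nonneg
  have e : Real.log (A.n * A.d * Real.exp A.ε / A.δ) =
      Real.log A.n + Real.log A.d + A.ε + Real.log (1 / A.δ) := by
    rw [← mul_one_div, Real.log_mul (by positivity) (by positivity),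
      Real.log_mul (by positivity) (by positivity), Real.log_exp,
      Real.log_mul (by positivity) (by positivity)]
  rw [e]
  refine ⟨?_, ?_, ?_⟩ <;>
  linarith [h.ε_pos, h.ε_le, h.one_le_log_inv_δ, h.eight_le_logFactor, h.log_kappa_nonneg]

lemma tau_pos (h : A.Admissible) {c : ℝ} (hc : 0 < c) : 0 < A.tau c := by
  have := h.L_pos
  have := h.m_ge
  have : 0 < Real.log (max (A.n * A.d * A.m : ℝ) (A.iters 1)) := by
    linarith [h.log_threshold.1, h.four_le_log]
  unfold tau
  positivity

end Admissible

end Params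

/-- The comparison deletes one user, so one other user has to remain. -/
lemma GlobalLoss.integral_outlierAt_le_of_two_le {d m K N : ℕ} {Z : Type*} [MeasurableSpace Z]
    {X : Set (Vec d)} {f : Vec d → Z → ℝ} {g : Vec d → Z → Vec d} {L β R : ℝ} (P : Measure Z)
    [IsProbabilityMeasure P] (H : GlobalLoss X f g L β R) (hm : 1 ≤ m) {τ a : ℝ}
    (hτ : τ = 2 * L * a / √m) (ha : 0 ≤ a) {I : PhaseInput d} (hI : I.Valid) (hN : 2 ≤ N)
    {ε σ h : ℝ} (hε : 0 < ε) (hσ : 0 < σ) (hρ : 2 * τ / K / σ * (2 * ((K : ℝ) / N) + h) ≤ 1)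
    (t : ℕ) (j : Fin N) :
    ∫ D : Fin N → Fin m → Z, (∫ ω, outlierAt P g I τ t (D j)
        (batchRun I (fun l => clipGrad P g τ (D l)) t ω)
          ∂(Measure.pi fun _ : Fin t => stepLaw K N d ε σ))
        ∂(Measure.pi fun _ => Measure.pi fun _ => P) ≤
      √((1 + 2 * (2 * τ / K / σ * ((K : ℝ) / N)) ^ 2) ^ t * (2 * Real.exp (1 - a)))
        + t * Real.exp (-h) := by
  obtain ⟨k, rfl⟩ : ∃ k, N = k + 1 := ⟨N - 1, by omega⟩
  exact H.integral_outlierAt_le P hm hτ ha hI (by omega) hε hσ hρ t j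

namespace Params

variable {A : Params}

/-! ### Errors of the phases -/

lemma outlierProb_nonneg (A : Params) (i : ℕ) : 0 ≤ A.outlierProb i := by
  unfold outlierProb; positivity

namespace Admissible

lemma exp_neg_mul_log_le {x y : ℝ} (hx : 1 ≤ x) (hy : 1 ≤ y) {a : ℝ}
    (ha : 6 * (Real.log x + Real.log y) ≤ a) : Real.exp (-a) ≤ 1 / (x ^ 6 * y ^ 6) := by
  have e : Real.exp (6 * (Real.log x + Real.log y)) = x ^ 6 * y ^ 6 := by
    rw [mul_add, Real.exp_add]
    have h1 : ∀ z : ℝ, 1 ≤ z → Real.exp (6 * Real.log z) = z ^ 6 := fun z hz => by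
      rw [show (6 : ℝ) * Real.log z = ((6 : ℕ) : ℝ) * Real.log z by norm_num, Real.exp_nat_mul,
        Real.exp_log (by linarith)]
    rw [h1 x hx, h1 y hy]
  rw [Real.exp_neg, ← one_div, ← e]
  exact one_div_le_one_div_of_le (Real.exp_pos _) (Real.exp_le_exp.2 ha)

/-- The noise dominates the influence of a single user. -/
lemma influence (h : A.Admissible) {c : ℝ} (hc : 0 < c) {i : ℕ} (hN : 0 < (A.users i : ℝ)) :
    2 * A.tau c / A.batch i / A.sigma c i * ((A.batch i : ℝ) / A.users i) ≤
      1 / (500 * √(A.iters i : ℝ)) ∧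
    2 * A.tau c / A.batch i / A.sigma c i *
      (6 * (Real.log (A.n * A.m) + Real.log (A.iters i))) ≤ 1 / 2 := by
  have hτ := h.tau_pos hc
  have hK : (0 : ℝ) < A.batch i := by exact_mod_cast h.batch_pos i
  have hT := h.one_le_iters i
  have hs : 1 ≤ √(A.iters i : ℝ) := Real.one_le_sqrt.2 hT
  obtain ⟨hℓ1, hℓ2, -⟩ := h.log_noise
  have hε := h.ε_pos
  have hδ := h.one_le_log_inv_δ
  set ℓ := Real.log (A.n * A.d * Real.exp A.ε / A.δ) with hℓ
  have hℓ0 : 0 < ℓ := by linarith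
  have hσ : A.sigma c i = 1000 * A.tau c * √(A.iters i : ℝ) * ℓ / (A.ε * A.users i) := rfl
  have e1 : 2 * A.tau c / A.batch i / A.sigma c i =
      A.ε * A.users i / (500 * A.batch i * √(A.iters i : ℝ) * ℓ) := by
    rw [hσ]; field_simp; norm_num
  rw [e1]
  -- The first quantity is 2τ/(σ n_i), free of K, and is small by the definition of σ since ε ≤ ℓ.
  -- The second is the shift caused by an exceptional number of hits and needs the lower bound
  -- `batch_ge_noise`.
  constructor
  · rw [div_mul_div_comm, div_le_div_iff₀ (by positivity) (by positivity)]
    calc A.ε * A.users i * A.batch i * (500 * √(A.iters i : ℝ))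
        ≤ ℓ * A.users i * A.batch i * (500 * √(A.iters i : ℝ)) := by gcongr
      _ = _ := by ring
  · have hb := h.batch_ge_noise i
    obtain ⟨-, hQ, -, -⟩ := h.one_le_batchArg i
    set Q := Real.log (A.batchArg i)
    have hlog : Real.log (A.n * A.m) + Real.log (A.iters i) ≤ Q := by linarith [h.log_inv_δ_gt]
    have hsq : √(Real.log (1 / A.δ)) ≤ ℓ := by
      refine le_trans (Real.sqrt_le_iff.2 ⟨by linarith, ?_⟩) hℓ2
      nlinarith
    rw [div_mul_eq_mul_div, div_le_div_iff₀ (by positivity) (by positivity)]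
    calc A.ε * A.users i * (6 * (Real.log (A.n * A.m) + Real.log (A.iters i))) * 2
        ≤ A.ε * A.users i * (6 * Q) * 2 := by gcongr
      _ ≤ 500 * Q * (A.users i * A.ε) := by
        have : 0 ≤ Q * (A.users i * A.ε) := by
          have := h.four_le_log_batchArg i
          positivity
        nlinarith
      _ ≤ A.batch i * (√(A.iters i : ℝ) * √(Real.log (1 / A.δ))) := hb
      _ ≤ A.batch i * (√(A.iters i : ℝ) * ℓ) := by gcongr
      _ ≤ 1 * (500 * A.batch i * √(A.iters i : ℝ) * ℓ) := by
        have : 0 ≤ (A.batch i : ℝ) * (√(A.iters i : ℝ) * ℓ) := by positivity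
        nlinarith

/-- The change-of-measure factor over a whole phase is at most e, as its excess per iteration is
O(1/T_i). The root contributes 4 and the exceptional hits 1 to the constant 5; summing the latter
over t < T_i lowers the power of T_i from 6 to 5. The condition i ≥ 1 gives T_i ≤ T_1, the value
inside τ. -/
lemma outlier_bound_le (h : A.Admissible) {c : ℝ} (hc : 48 ≤ c) {i : ℕ} (hi : 1 ≤ i)
    (hN : 0 < (A.users i : ℝ)) {t : ℕ} (ht : t < A.iters i) {a : ℝ}
    (ha : a = c * Real.log (max (A.n * A.d * A.m : ℝ) (A.iters 1)) / 2) :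
    √((1 + 2 * (2 * A.tau c / A.batch i / A.sigma c i * ((A.batch i : ℝ) / A.users i)) ^ 2) ^ t
        * (2 * Real.exp (1 - a)))
      + t * Real.exp (-(6 * (Real.log (A.n * A.m) + Real.log (A.iters i)))) ≤ A.outlierProb i := by
  have hT := h.one_le_iters i
  have hnm := h.hundred_le_mul
  obtain ⟨hρ, -⟩ := h.influence (show 0 < c by linarith) hN
  set r := 2 * A.tau c / A.batch i / A.sigma c i * ((A.batch i : ℝ) / A.users i) with hr
  have hr0 : 0 ≤ r := by
    have hτ := h.tau_pos (show 0 < c by linarith)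
    have hσ : 0 ≤ A.sigma c i := by
      have := h.log_noise.1
      have := h.ε_pos
      unfold sigma
      have h0 : 0 ≤ Real.log (A.n * A.d * Real.exp A.ε / A.δ) := by linarith
      positivity
    positivity
  have htT : (t : ℝ) ≤ A.iters i := by exact_mod_cast ht.le
  have hr2 : r ^ 2 ≤ 1 / (250000 * A.iters i) := by
    refine (pow_le_pow_left₀ hr0 hρ 2).trans_eq ?_
    rw [div_pow, mul_pow, Real.sq_sqrt (by linarith)]
    norm_num
  have hpow : (1 + 2 * r ^ 2) ^ t ≤ Real.exp 1 := by
    have h1 : 1 + 2 * r ^ 2 ≤ Real.exp (2 * r ^ 2) := by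
      linarith [Real.add_one_le_exp (2 * r ^ 2)]
    refine (pow_le_pow_left₀ (by positivity) h1 t).trans ?_
    rw [← Real.exp_nat_mul, Real.exp_le_exp]
    have h2 : r ^ 2 * A.iters i ≤ 1 / 250000 := by
      rw [← div_div, le_div_iff₀ (by linarith)] at hr2
      exact hr2
    nlinarith [sq_nonneg r]
  have hsqrt : √((1 + 2 * r ^ 2) ^ t * (2 * Real.exp (1 - a))) ≤ 4 * Real.exp (-(a / 2)) := by
    refine Real.sqrt_le_iff.2 ⟨by positivity, ?_⟩
    have h1 := Real.exp_one_lt_d9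
    have h2 : Real.exp (1 - a) = Real.exp 1 * Real.exp (-(a / 2)) ^ 2 := by
      rw [← Real.exp_nat_mul, ← Real.exp_add]; congr 1; push_cast; ring
    rw [h2]
    calc (1 + 2 * r ^ 2) ^ t * (2 * (Real.exp 1 * Real.exp (-(a / 2)) ^ 2))
        ≤ Real.exp 1 * (2 * (Real.exp 1 * Real.exp (-(a / 2)) ^ 2)) := by gcongr
      _ ≤ 2.7182818286 * (2 * (2.7182818286 * Real.exp (-(a / 2)) ^ 2)) := by gcongr
      _ ≤ _ := by nlinarith [sq_nonneg (Real.exp (-(a / 2)))]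
  obtain ⟨hM1, hM2, -⟩ := h.log_threshold
  have hM3 := Real.log_le_log (by linarith) (h.iters_anti hi)
  set lM := Real.log (max (A.n * A.d * A.m : ℝ) (A.iters 1))
  -- Source of the threshold 48: a/2 = (c/4) log max(ndm, T₁), and each of the two logarithms on the
  -- left is at most log max(ndm, T₁), so c/4 ≥ 12 suffices.
  have ha2 : 6 * (Real.log (A.n * A.m) + Real.log (A.iters i)) ≤ a / 2 := by
    rw [ha]
    nlinarith [h.four_le_log]
  have hb := exp_neg_mul_log_le (x := A.n * A.m) (by linarith) hT ha2
  have hb' := exp_neg_mul_log_le (x := A.n * A.m) (by linarith) hT le_rfl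
  have hle : 1 / ((A.n * A.m : ℝ) ^ 6 * (A.iters i : ℝ) ^ 6) ≤
      1 / ((A.n * A.m : ℝ) ^ 6 * (A.iters i : ℝ) ^ 5) := by
    refine one_div_le_one_div_of_le (by positivity) (mul_le_mul_of_nonneg_left ?_ (by positivity))
    exact pow_le_pow_right₀ hT (by norm_num)
  have heq : (A.iters i : ℝ) * (1 / ((A.n * A.m : ℝ) ^ 6 * (A.iters i : ℝ) ^ 6)) =
      1 / ((A.n * A.m : ℝ) ^ 6 * (A.iters i : ℝ) ^ 5) := by
    have : (0 : ℝ) < A.n * A.m := by linarith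
    field_simp
  have e5 : A.outlierProb i = 5 * (1 / ((A.n * A.m : ℝ) ^ 6 * (A.iters i : ℝ) ^ 5)) := by
    unfold outlierProb; ring
  have hlast : t * Real.exp (-(6 * (Real.log (A.n * A.m) + Real.log (A.iters i)))) ≤
      1 / ((A.n * A.m : ℝ) ^ 6 * (A.iters i : ℝ) ^ 5) := by
    rw [← heq]
    gcongr
  rw [e5]
  linarith

lemma outlierBound (h : A.Admissible) {c : ℝ} (hc : 48 ≤ c) {Z : Type*} [MeasurableSpace Z]
    (P : Measure Z) [IsProbabilityMeasure P] {X : Set (Vec A.d)} {f : Vec A.d → Z → ℝ}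
    {g : Vec A.d → Z → Vec A.d} (H : GlobalLoss X f g A.L A.β A.R) :
    A.OutlierBound P X g c A.outlierProb := by
  intro i x hx t ht j
  have hi : (i : ℕ) + 1 ≤ A.phases := i.is_lt
  have hN := h.fifty_le_users hi
  have hN' : 50 ≤ A.users (i + 1) := by exact_mod_cast hN
  have hv := valid_phaseInput (c := c) H h.lam_pos (i + 1) hx
  have hτ := h.tau_pos (show 0 < c by linarith)
  have hε := h.ε_pos
  have hlM : 0 < Real.log (max (A.n * A.d * A.m : ℝ) (A.iters 1)) := by
    linarith [h.log_threshold.1, h.four_le_log]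
  have hσ : 0 < A.sigma c (i + 1) := by
    have h1 := h.log_noise.1
    have h0 : 0 < Real.log (A.n * A.d * Real.exp A.ε / A.δ) := by linarith
    have h2 := h.one_le_iters (i + 1)
    unfold sigma
    positivity
  have hfin := h.outlier_bound_le hc (Nat.le_add_left 1 i) (by linarith) ht rfl
  obtain ⟨hρ1, hρ2⟩ := h.influence (show 0 < c by linarith) (show 0 < (A.users (i + 1) : ℝ) by
      linarith)
  have hT := h.one_le_iters (i + 1)
  have hρ : 2 * A.tau c / A.batch (i + 1) / A.sigma c (i + 1) * (2 * ((A.batch (i + 1) : ℝ)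
      / A.users (i + 1)) + 6 * (Real.log (A.n * A.m) + Real.log (A.iters (i + 1)))) ≤ 1 := by
    have h1 : 1 / (500 * √(A.iters (i + 1) : ℝ)) ≤ 1 / 500 := by
      have := Real.one_le_sqrt.2 hT
      gcongr
      linarith
    rw [mul_add, mul_left_comm]
    linarith
  exact (H.integral_outlierAt_le_of_two_le (K := A.batch (i + 1)) P h.one_le_m (τ := A.tau c)
    (a := c * Real.log (max (A.n * A.d * A.m : ℝ) (A.iters 1)) / 2)
    (by unfold tau; ring) (by positivity) hv (by omega) hε hσ hρ t j).trans hfin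

end Admissible

end Params

namespace Params

variable {A : Params}

/-! ### Excess risk -/

/-- The factor in the bound for the errors of the phases. -/
def errFactor (A : Params) (c : ℝ) : ℝ := 5 * 10 ^ 9 * c ^ 2 * A.logFactor ^ 5 / A.gap ^ 2

namespace Admissible

/-- With Q the argument of the logarithm in K_i, both Laplace contributions are at most 1/Q ≤ δ ≤
1/(nm), since K_i ε ≥ 500 log Q and T_i ≤ Q; the outliers contribute 5/(nm). -/
lemma failProb_le (h : A.Admissible) (i : ℕ) :
    A.failProb A.outlierProb i ≤ 7 / √(A.n * A.m : ℝ) := by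
  have hnm := h.hundred_le_mul
  have hT := h.one_le_iters i
  have hn := h.n_ge
  have hm := h.m_ge
  obtain ⟨hQδ, -, hQT, -⟩ := h.one_le_batchArg i
  have hKε := h.batch_ge_eps i
  have hlQ := h.four_le_log_batchArg i
  have hδ := h.δ_pos
  have hQ0 : 0 < A.batchArg i := lt_of_lt_of_le (by positivity) hQδ
  set Q := A.batchArg i with hQ
  have hδ' : 1 / Q ≤ 1 / (A.n * A.m) := by
    refine one_div_le_one_div_of_le (by positivity) (le_trans ?_ hQδ)
    rw [le_div_iff₀ hδ]
    have := h.δ_lt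
    rw [lt_div_iff₀ (by positivity)] at this
    nlinarith
  have hQ1 : 1 ≤ Q := hT.trans hQT
  have h2 : Real.exp (-(A.batch i * A.ε / 160)) ≤ 1 / Q ^ 2 := by
    have e : 1 / Q ^ 2 = Real.exp (-(2 * Real.log Q)) := by
      rw [Real.exp_neg, two_mul, Real.exp_add, Real.exp_log hQ0, one_div, sq]
    rw [e, Real.exp_le_exp]
    linarith
  have h1 : Real.exp (-(A.batch i * A.ε / 80)) ≤ 1 / Q := by
    have e : 1 / Q = Real.exp (-(Real.log Q)) := by
      rw [Real.exp_neg, Real.exp_log hQ0, one_div]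
    rw [e, Real.exp_le_exp]
    linarith
  have h3 : A.iters i * Real.exp (-(A.batch i * A.ε / 160)) ≤ 1 / Q := by
    calc A.iters i * Real.exp (-(A.batch i * A.ε / 160)) ≤ Q * (1 / Q ^ 2) := by gcongr
      _ = 1 / Q := by field_simp
  have h4 : A.iters i * (A.users i * A.outlierProb i) ≤ 5 / (A.n * A.m) := by
    unfold outlierProb
    have hu := h.users_le i
    calc A.iters i * (A.users i * (5 / ((A.n * A.m : ℝ) ^ 6 * (A.iters i : ℝ) ^ 5)))
        ≤ A.iters i * (A.n * A.m * (5 / ((A.n * A.m : ℝ) ^ 6 * (A.iters i : ℝ) ^ 5))) := by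
          gcongr
          nlinarith
      _ = 5 / ((A.n * A.m : ℝ) ^ 5 * (A.iters i : ℝ) ^ 4) := by field_simp
      _ ≤ 5 / (A.n * A.m) := by
          refine div_le_div_of_nonneg_left (by norm_num) (by positivity) ?_
          have h5 : (A.n * A.m : ℝ) ≤ (A.n * A.m : ℝ) ^ 5 := le_self_pow₀ (by linarith)
              (by norm_num)
          have h6 : (1 : ℝ) ≤ (A.iters i : ℝ) ^ 4 := one_le_pow₀ hT
          nlinarith
  have h7 : 1 / (A.n * A.m : ℝ) ≤ 1 / √(A.n * A.m : ℝ) := by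
    refine one_div_le_one_div_of_le (by positivity) (Real.sqrt_le_iff.2 ⟨by linarith, by nlinarith⟩)
  have e7 : 7 / √(A.n * A.m : ℝ) = 7 * (1 / √(A.n * A.m : ℝ)) := by ring
  have e5 : 5 / (A.n * A.m : ℝ) = 5 * (1 / (A.n * A.m)) := by ring
  rw [e7]
  rw [e5] at h4
  unfold failProb
  rw [mul_add]
  linarith

/-- The two summands of λ give two upper bounds for L. This one pays for sampling and
generalization, `L_sq_le_noise` for the Gaussian noise. -/
lemma L_le_base (h : A.Admissible) : A.L ≤ A.lam * A.R * √(A.n * A.m : ℝ) := by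
  have h1 := h.lam_ge_base
  have hR := h.R_pos
  have hs : 0 < √(A.n * A.m : ℝ) := Real.sqrt_pos.2 (by linarith [h.hundred_le_mul])
  rw [mul_one_div, div_div, div_le_iff₀ (by positivity)] at h1
  linarith

lemma L_sq_le_base (h : A.Admissible) : A.L ^ 2 ≤ A.n * A.m * (A.lam ^ 2 * A.R ^ 2) := by
  have h1 := pow_le_pow_left₀ h.L_pos.le h.L_le_base 2
  rw [mul_pow, Real.sq_sqrt (by linarith [h.hundred_le_mul])] at h1
  linarith

lemma L_sq_le_noise (h : A.Admissible) :
    A.d * A.L ^ 2 ≤ A.ε ^ 2 * A.n ^ 2 * A.m * (A.lam ^ 2 * A.R ^ 2) := by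
  have h1 := h.lam_ge_noise
  have hR := h.R_pos
  have hε := h.ε_pos
  have hn := h.n_pos
  have hm := h.m_ge
  have hL := h.L_pos
  rw [div_mul_div_comm, div_le_iff₀ (by positivity)] at h1
  have h2 := pow_le_pow_left₀ (by positivity) h1 2
  have e1 : (A.L * √(A.d : ℝ)) ^ 2 = A.d * A.L ^ 2 := by
    rw [mul_pow, Real.sq_sqrt (by positivity)]; ring
  have e2 : (A.lam * (A.R * (A.ε * A.n * √(A.m : ℝ)))) ^ 2 =
      A.ε ^ 2 * A.n ^ 2 * A.m * (A.lam ^ 2 * A.R ^ 2) := by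
    have := Real.sq_sqrt (show (0 : ℝ) ≤ A.m by linarith)
    calc _ = A.ε ^ 2 * A.n ^ 2 * √(A.m : ℝ) ^ 2 * (A.lam ^ 2 * A.R ^ 2) := by ring
      _ = _ := by rw [this]
  rwa [e1, e2] at h2

/-- The regularization grows faster than the number of users of the phases drops. -/
lemma users_mul_lamPh_ge (h : A.Admissible) {i : ℕ} (hi : i ≤ A.phases) :
    A.gap * A.n * A.lam * (2 : ℝ) ^ ((A.p - 2 * A.q) * i) / 2 ≤ A.users i * A.lamPh i ∧
    A.gap ^ 2 * A.n ^ 2 * A.lam * (2 : ℝ) ^ ((A.p - 2 * A.q) * i) / 4 ≤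
      (A.users i : ℝ) ^ 2 * A.lamPh i := by
  have hu := h.users_ge hi
  have hg := h.gap_pos
  have hn := h.n_pos
  have hl := h.lam_pos
  set u := (2 : ℝ) ^ ((i : ℝ) * A.q) with hu'
  have hu1 : 1 ≤ u := Real.one_le_rpow (by norm_num) (mul_nonneg (Nat.cast_nonneg _) h.q_pos.le)
  set v := (2 : ℝ) ^ ((A.p - 2 * A.q) * i) with hv
  have hv0 : 0 < v := by positivity
  -- Written as 2^{pi} = 2^{(p-2q)i}(2^{iq})²: the square compensates the drop of n_i², leaving
  -- growth at rate p - 2q.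
  have e : A.lamPh i = A.lam * (v * u ^ 2) := by
    unfold lamPh
    rw [hv, hu', sq, ← Real.rpow_add (by norm_num), ← Real.rpow_add (by norm_num)]
    congr 2
    ring
  rw [e]
  constructor
  · calc A.gap * A.n * A.lam * v / 2 ≤ A.gap * A.n * A.lam * v / 2 * u :=
          le_mul_of_one_le_right (by positivity) hu1
      _ = A.gap * A.n / u / 2 * (A.lam * (v * u ^ 2)) := by field_simp
      _ ≤ _ := by gcongr
  · calc A.gap ^ 2 * A.n ^ 2 * A.lam * v / 4
        = (A.gap * A.n / u / 2) ^ 2 * (A.lam * (v * u ^ 2)) := by field_simp; norm_num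
      _ ≤ _ := by gcongr

lemma tau_sq (h : A.Admissible) (c : ℝ) :
    A.tau c ^ 2 ≤ 4 * c ^ 2 * A.logFactor ^ 2 * A.L ^ 2 / A.m := by
  have hm := h.m_ge
  obtain ⟨h1, -, h2⟩ := h.log_threshold
  have h0 := h.four_le_log
  unfold tau
  rw [div_pow, Real.sq_sqrt (by linarith)]
  have h3 : Real.log (max (A.n * A.d * A.m : ℝ) (A.iters 1)) ^ 2 ≤ (2 * A.logFactor) ^ 2 :=
    pow_le_pow_left₀ (by linarith) h2 2
  gcongr
  calc (c * A.L * Real.log (max (A.n * A.d * A.m : ℝ) (A.iters 1))) ^ 2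
      = c ^ 2 * A.L ^ 2 * Real.log (max (A.n * A.d * A.m : ℝ) (A.iters 1)) ^ 2 := by ring
    _ ≤ c ^ 2 * A.L ^ 2 * (2 * A.logFactor) ^ 2 := by gcongr
    _ = _ := by ring

/-- The sampling error of a phase. -/
lemma sampling_error_le (h : A.Admissible) (c : ℝ) {i : ℕ} (hi : i ≤ A.phases) :
    A.tau c ^ 2 / A.batch i / (A.lamPh i * A.stageLen i) ≤
      56 * c ^ 2 * A.logFactor ^ 3 / A.gap
        * (A.lam * A.R ^ 2 / (2 : ℝ) ^ ((A.p - 2 * A.q) * i)) := by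
  have hn := h.n_pos
  have hm := h.m_ge
  have hg := h.gap_pos
  have hl := h.lam_pos
  have hli := lamPh_pos hl i
  have hK : (0 : ℝ) < A.batch i := by exact_mod_cast h.batch_pos i
  have hN₀ : (0 : ℝ) < A.stageLen i := by exact_mod_cast h.stageLen_pos i
  have hu : (0 : ℝ) < A.users i := by linarith [h.fifty_le_users hi]
  have hΛ : 0 < A.logFactor := by linarith [h.eight_le_logFactor]
  have hS := h.stages_le
  -- Since K_i T_i ≥ n_i and T_i is the number of stages times their length, the product of K_i and
  -- the stage length is n_i up to a logarithm.
  have h1 := h.users_le_batch_mul i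
  rw [h.iters_eq] at h1
  have h2 := (h.users_mul_lamPh_ge hi).1
  set v := (2 : ℝ) ^ ((A.p - 2 * A.q) * i) with hv
  have hv0 : 0 < v := by positivity
  have h3 := h.tau_sq c
  have h4 := h.L_sq_le_base
  have h6 : A.gap * A.n * A.lam * v / 2 ≤ 7 * A.logFactor * (A.batch i *
      (A.lamPh i * A.stageLen i)) := by
    refine h2.trans ?_
    calc A.users i * A.lamPh i ≤ A.batch i * (A.stages * A.stageLen i) * A.lamPh i := by gcongr
      _ ≤ A.batch i * (7 * A.logFactor * A.stageLen i) * A.lamPh i := by gcongr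
      _ = _ := by ring
  rw [div_div, div_le_iff₀ (by positivity)]
  calc A.tau c ^ 2 ≤ 4 * c ^ 2 * A.logFactor ^ 2 * A.L ^ 2 / A.m := h3
    _ ≤ 4 * c ^ 2 * A.logFactor ^ 2 * (A.n * A.m * (A.lam ^ 2 * A.R ^ 2)) / A.m := by gcongr
    _ = 8 * c ^ 2 * A.logFactor ^ 2 / A.gap * (A.lam * A.R ^ 2 / v)
        * (A.gap * A.n * A.lam * v / 2) := by field_simp; ring
    _ ≤ 8 * c ^ 2 * A.logFactor ^ 2 / A.gap * (A.lam * A.R ^ 2 / v)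
        * (7 * A.logFactor * (A.batch i * (A.lamPh i * A.stageLen i))) := by gcongr
    _ = _ := by ring

/-- The error due to the Gaussian noise of a phase. -/
lemma noise_error_le (h : A.Admissible) (c : ℝ) {i : ℕ} (hi : i ≤ A.phases) :
    A.d * A.sigma c i ^ 2 / (A.lamPh i * A.stageLen i) ≤
      1008 * 10 ^ 6 * c ^ 2 * A.logFactor ^ 5 / A.gap ^ 2
        * (A.lam * A.R ^ 2 / (2 : ℝ) ^ ((A.p - 2 * A.q) * i)) := by
  have hn := h.n_pos
  have hm := h.m_ge
  have hg := h.gap_pos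
  have hl := h.lam_pos
  have hε := h.ε_pos
  have hli := lamPh_pos hl i
  have hN₀ : (0 : ℝ) < A.stageLen i := by exact_mod_cast h.stageLen_pos i
  have hu : (0 : ℝ) < A.users i := by linarith [h.fifty_le_users hi]
  have hΛ : 0 < A.logFactor := by linarith [h.eight_le_logFactor]
  have hS := h.stages_le
  have h2 := (h.users_mul_lamPh_ge hi).2
  set v := (2 : ℝ) ^ ((A.p - 2 * A.q) * i) with hv
  have hv0 : 0 < v := by positivity
  have h3 := h.tau_sq c
  have h4 := h.L_sq_le_noise
  obtain ⟨hℓ1, -, hℓ3⟩ := h.log_noise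
  set ℓ := Real.log (A.n * A.d * Real.exp A.ε / A.δ) with hℓ
  have hℓsq : ℓ ^ 2 ≤ (3 * A.logFactor) ^ 2 := pow_le_pow_left₀ (by linarith) hℓ3 2
  -- σ_i² is proportional to T_i; division by the stage length leaves only the number of stages, so
  -- the condition number drops out.
  have hσ : A.sigma c i ^ 2 = 10 ^ 6 * A.tau c ^ 2 * A.iters i * ℓ ^ 2 /
      (A.ε ^ 2 * A.users i ^ 2) := by
    have e : A.sigma c i = 1000 * A.tau c * √(A.iters i : ℝ) * ℓ / (A.ε * A.users i) := rfl
    have e2 := Real.sq_sqrt (show (0 : ℝ) ≤ A.iters i by positivity)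
    rw [e, div_pow, mul_pow, mul_pow, mul_pow, e2, mul_pow]
    norm_num
  rw [hσ, h.iters_eq, div_le_iff₀ (by positivity)]
  calc A.d * (10 ^ 6 * A.tau c ^ 2 * (A.stages * A.stageLen i) * ℓ ^ 2 / (A.ε ^ 2 * A.users i ^ 2))
      ≤ A.d * (10 ^ 6 * (4 * c ^ 2 * A.logFactor ^ 2 * A.L ^ 2 / A.m)
        * (7 * A.logFactor * A.stageLen i) * (3 * A.logFactor) ^ 2
          / (A.ε ^ 2 * A.users i ^ 2)) := by gcongr
    _ = 252 * 10 ^ 6 * c ^ 2 * A.logFactor ^ 5 * A.stageLen i / (A.m * A.ε ^ 2 * A.users i ^ 2)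
        * (A.d * A.L ^ 2) := by field_simp; ring
    _ ≤ 252 * 10 ^ 6 * c ^ 2 * A.logFactor ^ 5 * A.stageLen i / (A.m * A.ε ^ 2 * A.users i ^ 2)
        * (A.ε ^ 2 * A.n ^ 2 * A.m * (A.lam ^ 2 * A.R ^ 2)) := by gcongr
    _ = 1008 * 10 ^ 6 * c ^ 2 * A.logFactor ^ 5 / A.gap ^ 2 * (A.lam * A.R ^ 2 / v)
        * (A.gap ^ 2 * A.n ^ 2 * A.lam * v / 4) * A.stageLen i / A.users i ^ 2 := by
        field_simp; ring
    _ ≤ 1008 * 10 ^ 6 * c ^ 2 * A.logFactor ^ 5 / A.gap ^ 2 * (A.lam * A.R ^ 2 / v)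
        * (A.users i ^ 2 * A.lamPh i) * A.stageLen i / A.users i ^ 2 := by gcongr
    _ = _ := by field_simp

/-- The initial gap contributes 1 and the clipping bias 2 · 10 to the constant 21. The two variances
enter with a factor 4, and 4(56 + 1008 · 10⁶) is below the 5 · 10⁹ of `errFactor`. -/
lemma errSq_le (h : A.Admissible) (c : ℝ) {i : ℕ} (hi : i + 1 ≤ A.phases) :
    A.errSq c A.outlierProb (i + 1) ≤ 2 / A.lamPh (i + 1) *
      (21 * (A.L * A.R / (A.n * A.m : ℝ) ^ 6) + A.errFactor c *
        (A.lam * A.R ^ 2 / (2 : ℝ) ^ ((A.p - 2 * A.q) * (i + 1 : ℕ)))) := by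
  have hL := h.L_pos
  have hR := h.R_pos
  have hl := lamPh_pos h.lam_pos (i + 1)
  have hT := h.one_le_iters (i + 1)
  have hnm := h.hundred_le_mul
  have hΛ := h.eight_le_logFactor
  have hg := h.gap_pos
  have h1 : A.L * A.R / 8 ^ A.stages ≤ A.L * A.R / (A.n * A.m : ℝ) ^ 6 := by
    have := h.pow_le_eight_pow_stages
    gcongr
  have h2 : A.R * (A.iters (i + 1) * (2 * A.L * A.outlierProb (i + 1))) ≤
      10 * (A.L * A.R / (A.n * A.m : ℝ) ^ 6) := by
    unfold outlierProb
    have e : A.R * (A.iters (i + 1) * (2 * A.L * (5 / ((A.n * A.m : ℝ) ^ 6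
        * (A.iters (i + 1) : ℝ) ^ 5)))) =
        10 * (A.L * A.R / (A.n * A.m : ℝ) ^ 6) / (A.iters (i + 1) : ℝ) ^ 4 := by
      have : (0 : ℝ) < A.n * A.m := by linarith
      field_simp
      norm_num
    rw [e]
    exact div_le_self (by positivity) (one_le_pow₀ hT)
  have h3 := h.sampling_error_le c hi
  have h4 := h.noise_error_le c hi
  have hW : 0 ≤ A.lam * A.R ^ 2 / (2 : ℝ) ^ ((A.p - 2 * A.q) * (i + 1 : ℕ)) := by
    have := h.lam_pos; positivity
  have h5 : 56 * c ^ 2 * A.logFactor ^ 3 / A.gap ≤ 56 * c ^ 2 * A.logFactor ^ 5 / A.gap ^ 2 := by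
    have h6 : A.logFactor ^ 3 ≤ A.logFactor ^ 5 := pow_le_pow_right₀ (by linarith) (by norm_num)
    have h7 : A.gap ^ 2 ≤ A.gap := by nlinarith [h.gap_lt_one]
    gcongr
  have h8 := mul_le_mul_of_nonneg_right h5 hW
  have h9 : 0 ≤ c ^ 2 * A.logFactor ^ 5 / A.gap ^ 2 := by positivity
  rw [errSq]
  refine mul_le_mul_of_nonneg_left ?_ (by positivity)
  have e2 : 2 * (A.tau c ^ 2 / A.batch (i + 1) + A.d * A.sigma c (i + 1) ^ 2)
      / (A.lamPh (i + 1) * A.stageLen (i + 1)) =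
      2 * (A.tau c ^ 2 / A.batch (i + 1) / (A.lamPh (i + 1) * A.stageLen (i + 1)))
      + 2 * (A.d * A.sigma c (i + 1) ^ 2 / (A.lamPh (i + 1) * A.stageLen (i + 1))) := by ring
  rw [e2]
  unfold errFactor
  set W := A.lam * A.R ^ 2 / (2 : ℝ) ^ ((A.p - 2 * A.q) * (i + 1 : ℕ))
  have e3 : 5 * 10 ^ 9 * c ^ 2 * A.logFactor ^ 5 / A.gap ^ 2 * W =
      5 * 10 ^ 9 * (c ^ 2 * A.logFactor ^ 5 / A.gap ^ 2 * W) := by ring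
  have e4 : 1008 * 10 ^ 6 * c ^ 2 * A.logFactor ^ 5 / A.gap ^ 2 * W =
      1008 * 10 ^ 6 * (c ^ 2 * A.logFactor ^ 5 / A.gap ^ 2 * W) := by ring
  have e5 : 56 * c ^ 2 * A.logFactor ^ 5 / A.gap ^ 2 * W =
      56 * (c ^ 2 * A.logFactor ^ 5 / A.gap ^ 2 * W) := by ring
  rw [e3]
  rw [e4] at h4
  rw [e5] at h8
  have h10 : 0 ≤ c ^ 2 * A.logFactor ^ 5 / A.gap ^ 2 * W := mul_nonneg h9 hW
  linarith

end Admissible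

end Params

/-! ### Summation of the errors over the phases -/

namespace Params

variable {A : Params}

namespace Admissible

lemma hundred_le_errFactor (h : A.Admissible) {c : ℝ} (hc : 48 ≤ c) :
    100 / A.gap ^ 2 ≤ A.errFactor c := by
  have hΛ := h.eight_le_logFactor
  have hg := h.gap_pos
  unfold errFactor
  gcongr
  have h1 : 1 ≤ A.logFactor ^ 5 := one_le_pow₀ (by linarith)
  have h2 : 1 ≤ c ^ 2 := one_le_pow₀ (by linarith)
  nlinarith

lemma base_le (h : A.Admissible) : A.L * A.R * (1 / √(A.n * A.m : ℝ)) ≤ A.lam * A.R ^ 2 := by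
  have h1 := mul_le_mul_of_nonneg_right h.lam_ge_base (sq_nonneg A.R)
  have hR := h.R_pos
  have e : A.L / A.R * (1 / √(A.n * A.m : ℝ)) * A.R ^ 2 =
      A.L * A.R * (1 / √(A.n * A.m : ℝ)) := by field_simp
  rwa [e] at h1

lemma two_rpow_ge_one (h : A.Admissible) (i : ℕ) : 1 ≤ (2 : ℝ) ^ ((A.p - 2 * A.q) * i) :=
  Real.one_le_rpow (by norm_num)
    (mul_nonneg (by linarith [h.p_ge, h.q_pos]) (Nat.cast_nonneg _))

/-- λ_i grows faster than n_i shrinks, so the stability term of every phase is bounded by that of an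
unregrouped sample with parameter λ, and L² ≤ nm λ²R². -/
lemma gen_le (h : A.Admissible) {i : ℕ} (hi : i + 1 ≤ A.phases) :
    2 * A.L ^ 2 / (A.lamPh (i + 1) * (A.users (i + 1) * A.m)) ≤ 4 / A.gap * (A.lam * A.R ^ 2) := by
  have h1 := (h.users_mul_lamPh_ge hi).1
  have h2 := h.L_sq_le_base
  have hg := h.gap_pos
  have hl := h.lam_pos
  have hn := h.n_pos
  have hm := h.m_ge
  have h3 := h.two_rpow_ge_one (i + 1)
  have hu : (0 : ℝ) < A.users (i + 1) := by linarith [h.fifty_le_users hi]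
  have hli := lamPh_pos hl (i + 1)
  have h4 : A.gap * A.n * A.lam / 2 ≤ A.users (i + 1) * A.lamPh (i + 1) := by
    refine le_trans ?_ h1
    exact div_le_div_of_nonneg_right (le_mul_of_one_le_right (by positivity) h3) (by norm_num)
  rw [div_le_iff₀ (by positivity)]
  calc 2 * A.L ^ 2 ≤ 2 * (A.n * A.m * (A.lam ^ 2 * A.R ^ 2)) := by gcongr
    _ = 4 / A.gap * (A.lam * A.R ^ 2) * (A.gap * A.n * A.lam / 2 * A.m) := by field_simp; ring
    _ ≤ 4 / A.gap * (A.lam * A.R ^ 2) * (A.users (i + 1) * A.lamPh (i + 1) * A.m) := by gcongr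
    _ = _ := by ring

lemma div_pow_le_base (h : A.Admissible) :
    A.L * A.R / (A.n * A.m : ℝ) ^ 6 ≤ A.L * A.R * (1 / √(A.n * A.m : ℝ)) := by
  have hL := h.L_pos
  have hR := h.R_pos
  have hnm := h.hundred_le_mul
  rw [← mul_one_div]
  gcongr
  refine (Real.sqrt_le_iff.2 ⟨by linarith, by nlinarith⟩ : √(A.n * A.m : ℝ) ≤ A.n * A.m).trans ?_
  exact le_self_pow₀ (by linarith) (by norm_num)

/-- The squared error of a phase carries the inverse of its own parameter, which cancels against the
parameter of the next phase up to their ratio 2^p. For i = 0 the error is R². -/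
lemma lamPh_mul_errSq_le (h : A.Admissible) {c : ℝ} (hc : 48 ≤ c) {i : ℕ} (hi : i + 1 ≤ A.phases) :
    A.lamPh (i + 1) / 2 * A.errSq c A.outlierProb i ≤
      (2 : ℝ) ^ A.p * (21 + A.errFactor c) * (A.lam * A.R ^ 2) := by
  have hB := h.hundred_le_errFactor hc
  have hg := h.gap_pos
  have hB0 : 0 ≤ A.errFactor c := le_trans (by positivity) hB
  have hl := h.lam_pos
  have hR := h.R_pos
  have hstep : A.lamPh (i + 1) = (2 : ℝ) ^ A.p * A.lamPh i := by
    unfold lamPh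
    rw [mul_left_comm, ← Real.rpow_add (by norm_num)]
    congr 2
    push_cast
    ring
  rw [hstep]
  cases i with
  | zero =>
    have e : A.lamPh 0 = A.lam := by simp [lamPh]
    rw [e, errSq]
    have : 0 ≤ (2 : ℝ) ^ A.p * (A.lam * A.R ^ 2) := by positivity
    nlinarith
  | succ i =>
    have hli := lamPh_pos hl (i + 1)
    have h1 := h.errSq_le c (i := i) (by omega)
    have h2 := h.div_pow_le_base.trans h.base_le
    have h3 : A.lam * A.R ^ 2 / (2 : ℝ) ^ ((A.p - 2 * A.q) * (i + 1 : ℕ)) ≤ A.lam * A.R ^ 2 :=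
      div_le_self (by positivity) (h.two_rpow_ge_one (i + 1))
    calc (2 : ℝ) ^ A.p * A.lamPh (i + 1) / 2 * A.errSq c A.outlierProb (i + 1)
        ≤ (2 : ℝ) ^ A.p * A.lamPh (i + 1) / 2 * (2 / A.lamPh (i + 1) *
          (21 * (A.L * A.R / (A.n * A.m : ℝ) ^ 6) + A.errFactor c *
          (A.lam * A.R ^ 2 / (2 : ℝ) ^ ((A.p - 2 * A.q) * (i + 1 : ℕ))))) := by gcongr
      _ = (2 : ℝ) ^ A.p * (21 * (A.L * A.R / (A.n * A.m : ℝ) ^ 6) + A.errFactor c *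
          (A.lam * A.R ^ 2 / (2 : ℝ) ^ ((A.p - 2 * A.q) * (i + 1 : ℕ)))) := by field_simp
      _ ≤ (2 : ℝ) ^ A.p * (21 * (A.lam * A.R ^ 2) + A.errFactor c * (A.lam * A.R ^ 2)) := by
          gcongr
      _ = _ := by ring

/-- The last phase is so strongly regularized that it moves its starting point very little. -/
lemma last_regularization (h : A.Admissible) :
    A.lam * (A.n * A.m) ≤ ((2 : ℝ) ^ A.p) ^ 2 *
      (A.lamPh A.phases * (2 : ℝ) ^ ((A.p - 2 * A.q) * A.phases)) := by
  have hl := h.lam_pos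
  have hn := h.n_pos
  have hn1 := h.n_ge
  have hm := h.m_ge
  have hpq : 0 ≤ A.p - A.q := by linarith [h.p_ge, h.q_pos]
  set w := (2 : ℝ) ^ ((A.p - A.q) * A.phases) with hw
  -- The exponents p and p - 2q add up to 2(p - q).
  have e : A.lamPh A.phases * (2 : ℝ) ^ ((A.p - 2 * A.q) * A.phases) = A.lam * w ^ 2 := by
    unfold lamPh
    rw [hw, mul_assoc, sq, ← Real.rpow_add (by norm_num), ← Real.rpow_add (by norm_num)]
    congr 2
    ring
  -- The number of phases is rounded down, so 2^l may be as small as n/2; this costs the factor 2^p.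
  have h1 : (A.n : ℝ) ^ (A.p - A.q) ≤ (2 : ℝ) ^ A.p * w := by
    have h2 : (A.n : ℝ) ^ (A.p - A.q) ≤ (2 * 2 ^ A.phases : ℝ) ^ (A.p - A.q) :=
      Real.rpow_le_rpow hn.le h.n_lt_two_pow.le hpq
    rw [Real.mul_rpow (by norm_num) (by positivity), ← Real.rpow_natCast_mul (by norm_num),
      mul_comm (A.phases : ℝ)] at h2
    refine h2.trans ?_
    gcongr
    · norm_num
    · linarith [h.q_pos]
  have h2 := h.n_rpow_p_ge.trans h1
  have h3 : (A.n : ℝ) ≤ (A.n : ℝ) ^ (2.5 : ℝ) := by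
    have := Real.rpow_le_rpow_of_exponent_le hn1 (show (1 : ℝ) ≤ 2.5 by norm_num)
    rwa [Real.rpow_one] at this
  have h4 : A.n * √(A.m : ℝ) ≤ (2 : ℝ) ^ A.p * w := by
    refine le_trans ?_ h2
    gcongr
  have h5 := pow_le_pow_left₀ (by positivity) h4 2
  rw [mul_pow, Real.sq_sqrt (by linarith), mul_pow] at h5
  rw [e]
  calc A.lam * (A.n * A.m) ≤ A.lam * (A.n ^ 2 * A.m) := by
        gcongr
        nlinarith
    _ ≤ A.lam * (((2 : ℝ) ^ A.p) ^ 2 * w ^ 2) := by gcongr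
    _ = _ := by ring

/-- No later phase damps the error of the last one, so it enters through the Lipschitz bound without
a square. `last_regularization` makes the distance of order R/√(nm). -/
lemma L_mul_sqrt_errSq_le (h : A.Admissible) {c : ℝ} (hc : 48 ≤ c) :
    A.L * √(A.errSq c A.outlierProb A.phases) ≤
      3 * (2 : ℝ) ^ A.p * A.errFactor c * (A.L * A.R * (1 / √(A.n * A.m : ℝ))) := by
  have hB := h.hundred_le_errFactor hc
  have hg := h.gap_pos
  have hg1 := h.gap_lt_one
  have hB1 : 100 ≤ A.errFactor c := by
    refine le_trans ?_ hB
    rw [le_div_iff₀ (by positivity)]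
    nlinarith
  have hl := h.lam_pos
  have hL := h.L_pos
  have hR := h.R_pos
  have hnm := h.hundred_le_mul
  have hp1 : 1 ≤ (2 : ℝ) ^ A.p := Real.one_le_rpow (by norm_num) h.p_pos.le
  have hlast := h.last_regularization
  obtain ⟨i, hi⟩ : ∃ i, A.phases = i + 1 := ⟨A.phases - 1, by have := h.one_le_phases; omega⟩
  have h1 := h.errSq_le c (i := i) hi.ge
  rw [← hi] at h1
  have hli := lamPh_pos hl A.phases
  set v := (2 : ℝ) ^ ((A.p - 2 * A.q) * A.phases) with hv
  have hv0 : 0 < v := by positivity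
  have hs : √(A.n * A.m : ℝ) ^ 2 = A.n * A.m := Real.sq_sqrt (by linarith)
  have hs0 : 0 < √(A.n * A.m : ℝ) := Real.sqrt_pos.2 (by linarith)
  have h2 : A.L * A.R / (A.n * A.m : ℝ) ^ 6 ≤ A.lam * A.R ^ 2 / (A.n * A.m) := by
    have h3 := h.L_le_base
    have h4 : √(A.n * A.m : ℝ) ≤ A.n * A.m := Real.sqrt_le_iff.2 ⟨by linarith, by nlinarith⟩
    rw [div_le_div_iff₀ (by positivity) (by positivity)]
    calc A.L * A.R * (A.n * A.m) ≤ A.lam * A.R * √(A.n * A.m : ℝ) * A.R * (A.n * A.m) := by gcongr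
      _ ≤ A.lam * A.R * (A.n * A.m : ℝ) * A.R * (A.n * A.m) := by gcongr
      _ = A.lam * A.R ^ 2 * (A.n * A.m : ℝ) ^ 2 := by ring
      _ ≤ A.lam * A.R ^ 2 * (A.n * A.m : ℝ) ^ 6 := by
          gcongr
          · linarith
          · norm_num
  have h5 : 2 / A.lamPh A.phases * (A.lam * A.R ^ 2 / (A.n * A.m)) ≤ 2 * (A.R ^ 2 / (A.n * A.m))
      := by
    have h6 := h.lam_le_lamPh A.phases
    calc 2 / A.lamPh A.phases * (A.lam * A.R ^ 2 / (A.n * A.m))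
        = A.lam / A.lamPh A.phases * (2 * (A.R ^ 2 / (A.n * A.m))) := by ring
      _ ≤ 1 * (2 * (A.R ^ 2 / (A.n * A.m))) := by
          gcongr
          exact (div_le_one hli).2 h6
      _ = _ := one_mul _
  have h7 : 2 / A.lamPh A.phases * (A.lam * A.R ^ 2 / v) ≤
      2 * ((2 : ℝ) ^ A.p) ^ 2 * (A.R ^ 2 / (A.n * A.m)) := by
    rw [div_mul_div_comm, ← mul_div_assoc, div_le_div_iff₀ (by positivity) (by positivity)]
    calc 2 * (A.lam * A.R ^ 2) * (A.n * A.m) = 2 * A.R ^ 2 * (A.lam * (A.n * A.m)) := by ring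
      _ ≤ 2 * A.R ^ 2 * (((2 : ℝ) ^ A.p) ^ 2 * (A.lamPh A.phases * v)) := by gcongr
      _ = _ := by ring
  have h8 : A.errSq c A.outlierProb A.phases ≤
      (3 * (2 : ℝ) ^ A.p * A.errFactor c * (A.R * (1 / √(A.n * A.m : ℝ)))) ^ 2 := by
    have e : (3 * (2 : ℝ) ^ A.p * A.errFactor c * (A.R * (1 / √(A.n * A.m : ℝ)))) ^ 2 =
        9 * A.errFactor c ^ 2 * (((2 : ℝ) ^ A.p) ^ 2 * (A.R ^ 2 / (A.n * A.m))) := by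
      calc _ = 9 * A.errFactor c ^ 2 * (((2 : ℝ) ^ A.p) ^ 2 * (A.R ^ 2 / √(A.n * A.m : ℝ) ^ 2))
          := by
            field_simp; norm_num
        _ = _ := by rw [hs]
    rw [e]
    set y := A.R ^ 2 / (A.n * A.m : ℝ) with hy
    have hy0 : 0 ≤ y := by positivity
    have hyp : y ≤ ((2 : ℝ) ^ A.p) ^ 2 * y := le_mul_of_one_le_left hy0 (one_le_pow₀ hp1)
    calc A.errSq c A.outlierProb A.phases
        ≤ 2 / A.lamPh A.phases * (21 * (A.L * A.R / (A.n * A.m : ℝ) ^ 6)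
          + A.errFactor c * (A.lam * A.R ^ 2 / v)) := h1
      _ ≤ 2 / A.lamPh A.phases * (21 * (A.lam * A.R ^ 2 / (A.n * A.m))
          + A.errFactor c * (A.lam * A.R ^ 2 / v)) := by gcongr
      _ = 21 * (2 / A.lamPh A.phases * (A.lam * A.R ^ 2 / (A.n * A.m)))
          + A.errFactor c * (2 / A.lamPh A.phases * (A.lam * A.R ^ 2 / v)) := by ring
      _ ≤ 21 * (2 * y) + A.errFactor c * (2 * ((2 : ℝ) ^ A.p) ^ 2 * y) := by gcongr
      _ ≤ (42 + 2 * A.errFactor c) * (((2 : ℝ) ^ A.p) ^ 2 * y) := by linarith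
      _ ≤ _ := by
        gcongr
        nlinarith
  have h9 := Real.sqrt_le_sqrt h8
  rw [Real.sqrt_sq (by positivity)] at h9
  calc A.L * √(A.errSq c A.outlierProb A.phases)
      ≤ A.L * (3 * (2 : ℝ) ^ A.p * A.errFactor c * (A.R * (1 / √(A.n * A.m : ℝ)))) := by gcongr
    _ = _ := by ring

/-- The bound for the excess risk. -/
lemma excess_le (h : A.Admissible) {c : ℝ} (hc : 48 ≤ c) :
    ∑ i ∈ Finset.range A.phases, (A.lamPh (i + 1) / 2 * A.errSq c A.outlierProb i
          + 2 * A.L ^ 2 / (A.lamPh (i + 1) * (A.users (i + 1) * A.m)))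
        + A.L * √(A.errSq c A.outlierProb A.phases)
        + A.L * A.R * ∑ i ∈ Finset.range A.phases, A.failProb A.outlierProb (i + 1) ≤
      10 ^ 11 * c ^ 2 * ((2 : ℝ) ^ A.p / A.gap) ^ 6 * A.logFactor ^ 6 * (A.L * A.R * A.rate) := by
  have hB := h.hundred_le_errFactor hc
  have hg := h.gap_pos
  have hg1 := h.gap_lt_one
  have hL := h.L_pos
  have hR := h.R_pos
  have hΛ := h.eight_le_logFactor
  have hp1 : 1 ≤ (2 : ℝ) ^ A.p := Real.one_le_rpow (by norm_num) h.p_pos.le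
  have hG : 1 / A.gap ≤ A.errFactor c / 100 := by
    rw [div_le_div_iff₀ hg (by norm_num)]
    rw [div_le_iff₀ (by positivity)] at hB
    have : 0 ≤ A.errFactor c := by unfold errFactor; positivity
    nlinarith [mul_nonneg this hg.le]
  have hG1 : 1 ≤ 1 / A.gap := by rw [le_div_iff₀ hg]; linarith
  have hB1 : 100 ≤ A.errFactor c := by linarith
  have hl1 := h.lam_mul_sq_le
  have hbE := h.base_le.trans hl1
  set E := A.L * A.R * A.rate with hE
  set B := A.errFactor c with hBdef
  have hE0 : 0 ≤ E := le_trans (mul_nonneg h.lam_pos.le (sq_nonneg _)) hl1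
  have h1 : ∀ i ∈ Finset.range A.phases, A.lamPh (i + 1) / 2 * A.errSq c A.outlierProb i
      + 2 * A.L ^ 2 / (A.lamPh (i + 1) * (A.users (i + 1) * A.m)) ≤ 2 * (2 : ℝ) ^ A.p * B * E :=
    fun i hi => by
    have hi' : i + 1 ≤ A.phases := Finset.mem_range.1 hi
    have h2 := h.lamPh_mul_errSq_le hc hi'
    have h3 := h.gen_le hi'
    have h4 : 4 / A.gap * (A.lam * A.R ^ 2) ≤ (B / 25) * E := by
      have e : 4 / A.gap = 4 * (1 / A.gap) := by ring
      have : 4 / A.gap ≤ B / 25 := by rw [e]; linarith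
      gcongr
      exact mul_nonneg h.lam_pos.le (sq_nonneg _)
    have h5 : (2 : ℝ) ^ A.p * (21 + B) * (A.lam * A.R ^ 2) ≤ (2 : ℝ) ^ A.p * (21 + B) * E := by
      gcongr
    have h6 : (B / 25) * E ≤ (2 : ℝ) ^ A.p * (B / 25 * E) := le_mul_of_one_le_left
        (by positivity) hp1
    have h7 : 0 ≤ (2 : ℝ) ^ A.p * E := by positivity
    nlinarith
  have h2 := h.L_mul_sqrt_errSq_le hc
  have h3 : ∀ i ∈ Finset.range A.phases,
      A.failProb A.outlierProb (i + 1) ≤ 7 / √(A.n * A.m : ℝ) := fun i _ => h.failProb_le _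
  have h1' := Finset.sum_le_card_nsmul _ _ _ h1
  have h3' := Finset.sum_le_card_nsmul _ _ _ h3
  rw [Finset.card_range, nsmul_eq_mul] at h1' h3'
  have hl := h.phases_le
  have hl0 : (1 : ℝ) ≤ A.phases := by exact_mod_cast h.one_le_phases
  have h4 : A.L * A.R * ∑ i ∈ Finset.range A.phases, A.failProb A.outlierProb (i + 1) ≤
      A.phases * (7 * E) := by
    calc _ ≤ A.L * A.R * (A.phases * (7 / √(A.n * A.m : ℝ))) := by gcongr
      _ = A.phases * (7 * (A.L * A.R * (1 / √(A.n * A.m : ℝ)))) := by ring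
      _ ≤ _ := by gcongr
  have h5 : 3 * (2 : ℝ) ^ A.p * B * (A.L * A.R * (1 / √(A.n * A.m : ℝ))) ≤
      3 * (2 : ℝ) ^ A.p * B * E := by gcongr
  have hPB : 0 ≤ (2 : ℝ) ^ A.p * B * E := by positivity
  have h6 : E ≤ (2 : ℝ) ^ A.p * B * E / 100 := by
    have : 100 ≤ (2 : ℝ) ^ A.p * B := by nlinarith
    nlinarith
  have hfin : ∑ i ∈ Finset.range A.phases, (A.lamPh (i + 1) / 2 * A.errSq c A.outlierProb i
          + 2 * A.L ^ 2 / (A.lamPh (i + 1) * (A.users (i + 1) * A.m)))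
        + A.L * √(A.errSq c A.outlierProb A.phases)
        + A.L * A.R * ∑ i ∈ Finset.range A.phases, A.failProb A.outlierProb (i + 1) ≤
      -- The phases contribute 2, the last distance 3 and the failures 1, the last because 7E ≤ 2^p
      -- B E.
      6 * A.phases * ((2 : ℝ) ^ A.p * B * E) := by
    have h7 : (2 : ℝ) ^ A.p * B * E ≤ A.phases * ((2 : ℝ) ^ A.p * B * E) :=
      le_mul_of_one_le_left hPB hl0
    have h8 : A.phases * (7 * E) ≤ A.phases * ((2 : ℝ) ^ A.p * B * E) :=
      mul_le_mul_of_nonneg_left (by linarith) (by linarith)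
    linarith
  refine hfin.trans ?_
  calc 6 * A.phases * ((2 : ℝ) ^ A.p * B * E)
      ≤ 6 * (2 * A.logFactor) * ((2 : ℝ) ^ A.p * B * E) := by gcongr
    _ = 6 * 10 ^ 10 * c ^ 2 * ((2 : ℝ) ^ A.p / A.gap ^ 2) * A.logFactor ^ 6 * E := by
        rw [hBdef, errFactor]; ring
    _ ≤ 10 ^ 11 * c ^ 2 * ((2 : ℝ) ^ A.p / A.gap) ^ 6 * A.logFactor ^ 6 * E := by
        have h9 : (2 : ℝ) ^ A.p / A.gap ^ 2 ≤ ((2 : ℝ) ^ A.p / A.gap) ^ 6 := by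
          have h10 : 1 ≤ (2 : ℝ) ^ A.p / A.gap := by rw [le_div_iff₀ hg]; linarith
          calc (2 : ℝ) ^ A.p / A.gap ^ 2 ≤ ((2 : ℝ) ^ A.p) ^ 2 / A.gap ^ 2 := by
                gcongr
                exact le_self_pow₀ hp1 (by norm_num)
            _ = ((2 : ℝ) ^ A.p / A.gap) ^ 2 := (div_pow _ _ _).symm
            _ ≤ _ := pow_le_pow_right₀ h10 (by norm_num)
        gcongr
        norm_num

end Admissible

end Params

namespace Params

variable {A : Params}

/-! ### Gradient complexity -/

namespace Admissible

/-- By ε ≤ 10 the first entry of the maximum is at least 1, which absorbs the rounding of either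
entry. -/
lemma batch_le (h : A.Admissible) (i : ℕ) : (A.batch i : ℝ) ≤ 3 * (500 * Real.log (A.batchArg i)
    * (1 / A.ε + A.users i * A.ε / √(A.iters i * Real.log (1 / A.δ)))) + A.users i / A.iters i := by
  have hlQ := h.four_le_log_batchArg i
  have hε := h.ε_pos
  have h1 : 1 ≤ 500 * Real.log (A.batchArg i)
      * (1 / A.ε + A.users i * A.ε / √(A.iters i * Real.log (1 / A.δ))) := by
    have h2 : 1 / 10 ≤ 1 / A.ε := one_div_le_one_div_of_le hε h.ε_le
    have h3 : 0 ≤ A.users i * A.ε / √(A.iters i * Real.log (1 / A.δ)) := by positivity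
    nlinarith
  have h2 : 0 ≤ (A.users i : ℝ) / A.iters i := by positivity
  have e : (A.batch i : ℝ) = max (⌈500 * Real.log (A.batchArg i)
      * (1 / A.ε + A.users i * A.ε / √(A.iters i * Real.log (1 / A.δ)))⌉₊ : ℝ)
      ⌈(A.users i : ℝ) / A.iters i⌉₊ := by
    unfold batch batchArg
    rw [Nat.cast_max]
  rw [e]
  have h3 := (Nat.ceil_lt_add_one (zero_le_one.trans h1)).le
  have h4 := (Nat.ceil_lt_add_one h2).le
  refine max_le ?_ ?_ <;> linarith

/-- Applied with 1/s either summand of λ; using both produces the minimum in the complexity. -/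
lemma β_div_lam_le (h : A.Admissible) {s : ℝ} (hs0 : 0 < s) (hs : A.L / A.R * (1 / s) ≤ A.lam) :
    A.β / A.lam ≤ A.β * A.R / A.L * s := by
  have hL := h.L_pos
  have hR := h.R_pos
  have hβ := h.β_nonneg
  rw [div_le_iff₀ h.lam_pos]
  calc A.β = A.β * A.R / A.L * s * (A.L / A.R * (1 / s)) := by field_simp
    _ ≤ _ := by gcongr

lemma sqrt_cond_le (h : A.Admissible) : √((A.β + A.lam) / A.lam) ≤
    1 + √(A.β * A.R / A.L) * ((A.n : ℝ) ^ (1 / 4 : ℝ) * (A.m : ℝ) ^ (1 / 4 : ℝ)) := by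
  have hnm := h.hundred_le_mul
  have hl := h.lam_pos
  have hβ := h.β_nonneg
  have hk := h.kappa_nonneg
  have h1 := h.β_div_lam_le (Real.sqrt_pos.2 (show (0 : ℝ) < A.n * A.m by linarith)) h.lam_ge_base
  have h2 : √(A.β / A.lam) ≤ √(A.β * A.R / A.L) * ((A.n : ℝ) ^ (1 / 4 : ℝ) * (A.m : ℝ) ^
      (1 / 4 : ℝ)) := by
    refine (Real.sqrt_le_sqrt h1).trans_eq ?_
    rw [Real.sqrt_mul hk, ← Real.mul_rpow (by positivity) (by positivity)]
    congr 1
    rw [Real.sqrt_eq_rpow, Real.sqrt_eq_rpow, ← Real.rpow_mul (by positivity)]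
    norm_num
  rw [add_div, div_self hl.ne', add_comm]
  refine le_trans ?_ (add_le_add_right h2 1)
  refine Real.sqrt_le_iff.2 ⟨by positivity, ?_⟩
  have := Real.sq_sqrt (show 0 ≤ A.β / A.lam by positivity)
  nlinarith [Real.sqrt_nonneg (A.β / A.lam)]

lemma sqrt_sqrt_cond_le (h : A.Admissible) : √(√((A.β + A.lam) / A.lam)) ≤
    1 + (A.β * A.R / A.L) ^ (1 / 4 : ℝ) * min ((A.m * A.n : ℝ) ^ (1 / 8 : ℝ))
          ((A.ε ^ 2 * (A.n : ℝ) ^ 2 * A.m / A.d) ^ (1 / 8 : ℝ)) := by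
  have hnm := h.hundred_le_mul
  have hl := h.lam_pos
  have hβ := h.β_nonneg
  have hk := h.kappa_nonneg
  have hε := h.ε_pos
  have hn := h.n_pos
  have hm := h.m_ge
  have hd := h.d_ge
  have hgen : ∀ {y : ℝ}, 0 < y → A.L / A.R * (1 / √y) ≤ A.lam →
      (A.β / A.lam) ^ (1 / 4 : ℝ) ≤ (A.β * A.R / A.L) ^ (1 / 4 : ℝ) * y ^ (1 / 8 : ℝ) := by
    intro y hy hs
    have h1 := h.β_div_lam_le (Real.sqrt_pos.2 hy) hs
    refine (Real.rpow_le_rpow (by positivity) h1 (by norm_num)).trans_eq ?_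
    rw [Real.mul_rpow hk (by positivity), Real.sqrt_eq_rpow, ← Real.rpow_mul hy.le]
    norm_num
  have h1 : (A.β / A.lam) ^ (1 / 4 : ℝ) ≤ (A.β * A.R / A.L) ^ (1 / 4 : ℝ) *
      min ((A.m * A.n : ℝ) ^ (1 / 8 : ℝ)) ((A.ε ^ 2 * (A.n : ℝ) ^ 2 * A.m / A.d) ^ (1 / 8 : ℝ))
          := by
    rw [mul_min_of_nonneg _ _ (by positivity)]
    refine le_min (hgen (by positivity) ?_) (hgen (by positivity) ?_)
    · rw [mul_comm (A.m : ℝ)]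
      exact h.lam_ge_base
    · refine le_of_eq_of_le ?_ h.lam_ge_noise
      have e : √(A.ε ^ 2 * (A.n : ℝ) ^ 2 * A.m / A.d) = A.ε * A.n * √(A.m : ℝ) / √(A.d : ℝ) := by
        rw [Real.sqrt_div (by positivity), Real.sqrt_mul (by positivity), ← mul_pow,
          Real.sqrt_sq (by positivity)]
      rw [e, one_div_div]
  refine le_trans ?_ (add_le_add_right h1 1)
  set x := (A.β / A.lam) ^ (1 / 4 : ℝ) with hx
  have hx0 : 0 ≤ x := by positivity
  have hx4 : x ^ 4 = A.β / A.lam := by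
    rw [hx, ← Real.rpow_natCast, ← Real.rpow_mul (by positivity)]
    norm_num
  rw [add_div, div_self hl.ne', ← hx4]
  refine Real.sqrt_le_iff.2 ⟨by positivity, Real.sqrt_le_iff.2 ⟨by positivity, ?_⟩⟩
  nlinarith [pow_nonneg hx0 2, pow_nonneg hx0 3]

/-- The last summand of the complexity, nonnegative, can be given away: the rest already dominates
the count. -/
lemma complexity_ge (h : A.Admissible) :
    A.m * A.n * (1 + A.ε * (A.β * A.R / A.L) ^ (1 / 4 : ℝ)
        * min ((A.m * A.n : ℝ) ^ (1 / 8 : ℝ)) ((A.ε ^ 2 * (A.n : ℝ) ^ 2 * A.m / A.d) ^ (1 / 8 : ℝ)))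
      + √(A.β * A.R / A.L) * ((A.n : ℝ) ^ (1 / 4 : ℝ) * (A.m : ℝ) ^ (5 / 4 : ℝ) / A.ε) ≤
      A.complexity := by
  have hε := h.ε_pos
  have h0 : 0 ≤ √(A.β * A.R / A.L) * ((A.n : ℝ) ^ (1 / 2 : ℝ) * (A.m : ℝ) ^ (5 / 4 : ℝ)
        / ((A.d : ℝ) ^ (1 / 4 : ℝ) * A.ε ^ (1 / 2 : ℝ))) := by positivity
  unfold complexity
  rw [mul_add (√(A.β * A.R / A.L))]
  linarith

lemma root_min_nonneg (h : A.Admissible) : 0 ≤ A.ε * (A.β * A.R / A.L) ^ (1 / 4 : ℝ)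
    * min ((A.m * A.n : ℝ) ^ (1 / 8 : ℝ)) ((A.ε ^ 2 * (A.n : ℝ) ^ 2 * A.m / A.d) ^ (1 / 8 : ℝ))
        := by
  have hε := h.ε_pos
  have hk := h.kappa_nonneg
  have : 0 ≤ min ((A.m * A.n : ℝ) ^ (1 / 8 : ℝ))
      ((A.ε ^ 2 * (A.n : ℝ) ^ 2 * A.m / A.d) ^ (1 / 8 : ℝ)) :=
    le_min (by positivity) (by positivity)
  positivity

lemma samples_le_complexity (h : A.Admissible) : (A.m * A.n : ℝ) ≤ A.complexity := by
  have hε := h.ε_pos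
  refine le_trans ?_ h.complexity_ge
  have h1 := mul_nonneg (show (0 : ℝ) ≤ A.m * A.n by positivity) h.root_min_nonneg
  have h2 : 0 ≤ √(A.β * A.R / A.L) * ((A.n : ℝ) ^ (1 / 4 : ℝ) * (A.m : ℝ) ^ (5 / 4 : ℝ) / A.ε) := by
    positivity
  linarith

lemma iters_div_le_complexity (h : A.Admissible) (i : ℕ) :
    A.m * A.iters i / A.ε ≤ 49 * A.logFactor * A.complexity := by
  have hΛ := h.eight_le_logFactor
  have hε := h.ε_pos
  have hm := h.m_ge
  have hTle := h.iters_le i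
  have hr := h.sqrt_cond_le
  have hcomp := h.complexity_ge
  have hmin := mul_nonneg (show (0 : ℝ) ≤ A.m * A.n by positivity) h.root_min_nonneg
  set b := √(A.β * A.R / A.L) * ((A.n : ℝ) ^ (1 / 4 : ℝ) * (A.m : ℝ) ^ (5 / 4 : ℝ) / A.ε) with hb
  have e : (A.m : ℝ) ^ (1 / 4 : ℝ) * A.m = (A.m : ℝ) ^ (5 / 4 : ℝ) := by
    conv_lhs => rw [← Real.rpow_add_one (by linarith)]
    norm_num
  have hme : A.m / A.ε ≤ A.m * A.n := by
    rw [div_le_iff₀ hε]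
    nlinarith [h.one_le_ε_mul_n]
  calc A.m * A.iters i / A.ε ≤ A.m * (49 * A.logFactor * (1 + √(A.β * A.R / A.L)
        * ((A.n : ℝ) ^ (1 / 4 : ℝ) * (A.m : ℝ) ^ (1 / 4 : ℝ)))) / A.ε := by
        gcongr
        exact hTle.trans (mul_le_mul_of_nonneg_left hr (by linarith))
    _ = 49 * A.logFactor * (A.m / A.ε + √(A.β * A.R / A.L)
        * ((A.n : ℝ) ^ (1 / 4 : ℝ) * ((A.m : ℝ) ^ (1 / 4 : ℝ) * A.m) / A.ε)) := by ring
    _ = 49 * A.logFactor * (A.m / A.ε + b) := by rw [e]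
    _ ≤ 49 * A.logFactor * A.complexity :=
        mul_le_mul_of_nonneg_left (by linarith) (by linarith)

/-- The root of T_i involves the fourth root of the condition number, where (βR/L)^{1/4} and the
eighth powers come from. The part without condition number is mnε ≤ 10mn. -/
lemma sqrt_iters_le_complexity (h : A.Admissible) (i : ℕ) :
    A.m * (A.n * A.ε * √(A.iters i : ℝ)) ≤ 70 * A.logFactor * A.complexity := by
  have hΛ := h.eight_le_logFactor
  have hε := h.ε_pos
  have hTle := h.iters_le i
  have hrr := h.sqrt_sqrt_cond_le
  have hcomp := h.complexity_ge
  have hmin := mul_nonneg (show (0 : ℝ) ≤ A.m * A.n by positivity) h.root_min_nonneg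
  have hb0 : 0 ≤ √(A.β * A.R / A.L) * ((A.n : ℝ) ^ (1 / 4 : ℝ) * (A.m : ℝ) ^ (5 / 4 : ℝ) / A.ε)
      := by
    positivity
  set mn := min ((A.m * A.n : ℝ) ^ (1 / 8 : ℝ))
    ((A.ε ^ 2 * (A.n : ℝ) ^ 2 * A.m / A.d) ^ (1 / 8 : ℝ)) with hmn
  have h3 : √(A.iters i : ℝ) ≤ 7 * A.logFactor *
      (1 + (A.β * A.R / A.L) ^ (1 / 4 : ℝ) * mn) := by
    calc √(A.iters i : ℝ) ≤ √(49 * A.logFactor * √((A.β + A.lam) / A.lam)) :=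
          Real.sqrt_le_sqrt hTle
      _ = √(49 * A.logFactor) * √(√((A.β + A.lam) / A.lam)) := Real.sqrt_mul (by linarith) _
      _ ≤ 7 * A.logFactor * (1 + (A.β * A.R / A.L) ^ (1 / 4 : ℝ) * mn) :=
          mul_le_mul (Real.sqrt_le_iff.2 ⟨by linarith, by nlinarith⟩) hrr (Real.sqrt_nonneg _)
            (by linarith)
  have h4 : (A.m * A.n : ℝ) * A.ε ≤ (A.m * A.n : ℝ) * 10 :=
    mul_le_mul_of_nonneg_left h.ε_le (by positivity)
  calc A.m * (A.n * A.ε * √(A.iters i : ℝ))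
      ≤ A.m * (A.n * A.ε * (7 * A.logFactor *
        (1 + (A.β * A.R / A.L) ^ (1 / 4 : ℝ) * mn))) := by gcongr
    _ = 7 * A.logFactor * (A.m * A.n * A.ε
        + A.m * A.n * (A.ε * (A.β * A.R / A.L) ^ (1 / 4 : ℝ) * mn)) := by ring
    _ ≤ 7 * A.logFactor * (10 * A.complexity) :=
        mul_le_mul_of_nonneg_left (by linarith) (by linarith)
    _ = _ := by ring

/-- T_i K_i m splits according to the batch size into m T_i/ε, m n_i ε √T_i and one pass m n_i over
the data; the first uses the condition number bound from the sample term of λ, the second its root.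
-/
lemma phase_evals_le (h : A.Admissible) (i : ℕ) :
    (A.iters i : ℝ) * (A.batch i * A.m) ≤ 10 ^ 6 * A.logFactor ^ 2 * A.complexity := by
  have hΛ := h.eight_le_logFactor
  have hε := h.ε_pos
  have hT := h.one_le_iters i
  have hδ := h.one_le_log_inv_δ
  have hu := h.users_le i
  obtain ⟨-, -, -, hQ⟩ := h.one_le_batchArg i
  have hlQ := h.four_le_log_batchArg i
  have h1 := h.iters_div_le_complexity i
  have h2 := h.sqrt_iters_le_complexity i
  have h3 := h.samples_le_complexity
  have hK := h.batch_le i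
  have hC0 : 0 ≤ A.complexity := le_trans (by positivity) h3
  have hT0 : (0 : ℝ) < A.iters i := by linarith
  have hsq : A.iters i / √(A.iters i * Real.log (1 / A.δ)) ≤ √(A.iters i : ℝ) := by
    have h5 : √(A.iters i : ℝ) ≤ √(A.iters i * Real.log (1 / A.δ)) :=
      Real.sqrt_le_sqrt (by nlinarith)
    have h6 : 0 < √(A.iters i : ℝ) := Real.sqrt_pos.2 hT0
    rw [div_le_iff₀ (by linarith)]
    nlinarith [Real.mul_self_sqrt hT0.le]
  have hw := Real.sqrt_nonneg (A.iters i * Real.log (1 / A.δ))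
  generalize A.complexity = Ξ at *
  generalize Real.log (A.batchArg i) = Q at *
  generalize √(A.iters i * Real.log (1 / A.δ)) = w at *
  have h5 : A.m * (A.users i * A.ε * (A.iters i / w)) ≤ 70 * A.logFactor * Ξ :=
    le_trans (by gcongr) h2
  have h6 : (A.m * A.users i : ℝ) ≤ Ξ := le_trans (by rw [mul_comm, mul_comm (A.m : ℝ)]; gcongr) h3
  have h7 : A.m * A.iters i / A.ε + A.m * (A.users i * A.ε * (A.iters i / w)) ≤
      119 * A.logFactor * Ξ := by linarith
  calc (A.iters i : ℝ) * (A.batch i * A.m)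
      ≤ A.iters i * ((3 * (500 * Q * (1 / A.ε + A.users i * A.ε / w))
        + A.users i / A.iters i) * A.m) := by gcongr
    _ = 1500 * Q * (A.m * A.iters i / A.ε + A.m * (A.users i * A.ε * (A.iters i / w)))
        + A.iters i / A.iters i * (A.m * A.users i) := by ring
    _ ≤ 1500 * Q * (119 * A.logFactor * Ξ) + 1 * Ξ := by
        rw [div_self hT0.ne']
        gcongr
    _ ≤ 1500 * (5 * A.logFactor) * (119 * A.logFactor * Ξ) + 1 * Ξ := by gcongr
    _ ≤ _ := by
        have : Ξ ≤ A.logFactor ^ 2 * Ξ := le_mul_of_one_le_left hC0 (one_le_pow₀ (by linarith))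
        nlinarith

lemma evals_le (h : A.Admissible) :
    ∑ i : Fin A.phases, (A.iters (i + 1) : ℝ) * (A.batch (i + 1) * A.m) ≤
      2 * 10 ^ 6 * A.logFactor ^ 3 * A.complexity := by
  have h1 := Finset.sum_le_card_nsmul (Finset.univ : Finset (Fin A.phases))
    (fun i => (A.iters (i + 1) : ℝ) * (A.batch (i + 1) * A.m)) _ fun i _ => h.phase_evals_le (i + 1)
  rw [Finset.card_univ, Fintype.card_fin, nsmul_eq_mul] at h1
  refine h1.trans ?_
  have hl := h.phases_le
  have h2 : 0 ≤ 10 ^ 6 * A.logFactor ^ 2 * A.complexity :=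
    le_trans (by positivity) (h.phase_evals_le 0)
  calc _ ≤ 2 * A.logFactor * (10 ^ 6 * A.logFactor ^ 2 * A.complexity) := by gcongr
    _ = _ := by ring

end Admissible

end Params

namespace Params

variable {A : Params}

/-! ### The algorithm -/

section Main

variable {Z : Type*} [MeasurableSpace Z] {P : Measure Z}
  {X : Set (Vec A.d)} {f : Vec A.d → Z → ℝ} {gradf : Vec A.d → Z → Vec A.d} {c : ℝ}
  {x₀ : Vec A.d} {sel : A.Selection}

lemma Admissible.users_pos (h : A.Admissible) (i : Fin A.phases) : 0 < A.users (i + 1) := by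
  have := h.fifty_le_users (show (i : ℕ) + 1 ≤ A.phases from i.is_lt)
  have : (0 : ℝ) < A.users (i + 1) := by linarith
  exact_mod_cast this

/-- The algorithm is a chain of phases driven by independent data and randomness. -/
lemma Admissible.popLoss_phasedERM (h : A.Admissible) (hX : Convex ℝ X) (hc : IsCompact X)
    (h0 : (0 : Vec A.d) ∈ X) (hd : ∀ x ∈ X, ∀ y ∈ X, ‖x - y‖ ≤ A.R)
    (hf : IsLoss P X f gradf A.L A.β) (hx₀ : x₀ ∈ X) (D : A.Data Z) (ω : A.Rand) :
    popLoss P f (A.phasedERM c X gradf x₀ sel D ω).1 =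
      popLoss P (extLoss X f) (chain (A.phaseStep c X (extGrad X gradf)) x₀
        (fun i => (fun j => D (sel i j), ω i))) + popLoss P f 0 := by
  have H := hf.globalLoss hX hc h0 hd h.L_pos h.β_nonneg h.R_pos
  have hI : ∀ i, ∀ x ∈ X, (A.phaseInput c X i x).Valid := fun i x hx =>
    valid_phaseInput H h.lam_pos i hx
  rw [A.phasedERM_fst hI h0 (g := extGrad X gradf)
    (fun x hx z => by rw [extGrad, proj_eq_self hc hx]) hx₀ sel D ω]
  exact hf.popLoss_eq hc h0 (chain_induction (p := fun x => x ∈ X)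
    (fun i x w hx => removalRun_mem (hI _ _ hx) h0 _ _) hx₀ _)

lemma Admissible.measurable_phases (h : A.Admissible) {g : Vec A.d → Z → Vec A.d}
    (H : GlobalLoss X f g A.L A.β A.R) (P : Measure Z) [IsProbabilityMeasure P] :
    Measurable fun ω => popLoss P f (chain (A.phaseStep c X g) x₀ ω) :=
  (H.continuous_popLoss P).measurable.comp
    (measurable_chain' x₀ fun i => measurable_phaseStep H h.lam_pos i)

/-- The constant by which the extended loss is shifted cancels in the excess risk, and the joint law
is transported to the product of the phase laws. -/
lemma Admissible.excessRisk [IsProbabilityMeasure P] (h : A.Admissible) (hc48 : 48 ≤ c)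
    (hX : Convex ℝ X)
    (hc : IsCompact X) (h0 : (0 : Vec A.d) ∈ X) (hd : ∀ x ∈ X, ∀ y ∈ X, ‖x - y‖ ≤ A.R)
    (hf : IsLoss P X f gradf A.L A.β) (hx₀ : x₀ ∈ X) (hsel : A.IsDisjoint sel) :
    Integrable (fun ω : A.Data Z × A.Rand =>
        popLoss P f (A.phasedERM c X gradf x₀ sel ω.1 ω.2).1) (A.jointLaw c P) ∧
      (∫ ω, popLoss P f (A.phasedERM c X gradf x₀ sel ω.1 ω.2).1 ∂(A.jointLaw c P))
          - sInf (popLoss P f '' X) ≤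
        10 ^ 11 * c ^ 2 * ((2 : ℝ) ^ A.p / (1 - (1 / 2 : ℝ) ^ A.q)) ^ 6 * A.logFactor ^ 6
          * (A.L * A.R * A.rate) := by
  have H := hf.globalLoss hX hc h0 hd h.L_pos h.β_nonneg h.R_pos
  have hmp := A.measurePreserving_jointLaw c P h.ε_pos h.users_pos hsel
  have hprob : ∀ i, IsProbabilityMeasure (A.phaseMeasure c P i) := fun i =>
    A.isProbabilityMeasure_phaseMeasure c P h.ε_pos (h.users_pos i)
  have hmeas := h.measurable_phases (c := c) (x₀ := x₀) H P
  have hint : Integrable (fun ω => popLoss P (extLoss X f)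
      (chain (A.phaseStep c X (extGrad X gradf)) x₀ ω)) (Measure.pi (A.phaseMeasure c P)) :=
    Integrable.of_bound hmeas.aestronglyMeasurable (A.L * A.R)
      (Filter.Eventually.of_forall fun ω => H.abs_popLoss_le P _)
  have hint' : Integrable (fun W : A.Data Z × A.Rand => popLoss P (extLoss X f)
      (chain (A.phaseStep c X (extGrad X gradf)) x₀ (fun i => (fun j => W.1 (sel i j), W.2 i))))
      (A.jointLaw c P) := hmp.integrable_comp_of_integrable hint
  have hpj : IsProbabilityMeasure (A.jointLaw c P) := by
    have hp : ∀ i : Fin A.phases, IsProbabilityMeasure (phaseLaw (A.iters (i + 1))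
        (A.batch (i + 1)) (A.users (i + 1)) A.d A.ε (A.sigma c (i + 1))) := fun i =>
      isProbabilityMeasure_phaseLaw (h.users_pos i) h.ε_pos _
    unfold jointLaw randLaw
    infer_instance
  simp only [h.popLoss_phasedERM hX hc h0 hd hf hx₀]
  refine ⟨hint'.add (integrable_const _), ?_⟩
  rw [integral_add hint' (integrable_const _), integral_const, probReal_univ, one_smul]
  have e1 : ∫ W, popLoss P (extLoss X f) (chain (A.phaseStep c X (extGrad X gradf)) x₀
      (fun i => (fun j => W.1 (sel i j), W.2 i))) ∂(A.jointLaw c P) =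
      ∫ ω, popLoss P (extLoss X f) (chain (A.phaseStep c X (extGrad X gradf)) x₀ ω)
        ∂(Measure.pi (A.phaseMeasure c P)) := by
    rw [← hmp.map_eq, integral_map hmp.measurable.aemeasurable hmeas.aestronglyMeasurable]
  rw [e1]
  obtain ⟨y₀, hy₀, hmin⟩ := hc.exists_isMinOn ⟨0, h0⟩ (H.continuous_popLoss P).continuousOn
  have hinf : popLoss P (extLoss X f) y₀ + popLoss P f 0 ≤ sInf (popLoss P f '' X) := by
    refine le_csInf ⟨_, Set.mem_image_of_mem _ h0⟩ ?_
    rintro _ ⟨x, hx, rfl⟩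
    rw [hf.popLoss_eq hc h0 hx]
    linarith [isMinOn_iff.1 hmin x hx]
  have key := integral_popLoss_phases_le (c := c) (P := P) H h.lam_pos h.ε_pos h.one_le_m
    h.users_pos (fun i => h.batch_pos _) (h.tau_pos (by linarith)).le (fun i => h.stageLen_pos _)
    (fun i => h.stageLen_sq_ge _) A.outlierProb_nonneg (h.outlierBound hc48 P H) hx₀ hy₀
  have hex := h.excess_le hc48
  unfold gap at hex
  linarith

end Main

end Params

end UserDP

end

theorem mainTheorem1 :
    ∃ (c₀ : ℝ) (k : ℕ), 0 < c₀ ∧ ∀ c : ℝ, c₀ ≤ c → ∃ C : ℝ, 0 < C ∧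
      ∀ (A : UserDP.Params), A.Admissible →
      ∀ (Z : Type*) [MeasurableSpace Z] (P : MeasureTheory.Measure Z)
        [MeasureTheory.IsProbabilityMeasure P]
        (X : Set (UserDP.Vec A.d)) (f : UserDP.Vec A.d → Z → ℝ)
        (gradf : UserDP.Vec A.d → Z → UserDP.Vec A.d),
        Convex ℝ X → IsCompact X → (0 : UserDP.Vec A.d) ∈ X →
        (∀ x ∈ X, ∀ y ∈ X, ‖x - y‖ ≤ A.R) →
        UserDP.IsLoss P X f gradf A.L A.β →
      ∀ (x₀ : UserDP.Vec A.d) (sel : A.Selection), x₀ ∈ X → A.IsDisjoint sel →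
        (MeasureTheory.Integrable
            (fun ω : A.Data Z × A.Rand =>
              UserDP.popLoss P f (A.phasedERM c X gradf x₀ sel ω.1 ω.2).1) (A.jointLaw c P)
          ∧ (∫ ω, UserDP.popLoss P f (A.phasedERM c X gradf x₀ sel ω.1 ω.2).1 ∂(A.jointLaw c P))
              - sInf (UserDP.popLoss P f '' X)
            ≤ C * ((2 : ℝ) ^ A.p / (1 - (1 / 2 : ℝ) ^ A.q)) ^ k * A.logFactor ^ k
                * (A.L * A.R * A.rate))
        ∧ ∀ (D : A.Data Z) (ω : A.Rand),
            ((A.phasedERM c X gradf x₀ sel D ω).2 : ℝ) ≤ C * A.logFactor ^ k * A.complexity := by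
  -- 48 is what the outlier probability requires of c; c² stems from τ². The sixth power of Λ is
  -- five from the noise error and one from the number of phases; the gradient count needs only Λ³.
  refine ⟨48, 6, by norm_num, fun c hc => ⟨10 ^ 11 * c ^ 2, by positivity, ?_⟩⟩
  intro A h Z _ P _ X f gradf hX hcomp h0 hd hf x₀ sel hx₀ hsel
  refine ⟨h.excessRisk hc hX hcomp h0 hd hf hx₀ hsel, fun D ω => ?_⟩
  have h1 := A.phasedERM_snd_le c X gradf x₀ sel D ω
  have h2 : ((A.phasedERM c X gradf x₀ sel D ω).2 : ℝ) ≤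
      ∑ i : Fin A.phases, (A.iters (i + 1) : ℝ) * (A.batch (i + 1) * A.m) := by
    exact_mod_cast h1
  have hΛ := h.eight_le_logFactor
  have hC : 0 ≤ A.complexity := le_trans (by positivity) h.samples_le_complexity
  refine (h2.trans h.evals_le).trans ?_
  have h3 : A.logFactor ^ 3 ≤ A.logFactor ^ 6 := pow_le_pow_right₀ (by linarith) (by norm_num)
  have h4 : (1 : ℝ) ≤ c ^ 2 := one_le_pow₀ (by linarith)
  have h5 : 2 * 10 ^ 6 ≤ 10 ^ 11 * c ^ 2 := by linarith
  exact mul_le_mul_of_nonneg_right (mul_le_mul h5 h3 (by positivity) (by positivity)) hC
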